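/- Let $\ell>1$ be an odd integer and let $q\in\mathbb C$ be a primitive $\ell$-th root of unity. **The edge algebra.** For $M,N\ge 0$ let $\mathcal D_q(N\to M)$ be the $\mathbb C$-algebra generated by $x^i_j$ and $\partial_k^l$ ($1\le i,k\le M$, $1\le j,l\le N$) with relations (where $\theta(t)=1$ for $t>0$ and $\theta(t)=0$ for $t\le 0$) $$x_m^i x_n^j = q^{\delta_{mn}} x_n^j x_m^i + \theta(n-m)(q-q^{-1})x_m^jx_n^i\ (i>j),\qquad x_m^ix_n^i=q^{-1}x_n^ix_m^i\ (m>n),$$ $$\partial_m^i \partial_n^j = q^{\delta_{mn}} \partial_n^j \partial_m^i + \theta(n-m)(q-q^{-1})\partial_m^j\partial_n^i\ (i>j),\qquad \partial_m^i\partial_n^i=q^{-1}\partial_n^i\partial_m^i\ (m>n),$$ $$\partial_m^i x_n^j = q^{\delta_{in}+\delta_{jm}}x_n^j\partial_m^i+\delta_{in}q^{\delta_{jm}}(q-q^{-1})\sum_{p>i}x^j_p\partial^p_m+\delta_{jm}(q^2-1)\sum_{p<j}\partial_p^ix_n^p+q\,\delta_{in}\delta_{jm}.$$ Let $Z_\ell$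 be the subalgebra generated by all $(x^i_j)^\ell$ and $(\partial_k^l)^\ell$. Write $(X^{[\ell]}=0)$ and $(D^{[\ell]}=0)$ for setting all $(x^i_j)^\ell$, respectively all $(\partial_k^l)^\ell$, equal to $0$ (a quotient by a two-sided ideal), and let $\mathcal D_q(N\to M)/(D=0)$ be the quotient of $\mathcal D_q(N\to M)$ by the left ideal generated by all $\partial_k^l$. **The quiver algebra.** Let $Q$ be a quiver without loops, with finite set $E$ of edges, totally ordered, and let $\mathbf d=(d_v)$ be a dimension vector. For an edge $e:\alpha\to\beta$ put $\mathcal D_q(\mathrm{Mat}(e))=\mathcal D_q(d_\alpha\to d_\beta)$. Let $\mathcal D_q(\mathrm{Mat}(Q,\mathbf d))$ be the braided tensor product of these edge algebras over $U_q(\mathfrak{gl}_{\mathbf d})$, where upper indices at a vertex $v$ transform as the standard basis $v^i$ of the vector representation of $U_q(\mathfrak{gl}_{d_v})$, lower indices as the dual basis $w_j$ of its right dual (so $v^i\otimes w_j\mapsto\delta_{ij}$ is invariant), and the braiding $\sigma$ has $\sigma(v^i\otimes v^j)=q^{\delta_{ij}}v^j\otimes v^i+\theta(i-j)(q-q^{-1})v^i\otimes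 v^j$ (it is the flip for different vertices). Explicitly, it is generated by the edge algebras subject to $ba=m(\sigma^{-1}(b\otimes a))$, $m$ being the multiplication, for all generators $a$ of $\mathcal D_q(\mathrm{Mat}(e))$ and $b$ of $\mathcal D_q(\mathrm{Mat}(f))$ with $e<f$. **Theorem.** 1. For all $M,N\ge0$ the subalgebra $Z_\ell$ is central in $\mathcal D_q(N\to M)$; its action on $\mathcal D_q(N\to M)/(D=0)$ by left multiplication factors through $Z_\ell/(D^{[\ell]}=0)$; and left multiplication induces an isomorphism $$\mathcal D_q(N\to M)/(D^{[\ell]}=0)\ \xrightarrow{\ \sim\ }\ \mathrm{End}_{Z_\ell/(D^{[\ell]}=0)}\bigl(\mathcal D_q(N\to M)/(D=0)\bigr).$$ Moreover, the fiber $\mathcal D_q(N\to M)/(D^{[\ell]}=0,\,X^{[\ell]}=0)$ over zero is isomorphic to the matrix algebra $\mathrm{Mat}_{\ell^{MN}}(\mathbb C)$. 2. For $Q$ and $\mathbf d$ as above, the ordered multiplication map $\bigotimes_{e\in E}\mathcal D_q(\mathrm{Mat}(e))\to\mathcal D_q(\mathrm{Mat}(Q,\mathbf d))$ is an isomorphism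 of vector spaces (so that the explicit presentation indeed gives the braided tensor product), and the fiber of $\mathcal D_q(\mathrm{Mat}(Q,\mathbf d))$ over the zero representation, that is, its quotient by the two-sided ideal generated by the $\ell$-th powers of all generators $x^i_j$, $\partial_k^l$ of all edges, is isomorphic to the matrix algebra $\mathrm{Mat}_{k}(\mathbb C)$ with $k=\ell^{\sum_{e:\alpha\to\beta}d_\alpha d_\beta}$. -/

import Mathlib

universe u v

open scoped TensorProduct

noncomputable section

/-! ### The edge algebra `D_q(N → M)` -/

/-- Generators of the edge algebra: `x i j` is `x^i_j` and `pd k l` is `∂_k^l`,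
where `i, k` range over `M` indices and `j, l` over `N` indices. -/
inductive EdgeGen (M N : ℕ) : Type
  | x (i : Fin M) (j : Fin N) : EdgeGen M N
  | pd (k : Fin M) (l : Fin N) : EdgeGen M N

/-- The free generator `x^i_j`. -/
abbrev freeX {M N : ℕ} (i : Fin M) (j : Fin N) : FreeAlgebra ℂ (EdgeGen M N) :=
  FreeAlgebra.ι ℂ (EdgeGen.x i j)

/-- The free generator `∂_k^l`. -/
abbrev freePd {M N : ℕ} (k : Fin M) (l : Fin N) : FreeAlgebra ℂ (EdgeGen M N) :=
  FreeAlgebra.ι ℂ (EdgeGen.pd k l)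

/-- The defining relations of the edge algebra, in coordinates. -/
inductive EdgeRel (q : ℂ) (M N : ℕ) :
    FreeAlgebra ℂ (EdgeGen M N) → FreeAlgebra ℂ (EdgeGen M N) → Prop
  | xx (i j : Fin M) (m n : Fin N) (h : j < i) :
      EdgeRel q M N (freeX i m * freeX j n)
        ((if m = n then q else 1) • (freeX j n * freeX i m)
          + (if m < n then q - q⁻¹ else 0) • (freeX j m * freeX i n))
  | xx_same (i : Fin M) (m n : Fin N) (h : n < m) :
      EdgeRel q M N (freeX i m * freeX i n) (q⁻¹ • (freeX i n * freeX i m))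
  | dd (i j : Fin N) (m n : Fin M) (h : j < i) :
      EdgeRel q M N (freePd m i * freePd n j)
        ((if m = n then q else 1) • (freePd n j * freePd m i)
          + (if m < n then q - q⁻¹ else 0) • (freePd m j * freePd n i))
  | dd_same (i : Fin N) (m n : Fin M) (h : n < m) :
      EdgeRel q M N (freePd m i * freePd n i) (q⁻¹ • (freePd n i * freePd m i))
  | dx (i n : Fin N) (j m : Fin M) :
      EdgeRel q M N (freePd m i * freeX j n)
        (((if i = n then q else 1) * (if j = m then q else 1)) • (freeX j n * freePd m i)
          + (if i = n then (if j = m then q else 1) * (q - q⁻¹) else 0) •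
              ∑ p ∈ Finset.Ioi i, freeX j p * freePd m p
          + (if j = m then q ^ 2 - 1 else 0) •
              ∑ p ∈ Finset.Iio j, freePd p i * freeX p n
          + (if i = n ∧ j = m then q else 0) • 1)

/-- The edge algebra `D_q(N → M)`. -/
abbrev EdgeAlg (q : ℂ) (M N : ℕ) : Type := RingQuot (EdgeRel q M N)

/-- The generator `x^i_j` of the edge algebra. -/
def edgeX (q : ℂ) {M N : ℕ} (i : Fin M) (j : Fin N) : EdgeAlg q M N :=
  RingQuot.mkAlgHom ℂ (EdgeRel q M N) (freeX i j)

/-- The generator `∂_k^l` of the edge algebra. -/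
def edgePd (q : ℂ) {M N : ℕ} (k : Fin M) (l : Fin N) : EdgeAlg q M N :=
  RingQuot.mkAlgHom ℂ (EdgeRel q M N) (freePd k l)

/-- The subalgebra `Z_ℓ` generated by the `ℓ`-th powers of all generators, that is, by the
entries of `X^{[ℓ]}` and `D^{[ℓ]}`. -/
def edgeZ (q : ℂ) (ℓ M N : ℕ) : Subalgebra ℂ (EdgeAlg q M N) :=
  Algebra.adjoin ℂ {z | ∃ (i : Fin M) (j : Fin N), z = edgeX q i j ^ ℓ ∨ z = edgePd q i j ^ ℓ}

/-- The relation `D^{[ℓ]} = 0` on `Z_ℓ`. -/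
def EdgeZRel (q : ℂ) (ℓ M N : ℕ) (a b : edgeZ q ℓ M N) : Prop :=
  b = 0 ∧ ∃ (k : Fin M) (l : Fin N), (a : EdgeAlg q M N) = edgePd q k l ^ ℓ

/-- The quotient `Z_ℓ / (D^{[ℓ]} = 0)`. -/
abbrev EdgeZbar (q : ℂ) (ℓ M N : ℕ) : Type := RingQuot (EdgeZRel q ℓ M N)

/-- The relation `D^{[ℓ]} = 0` on the edge algebra. -/
def EdgePdRel (q : ℂ) (ℓ M N : ℕ) (a b : EdgeAlg q M N) : Prop :=
  b = 0 ∧ ∃ (k : Fin M) (l : Fin N), a = edgePd q k l ^ ℓ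

/-- The quotient algebra `D_q(N → M) / (D^{[ℓ]} = 0)`. -/
abbrev EdgeA (q : ℂ) (ℓ M N : ℕ) : Type := RingQuot (EdgePdRel q ℓ M N)

/-- The left module `D_q(N → M) / (D = 0)`: the quotient by the left ideal generated by all
the `∂_k^l`. -/
abbrev EdgeMod (q : ℂ) (M N : ℕ) : Type :=
  EdgeAlg q M N ⧸ Submodule.span (EdgeAlg q M N)
    {z : EdgeAlg q M N | ∃ (k : Fin M) (l : Fin N), z = edgePd q k l}

/-- The relation `D^{[ℓ]} = 0, X^{[ℓ]} = 0` on the edge algebra. -/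
def EdgeZeroRel (q : ℂ) (ℓ M N : ℕ) (a b : EdgeAlg q M N) : Prop :=
  b = 0 ∧ ∃ (i : Fin M) (j : Fin N), a = edgeX q i j ^ ℓ ∨ a = edgePd q i j ^ ℓ

/-- The fiber `D_q(N → M) / (D^{[ℓ]} = 0, X^{[ℓ]} = 0)` over zero. -/
abbrev EdgeFiber (q : ℂ) (ℓ M N : ℕ) : Type := RingQuot (EdgeZeroRel q ℓ M N)

/-! ### Braidings of the standard representations

An index `⟨v, i⟩` labels the `i`-th vector of the standard basis of `⊕_v V_v`, `V_v = ℂ^{d_v}`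
being the vector representation of `U_q(gl_{d_v})` (and `V_w`, `w ≠ v`, being trivial for it, so
that indices at different vertices are just flipped).  Upper indices of generators transform as
basis vectors `v^I` of `V_v`; lower indices transform as the basis vectors `w_J` of the right dual
of `V_v`, with `v^I ⊗ w_J ↦ δ_{IJ}` invariant.  The braiding `σ` is normalized by
`σ(v^i ⊗ v^j) = q^{δ_{ij}} v^j ⊗ v^i + θ(i - j) (q - q⁻¹) v^i ⊗ v^j`
on each `V_v ⊗ V_v`, and it is extended to the duals in the only possible way. -/

/-- Basis indices of all the vector spaces `ℂ^{d_v}`. -/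
abbrev VIdx {V : Type*} (d : V → ℕ) := Σ v : V, Fin (d v)

/-- `K` and `I` lie at the same vertex and `K` precedes `I`. -/
def VIdx.Before {V : Type*} {d : V → ℕ} (K I : VIdx d) : Prop :=
  K.1 = I.1 ∧ (K.2 : ℕ) < (I.2 : ℕ)

open Classical in
/-- The coefficient of `v^{I'} ⊗ v^{K'}` in `σ⁻¹ (v^K ⊗ v^I)`. -/
def braidUU (q : ℂ) {V : Type*} {d : V → ℕ} (K I I' K' : VIdx d) : ℂ :=
  (if I' = I ∧ K' = K then (if I = K then q⁻¹ else 1) else 0)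
    - (if K.Before I ∧ I' = K ∧ K' = I then q - q⁻¹ else 0)

open Classical in
/-- The coefficient of `w_{J'} ⊗ w_{L'}` in `σ⁻¹ (w_L ⊗ w_J)`. -/
def braidLL (q : ℂ) {V : Type*} {d : V → ℕ} (L J J' L' : VIdx d) : ℂ :=
  (if J' = J ∧ L' = L then (if J = L then q⁻¹ else 1) else 0)
    - (if J.Before L ∧ J' = L ∧ L' = J then q - q⁻¹ else 0)

open Classical in
/-- The coefficient of `w_{J'} ⊗ v^{K'}` in `σ⁻¹ (v^K ⊗ w_J)`. -/
def braidUL (q : ℂ) {V : Type*} {d : V → ℕ} (K J J' K' : VIdx d) : ℂ :=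
  (if J' = J ∧ K' = K then (if J = K then q else 1) else 0)
    + (if J = K ∧ J' = K' ∧ K.Before K' then q - q⁻¹ else 0)

open Classical in
/-- The coefficient of `w_{L'} ⊗ v^{I'}` in `σ (v^I ⊗ w_L)`. -/
def braidUL' (q : ℂ) {V : Type*} {d : V → ℕ} (I L L' I' : VIdx d) : ℂ :=
  (if L' = L ∧ I' = I then (if I = L then q⁻¹ else 1) else 0)
    - (if I = L ∧ L' = I' ∧ I'.Before I then q - q⁻¹ else 0)

/-! ### The algebra `D_q(Mat(Q, d))` of a quiver without loops -/

section QuiverAlgebra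

variable {V : Type*} [Quiver V]

/-- Arrows of the doubled quiver: `(e, true)` is `e` itself, `(e, false)` is the dual edge. -/
abbrev DArrow (V : Type*) [Quiver V] := Quiver.Total V × Bool

/-- Source of an arrow of the doubled quiver. -/
def DArrow.src : DArrow V → V
  | (e, true) => e.left
  | (e, false) => e.right

/-- Target of an arrow of the doubled quiver. -/
def DArrow.tgt : DArrow V → V
  | (e, true) => e.right
  | (e, false) => e.left

/-- Generators of `D_q(Mat(Q, d))`: the generators of the edge algebras
`D_q(Mat(e)) = D_q(N → M)` with `N = d_α`, `M = d_β` for `e : α → β`. -/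
abbrev QuiverGen (d : V → ℕ) := Σ e : Quiver.Total V, EdgeGen (d e.right) (d e.left)

/-- The free generator attached to an arrow `a` of the doubled quiver, with upper index `i` at
the target and lower index `j` at the source of `a`: `x^i_j` if `a` is an edge of the quiver and
`∂_j^i` if `a` is a dual edge. -/
def freeEntry {d : V → ℕ} : (a : DArrow V) → Fin (d a.tgt) → Fin (d a.src) →
    FreeAlgebra ℂ (QuiverGen d)
  | (e, true), i, j => FreeAlgebra.ι ℂ ⟨e, EdgeGen.x i j⟩
  | (e, false), i, j => FreeAlgebra.ι ℂ ⟨e, EdgeGen.pd j i⟩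

/-- The inclusion of the free algebra of one edge. -/
def freeIncl (d : V → ℕ) (e : Quiver.Total V) :
    FreeAlgebra ℂ (EdgeGen (d e.right) (d e.left)) →ₐ[ℂ] FreeAlgebra ℂ (QuiverGen d) :=
  FreeAlgebra.lift ℂ fun g => FreeAlgebra.ι ℂ ⟨e, g⟩

/-- The relations of the braided tensor product of the edge algebras (in the order of the edges):
the relations of each edge algebra and, for generators `a` and `b` of the edges `e < f`, the
relations `b a = m (σ⁻¹ (b ⊗ a))`, where `m` is the multiplication.  Passing `b = v^K ⊗ w_L` across
`a = v^I ⊗ w_J` is the composite of four elementary braidings; the one of `w_L` with `v^I` is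
inverted and stands on the left-hand side. -/
inductive QuiverRel (q : ℂ) (d : V → ℕ) [LinearOrder (Quiver.Total V)] :
    FreeAlgebra ℂ (QuiverGen d) → FreeAlgebra ℂ (QuiverGen d) → Prop
  | edge (e : Quiver.Total V) {s t : FreeAlgebra ℂ (EdgeGen (d e.right) (d e.left))}
      (h : EdgeRel q (d e.right) (d e.left) s t) :
      QuiverRel q d (freeIncl d e s) (freeIncl d e t)
  | cross (a b : DArrow V) (hab : a.1 < b.1)
      (I : Fin (d a.tgt)) (J : Fin (d a.src)) (K : Fin (d b.tgt)) (L : Fin (d b.src)) :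
      QuiverRel q d
        (∑ L' : Fin (d b.src), ∑ I' : Fin (d a.tgt),
          braidUL' (d := d) q ⟨a.tgt, I⟩ ⟨b.src, L⟩ ⟨b.src, L'⟩ ⟨a.tgt, I'⟩ •
            (freeEntry b K L' * freeEntry a I' J))
        (∑ I' : Fin (d a.tgt), ∑ K' : Fin (d b.tgt), ∑ J' : Fin (d a.src), ∑ L' : Fin (d b.src),
          ∑ J'' : Fin (d a.src), ∑ K'' : Fin (d b.tgt),
          (braidUU (d := d) q ⟨b.tgt, K⟩ ⟨a.tgt, I⟩ ⟨a.tgt, I'⟩ ⟨b.tgt, K'⟩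
            * braidLL (d := d) q ⟨b.src, L⟩ ⟨a.src, J⟩ ⟨a.src, J'⟩ ⟨b.src, L'⟩
            * braidUL (d := d) q ⟨b.tgt, K'⟩ ⟨a.src, J'⟩ ⟨a.src, J''⟩ ⟨b.tgt, K''⟩) •
            (freeEntry a I' J'' * freeEntry b K'' L'))

/-- The algebra `D_q(Mat(Q, d))` of a quiver without loops: the braided tensor product of the edge
algebras `D_q(Mat(e))`. -/
abbrev QuiverAlg (q : ℂ) (d : V → ℕ) [LinearOrder (Quiver.Total V)] :=
  RingQuot (QuiverRel q d)

/-- The canonical homomorphism from an edge algebra `D_q(Mat(e))` to `D_q(Mat(Q, d))`. -/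
def edgeIncl (q : ℂ) (d : V → ℕ) [LinearOrder (Quiver.Total V)] (e : Quiver.Total V) :
    EdgeAlg q (d e.right) (d e.left) →ₐ[ℂ] QuiverAlg q d :=
  RingQuot.liftAlgHom ℂ ⟨(RingQuot.mkAlgHom ℂ (QuiverRel q d)).comp (freeIncl d e),
    fun _ _ h => RingQuot.mkAlgHom_rel ℂ (QuiverRel.edge e h)⟩

/-- The relation on `D_q(Mat(Q, d))` which sets the `ℓ`-th powers of all generators equal to
zero. -/
def QuiverZeroRel (q : ℂ) (ℓ : ℕ) (d : V → ℕ) [LinearOrder (Quiver.Total V)]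
    (a b : QuiverAlg q d) : Prop :=
  b = 0 ∧ ∃ (e : Quiver.Total V) (i : Fin (d e.right)) (j : Fin (d e.left)),
    a = edgeIncl q d e (edgeX q i j) ^ ℓ ∨ a = edgeIncl q d e (edgePd q i j) ^ ℓ

/-- The fiber of `D_q(Mat(Q, d))` over the zero representation. -/
abbrev QuiverFiber (q : ℂ) (ℓ : ℕ) (d : V → ℕ) [LinearOrder (Quiver.Total V)] :=
  RingQuot (QuiverZeroRel q ℓ d)

end QuiverAlgebra

end

/-! All relations are put in R-matrix form. Let R be the standard solution of the Yang–Baxter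
equation at a vertex, and the identity between two different vertices; P is the flip, and subscripts
name tensor legs. One edge then has R X₁X₂ = X₂X₁R₂₁ for the coordinates X, the same for the
derivations D, and D₁R⁻¹X₂ = X₂RD₁ + P. The relations between two edges are a homogeneous identity
of the same kind.

One edge. The module D_q/(D = 0) is generated by a vacuum killed by all derivations. For a suitable
order of the indices c, on vectors killed by all earlier derivations the pair ∂_c, x_c is a
q-oscillator: ∂_c lowers x_c^a with a factor proportional to the q²-integer of a
(`dAt_smul_xAt_pow_succ_smul`). As ℓ is odd, this factor is nonzero for 0 < a < ℓ and vanishes at a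
= ℓ. So ∂^(ℓ-1) x^(ℓ-1-b) isolates the exponent b, and such operators produce every endomorphism
commuting with the x^ℓ (`exists_smul_of_comm`). By triangularity a normally ordered element with
derivation exponents below ℓ that acts by zero is zero (`eq_zero_of_smul_xMon`). Centrality of the
ℓ-th powers holds because moving a generator past x is triangular with distinct eigenvalues that are
ℓ-th roots of unity.

This argument needs the modules to be large enough: a polynomial in the coordinates must not die on
the vacuum. For that, derivations are constructed on the algebra of quantum matrices alone, from a
block triangular homomorphism (`isQMat_blockM`). Only the relation between D and X has to be
verified there; the relations among the derivations follow from it on any module generated from a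
killed vacuum (`isQMat_of_isWeyl`).

Quivers. Every edge module carries operators T that act on generators through R, like the
L-operators of U_q. They satisfy RTT by the Yang–Baxter equation, are upper triangular, and have
diagonal entries whose ℓ-th power is 1, hence are invertible. On the tensor product of the edge
modules the generators of an edge e act after conjugation ("dressing") by the T of all earlier
edges. The relations of each edge survive by covariance, and the cross relations hold because
passing T across a generator produces exactly the braiding (`IsSmash.isCross`, `isCross_dress`).
Applied to the product of the vacua, an ordered product returns the tensor of its factors, so
ordered multiplication is injective; straightening by the cross relations gives surjectivity.

For the fibre, the q-binomial theorem shows that ℓ-th powers of dressed generators are combinations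
of ℓ-th powers of undressed ones (`IsRTT.dress_pow`), hence vanish on the product of the zero fibre
modules. Undressing edge by edge shows that the image is the full endomorphism algebra, and counting
ordered products bounds the dimension of the fibre by the dimension of that algebra. -/

open scoped TensorProduct

set_option linter.unusedSectionVars false
set_option linter.unusedSimpArgs false

noncomputable section

/-! ### Matrices acting on some of the factors of a product of index sets -/

section Legs

variable {E : Type*} [Ring E] [Algebra ℂ E]
variable {a a' a'' b b' b'' c c' c'' : Type*}

/-- A matrix with scalar entries, seen as a matrix over an algebra. -/
def scal (E : Type*) [Ring E] [Algebra ℂ E] (A : Matrix a b ℂ) : Matrix a b E :=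
  A.map (algebraMap ℂ E)

/-- `A ⊗ 1`. -/
def legL (b : Type*) [DecidableEq b] (A : Matrix a a' E) : Matrix (a × b) (a' × b) E :=
  fun p p' => if p.2 = p'.2 then A p.1 p'.1 else 0

/-- `1 ⊗ A`. -/
def legR (a : Type*) [DecidableEq a] (A : Matrix b b' E) : Matrix (a × b) (a × b') E :=
  fun p p' => if p.1 = p'.1 then A p.2 p'.2 else 0

/-- The action of a matrix on the first of three factors. -/
def leg1 (b c : Type*) [DecidableEq b] [DecidableEq c] (A : Matrix a a' E) :
    Matrix (a × b × c) (a' × b × c) E :=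
  fun p p' => if p.2.1 = p'.2.1 ∧ p.2.2 = p'.2.2 then A p.1 p'.1 else 0

/-- The action of a matrix on the second of three factors. -/
def leg2 (a c : Type*) [DecidableEq a] [DecidableEq c] (A : Matrix b b' E) :
    Matrix (a × b × c) (a × b' × c) E :=
  fun p p' => if p.1 = p'.1 ∧ p.2.2 = p'.2.2 then A p.2.1 p'.2.1 else 0

/-- The action of a matrix on the third of three factors. -/
def leg3 (a b : Type*) [DecidableEq a] [DecidableEq b] (A : Matrix c c' E) :
    Matrix (a × b × c) (a × b × c') E :=
  fun p p' => if p.1 = p'.1 ∧ p.2.1 = p'.2.1 then A p.2.2 p'.2.2 else 0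

/-- The action of a matrix on the first two of three factors. -/
def leg12 (c : Type*) [DecidableEq c] (A : Matrix (a × b) (a' × b') E) :
    Matrix (a × b × c) (a' × b' × c) E :=
  fun p p' => if p.2.2 = p'.2.2 then A (p.1, p.2.1) (p'.1, p'.2.1) else 0

/-- The action of a matrix on the first and third of three factors. -/
def leg13 (b : Type*) [DecidableEq b] (A : Matrix (a × c) (a' × c') E) :
    Matrix (a × b × c) (a' × b × c') E :=
  fun p p' => if p.2.1 = p'.2.1 then A (p.1, p.2.2) (p'.1, p'.2.2) else 0

/-- The action of a matrix on the last two of three factors. -/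
def leg23 (a : Type*) [DecidableEq a] (A : Matrix (b × c) (b' × c') E) :
    Matrix (a × b × c) (a × b' × c') E :=
  fun p p' => if p.1 = p'.1 then A p.2 p'.2 else 0

/-- Exchange of the two factors. -/
def flipM (A : Matrix (a × b) (a' × b') E) : Matrix (b × a) (b' × a') E :=
  fun p p' => A (p.2, p.1) (p'.2, p'.1)

/-- The permutation matrix which exchanges two factors. -/
def swapM (E : Type*) [Ring E] (a b : Type*) [DecidableEq a] [DecidableEq b] :
    Matrix (a × b) (b × a) E :=
  fun p p' => if p.1 = p'.2 ∧ p.2 = p'.1 then 1 else 0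

/-- Two matrices whose entries commute with each other. -/
def EntriesCommute (A : Matrix a a' E) (B : Matrix b b' E) : Prop :=
  ∀ i i' j j', Commute (A i i') (B j j')

theorem EntriesCommute.symm {A : Matrix a a' E} {B : Matrix b b' E} (h : EntriesCommute A B) :
    EntriesCommute B A := fun i i' j j' => (h j j' i i').symm

theorem entriesCommute_scal (A : Matrix a a' ℂ) (B : Matrix b b' E) :
    EntriesCommute (scal E A) B := fun _ _ _ _ => Algebra.commute_algebraMap_left _ _

section Mul

variable [Fintype a'] [Fintype b'] [Fintype c']

theorem scal_mul (A : Matrix a a' ℂ) (B : Matrix a' a'' ℂ) :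
    scal E (A * B) = scal E A * scal E B := by
  simp [scal, Matrix.map_mul]

theorem EntriesCommute.mul_left {A : Matrix a a' E} {A' : Matrix a' a'' E} {B : Matrix b b' E}
    (h : EntriesCommute A B) (h' : EntriesCommute A' B) : EntriesCommute (A * A') B := by
  intro i i' j j'
  rw [Matrix.mul_apply]
  exact Commute.sum_left _ _ _ fun k _ => (h _ _ _ _).mul_left (h' _ _ _ _)

theorem EntriesCommute.mul_right {A : Matrix a a' E} {B : Matrix b b' E} {B' : Matrix b' b'' E}
    (h : EntriesCommute A B) (h' : EntriesCommute A B') : EntriesCommute A (B * B') :=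
  (h.symm.mul_left h'.symm).symm

variable [DecidableEq a] [DecidableEq b] [DecidableEq c]
variable [DecidableEq a'] [DecidableEq b'] [DecidableEq c']

theorem legL_mul [Fintype b] (A : Matrix a a' E) (B : Matrix a' a'' E) :
    legL b (A * B) = legL b A * legL b B := by
  ext ⟨i, j⟩ ⟨i', j'⟩
  simp [legL, Matrix.mul_apply, Fintype.sum_prod_type]

theorem legR_mul [Fintype a] (A : Matrix b b' E) (B : Matrix b' b'' E) :
    legR a (A * B) = legR a A * legR a B := by
  ext ⟨i, j⟩ ⟨i', j'⟩
  simp [legR, Matrix.mul_apply, Fintype.sum_prod_type, Finset.sum_ite_irrel]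

theorem leg12_mul [Fintype c] (A : Matrix (a × b) (a' × b') E) (B : Matrix (a' × b') (a'' × b'') E) :
    leg12 c (A * B) = leg12 c A * leg12 c B := by
  ext ⟨i, j, k⟩ ⟨i', j', k'⟩
  simp [leg12, Matrix.mul_apply, Fintype.sum_prod_type]

theorem leg13_mul [Fintype b] (A : Matrix (a × c) (a' × c') E) (B : Matrix (a' × c') (a'' × c'') E) :
    leg13 b (A * B) = leg13 b A * leg13 b B := by
  ext ⟨i, j, k⟩ ⟨i', j', k'⟩
  simp [leg13, Matrix.mul_apply, Fintype.sum_prod_type, Finset.sum_ite_irrel]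

theorem leg23_mul [Fintype a] (A : Matrix (b × c) (b' × c') E) (B : Matrix (b' × c') (b'' × c'') E) :
    leg23 a (A * B) = leg23 a A * leg23 a B := by
  ext ⟨i, j, k⟩ ⟨i', j', k'⟩
  simp [leg23, Matrix.mul_apply, Fintype.sum_prod_type, Finset.sum_ite_irrel]

theorem legL_mul_legR [Fintype b] (A : Matrix a a' E) (B : Matrix b b' E)
    (p : a × b) (p' : a' × b') :
    (legL b A * legR a' B) p p' = A p.1 p'.1 * B p.2 p'.2 := by
  simp [legL, legR, Matrix.mul_apply, Fintype.sum_prod_type, Finset.sum_ite_irrel]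

theorem legR_mul_legL [Fintype a] (A : Matrix a a' E) (B : Matrix b b' E)
    (p : a × b) (p' : a' × b') :
    (legR a B * legL b' A) p p' = B p.2 p'.2 * A p.1 p'.1 := by
  simp [legL, legR, Matrix.mul_apply, Fintype.sum_prod_type, Finset.sum_ite_irrel]

/-- Matrices over a noncommutative ring on different legs do not commute automatically: A₁B₂
multiplies entries in the order A, B, and B₂A₁ in the other order. Entrywise commutation is what
lets them pass each other in all leg computations below. -/
theorem EntriesCommute.leg_comm [Fintype a] [Fintype b] {A : Matrix a a' E} {B : Matrix b b' E}
    (h : EntriesCommute A B) : legL b A * legR a' B = legR a B * legL b' A := by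
  ext p p'
  rw [legL_mul_legR, legR_mul_legL, (h _ _ _ _).eq]

theorem EntriesCommute.leg12_leg3 [Fintype a] [Fintype b] [Fintype c]
    {A : Matrix (a × b) (a' × b') E} {B : Matrix c c' E} (h : EntriesCommute A B) :
    leg12 c A * leg3 a' b' B = leg3 a b B * leg12 c' A := by
  ext ⟨i, j, k⟩ ⟨i', j', k'⟩
  simp [leg12, leg3, Matrix.mul_apply, Fintype.sum_prod_type, Finset.sum_ite_irrel, ite_and,
    (h _ _ _ _).eq]

theorem EntriesCommute.leg13_leg2 [Fintype a] [Fintype b] [Fintype c]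
    {A : Matrix (a × c) (a' × c') E} {B : Matrix b b' E} (h : EntriesCommute A B) :
    leg13 b A * leg2 a' c' B = leg2 a c B * leg13 b' A := by
  ext ⟨i, j, k⟩ ⟨i', j', k'⟩
  simp [leg13, leg2, Matrix.mul_apply, Fintype.sum_prod_type, Finset.sum_ite_irrel, ite_and,
    (h _ _ _ _).eq]

theorem EntriesCommute.leg23_leg1 [Fintype a] [Fintype b] [Fintype c]
    {A : Matrix (b × c) (b' × c') E} {B : Matrix a a' E} (h : EntriesCommute A B) :
    leg23 a A * leg1 b' c' B = leg1 b c B * leg23 a' A := by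
  ext ⟨i, j, k⟩ ⟨i', j', k'⟩
  simp [leg23, leg1, Matrix.mul_apply, Fintype.sum_prod_type, Finset.sum_ite_irrel, ite_and,
    (h _ _ _ _).eq]

theorem swapM_mul_flipM [Fintype a] [Fintype b] (A : Matrix (a × b) (a' × b') E) :
    swapM E a b * flipM A = A * swapM E a' b' := by
  ext ⟨i, j⟩ ⟨i', j'⟩
  simp [swapM, flipM, Matrix.mul_apply, Fintype.sum_prod_type, Finset.sum_ite_irrel, ite_and]

theorem flipM_mul (A : Matrix (a × b) (a' × b') E) (B : Matrix (a' × b') (a'' × b'') E) :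
    flipM (A * B) = flipM A * flipM B := by
  ext ⟨i, j⟩ ⟨i', j'⟩
  simp only [flipM, Matrix.mul_apply, Fintype.sum_prod_type]
  rw [Finset.sum_comm]

end Mul

section Simple

variable [DecidableEq a] [DecidableEq b] [DecidableEq c]

theorem legL_one : legL b (1 : Matrix a a E) = 1 := by
  ext ⟨i, j⟩ ⟨i', j'⟩
  simp only [legL, Matrix.one_apply, Prod.mk.injEq, ite_and]; split_ifs <;> rfl

theorem legR_one : legR a (1 : Matrix b b E) = 1 := by
  ext ⟨i, j⟩ ⟨i', j'⟩
  simp only [legR, Matrix.one_apply, Prod.mk.injEq, ite_and]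

theorem leg12_one : leg12 c (1 : Matrix (a × b) (a × b) E) = 1 := by
  ext ⟨i, j, k⟩ ⟨i', j', k'⟩
  simp only [leg12, Matrix.one_apply, Prod.mk.injEq, ite_and]; split_ifs <;> rfl

theorem leg13_one : leg13 b (1 : Matrix (a × c) (a × c) E) = 1 := by
  ext ⟨i, j, k⟩ ⟨i', j', k'⟩
  simp only [leg13, Matrix.one_apply, Prod.mk.injEq, ite_and]; split_ifs <;> rfl

theorem leg23_one : leg23 a (1 : Matrix (b × c) (b × c) E) = 1 := by
  ext ⟨i, j, k⟩ ⟨i', j', k'⟩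
  simp only [leg23, Matrix.one_apply, Prod.mk.injEq, ite_and]

theorem leg12_legL (A : Matrix a a' E) : leg12 c (legL b A) = leg1 b c A := by
  ext ⟨i, j, k⟩ ⟨i', j', k'⟩
  simp only [leg12, legL, leg1, ite_and]; split_ifs <;> rfl

theorem leg12_legR (A : Matrix b b' E) : leg12 c (legR a A) = leg2 a c A := by
  ext ⟨i, j, k⟩ ⟨i', j', k'⟩
  simp only [leg12, legR, leg2, ite_and]; split_ifs <;> rfl

theorem leg13_legL (A : Matrix a a' E) : leg13 b (legL c A) = leg1 b c A := by
  ext ⟨i, j, k⟩ ⟨i', j', k'⟩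
  simp only [leg13, legL, leg1, ite_and]

theorem leg13_legR (A : Matrix c c' E) : leg13 b (legR a A) = leg3 a b A := by
  ext ⟨i, j, k⟩ ⟨i', j', k'⟩
  simp only [leg13, legR, leg3, ite_and]; split_ifs <;> rfl

theorem leg23_legL (A : Matrix b b' E) : leg23 a (legL c A) = leg2 a c A := by
  ext ⟨i, j, k⟩ ⟨i', j', k'⟩
  simp only [leg23, legL, leg2, ite_and]

theorem leg23_legR (A : Matrix c c' E) : leg23 a (legR b A) = leg3 a b A := by
  ext ⟨i, j, k⟩ ⟨i', j', k'⟩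
  simp only [leg23, legR, leg3, ite_and]

theorem leg12_scal (A : Matrix (a × b) (a' × b') ℂ) : leg12 c (scal E A) = scal E (leg12 c A) := by
  ext ⟨i, j, k⟩ ⟨i', j', k'⟩
  simp only [leg12, scal, Matrix.map_apply]; split_ifs <;> simp

theorem leg13_scal (A : Matrix (a × c) (a' × c') ℂ) : leg13 b (scal E A) = scal E (leg13 b A) := by
  ext ⟨i, j, k⟩ ⟨i', j', k'⟩
  simp only [leg13, scal, Matrix.map_apply]; split_ifs <;> simp

theorem leg23_scal (A : Matrix (b × c) (b' × c') ℂ) : leg23 a (scal E A) = scal E (leg23 a A) := by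
  ext ⟨i, j, k⟩ ⟨i', j', k'⟩
  simp only [leg23, scal, Matrix.map_apply]; split_ifs <;> simp

theorem flipM_legL (A : Matrix a a' E) : flipM (legL b A) = legR b A := rfl

theorem flipM_legR (A : Matrix b b' E) : flipM (legR a A) = legL a A := rfl

theorem flipM_scal (A : Matrix (a × b) (a' × b') ℂ) : flipM (scal E A) = scal E (flipM A) := rfl

theorem scal_one : scal E (1 : Matrix a a ℂ) = 1 := by
  simp [scal]

theorem flipM_one : flipM (1 : Matrix (a × b) (a × b) E) = 1 := by
  ext ⟨i, j⟩ ⟨i', j'⟩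
  simp only [flipM, Matrix.one_apply, Prod.mk.injEq, and_comm]

theorem flipM_swapM : flipM (swapM E a b) = swapM E b a := by
  ext ⟨i, j⟩ ⟨i', j'⟩
  simp only [flipM, swapM, and_comm]

end Simple

end Legs

/-! ### The R-matrix -/

section RMatrix

/-- The standard R-matrix on a linearly ordered index set. -/
def stdR (q : ℂ) (ι : Type*) [LinearOrder ι] : Matrix (ι × ι) (ι × ι) ℂ := fun p p' =>
  (if p = p' then (if p.1 = p.2 then q else 1) else 0)
    + (if p.1 < p.2 ∧ p' = (p.2, p.1) then q - q⁻¹ else 0)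

section Std

variable {ι : Type*} [LinearOrder ι] [Fintype ι] {q : ℂ}

/-- Identities for R are verified on row basis vectors: R sends such a vector to a combination of at
most two others, so products of several R-matrices become short explicit sums. -/
theorem single_vecMul_stdR (i j : ι) :
    Matrix.vecMul (Pi.single (i, j) 1) (stdR q ι) =
      (if i = j then q else 1) • Pi.single (i, j) 1 +
        (if i < j then q - q⁻¹ else 0) • Pi.single (j, i) 1 := by
  ext p
  rw [Matrix.single_one_vecMul]
  simp only [stdR, Matrix.row, Pi.add_apply, Pi.smul_apply, Pi.single_apply, smul_eq_mul, ite_and,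
    mul_ite, mul_one, mul_zero, eq_comm (a := p)]
  split_ifs <;> simp_all

theorem single_vecMul_leg12 (i j k : ι) :
    Matrix.vecMul (Pi.single (i, j, k) 1) (leg12 ι (stdR q ι)) =
      (if i = j then q else 1) • Pi.single (i, j, k) 1 +
        (if i < j then q - q⁻¹ else 0) • Pi.single (j, i, k) 1 := by
  ext ⟨a, b, c⟩
  rw [Matrix.single_one_vecMul]
  simp only [stdR, leg12, Matrix.row, Pi.add_apply, Pi.smul_apply, Pi.single_apply, smul_eq_mul,
    ite_and, mul_ite, mul_one, mul_zero, Prod.mk.injEq, eq_comm (b := a), eq_comm (b := b),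
    eq_comm (b := c)]
  split_ifs <;> simp_all

theorem single_vecMul_leg13 (i j k : ι) :
    Matrix.vecMul (Pi.single (i, j, k) 1) (leg13 ι (stdR q ι)) =
      (if i = k then q else 1) • Pi.single (i, j, k) 1 +
        (if i < k then q - q⁻¹ else 0) • Pi.single (k, j, i) 1 := by
  ext ⟨a, b, c⟩
  rw [Matrix.single_one_vecMul]
  simp only [stdR, leg13, Matrix.row, Pi.add_apply, Pi.smul_apply, Pi.single_apply, smul_eq_mul,
    ite_and, mul_ite, mul_one, mul_zero, Prod.mk.injEq, eq_comm (b := a), eq_comm (b := b),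
    eq_comm (b := c)]
  split_ifs <;> simp_all

theorem single_vecMul_leg23 (i j k : ι) :
    Matrix.vecMul (Pi.single (i, j, k) 1) (leg23 ι (stdR q ι)) =
      (if j = k then q else 1) • Pi.single (i, j, k) 1 +
        (if j < k then q - q⁻¹ else 0) • Pi.single (i, k, j) 1 := by
  ext ⟨a, b, c⟩
  rw [Matrix.single_one_vecMul]
  simp only [stdR, leg23, Matrix.row, Pi.add_apply, Pi.smul_apply, Pi.single_apply, smul_eq_mul,
    ite_and, mul_ite, mul_one, mul_zero, Prod.mk.injEq, eq_comm (b := a), eq_comm (b := b),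
    eq_comm (b := c)]
  split_ifs <;> simp_all

/-- R decomposes into scalars q and unipotent triangular blocks on the pairs (i, j), (j, i), with
off-diagonal entry q − q⁻¹, which changes sign under q ↦ q⁻¹. Hence an R-matrix with parameter q⁻¹
stands for R⁻¹ throughout. -/
theorem stdR_mul_inv (hq : q ≠ 0) : stdR q ι * stdR q⁻¹ ι = 1 := by
  refine Matrix.ext_of_single_vecMul fun ⟨i, j⟩ => ?_
  rw [← Matrix.vecMul_vecMul, single_vecMul_stdR, Matrix.add_vecMul, Matrix.smul_vecMul,
    Matrix.smul_vecMul, single_vecMul_stdR, single_vecMul_stdR, Matrix.vecMul_one]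
  rcases lt_trichotomy i j with h | h | h
  · simp [h, h.ne, h.ne', h.not_gt]
    module
  · simp [h, smul_smul, hq]
  · simp [h, h.ne, h.ne', h.not_gt]

/-- This is the Hecke condition R − R₂₁⁻¹ = (q − q⁻¹)P. It is responsible for the cancellation of
the inhomogeneous terms in `IsWeyl.qMatDefect_comm`. -/
theorem stdR_sub_flip :
    stdR q ι - flipM (stdR q⁻¹ ι) = (q - q⁻¹) • swapM ℂ ι ι := by
  ext ⟨i, j⟩ ⟨i', j'⟩
  simp only [stdR, flipM, swapM, Matrix.sub_apply, Matrix.smul_apply, Prod.mk.injEq, smul_eq_mul]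
  rcases lt_trichotomy i j with h | h | h
  · simp [h, h.ne, h.ne', h.not_gt, and_comm, eq_comm]
  · subst h; simp [and_comm, eq_comm]; split_ifs <;> simp
  · simp [h, h.ne, h.ne', h.not_gt, and_comm, eq_comm]; split_ifs <;> simp

/-- On a row basis vector the coefficients depend only on the relative order of its three indices,
so finitely many explicit identities remain. -/
theorem stdR_yangBaxter (hq : q ≠ 0) :
    leg12 ι (stdR q ι) * leg13 ι (stdR q ι) * leg23 ι (stdR q ι) =
      leg23 ι (stdR q ι) * leg13 ι (stdR q ι) * leg12 ι (stdR q ι) := by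
  refine Matrix.ext_of_single_vecMul fun ⟨i, j, k⟩ => ?_
  simp only [← Matrix.vecMul_vecMul, single_vecMul_leg12, single_vecMul_leg13, single_vecMul_leg23,
    Matrix.add_vecMul, Matrix.smul_vecMul]
  rcases lt_trichotomy i j with h | h | h <;> rcases lt_trichotomy j k with h' | h' | h' <;>
  rcases lt_trichotomy i k with h'' | h'' | h'' <;>
  first
  | (exfalso; order)
  | (simp [*, h.ne, h.ne', h.not_gt, h'.ne, h'.ne', h'.not_gt, h''.ne, h''.ne', h''.not_gt]; done)
  | (simp [*, h.ne, h.ne', h.not_gt, h'.ne, h'.ne', h'.not_gt, h''.ne, h''.ne', h''.not_gt]; module)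
  | (subst_vars; simp [*, h'.ne, h'.ne', h'.not_gt]; match_scalars <;> field_simp <;> ring)
  | (subst_vars; simp [*, h.ne, h.ne', h.not_gt]; match_scalars <;> field_simp <;> ring)
  | (subst_vars; simp [h''.ne, h''.ne', h''.not_gt])
  | (subst_vars; simp)

end Std

variable {V : Type*} (q : ℂ) {d : V → ℕ}

open Classical in
/-- The R-matrix on the product of the standard representations of two vertices. -/
def vertR (d : V → ℕ) (u v : V) : Matrix (Fin (d u) × Fin (d v)) (Fin (d u) × Fin (d v)) ℂ :=
  fun p p' =>
    (if p = p' then (if (⟨u, p.1⟩ : VIdx d) = ⟨v, p.2⟩ then q else 1) else 0)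
      + (if VIdx.Before (d := d) ⟨u, p.1⟩ ⟨v, p.2⟩ ∧ (⟨u, p'.1⟩ : VIdx d) = ⟨v, p.2⟩ ∧
          (⟨v, p'.2⟩ : VIdx d) = ⟨u, p.1⟩ then q - q⁻¹ else 0)

theorem vertR_self (u : V) : vertR q d u u = stdR q (Fin (d u)) := by
  ext ⟨i, j⟩ ⟨i', j'⟩
  simp only [vertR, stdR, VIdx.Before, Sigma.mk.injEq, heq_eq_eq, true_and, Prod.mk.injEq,
    Fin.val_fin_lt]

theorem vertR_of_ne {u v : V} (h : u ≠ v) : vertR q d u v = 1 := by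
  ext ⟨i, j⟩ ⟨i', j'⟩
  simp [vertR, VIdx.Before, h, Matrix.one_apply]

variable {q}

theorem vertR_mul_inv (hq : q ≠ 0) (u v : V) : vertR q d u v * vertR q⁻¹ d u v = 1 := by
  by_cases h : u = v
  · subst h; rw [vertR_self, vertR_self, stdR_mul_inv hq]
  · rw [vertR_of_ne _ h, vertR_of_ne _ h, mul_one]

theorem vertR_inv_mul (hq : q ≠ 0) (u v : V) : vertR q⁻¹ d u v * vertR q d u v = 1 := by
  have := vertR_mul_inv (d := d) (inv_ne_zero hq) u v
  rwa [inv_inv] at this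

theorem vertR_sub_flip (u : V) :
    vertR q d u u - flipM (vertR q⁻¹ d u u) = (q - q⁻¹) • swapM ℂ (Fin (d u)) (Fin (d u)) := by
  rw [vertR_self, vertR_self, stdR_sub_flip]

/-- Unless all three vertices coincide, at most one of the three R-matrices differs from the
identity and both sides are equal to it. -/
theorem vertR_yangBaxter (hq : q ≠ 0) (u v w : V) :
    leg12 (Fin (d w)) (vertR q d u v) * leg13 (Fin (d v)) (vertR q d u w) *
        leg23 (Fin (d u)) (vertR q d v w) =
      leg23 (Fin (d u)) (vertR q d v w) * leg13 (Fin (d v)) (vertR q d u w) *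
        leg12 (Fin (d w)) (vertR q d u v) := by
  by_cases huv : u = v
  · subst huv
    by_cases huw : u = w
    · subst huw
      simp only [vertR_self, stdR_yangBaxter hq]
    · simp [vertR_of_ne q huw, leg13_one, leg23_one]
  · by_cases huw : u = w
    · subst huw
      simp [vertR_of_ne q huv, vertR_of_ne q (Ne.symm huv), leg12_one, leg23_one]
    · simp [vertR_of_ne q huv, vertR_of_ne q huw, leg12_one, leg13_one]

end RMatrix

/-! ### Matrix form of the relations, and their covariance -/

section Covariance

theorem mul_eq_mul_assoc {E : Type*} [Ring E] {a b c c' f : Type*} [Fintype b] [Fintype c]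
    [Fintype c']
    {A : Matrix a b E} {B : Matrix b c E} {A' : Matrix a c' E} {B' : Matrix c' c E}
    (h : A * B = A' * B') (Z : Matrix c f E) : A * (B * Z) = A' * (B' * Z) := by
  rw [← Matrix.mul_assoc, h, Matrix.mul_assoc]

theorem mul_mul_eq_assoc {E : Type*} [Ring E] {a b c e f : Type*} [Fintype b] [Fintype c]
    [Fintype e] {A : Matrix a b E} {B : Matrix b c E} {C : Matrix c e E} {D : Matrix a e E}
    (h : A * (B * C) = D) (Z : Matrix e f E) : A * (B * (C * Z)) = D * Z := by
  rw [← h, Matrix.mul_assoc, Matrix.mul_assoc]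

theorem mul_eq_one_assoc {E : Type*} [Ring E] {a b f : Type*} [Fintype a] [Fintype b]
    [DecidableEq a] {A : Matrix a b E} {B : Matrix b a E}
    (h : A * B = 1) (Z : Matrix a f E) : A * (B * Z) = Z := by
  rw [← Matrix.mul_assoc, h, Matrix.one_mul]


variable {V : Type*} {q : ℂ} {d : V → ℕ} {E : Type*} [Ring E] [Algebra ℂ E]

/-- The R-matrix of two vertices over an algebra. -/
def RE (E : Type*) [Ring E] [Algebra ℂ E] (q : ℂ) (d : V → ℕ) (u v : V) :
    Matrix (Fin (d u) × Fin (d v)) (Fin (d u) × Fin (d v)) E :=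
  scal E (vertR q d u v)

theorem RE_mul_inv (hq : q ≠ 0) (u v : V) : RE E q d u v * RE E q⁻¹ d u v = 1 := by
  rw [RE, RE, ← scal_mul, vertR_mul_inv hq, scal_one]

theorem RE_inv_mul (hq : q ≠ 0) (u v : V) : RE E q⁻¹ d u v * RE E q d u v = 1 := by
  rw [RE, RE, ← scal_mul, vertR_inv_mul hq, scal_one]

theorem RE_of_ne {u v : V} (h : u ≠ v) : RE E q d u v = 1 := by
  rw [RE, vertR_of_ne _ h, scal_one]

/-- The relations of a quantum matrix. -/
def IsQMat (q : ℂ) (d : V → ℕ) {t s : V} (X : Matrix (Fin (d t)) (Fin (d s)) E) : Prop :=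
  RE E q d t t * (legL (Fin (d t)) X * legR (Fin (d s)) X) =
    legR (Fin (d t)) X * legL (Fin (d s)) X * flipM (RE E q d s s)

/-- The cross relations of a braided tensor product. -/
def IsCross (q : ℂ) (d : V → ℕ) {ta sa tb sb : V} (A : Matrix (Fin (d ta)) (Fin (d sa)) E)
    (B : Matrix (Fin (d tb)) (Fin (d sb)) E) : Prop :=
  legL (Fin (d ta)) B * (RE E q⁻¹ d sb ta * legR (Fin (d sb)) A) =
    RE E q⁻¹ d tb ta * (legR (Fin (d tb)) A * (RE E q d tb sa * (legL (Fin (d sa)) B *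
      RE E q⁻¹ d sb sa)))

/-- The relations between derivations and coordinates. -/
def IsWeyl (q : ℂ) (d : V → ℕ) {t s : V} (X : Matrix (Fin (d t)) (Fin (d s)) E)
    (D : Matrix (Fin (d s)) (Fin (d t)) E) : Prop :=
  legL (Fin (d t)) D * (RE E q⁻¹ d t t * legR (Fin (d t)) X) =
    legR (Fin (d s)) X * (RE E q d s s * legL (Fin (d s)) D) + swapM E (Fin (d s)) (Fin (d t))

/-- An invertible family of matrices, one for each vertex, which satisfies the RTT relations. -/
structure IsRTT (q : ℂ) (d : V → ℕ) (C C' : ∀ v : V, Matrix (Fin (d v)) (Fin (d v)) E) : Prop where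
  mul_inv : ∀ v, C v * C' v = 1
  inv_mul : ∀ v, C' v * C v = 1
  rtt : ∀ u v, RE E q d u v * (legL (Fin (d v)) (C u) * legR (Fin (d u)) (C v)) =
    legR (Fin (d u)) (C v) * (legL (Fin (d v)) (C u) * RE E q d u v)

namespace IsRTT

variable {C C' : ∀ v : V, Matrix (Fin (d v)) (Fin (d v)) E}

theorem legL_mul_inv (h : IsRTT q d C C') (v : V) (b : Type*) [Fintype b] [DecidableEq b] :
    legL b (C v) * legL b (C' v) = 1 := by rw [← legL_mul, h.mul_inv, legL_one]

theorem legL_inv_mul (h : IsRTT q d C C') (v : V) (b : Type*) [Fintype b] [DecidableEq b] :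
    legL b (C' v) * legL b (C v) = 1 := by rw [← legL_mul, h.inv_mul, legL_one]

theorem legR_mul_inv (h : IsRTT q d C C') (v : V) (b : Type*) [Fintype b] [DecidableEq b] :
    legR b (C v) * legR b (C' v) = 1 := by rw [← legR_mul, h.mul_inv, legR_one]

theorem legR_inv_mul (h : IsRTT q d C C') (v : V) (b : Type*) [Fintype b] [DecidableEq b] :
    legR b (C' v) * legR b (C v) = 1 := by rw [← legR_mul, h.inv_mul, legR_one]

/-- This and the following lemmas rearrange the RTT relation by multiplying with inverses on both
sides, so that C, C⁻¹ and R can be moved past each other in every configuration that occurs in the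
covariance proofs. -/
theorem comm_inv (hq : q ≠ 0) (h : IsRTT q d C C') (u v : V) :
    legL (Fin (d v)) (C u) * (legR (Fin (d u)) (C v) * RE E q⁻¹ d u v) =
      RE E q⁻¹ d u v * (legR (Fin (d u)) (C v) * legL (Fin (d v)) (C u)) := by
  have h1 := congrArg (fun Z => RE E q⁻¹ d u v * (Z * RE E q⁻¹ d u v)) (h.rtt u v)
  simp only [Matrix.mul_assoc, RE_mul_inv hq, Matrix.mul_one] at h1
  rwa [mul_eq_one_assoc (RE_inv_mul hq u v)] at h1

theorem inv_R_mul (hq : q ≠ 0) (h : IsRTT q d C C') (u v : V) :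
    legL (Fin (d v)) (C' u) * (RE E q⁻¹ d u v * legR (Fin (d u)) (C v)) =
      legR (Fin (d u)) (C v) * (RE E q⁻¹ d u v * legL (Fin (d v)) (C' u)) := by
  have h1 := congrArg (fun Z => legL (Fin (d v)) (C' u) * (Z * legL (Fin (d v)) (C' u)))
    (h.comm_inv hq u v)
  simp only [Matrix.mul_assoc, h.legL_mul_inv, Matrix.mul_one] at h1
  rw [mul_eq_one_assoc (h.legL_inv_mul u _)] at h1
  exact h1.symm

theorem inv_R_mul' (h : IsRTT q d C C') (u v : V) :
    legR (Fin (d u)) (C' v) * (RE E q d u v * legL (Fin (d v)) (C u)) =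
      legL (Fin (d v)) (C u) * (RE E q d u v * legR (Fin (d u)) (C' v)) := by
  have h1 := congrArg (fun Z => legR (Fin (d u)) (C' v) * (Z * legR (Fin (d u)) (C' v)))
    (h.rtt u v)
  simp only [Matrix.mul_assoc, h.legR_mul_inv, Matrix.mul_one] at h1
  rwa [mul_eq_one_assoc (h.legR_inv_mul v _)] at h1

theorem inv_comm (h : IsRTT q d C C') (u v : V) :
    RE E q d u v * (legR (Fin (d u)) (C' v) * legL (Fin (d v)) (C' u)) =
      legL (Fin (d v)) (C' u) * (legR (Fin (d u)) (C' v) * RE E q d u v) := by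
  have h1 := congrArg (fun Z => legL (Fin (d v)) (C' u) * (Z * legL (Fin (d v)) (C' u)))
    (h.inv_R_mul' u v)
  simp only [Matrix.mul_assoc] at h1
  rw [mul_eq_one_assoc (h.legL_inv_mul u _), h.legL_mul_inv, Matrix.mul_one] at h1
  exact h1.symm

theorem inv_comm_inv (hq : q ≠ 0) (h : IsRTT q d C C') (u v : V) :
    RE E q⁻¹ d u v * (legL (Fin (d v)) (C' u) * legR (Fin (d u)) (C' v)) =
      legR (Fin (d u)) (C' v) * (legL (Fin (d v)) (C' u) * RE E q⁻¹ d u v) := by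
  have h1 := congrArg (fun Z => RE E q⁻¹ d u v * (Z * RE E q⁻¹ d u v)) (h.inv_comm u v)
  simp only [Matrix.mul_assoc, RE_mul_inv hq, Matrix.mul_one] at h1
  rw [mul_eq_one_assoc (RE_inv_mul hq u v)] at h1
  exact h1.symm

theorem flip_inv_comm (h : IsRTT q d C C') (u : V) :
    flipM (RE E q d u u) * (legL (Fin (d u)) (C' u) * legR (Fin (d u)) (C' u)) =
      legR (Fin (d u)) (C' u) * (legL (Fin (d u)) (C' u) * flipM (RE E q d u u)) := by
  have h1 := congrArg flipM (h.inv_comm u u)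
  simpa only [flipM_mul, flipM_legL, flipM_legR] using h1

/-- Covariance of quantum matrices: R passes the two copies of C by RTT, then the relation of X
applies, and the resulting R₂₁ passes the two copies of C⁻¹. Since the two vertices differ, C at the
target and C⁻¹ at the source commute, which brings the factors into position. -/
theorem isQMat (h : IsRTT q d C C') (hq : q ≠ 0) {t s : V} (hts : t ≠ s)
    {X : Matrix (Fin (d t)) (Fin (d s)) E} (hX : IsQMat q d X)
    (hC : ∀ v, EntriesCommute (C v) X) (hC' : ∀ v, EntriesCommute (C' v) X) :
    IsQMat q d (C t * (X * C' s)) := by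
  have e1 := h.inv_R_mul hq s t
  rw [RE_of_ne hts.symm, Matrix.one_mul, Matrix.one_mul] at e1
  have e2 := h.inv_R_mul' t s
  rw [RE_of_ne hts, Matrix.one_mul, Matrix.one_mul] at e2
  rw [IsQMat] at hX ⊢
  simp only [Matrix.mul_assoc] at hX
  simp only [legL_mul, legR_mul, Matrix.mul_assoc]
  rw [mul_eq_mul_assoc e1, mul_eq_mul_assoc (hC t).symm.leg_comm,
    mul_eq_mul_assoc (hC' s).leg_comm, mul_mul_eq_assoc (h.rtt t t)]
  simp only [Matrix.mul_assoc]
  rw [mul_mul_eq_assoc hX]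
  simp only [Matrix.mul_assoc]
  rw [h.flip_inv_comm, mul_eq_mul_assoc (hC t).leg_comm, mul_eq_mul_assoc (hC' s).symm.leg_comm,
    mul_eq_mul_assoc e2.symm]

/-- Both edges are dressed by the same family. Each R-matrix in the cross relation sits between the
legs on which C or C⁻¹ acts, and passes them by one form of RTT. -/
theorem isCross (h : IsRTT q d C C') (hq : q ≠ 0) {ta sa tb sb : V}
    {A : Matrix (Fin (d ta)) (Fin (d sa)) E} {B : Matrix (Fin (d tb)) (Fin (d sb)) E}
    (hAB : IsCross q d A B)
    (hA : ∀ v, EntriesCommute (C v) A) (hA' : ∀ v, EntriesCommute (C' v) A)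
    (hB : ∀ v, EntriesCommute (C v) B) (hB' : ∀ v, EntriesCommute (C' v) B) :
    IsCross q d (C ta * (A * C' sa)) (C tb * (B * C' sb)) := by
  rw [IsCross] at hAB ⊢
  simp only [legL_mul, legR_mul, Matrix.mul_assoc]
  rw [mul_mul_eq_assoc (h.inv_R_mul hq sb ta)]
  simp only [Matrix.mul_assoc]
  rw [mul_eq_mul_assoc (hB ta).symm.leg_comm, mul_eq_mul_assoc (hA' sb).leg_comm,
    mul_mul_eq_assoc hAB]
  simp only [Matrix.mul_assoc]
  rw [mul_mul_eq_assoc (h.comm_inv hq tb ta), h.inv_comm_inv hq]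
  simp only [Matrix.mul_assoc]
  rw [mul_eq_mul_assoc (hA tb).leg_comm, mul_eq_mul_assoc (hB' sa).symm.leg_comm,
    mul_mul_eq_assoc (h.inv_R_mul' tb sa)]
  simp only [Matrix.mul_assoc]

/-- The homogeneous part transforms as the cross relations do. In the inhomogeneous part the flip
carries C⁻¹ and C to the opposite legs, where each meets its inverse and disappears. -/
theorem isWeyl (h : IsRTT q d C C') (hq : q ≠ 0) {t s : V} (hts : t ≠ s)
    {X : Matrix (Fin (d t)) (Fin (d s)) E} {D : Matrix (Fin (d s)) (Fin (d t)) E}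
    (hXD : IsWeyl q d X D)
    (hX : ∀ v, EntriesCommute (C v) X) (hX' : ∀ v, EntriesCommute (C' v) X)
    (hD : ∀ v, EntriesCommute (C v) D) (hD' : ∀ v, EntriesCommute (C' v) D) :
    IsWeyl q d (C t * (X * C' s)) (C s * (D * C' t)) := by
  have e1 := h.inv_comm t s
  rw [RE_of_ne hts, Matrix.one_mul, Matrix.mul_one] at e1
  have e2 := h.rtt s t
  rw [RE_of_ne hts.symm, Matrix.one_mul, Matrix.mul_one] at e2
  have e3 : swapM E (Fin (d s)) (Fin (d t)) * legL (Fin (d s)) (C' t) =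
      legR (Fin (d s)) (C' t) * swapM E (Fin (d s)) (Fin (d t)) :=
    swapM_mul_flipM (legR (Fin (d s)) (C' t))
  have e4 : swapM E (Fin (d s)) (Fin (d t)) * legR (Fin (d t)) (C' s) =
      legL (Fin (d t)) (C' s) * swapM E (Fin (d s)) (Fin (d t)) :=
    swapM_mul_flipM (legL (Fin (d t)) (C' s))
  rw [IsWeyl] at hXD ⊢
  simp only [legL_mul, legR_mul, Matrix.mul_assoc]
  rw [mul_mul_eq_assoc (h.inv_R_mul hq t t)]
  simp only [Matrix.mul_assoc]
  rw [mul_eq_mul_assoc (hD t).symm.leg_comm, mul_eq_mul_assoc (hX' t).leg_comm,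
    mul_mul_eq_assoc hXD]
  simp only [Matrix.mul_assoc, Matrix.add_mul, Matrix.mul_add]
  congr 1
  · rw [← e1, mul_eq_mul_assoc e2, mul_eq_mul_assoc (hX s).leg_comm,
      mul_eq_mul_assoc (hD' s).symm.leg_comm, mul_mul_eq_assoc (h.inv_R_mul' s s)]
    simp only [Matrix.mul_assoc]
  · rw [mul_eq_mul_assoc e3, e4, mul_eq_one_assoc (h.legR_mul_inv t _),
      mul_eq_one_assoc (h.legL_mul_inv s _)]

end IsRTT

/-- The commutation relations of a family of operators with a quantum matrix on which they act by
the R-matrix. -/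
def IsSmash (q : ℂ) (d : V → ℕ) (C : ∀ v : V, Matrix (Fin (d v)) (Fin (d v)) E) {t s : V}
    (A : Matrix (Fin (d t)) (Fin (d s)) E) : Prop :=
  ∀ v, legL (Fin (d t)) (C v) * legR (Fin (d v)) A =
    RE E q⁻¹ d v t * (legR (Fin (d v)) A * (RE E q d v s * legL (Fin (d s)) (C v)))

/-- The bosonization principle: if passing C across A produces R, then replacing B by C B C⁻¹ turns
ordinary commutation of A and B into the braided relation. First C⁻¹ is moved across R⁻¹A, then B
commutes with A, and finally C is moved across A. -/
theorem IsSmash.isCross {C C' : ∀ v : V, Matrix (Fin (d v)) (Fin (d v)) E}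
    (h : IsRTT q d C C') (hq : q ≠ 0) {ta sa tb sb : V}
    {A : Matrix (Fin (d ta)) (Fin (d sa)) E} {B : Matrix (Fin (d tb)) (Fin (d sb)) E}
    (hA : IsSmash q d C A) (hAB : EntriesCommute A B) :
    IsCross q d A (C tb * (B * C' sb)) := by
  have e : legL (Fin (d ta)) (C' sb) * (RE E q⁻¹ d sb ta * legR (Fin (d sb)) A) =
      legR (Fin (d sb)) A * (legL (Fin (d sa)) (C' sb) * RE E q⁻¹ d sb sa) := by
    have h1 := congrArg (fun Z => legL (Fin (d ta)) (C' sb) * (Z * (legL (Fin (d sa)) (C' sb) *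
      RE E q⁻¹ d sb sa))) (hA sb)
    simp only [Matrix.mul_assoc] at h1
    rw [mul_eq_one_assoc (h.legL_inv_mul sb _), mul_eq_one_assoc (h.legL_mul_inv sb _),
      RE_mul_inv hq, Matrix.mul_one] at h1
    exact h1.symm
  rw [IsCross]
  simp only [legL_mul, Matrix.mul_assoc]
  rw [e, mul_eq_mul_assoc hAB.symm.leg_comm, ← Matrix.mul_assoc (legL (Fin (d ta)) (C tb)), hA tb]
  simp only [Matrix.mul_assoc]

end Covariance

/-! ### Coordinate form of the relations -/

section Coordinates

variable {V : Type*} {q : ℂ} {d : V → ℕ} {E : Type*} [Ring E] [Algebra ℂ E]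

theorem RE_self_mul_apply {u : V} {p : Type*} (A : Matrix (Fin (d u) × Fin (d u)) p E)
    (i j : Fin (d u)) (k : p) :
    (RE E q d u u * A) (i, j) k =
      (if i = j then q else 1) • A (i, j) k + (if i < j then q - q⁻¹ else 0) • A (j, i) k := by
  simp only [RE, vertR_self, scal, Matrix.mul_apply, Matrix.map_apply, stdR, map_add, add_mul,
    Finset.sum_add_distrib, ite_and]
  congr 1
  · rw [Finset.sum_eq_single (i, j)] <;> simp +contextual [Algebra.smul_def, eq_comm]
  · rw [Finset.sum_eq_single (j, i)] <;> simp +contextual [Algebra.smul_def]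

theorem mul_RE_self_apply {u : V} {p : Type*} (A : Matrix p (Fin (d u) × Fin (d u)) E)
    (i j : Fin (d u)) (k : p) :
    (A * RE E q d u u) k (i, j) =
      (if i = j then q else 1) • A k (i, j) + (if j < i then q - q⁻¹ else 0) • A k (j, i) := by
  simp only [RE, vertR_self, scal, Matrix.mul_apply, Matrix.map_apply, stdR, map_add, mul_add,
    Finset.sum_add_distrib, ite_and]
  congr 1
  · rw [Finset.sum_eq_single (i, j)] <;>
      simp +contextual [Algebra.smul_def, ← Algebra.commutes]
  · rw [Finset.sum_eq_single (j, i)]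
    · simp [Algebra.smul_def, ← Algebra.commutes]
    · rintro ⟨a, b⟩ - h
      have : ¬ ((i, j) = (b, a)) := fun h' => h (by cases h'; rfl)
      simp [this]
    · simp

theorem mul_flipM_RE_apply {u : V} {p : Type*} (A : Matrix p (Fin (d u) × Fin (d u)) E)
    (i j : Fin (d u)) (k : p) :
    (A * flipM (RE E q d u u)) k (i, j) =
      (if i = j then q else 1) • A k (i, j) + (if i < j then q - q⁻¹ else 0) • A k (j, i) := by
  have h := mul_RE_self_apply (q := q) (A.submatrix id Prod.swap) j i k
  simp only [Matrix.submatrix_apply, id, Prod.swap_prod_mk, eq_comm (a := j)] at h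
  rw [← h, Matrix.mul_apply, Matrix.mul_apply, ← (Equiv.prodComm _ _).sum_comp]
  rfl

theorem isQMat_iff {t s : V} {X : Matrix (Fin (d t)) (Fin (d s)) E} :
    IsQMat q d X ↔ ∀ i j m n,
      (if i = j then q else 1) • (X i m * X j n) +
          (if i < j then q - q⁻¹ else 0) • (X j m * X i n) =
        (if m = n then q else 1) • (X j n * X i m) +
          (if m < n then q - q⁻¹ else 0) • (X j m * X i n) := by
  rw [IsQMat, ← Matrix.ext_iff]
  simp only [Prod.forall, RE_self_mul_apply, mul_flipM_RE_apply, legL_mul_legR, legR_mul_legL]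

/-- The matrix equation contains each exchange relation for i < j as well as for i > j; the case i <
j follows from the other by substitution. -/
theorem isQMat_of_relations (hq : q ≠ 0) {t s : V} {X : Matrix (Fin (d t)) (Fin (d s)) E}
    (h1 : ∀ i j m n, j < i → X i m * X j n = (if m = n then q else 1) • (X j n * X i m)
          + (if m < n then q - q⁻¹ else 0) • (X j m * X i n))
    (h2 : ∀ i m n, n < m → X i m * X i n = q⁻¹ • (X i n * X i m)) :
    IsQMat q d X := by
  rw [isQMat_iff]
  intro i j m n
  rcases lt_trichotomy i j with h | rfl | h
  · rw [h1 j i n m h, h1 j i m n h]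
    rcases lt_trichotomy m n with h' | rfl | h'
    · simp [h, h.ne, h'.ne, h'.ne', h', h'.not_gt]
    · simp only [h, h.ne, if_true, if_false, lt_irrefl, smul_smul]
      match_scalars
      field_simp
      ring
    · simp [h, h.ne, h'.ne, h'.ne', h', h'.not_gt]
  · rcases lt_trichotomy m n with h' | rfl | h'
    · rw [h2 i n m h']
      simp [h'.ne, h']
      module
    · simp
    · rw [h2 i m n h']
      simp [h'.ne', h'.not_gt, smul_smul, hq]
  · rw [h1 i j m n h]
    simp [h.ne', h.not_gt]

theorem IsQMat.relation {t s : V} {X : Matrix (Fin (d t)) (Fin (d s)) E} (h : IsQMat q d X)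
    {i j : Fin (d t)} (m n : Fin (d s)) (hij : j < i) :
    X i m * X j n = (if m = n then q else 1) • (X j n * X i m)
          + (if m < n then q - q⁻¹ else 0) • (X j m * X i n) := by
  have := isQMat_iff.1 h i j m n
  simpa [hij.ne', hij.not_gt] using this

theorem IsQMat.relation_same (hq : q ≠ 0) {t s : V} {X : Matrix (Fin (d t)) (Fin (d s)) E}
    (h : IsQMat q d X) (i : Fin (d t)) {m n : Fin (d s)} (hmn : n < m) :
    X i m * X i n = q⁻¹ • (X i n * X i m) := by
  have := isQMat_iff.1 h i i m n
  simp only [if_true, lt_irrefl, if_false, zero_smul, add_zero, hmn.ne', hmn.not_gt,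
    one_smul] at this
  rw [← this, smul_smul, inv_mul_cancel₀ hq, one_smul]

theorem isWeyl_iff {t s : V} {X : Matrix (Fin (d t)) (Fin (d s)) E}
    {D : Matrix (Fin (d s)) (Fin (d t)) E} :
    IsWeyl q d X D ↔ ∀ i j m n,
      (if j = m then q⁻¹ else 1) • (D i m * X j n) -
          (if j = m then q - q⁻¹ else 0) • ∑ p ∈ Finset.Iio j, D i p * X p n =
        (if i = n then q else 1) • (X j n * D i m) +
          (if i = n then q - q⁻¹ else 0) • ∑ p ∈ Finset.Ioi i, X j p * D p m +
          (if i = n ∧ j = m then 1 else 0) := by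
  have hL : ∀ i j m n, (legL (Fin (d t)) D * (RE E q⁻¹ d t t * legR (Fin (d t)) X)) (i, j) (m, n) =
      (if j = m then q⁻¹ else 1) • (D i m * X j n) -
          (if j = m then q - q⁻¹ else 0) • ∑ p ∈ Finset.Iio j, D i p * X p n := by
    intro i j m n
    have : ∀ x x1, legL (Fin (d t)) D (i, j) (x, x1) * ((if x = x1 then q⁻¹ else 1) •
        legR (Fin (d t)) X (x, x1) (m, n) +
        (if x < x1 then q⁻¹ - q⁻¹⁻¹ else 0) • legR (Fin (d t)) X (x1, x) (m, n)) =
        (if j = x1 then ((if x = m then (if j = m then q⁻¹ else 1) • (D i x * X j n) else 0) -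
        (if j = m then (if x < j then (q - q⁻¹) • (D i x * X x n) else 0) else 0)) else 0) := by
      intro x x1
      simp only [legL, legR, inv_inv]
      split_ifs <;> first
        | (simp_all [mul_add, sub_eq_add_neg, add_smul, neg_smul]; done)
        | (exfalso; order)
    rw [Matrix.mul_apply, Fintype.sum_prod_type]
    simp only [RE_self_mul_apply, this]
    simp only [Finset.sum_ite_eq, Finset.mem_univ, if_true, Finset.sum_sub_distrib,
      Finset.sum_ite_eq']
    congr 1
    split_ifs with h
    · rw [Finset.smul_sum, ← Finset.sum_filter]
      congr 1; ext p; simp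
    · simp
  have hR : ∀ i j m n, (legR (Fin (d s)) X * (RE E q d s s * legL (Fin (d s)) D)) (i, j) (m, n) =
      (if i = n then q else 1) • (X j n * D i m) +
          (if i = n then q - q⁻¹ else 0) • ∑ p ∈ Finset.Ioi i, X j p * D p m := by
    intro i j m n
    have : ∀ x x1, legR (Fin (d s)) X (i, j) (x, x1) * ((if x = x1 then q else 1) •
        legL (Fin (d s)) D (x, x1) (m, n) +
        (if x < x1 then q - q⁻¹ else 0) • legL (Fin (d s)) D (x1, x) (m, n)) =
        (if i = x then ((if x1 = n then (if i = n then q else 1) • (X j n * D i m) else 0) +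
        (if i = n then (if i < x1 then (q - q⁻¹) • (X j x1 * D x1 m) else 0) else 0)) else 0) := by
      intro x x1
      simp only [legL, legR]
      split_ifs <;> first
        | (simp_all [mul_add]; done)
        | (exfalso; order)
    rw [Matrix.mul_apply, Fintype.sum_prod_type, Finset.sum_comm]
    simp only [RE_self_mul_apply, this]
    simp only [Finset.sum_ite_eq, Finset.mem_univ, if_true, Finset.sum_add_distrib,
      Finset.sum_ite_eq']
    congr 1
    split_ifs with h
    · rw [Finset.smul_sum, ← Finset.sum_filter]
      congr 1; ext p; simp
    · simp
  rw [IsWeyl, ← Matrix.ext_iff]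
  simp only [Prod.forall, hL, hR, Matrix.add_apply, swapM]

/-- The matrix of the generators `x^i_j`. -/
def matX (q : ℂ) (M N : ℕ) : Matrix (Fin M) (Fin N) (EdgeAlg q M N) := fun i j => edgeX q i j

/-- The matrix of the generators `∂_k^l`. -/
def matD (q : ℂ) (M N : ℕ) : Matrix (Fin N) (Fin M) (EdgeAlg q M N) := fun l k => edgePd q k l

theorem edge_xx (q : ℂ) {M N : ℕ} (i j : Fin M) (m n : Fin N) (h : j < i) :
    edgeX q i m * edgeX q j n = (if m = n then q else 1) • (edgeX q j n * edgeX q i m)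
      + (if m < n then q - q⁻¹ else 0) • (edgeX q j m * edgeX q i n) := by
  have h := RingQuot.mkAlgHom_rel ℂ (EdgeRel.xx (q := q) i j m n h)
  simp only [map_add, map_smul, map_mul] at h
  exact h

theorem edge_xx_same (q : ℂ) {M N : ℕ} (i : Fin M) (m n : Fin N) (h : n < m) :
    edgeX q i m * edgeX q i n = q⁻¹ • (edgeX q i n * edgeX q i m) := by
  simpa [edgeX] using RingQuot.mkAlgHom_rel ℂ (EdgeRel.xx_same (q := q) i m n h)

theorem edge_dd (q : ℂ) {M N : ℕ} (i j : Fin N) (m n : Fin M) (h : j < i) :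
    edgePd q m i * edgePd q n j = (if m = n then q else 1) • (edgePd q n j * edgePd q m i)
      + (if m < n then q - q⁻¹ else 0) • (edgePd q m j * edgePd q n i) := by
  have h := RingQuot.mkAlgHom_rel ℂ (EdgeRel.dd (q := q) i j m n h)
  simp only [map_add, map_smul, map_mul] at h
  exact h

theorem edge_dd_same (q : ℂ) {M N : ℕ} (i : Fin N) (m n : Fin M) (h : n < m) :
    edgePd q m i * edgePd q n i = q⁻¹ • (edgePd q n i * edgePd q m i) := by
  simpa [edgePd] using RingQuot.mkAlgHom_rel ℂ (EdgeRel.dd_same (q := q) i m n h)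

theorem edge_dx (q : ℂ) {M N : ℕ} (i n : Fin N) (j m : Fin M) :
    edgePd q m i * edgeX q j n =
      ((if i = n then q else 1) * (if j = m then q else 1)) • (edgeX q j n * edgePd q m i)
      + (if i = n then (if j = m then q else 1) * (q - q⁻¹) else 0) •
          ∑ p ∈ Finset.Ioi i, edgeX q j p * edgePd q m p
      + (if j = m then q ^ 2 - 1 else 0) • ∑ p ∈ Finset.Iio j, edgePd q p i * edgeX q p n
      + (if i = n ∧ j = m then q else 0) • 1 := by
  have h := RingQuot.mkAlgHom_rel ℂ (EdgeRel.dx (q := q) i n j m)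
  rw [map_add, map_add, map_add, map_smul, map_smul, map_smul, map_smul, map_sum, map_sum,
    map_one] at h
  simp only [map_mul] at h
  exact h

theorem isQMat_matX (hq : q ≠ 0) (t s : V) : IsQMat q d (matX q (d t) (d s)) :=
  isQMat_of_relations hq (fun i j m n h => edge_xx q i j m n h)
    (fun i m n h => edge_xx_same q i m n h)

theorem isQMat_matD (hq : q ≠ 0) (t s : V) : IsQMat q d (matD q (d t) (d s)) :=
  isQMat_of_relations hq (fun i j m n h => edge_dd q i j m n h)
    (fun i m n h => edge_dd_same q i m n h)

theorem isWeyl_matX_matD (hq : q ≠ 0) (t s : V) :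
    IsWeyl q d (matX q (d t) (d s)) (matD q (d t) (d s)) := by
  rw [isWeyl_iff]
  intro i j m n
  simp only [matX, matD]
  rw [edge_dx]
  by_cases hin : i = n <;> by_cases hjm : j = m <;> simp only [hin, hjm, if_true, if_false,
    true_and, and_true, and_false, false_and] <;> match_scalars <;> field_simp <;> ring

theorem IsWeyl.relation (hq : q ≠ 0) {t s : V} {X : Matrix (Fin (d t)) (Fin (d s)) E}
    {D : Matrix (Fin (d s)) (Fin (d t)) E} (h : IsWeyl q d X D) (i n : Fin (d s)) (j m : Fin (d t)) :
    D i m * X j n =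
      ((if i = n then q else 1) * (if j = m then q else 1)) • (X j n * D i m)
      + (if i = n then (if j = m then q else 1) * (q - q⁻¹) else 0) •
          ∑ p ∈ Finset.Ioi i, X j p * D p m
      + (if j = m then q ^ 2 - 1 else 0) • ∑ p ∈ Finset.Iio j, D i p * X p n
      + (if i = n ∧ j = m then q else 0) • 1 := by
  -- The presentation is the matrix relation multiplied by q^{δ_{jm}}: this removes the coefficient
  -- q⁻¹ on the left and turns q − q⁻¹ into q² − 1.
  have h1 := congrArg (fun z => (if j = m then q else 1) • z) (isWeyl_iff.1 h i j m n)
  have h2 : ∀ a b : E, (if j = m then q else 1) • ((if j = m then q⁻¹ else 1) • a -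
      (if j = m then q - q⁻¹ else 0) • b) = a - (if j = m then q ^ 2 - 1 else 0) • b := by
    intro a b
    split_ifs
    · match_scalars <;> field_simp
    · simp
  simp only [h2, sub_eq_iff_eq_add] at h1
  rw [h1]
  by_cases hin : i = n <;> by_cases hjm : j = m <;> simp only [hin, hjm, if_true, if_false,
    true_and, and_true, and_false, false_and] <;> match_scalars <;> ring

/-- The homomorphism from an edge algebra given by matrices which satisfy its relations. -/
def edgeLift (hq : q ≠ 0) {t s : V} {X : Matrix (Fin (d t)) (Fin (d s)) E}
    {D : Matrix (Fin (d s)) (Fin (d t)) E} (hX : IsQMat q d X) (hD : IsQMat q d D)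
    (h : IsWeyl q d X D) : EdgeAlg q (d t) (d s) →ₐ[ℂ] E :=
  RingQuot.liftAlgHom ℂ ⟨FreeAlgebra.lift ℂ
    (fun | EdgeGen.x i j => X i j | EdgeGen.pd k l => D l k), by
      intro a b hab
      cases hab with
      | xx i j m n h =>
        simp only [map_add, map_smul, map_mul, FreeAlgebra.lift_ι_apply]
        exact hX.relation m n h
      | xx_same i m n h => simpa using hX.relation_same hq i h
      | dd i j m n h =>
        simp only [map_add, map_smul, map_mul, FreeAlgebra.lift_ι_apply]
        exact hD.relation m n h
      | dd_same i m n h => simpa using hD.relation_same hq i h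
      | dx i n j m =>
        rw [map_add, map_add, map_add, map_smul, map_smul, map_smul, map_smul, map_sum, map_sum,
          map_one]
        simpa only [map_mul, FreeAlgebra.lift_ι_apply] using h.relation hq i n j m⟩

theorem edgeLift_edgeX (hq : q ≠ 0) {t s : V} {X : Matrix (Fin (d t)) (Fin (d s)) E}
    {D : Matrix (Fin (d s)) (Fin (d t)) E} (hX : IsQMat q d X) (hD : IsQMat q d D)
    (h : IsWeyl q d X D) (i : Fin (d t)) (j : Fin (d s)) :
    edgeLift hq hX hD h (edgeX q i j) = X i j := by
  simp [edgeLift, edgeX]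

theorem edgeLift_edgePd (hq : q ≠ 0) {t s : V} {X : Matrix (Fin (d t)) (Fin (d s)) E}
    {D : Matrix (Fin (d s)) (Fin (d t)) E} (hX : IsQMat q d X) (hD : IsQMat q d D)
    (h : IsWeyl q d X D) (i : Fin (d t)) (j : Fin (d s)) :
    edgeLift hq hX hD h (edgePd q i j) = D j i := by
  simp [edgeLift, edgePd]

theorem edgeAlg_adjoin (q : ℂ) (M N : ℕ) :
    Algebra.adjoin ℂ (Set.range (fun c : Fin M × Fin N => edgeX q c.1 c.2) ∪
      Set.range (fun c : Fin M × Fin N => edgePd q c.1 c.2)) = ⊤ := by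
  rw [eq_top_iff]
  rintro z -
  obtain ⟨y, rfl⟩ := RingQuot.mkAlgHom_surjective ℂ (EdgeRel q M N) z
  induction y using FreeAlgebra.induction with
  | grade0 r => rw [AlgHom.commutes]; exact Subalgebra.algebraMap_mem _ _
  | grade1 g =>
    apply Algebra.subset_adjoin
    cases g with
    | x i j => exact Or.inl ⟨(i, j), rfl⟩
    | pd i j => exact Or.inr ⟨(i, j), rfl⟩
  | mul a b ha hb => rw [map_mul]; exact mul_mem ha hb
  | add a b ha hb => rw [map_add]; exact add_mem ha hb

theorem edgeAlg_hom_ext {M N : ℕ} {f g : EdgeAlg q M N →ₐ[ℂ] E}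
    (hX : ∀ i j, f (edgeX q i j) = g (edgeX q i j))
    (hD : ∀ i j, f (edgePd q i j) = g (edgePd q i j)) : f = g := by
  apply AlgHom.ext_of_adjoin_eq_top (edgeAlg_adjoin q M N)
  rintro _ (⟨c, rfl⟩ | ⟨c, rfl⟩)
  · exact hX _ _
  · exact hD _ _

end Coordinates

/-! ### Operators on modules which act on generators by the R-matrix -/

section Smash

variable {V : Type*} {q : ℂ} {d : V → ℕ} {E : Type*} [Ring E] [Algebra ℂ E]

theorem leg_yangBaxter (hq : q ≠ 0) (u v w : V) :
    leg12 (Fin (d w)) (RE E q d u v) * (leg13 (Fin (d v)) (RE E q d u w) *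
        leg23 (Fin (d u)) (RE E q d v w)) =
      leg23 (Fin (d u)) (RE E q d v w) * (leg13 (Fin (d v)) (RE E q d u w) *
        leg12 (Fin (d w)) (RE E q d u v)) := by
  simp only [RE, leg12_scal, leg13_scal, leg23_scal, ← scal_mul]
  rw [← Matrix.mul_assoc, vertR_yangBaxter hq, Matrix.mul_assoc]

theorem leg12_RE_mul_inv (hq : q ≠ 0) (u v : V) (c : Type*) [Fintype c] [DecidableEq c] :
    leg12 c (RE E q d u v) * leg12 c (RE E q⁻¹ d u v) = 1 := by
  rw [← leg12_mul, RE_mul_inv hq, leg12_one]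

theorem leg12_RE_inv_mul (hq : q ≠ 0) (u v : V) (c : Type*) [Fintype c] [DecidableEq c] :
    leg12 c (RE E q⁻¹ d u v) * leg12 c (RE E q d u v) = 1 := by
  rw [← leg12_mul, RE_inv_mul hq, leg12_one]

theorem leg13_RE_mul_inv (hq : q ≠ 0) (u v : V) (c : Type*) [Fintype c] [DecidableEq c] :
    leg13 c (RE E q d u v) * leg13 c (RE E q⁻¹ d u v) = 1 := by
  rw [← leg13_mul, RE_mul_inv hq, leg13_one]

theorem leg13_RE_inv_mul (hq : q ≠ 0) (u v : V) (c : Type*) [Fintype c] [DecidableEq c] :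
    leg13 c (RE E q⁻¹ d u v) * leg13 c (RE E q d u v) = 1 := by
  rw [← leg13_mul, RE_inv_mul hq, leg13_one]

theorem leg23_RE_mul_inv (hq : q ≠ 0) (u v : V) (c : Type*) [Fintype c] [DecidableEq c] :
    leg23 c (RE E q d u v) * leg23 c (RE E q⁻¹ d u v) = 1 := by
  rw [← leg23_mul, RE_mul_inv hq, leg23_one]

theorem leg23_RE_inv_mul (hq : q ≠ 0) (u v : V) (c : Type*) [Fintype c] [DecidableEq c] :
    leg23 c (RE E q⁻¹ d u v) * leg23 c (RE E q d u v) = 1 := by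
  rw [← leg23_mul, RE_inv_mul hq, leg23_one]

theorem leg_yangBaxter_inv₂₃ (hq : q ≠ 0) (u v w : V) :
    leg12 (Fin (d w)) (RE E q d u v) * (leg23 (Fin (d u)) (RE E q⁻¹ d v w) *
        leg13 (Fin (d v)) (RE E q⁻¹ d u w)) =
      leg13 (Fin (d v)) (RE E q⁻¹ d u w) * (leg23 (Fin (d u)) (RE E q⁻¹ d v w) *
        leg12 (Fin (d w)) (RE E q d u v)) := by
  have h := congrArg (fun Z => leg13 (Fin (d v)) (RE E q⁻¹ d u w) *
    (leg23 (Fin (d u)) (RE E q⁻¹ d v w) * (Z * (leg23 (Fin (d u)) (RE E q⁻¹ d v w) *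
    leg13 (Fin (d v)) (RE E q⁻¹ d u w))))) (leg_yangBaxter (E := E) (d := d) hq u v w)
  simp only [Matrix.mul_assoc] at h
  rw [mul_eq_one_assoc (leg23_RE_mul_inv hq v w _), leg13_RE_mul_inv hq, Matrix.mul_one,
    mul_eq_one_assoc (leg23_RE_inv_mul hq v w _),
    mul_eq_one_assoc (leg13_RE_inv_mul hq u w _)] at h
  exact h.symm

theorem leg_yangBaxter_inv₁₂ (hq : q ≠ 0) (u v w : V) :
    leg23 (Fin (d u)) (RE E q d v w) * (leg12 (Fin (d w)) (RE E q⁻¹ d u v) *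
        leg13 (Fin (d v)) (RE E q⁻¹ d u w)) =
      leg13 (Fin (d v)) (RE E q⁻¹ d u w) * (leg12 (Fin (d w)) (RE E q⁻¹ d u v) *
        leg23 (Fin (d u)) (RE E q d v w)) := by
  have h := congrArg (fun Z => leg13 (Fin (d v)) (RE E q⁻¹ d u w) *
    (leg12 (Fin (d w)) (RE E q⁻¹ d u v) * (Z * (leg12 (Fin (d w)) (RE E q⁻¹ d u v) *
    leg13 (Fin (d v)) (RE E q⁻¹ d u w))))) (leg_yangBaxter (E := E) (d := d) hq u v w)
  simp only [Matrix.mul_assoc] at h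
  rw [mul_eq_one_assoc (leg12_RE_mul_inv hq u v _), leg13_RE_mul_inv hq, Matrix.mul_one,
    mul_eq_one_assoc (leg12_RE_inv_mul hq u v _),
    mul_eq_one_assoc (leg13_RE_inv_mul hq u w _)] at h
  exact h

/-- A matrix with entries in a matrix algebra, as a matrix on a product of index sets. -/
def unnest {p p' w : Type*} (A : Matrix p p' (Matrix w w E)) : Matrix (w × p) (w × p') E :=
  fun i i' => A i.2 i'.2 i.1 i'.1

theorem unnest_injective {p p' w : Type*} :
    Function.Injective (unnest : Matrix p p' (Matrix w w E) → Matrix (w × p) (w × p') E) := by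
  intro A B h
  ext j j' i i'
  exact congrFun (congrFun h (i, j)) (i', j')

theorem unnest_mul {p p' p'' w : Type*} [Fintype w] [Fintype p'] [DecidableEq w]
    (A : Matrix p p' (Matrix w w E)) (B : Matrix p' p'' (Matrix w w E)) :
    unnest (A * B) = unnest A * unnest B := by
  ext ⟨i, j⟩ ⟨i', j'⟩
  simp only [unnest, Matrix.mul_apply, Fintype.sum_prod_type, Matrix.sum_apply]
  rw [Finset.sum_comm]

theorem unnest_one {p w : Type*} [DecidableEq p] [DecidableEq w] [Fintype w] :
    unnest (1 : Matrix p p (Matrix w w E)) = 1 := by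
  ext ⟨i, j⟩ ⟨i', j'⟩
  simp only [unnest, Matrix.one_apply, Prod.mk.injEq]
  by_cases h : j = j' <;> simp [h, Matrix.one_apply]

/-- The inverse R-matrix `R_{uv}⁻¹` as a matrix over `Mat(d_u)`. -/
def auxR (E : Type*) [Ring E] [Algebra ℂ E] (q : ℂ) (d : V → ℕ) (u v : V) :
    Matrix (Fin (d v)) (Fin (d v)) (Matrix (Fin (d u)) (Fin (d u)) E) :=
  fun j j' i i' => RE E q⁻¹ d u v (i, j) (i', j')

theorem unnest_auxR (u v : V) : unnest (auxR E q d u v) = RE E q⁻¹ d u v := rfl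

theorem unnest_legL {a a' b w : Type*} [DecidableEq b] [Fintype w] [DecidableEq w]
    (A : Matrix a a' (Matrix w w E)) : unnest (legL b A) = leg12 b (unnest A) := by
  ext ⟨i, j, k⟩ ⟨i', j', k'⟩
  simp only [unnest, legL, leg12]
  split_ifs <;> rfl

theorem unnest_legR {a b b' w : Type*} [DecidableEq a] [Fintype w] [DecidableEq w]
    (A : Matrix b b' (Matrix w w E)) : unnest (legR a A) = leg13 a (unnest A) := by
  ext ⟨i, j, k⟩ ⟨i', j', k'⟩
  simp only [unnest, legR, leg13]
  split_ifs <;> rfl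

theorem unnest_scal {a b c c' w : Type*} [Fintype w] [DecidableEq w]
    (A : Matrix (a × b) (c × c') ℂ) :
    unnest (scal (Matrix w w E) A) = leg23 w (scal E A) := by
  ext ⟨i, p⟩ ⟨i', p'⟩
  simp [unnest, scal, leg23, Matrix.algebraMap_matrix_apply]

/-- Treating the space at u as auxiliary, the Yang–Baxter equation for u, v, w is precisely the RTT
relation for the matrices R⁻¹ with values in Mat(d_u). -/
theorem isRTT_auxR (hq : q ≠ 0) (u : V) : IsRTT q d (E := Matrix (Fin (d u)) (Fin (d u)) E)
    (fun v => auxR E q d u v) (fun v => auxR E q⁻¹ d u v) where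
  mul_inv v := unnest_injective <| by
    rw [unnest_mul, unnest_auxR, unnest_auxR, inv_inv, RE_inv_mul hq, unnest_one]
  inv_mul v := unnest_injective <| by
    rw [unnest_mul, unnest_auxR, unnest_auxR, inv_inv, RE_mul_inv hq, unnest_one]
  rtt v w := unnest_injective <| by
    have h : unnest (RE (Matrix (Fin (d u)) (Fin (d u)) E) q d v w) =
      leg23 (Fin (d u)) (RE E q d v w) := unnest_scal _
    simp only [unnest_mul, unnest_legL, unnest_legR, unnest_auxR, h]
    exact leg_yangBaxter_inv₁₂ hq u v w

theorem IsQMat.map {F : Type*} [Ring F] [Algebra ℂ F] (f : E →ₐ[ℂ] F) {t s : V}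
    {X : Matrix (Fin (d t)) (Fin (d s)) E} (h : IsQMat q d X) : IsQMat q d (X.map f) := by
  rw [isQMat_iff] at h ⊢
  intro i j m n
  simpa only [map_add, map_smul, map_mul, Matrix.map_apply] using congrArg f (h i j m n)

theorem IsWeyl.map {F : Type*} [Ring F] [Algebra ℂ F] (f : E →ₐ[ℂ] F) {t s : V}
    {X : Matrix (Fin (d t)) (Fin (d s)) E} {D : Matrix (Fin (d s)) (Fin (d t)) E}
    (h : IsWeyl q d X D) : IsWeyl q d (X.map f) (D.map f) := by
  rw [isWeyl_iff] at h ⊢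
  intro i j m n
  have := congrArg f (h i j m n)
  rw [map_add, apply_ite f] at this
  simpa only [map_add, map_sub, map_smul, map_mul, map_sum, map_zero, map_one,
    Matrix.map_apply] using this

/-- A matrix over `E`, as a matrix over `Mat(w, E)`. -/
def nestM (w : Type*) [Fintype w] [DecidableEq w] {a b : Type*} (A : Matrix a b E) :
    Matrix a b (Matrix w w E) :=
  A.map (Matrix.scalarAlgHom w ℂ)

theorem unnest_nestM {a b w : Type*} [Fintype w] [DecidableEq w] (A : Matrix a b E) :
    unnest (nestM w A) = legR w A := by
  ext ⟨i, p⟩ ⟨i', p'⟩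
  simp [unnest, nestM, legR, Matrix.scalar_apply, Matrix.diagonal_apply]

theorem auxR_comm_nestM (u v : V) {a b : Type*} (A : Matrix a b E) :
    EntriesCommute (auxR E q d u v) (nestM (Fin (d u)) A) := by
  intro i i' j j'
  ext k k'
  simp [nestM, Matrix.scalar_apply, Matrix.mul_diagonal, Matrix.diagonal_mul, auxR, RE, scal,
    Algebra.commutes]

/-- The action of the operators of vertex `u` on a matrix of generators. -/
def smashM (q : ℂ) (d : V → ℕ) (u : V) {t s : V} (A : Matrix (Fin (d t)) (Fin (d s)) E) :
    Matrix (Fin (d t)) (Fin (d s)) (Matrix (Fin (d u)) (Fin (d u)) E) :=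
  auxR E q d u t * (nestM (Fin (d u)) A * auxR E q⁻¹ d u s)

/-- The matrix R⁻¹X₂R is X dressed by the RTT family of `isRTT_auxR`, so general covariance applies.
The quantum group action on an edge algebra therefore comes from covariance alone, with no separate
check of relations. -/
theorem isQMat_smashM (hq : q ≠ 0) (u : V) {t s : V} (hts : t ≠ s)
    {X : Matrix (Fin (d t)) (Fin (d s)) E} (hX : IsQMat q d X) : IsQMat q d (smashM q d u X) := by
  have h1 : IsQMat q d (E := Matrix (Fin (d u)) (Fin (d u)) E) (nestM (Fin (d u)) X) :=
    IsQMat.map (F := Matrix (Fin (d u)) (Fin (d u)) E) (Matrix.scalarAlgHom (Fin (d u)) ℂ) hX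
  exact IsRTT.isQMat (E := Matrix (Fin (d u)) (Fin (d u)) E) (isRTT_auxR hq u) hq hts h1
    (fun v => auxR_comm_nestM u v X) (fun v => auxR_comm_nestM u v X)

theorem isWeyl_smashM (hq : q ≠ 0) (u : V) {t s : V} (hts : t ≠ s)
    {X : Matrix (Fin (d t)) (Fin (d s)) E} {D : Matrix (Fin (d s)) (Fin (d t)) E}
    (hXD : IsWeyl q d X D) : IsWeyl q d (smashM q d u X) (smashM q d u D) := by
  have h1 : IsWeyl q d (E := Matrix (Fin (d u)) (Fin (d u)) E) (nestM (Fin (d u)) X)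
      (nestM (Fin (d u)) D) :=
    IsWeyl.map (F := Matrix (Fin (d u)) (Fin (d u)) E) (Matrix.scalarAlgHom (Fin (d u)) ℂ) hXD
  exact IsRTT.isWeyl (E := Matrix (Fin (d u)) (Fin (d u)) E) (isRTT_auxR hq u) hq hts h1
    (fun v => auxR_comm_nestM u v X) (fun v => auxR_comm_nestM u v X)
    (fun v => auxR_comm_nestM u v D) (fun v => auxR_comm_nestM u v D)

theorem unnest_smashM (u : V) {t s : V} (A : Matrix (Fin (d t)) (Fin (d s)) E) :
    unnest (smashM q d u A) =
      RE E q⁻¹ d u t * (legR (Fin (d u)) A * RE E q d u s) := by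
  rw [smashM, unnest_mul, unnest_mul, unnest_nestM, unnest_auxR, unnest_auxR, inv_inv]

/-- The algebra homomorphism by which the operators of vertex `u` act on an edge algebra. -/
def edgeSmash (hq : q ≠ 0) (d : V → ℕ) (u : V) {t s : V} (hts : t ≠ s) :
    EdgeAlg q (d t) (d s) →ₐ[ℂ] Matrix (Fin (d u)) (Fin (d u)) (EdgeAlg q (d t) (d s)) :=
  edgeLift hq (isQMat_smashM hq u hts (isQMat_matX (d := d) hq t s))
    (isQMat_smashM hq u hts.symm (isQMat_matD (d := d) hq t s))
    (isWeyl_smashM hq u hts (isWeyl_matX_matD (d := d) hq t s))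

theorem edgeSmash_edgeX (hq : q ≠ 0) (u : V) {t s : V} (hts : t ≠ s) (i : Fin (d t))
    (j : Fin (d s)) : edgeSmash hq d u hts (edgeX q i j) = smashM q d u (matX q (d t) (d s)) i j :=
  edgeLift_edgeX ..

theorem edgeSmash_edgePd (hq : q ≠ 0) (u : V) {t s : V} (hts : t ≠ s) (i : Fin (d t))
    (j : Fin (d s)) : edgeSmash hq d u hts (edgePd q i j) = smashM q d u (matD q (d t) (d s)) j i :=
  edgeLift_edgePd ..

end Smash

/-! ### Cyclic modules with operators acting by the R-matrix -/

section Operators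

theorem Matrix.pow_eq_zero_of_strictlyUpper {E : Type*} [Ring E] {n : ℕ}
    (A : Matrix (Fin n) (Fin n) E) (h : ∀ i j, j ≤ i → A i j = 0) : A ^ n = 0 := by
  have key : ∀ (k : ℕ) (i j : Fin n), (j : ℕ) < i + k → (A ^ k) i j = 0 := by
    intro k
    induction k with
    | zero =>
      intro i j hij
      rw [pow_zero, Matrix.one_apply_ne]
      rintro rfl
      omega
    | succ k ih =>
      intro i j hij
      rw [pow_succ, Matrix.mul_apply]
      refine Finset.sum_eq_zero fun p _ => ?_
      by_cases hp : (p : ℕ) < i + k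
      · rw [ih i p hp, zero_mul]
      · rw [h p j (by rw [Fin.le_def]; omega), mul_zero]
  ext i j
  exact key n i j (by omega)

/-- After dividing by the invertible diagonal part, the matrix is 1 plus a strictly upper triangular
matrix, which is nilpotent even over a noncommutative ring. -/
theorem Matrix.isUnit_of_upperTriangular {E : Type*} [Ring E] {n : ℕ}
    (A : Matrix (Fin n) (Fin n) E) (h : ∀ i j, j < i → A i j = 0) (hd : ∀ i, IsUnit (A i i)) :
    IsUnit A := by
  choose u hu using hd
  let B : Matrix (Fin n) (Fin n) E := Matrix.diagonal fun i => ((u i)⁻¹ : Eˣ)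
  let D : Matrix (Fin n) (Fin n) E := Matrix.diagonal fun i => (u i : E)
  have hDB : D * B = 1 := by simp [D, B]
  have hBD : B * D = 1 := by simp [D, B]
  have hN : IsNilpotent (B * A - 1) := ⟨n, Matrix.pow_eq_zero_of_strictlyUpper _ fun i j hij => by
    rw [Matrix.sub_apply, Matrix.diagonal_mul]
    rcases hij.lt_or_eq with h' | rfl
    · rw [h _ _ h', mul_zero, Matrix.one_apply_ne h'.ne', sub_zero]
    · rw [← hu, Units.inv_mul, Matrix.one_apply_eq, sub_self]⟩
  have h1 := hN.isUnit_one_add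
  rw [add_sub_cancel] at h1
  have : A = D * (B * A) := by rw [← mul_assoc, hDB, one_mul]
  rw [this]
  exact (IsUnit.mul ⟨⟨D, B, hDB, hBD⟩, rfl⟩ h1)

variable {V : Type*} {q : ℂ} {d : V → ℕ} {P : Type*} [AddCommGroup P] [Module ℂ P]
  {κ : Type*} {t s : κ → V}

/-- A family of operators on a module with a cyclic vector fixed by the operators, which act on
the generating operators by the R-matrix. -/
structure IsSmashModule (q : ℂ) (d : V → ℕ)
    (T : ∀ v : V, Matrix (Fin (d v)) (Fin (d v)) (Module.End ℂ P))
    (G : ∀ k : κ, Matrix (Fin (d (t k))) (Fin (d (s k))) (Module.End ℂ P)) (vac : P) : Prop where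
  smash : ∀ k, IsSmash q d T (G k)
  fix_vac : ∀ v i j, T v i j vac = if i = j then vac else 0
  cyclic : ∀ W : Submodule ℂ P, vac ∈ W → (∀ k i j, ∀ y ∈ W, G k i j y ∈ W) → W = ⊤

theorem RE_diag_apply {E : Type*} [Ring E] [Algebra ℂ E] (u v : V) (i : Fin (d u))
    (j : Fin (d v)) : ∃ c : ℂ, (c = 1 ∨ c = q) ∧ RE E q d u v (i, j) (i, j) = algebraMap ℂ E c := by
  classical
  by_cases h : u = v
  · subst h
    refine ⟨if i = j then q else 1, by split_ifs <;> simp, ?_⟩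
    simp only [RE, vertR_self, scal, Matrix.map_apply, stdR]
    by_cases hij : i = j <;> simp [hij]
  · exact ⟨1, Or.inl rfl, by simp [RE_of_ne h]⟩

/-- Off the diagonal, R only sends (i, j) to (j, i) with i < j, so its first index strictly
increases. This monotonicity is the source of the triangularity of T. -/
theorem RE_apply_ne {E : Type*} [Ring E] [Algebra ℂ E] {u v : V} {i i' : Fin (d u)}
    {j j' : Fin (d v)} (h : (i, j) ≠ (i', j')) (hii' : ¬ i < i') :
    RE E q d u v (i, j) (i', j') = 0 := by
  classical
  by_cases huv : u = v
  · subst huv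
    have h1 : ¬ (i = i' ∧ j = j') := fun h' => h (by rw [h'.1, h'.2])
    simp only [RE, vertR_self, scal, Matrix.map_apply, stdR]
    rw [if_neg (fun h' => h1 (by simp_all)), if_neg (fun h' => hii' (by
      obtain ⟨h1, h2⟩ := h'
      simp_all))]
    simp
  · rw [RE_of_ne huv, Matrix.one_apply_ne h]

namespace IsSmashModule

variable {T : ∀ v : V, Matrix (Fin (d v)) (Fin (d v)) (Module.End ℂ P)}
  {G : ∀ k : κ, Matrix (Fin (d (t k))) (Fin (d (s k))) (Module.End ℂ P)} {vac : P}

theorem eq_top (h : IsSmashModule q d T G vac) {W : Submodule ℂ P} (h1 : vac ∈ W)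
    (h2 : ∀ k i j, ∀ y ∈ W, G k i j y ∈ W) (y : P) : y ∈ W := by
  rw [h.cyclic W h1 h2]; trivial

theorem end_ext (h : IsSmashModule q d T G vac) {f g : Module.End ℂ P} (h1 : f vac = g vac)
    (h2 : ∀ k i j, f * G k i j = G k i j * f) (h3 : ∀ k i j, g * G k i j = G k i j * g) : f = g := by
  have key : ∀ y, y ∈ LinearMap.ker (f - g) := by
    refine h.eq_top (by simp [h1, sub_eq_zero]) ?_
    intro k i j y hy
    rw [LinearMap.mem_ker, LinearMap.sub_apply, sub_eq_zero] at hy ⊢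
    have e1 := LinearMap.congr_fun (h2 k i j) y
    have e2 := LinearMap.congr_fun (h3 k i j) y
    simp only [Module.End.mul_apply] at e1 e2
    rw [e1, e2, hy]
  ext y
  simpa [sub_eq_zero] using key y

/-- The common kernel of the entries of Δ contains the vacuum. Since Δ₁₂G₃ = ΓΔ₁₂ has Δ on the far
right, this kernel is stable under the generators, hence is everything. -/
theorem eq_zero_of_leg12 (h : IsSmashModule q d T G vac) {u v : V}
    {Δ : Matrix (Fin (d u) × Fin (d v)) (Fin (d u) × Fin (d v)) (Module.End ℂ P)}
    (h1 : ∀ a b, Δ a b vac = 0)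
    (h2 : ∀ k, ∃ Γ : Matrix (Fin (d u) × Fin (d v) × Fin (d (t k)))
      (Fin (d u) × Fin (d v) × Fin (d (s k))) (Module.End ℂ P), leg12 (Fin (d (t k))) Δ * leg3 (Fin (d u)) (Fin (d v)) (G k) =
      Γ * leg12 (Fin (d (s k))) Δ) : Δ = 0 := by
  have key : ∀ y, ∀ a b, Δ a b y = 0 := by
    intro y
    let W : Submodule ℂ P := ⨅ a, ⨅ b, LinearMap.ker (Δ a b)
    have hW : ∀ y, y ∈ W ↔ ∀ a b, Δ a b y = 0 := by simp [W, Submodule.mem_iInf]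
    rw [← hW]
    refine h.eq_top ((hW _).2 h1) ?_ y
    intro k i j y hy
    rw [hW] at hy ⊢
    rintro ⟨a1, a2⟩ ⟨b1, b2⟩
    obtain ⟨Γ, hΓ⟩ := h2 k
    have e := LinearMap.congr_fun (congrFun (congrFun hΓ (a1, a2, i)) (b1, b2, j)) y
    have e1 : (leg12 (Fin (d (t k))) Δ * leg3 (Fin (d u)) (Fin (d v)) (G k)) (a1, a2, i)
        (b1, b2, j) = Δ (a1, a2) (b1, b2) * G k i j := by
      simp [Matrix.mul_apply, leg12, leg3, Fintype.sum_prod_type, ite_and]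
    rw [e1, Module.End.mul_apply] at e
    rw [e, Matrix.mul_apply, LinearMap.sum_apply]
    refine Finset.sum_eq_zero fun p _ => ?_
    rw [Module.End.mul_apply]
    have : leg12 (Fin (d (s k))) Δ p (b1, b2, j) y = 0 := by
      rw [leg12]
      split_ifs
      · exact hy _ _
      · rfl
    rw [this, map_zero]
  ext a b y
  exact key y a b

/-- Both sides agree on the vacuum, where T acts as the identity matrix. Moving both across a
generator produces R-matrices on its two sides, and the Yang–Baxter equation makes these agree, so
the defect satisfies the criterion of `eq_zero_of_leg12`. -/
theorem rtt (h : IsSmashModule q d T G vac) (hq : q ≠ 0) (u v : V) :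
    RE (Module.End ℂ P) q d u v * (legL (Fin (d v)) (T u) * legR (Fin (d u)) (T v)) =
      legR (Fin (d u)) (T v) * (legL (Fin (d v)) (T u) * RE (Module.End ℂ P) q d u v) := by
  rw [← sub_eq_zero]
  refine h.eq_zero_of_leg12 ?_ fun k => ?_
  · have hL : ∀ a b, legL (Fin (d v)) (T u) a b vac = if a = b then vac else 0 := by
      rintro ⟨a1, a2⟩ ⟨b1, b2⟩
      by_cases h2 : a2 = b2 <;> simp [legL, h2, h.fix_vac]
    have hR : ∀ a b, legR (Fin (d u)) (T v) a b vac = if a = b then vac else 0 := by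
      rintro ⟨a1, a2⟩ ⟨b1, b2⟩
      by_cases h2 : a1 = b1 <;> simp [legR, h2, h.fix_vac]
    intro a b
    have hs : ∀ a b, ∃ c : ℂ, RE (Module.End ℂ P) q d u v a b = algebraMap ℂ _ c :=
      fun a b => ⟨_, rfl⟩
    choose c hc using hs
    simp [Matrix.mul_apply, LinearMap.sum_apply, hL, hR, hc, apply_ite, Finset.sum_ite_eq,
      Finset.sum_ite_eq', Module.algebraMap_end_apply, sub_eq_zero]
  · have eL : leg1 (Fin (d v)) (Fin (d (t k))) (T u) * leg3 (Fin (d u)) (Fin (d v)) (G k) =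
        leg13 (Fin (d v)) (RE (Module.End ℂ P) q⁻¹ d u (t k)) * (leg3 (Fin (d u)) (Fin (d v)) (G k) *
          (leg13 (Fin (d v)) (RE (Module.End ℂ P) q d u (s k)) * leg1 (Fin (d v)) (Fin (d (s k))) (T u))) := by
      have := congrArg (leg13 (Fin (d v))) (h.smash k u)
      simpa only [leg13_mul, leg13_legL, leg13_legR] using this
    have eR : leg2 (Fin (d u)) (Fin (d (t k))) (T v) * leg3 (Fin (d u)) (Fin (d v)) (G k) =
        leg23 (Fin (d u)) (RE (Module.End ℂ P) q⁻¹ d v (t k)) * (leg3 (Fin (d u)) (Fin (d v)) (G k) *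
          (leg23 (Fin (d u)) (RE (Module.End ℂ P) q d v (s k)) * leg2 (Fin (d u)) (Fin (d (s k))) (T v))) := by
      have := congrArg (leg23 (Fin (d u))) (h.smash k v)
      simpa only [leg23_mul, leg23_legL, leg23_legR] using this
    have c1 : ∀ (c : V) (x : ℂ), leg1 (Fin (d v)) (Fin (d c)) (T u) *
        leg23 (Fin (d u)) (RE (Module.End ℂ P) x d v c) = leg23 (Fin (d u)) (RE (Module.End ℂ P) x d v c) *
        leg1 (Fin (d v)) (Fin (d c)) (T u) := fun c x =>
      (EntriesCommute.leg23_leg1 (entriesCommute_scal _ (T u))).symm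
    have c2 : ∀ (c : V) (x : ℂ), leg2 (Fin (d u)) (Fin (d c)) (T v) *
        leg13 (Fin (d v)) (RE (Module.End ℂ P) x d u c) = leg13 (Fin (d v)) (RE (Module.End ℂ P) x d u c) *
        leg2 (Fin (d u)) (Fin (d c)) (T v) := fun c x =>
      (EntriesCommute.leg13_leg2 (entriesCommute_scal _ (T v))).symm
    have c3 : leg12 (Fin (d (t k))) (RE (Module.End ℂ P) q d u v) * leg3 (Fin (d u)) (Fin (d v)) (G k) =
        leg3 (Fin (d u)) (Fin (d v)) (G k) * leg12 (Fin (d (s k))) (RE (Module.End ℂ P) q d u v) :=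
      EntriesCommute.leg12_leg3 (entriesCommute_scal _ (G k))
    refine ⟨leg13 (Fin (d v)) (RE (Module.End ℂ P) q⁻¹ d u (t k)) * (leg23 (Fin (d u)) (RE (Module.End ℂ P) q⁻¹ d v (t k)) *
      (leg3 (Fin (d u)) (Fin (d v)) (G k) * (leg23 (Fin (d u)) (RE (Module.End ℂ P) q d v (s k)) *
      leg13 (Fin (d v)) (RE (Module.End ℂ P) q d u (s k))))), ?_⟩
    have hsub : ∀ (c : Type _) [DecidableEq c] (A B : Matrix (Fin (d u) × Fin (d v))
        (Fin (d u) × Fin (d v)) (Module.End ℂ P)), leg12 c (A - B) = leg12 c A - leg12 c B := by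
      intro c _ A B
      ext ⟨a1, a2, a3⟩ ⟨b1, b2, b3⟩
      simp only [leg12, Matrix.sub_apply]
      split_ifs <;> simp
    rw [hsub, hsub, Matrix.sub_mul, Matrix.mul_sub]
    simp only [leg12_mul, leg12_legL, leg12_legR, Matrix.mul_assoc]
    congr 1
    · rw [eR, mul_eq_mul_assoc (c1 _ _), mul_eq_mul_assoc eL]
      simp only [Matrix.mul_assoc]
      rw [mul_eq_mul_assoc (c1 _ _), mul_mul_eq_assoc (leg_yangBaxter_inv₂₃ hq u v (t k))]
      simp only [Matrix.mul_assoc]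
      rw [mul_eq_mul_assoc c3, mul_mul_eq_assoc (leg_yangBaxter hq u v (s k))]
      simp only [Matrix.mul_assoc]
    · rw [c3, mul_eq_mul_assoc eL]
      simp only [Matrix.mul_assoc]
      rw [mul_eq_mul_assoc (c2 _ _), mul_eq_mul_assoc eR]
      simp only [Matrix.mul_assoc]
      rw [mul_eq_mul_assoc (c2 _ _)]

theorem apply_eq_sum (h : IsSmashModule q d T G vac) (u : V) (k : κ) (K K' : Fin (d u))
    (j : Fin (d (t k))) (n : Fin (d (s k))) :
    T u K K' * G k j n = ∑ L, ∑ j', RE (Module.End ℂ P) q⁻¹ d u (t k) (K, j) (L, j') *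
      ∑ n', G k j' n' * ∑ L', RE (Module.End ℂ P) q d u (s k) (L, n') (L', n) * T u L' K' := by
  have := congrFun (congrFun (h.smash k u) (K, j)) (K', n)
  rw [legL_mul_legR] at this
  rw [this]
  simp [Matrix.mul_apply, Fintype.sum_prod_type, legL, legR]

/-- The entries below the diagonal vanish on the vacuum. Passing T K K' across a generator gives
only T L' K' with K ≤ L', because the R-matrices never lower the auxiliary index; so entries below
the diagonal are turned into entries below the diagonal. -/
theorem upper (h : IsSmashModule q d T G vac) (u : V) :
    ∀ K K' : Fin (d u), K' < K → T u K K' = 0 := by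
  have key : ∀ y, ∀ K K' : Fin (d u), K' < K → T u K K' y = 0 := by
    intro y
    let W : Submodule ℂ P := ⨅ K, ⨅ K', ⨅ _ : K' < K, LinearMap.ker (T u K K')
    have hW : ∀ y, y ∈ W ↔ ∀ K K', K' < K → T u K K' y = 0 := by simp [W, Submodule.mem_iInf]
    rw [← hW]
    refine h.eq_top ((hW _).2 fun K K' hK => by rw [h.fix_vac, if_neg hK.ne']) ?_ y
    intro k j n y hy
    rw [hW] at hy ⊢
    intro K K' hK
    rw [← Module.End.mul_apply, h.apply_eq_sum]
    simp only [LinearMap.sum_apply, Module.End.mul_apply, map_sum]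
    refine Finset.sum_eq_zero fun L _ => Finset.sum_eq_zero fun j' _ =>
      Finset.sum_eq_zero fun n' _ => Finset.sum_eq_zero fun L' _ => ?_
    by_cases h1 : K ≤ L
    · by_cases h2 : L ≤ L'
      · rw [hy L' K' (hK.trans_le (h1.trans h2))]
        simp
      · rw [RE_apply_ne (i := L) (i' := L') (by rintro ⟨⟩; exact h2 le_rfl)
          (fun h3 => h2 h3.le)]
        simp
    · rw [RE_apply_ne (i := K) (i' := L) (by rintro ⟨⟩; exact h1 le_rfl)
          (fun h3 => h1 h3.le)]
      simp
  intro K K' hK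
  ext y
  exact key y K K' hK

/-- By triangularity only the diagonal entries of the two R-matrices contribute, so a diagonal entry
of T commutes with generators up to a power of q. -/
theorem diag_comm (h : IsSmashModule q d T G vac) (u : V) (K : Fin (d u)) (k : κ)
    (j : Fin (d (t k))) (n : Fin (d (s k))) :
    ∃ c c' : ℂ, (c = 1 ∨ c = q⁻¹) ∧ (c' = 1 ∨ c' = q) ∧
      T u K K * G k j n = (c * c') • (G k j n * T u K K) := by
  obtain ⟨c, hc, ec⟩ := RE_diag_apply (E := Module.End ℂ P) (d := d) (q := q⁻¹) u (t k) K j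
  obtain ⟨c', hc', ec'⟩ := RE_diag_apply (E := Module.End ℂ P) (d := d) (q := q) u (s k) K n
  refine ⟨c, c', hc, hc', ?_⟩
  rw [h.apply_eq_sum, ← Fintype.sum_prod_type', Fintype.sum_eq_single (K, j)]
  · rw [Fintype.sum_eq_single n, Fintype.sum_eq_single K, ec, ec']
    · simp only [← Algebra.smul_def, smul_mul_assoc, mul_smul_comm, smul_smul]
      rw [mul_comm]
    · intro L hL
      by_cases h1 : K < L
      · rw [h.upper u L K h1, mul_zero]
      · rw [RE_apply_ne (by rintro ⟨⟩; exact hL rfl) h1, zero_mul]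
    · intro n' hn'
      rw [Finset.sum_eq_zero, mul_zero]
      intro L _
      by_cases h1 : K < L
      · rw [h.upper u L K h1, mul_zero]
      · rw [RE_apply_ne (by rintro ⟨⟩; exact hn' rfl) h1, zero_mul]
  · rintro ⟨L, j'⟩ hL
    by_cases h1 : K < L
    · rw [Finset.sum_eq_zero, mul_zero]
      intro n' _
      rw [Finset.sum_eq_zero, mul_zero]
      intro L' _
      by_cases h2 : L ≤ L'
      · rw [h.upper u L' K (h1.trans_le h2), mul_zero]
      · rw [RE_apply_ne (i := L) (i' := L') (by rintro ⟨⟩; exact h2 le_rfl)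
          (fun h3 => h2 h3.le), zero_mul]
    · rw [RE_apply_ne (fun h => hL h.symm) h1, zero_mul]

/-- Here the root of unity enters: the ℓ-th power of a diagonal entry commutes with all generators
and fixes the cyclic vector, as the identity does. -/
theorem diag_pow (h : IsSmashModule q d T G vac) {ℓ : ℕ} (hq : q ^ ℓ = 1) (u : V)
    (K : Fin (d u)) : T u K K ^ ℓ = 1 := by
  refine h.end_ext ?_ ?_ (fun k i j => by rw [one_mul, mul_one])
  · have : ∀ n : ℕ, (T u K K ^ n) vac = vac := by
      intro n
      induction n with
      | zero => simp
      | succ n ih => rw [pow_succ, Module.End.mul_apply, h.fix_vac, if_pos rfl, ih]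
    simp [this]
  · intro k j n
    obtain ⟨c, c', hc, hc', e⟩ := h.diag_comm u K k j n
    have e1 : ∀ m : ℕ, T u K K ^ m * G k j n = (c * c') ^ m • (G k j n * T u K K ^ m) := by
      intro m
      induction m with
      | zero => simp
      | succ m ih =>
        rw [pow_succ, mul_assoc, e, mul_smul_comm, ← mul_assoc, ih, smul_mul_assoc, smul_smul,
          ← pow_succ' (c * c'), mul_assoc (G k j n), ← pow_succ]
    rw [e1, mul_pow]
    have hc1 : c ^ ℓ = 1 := by rcases hc with rfl | rfl <;> simp [hq]
    have hc2 : c' ^ ℓ = 1 := by rcases hc' with rfl | rfl <;> simp [hq]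
    rw [hc1, hc2, one_mul, one_smul]

/-- Dressing needs T⁻¹. Triangularity and diagonal entries of finite order provide it without an
antipode. -/
theorem isUnit (h : IsSmashModule q d T G vac) {ℓ : ℕ} (hℓ : ℓ ≠ 0) (hq : q ^ ℓ = 1) (u : V) :
    IsUnit (T u) :=
  Matrix.isUnit_of_upperTriangular _ (h.upper u) fun K =>
    IsUnit.of_pow_eq_one (h.diag_pow hq u K) hℓ

theorem isRTT (h : IsSmashModule q d T G vac) (hq0 : q ≠ 0) {ℓ : ℕ} (hℓ : ℓ ≠ 0)
    (hq : q ^ ℓ = 1) : IsRTT q d T (fun v => Ring.inverse (T v)) where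
  mul_inv v := Ring.mul_inverse_cancel _ (h.isUnit hℓ hq v)
  inv_mul v := Ring.inverse_mul_cancel _ (h.isUnit hℓ hq v)
  rtt := h.rtt hq0

theorem inverse_vac (h : IsSmashModule q d T G vac) {ℓ : ℕ} (hℓ : ℓ ≠ 0)
    (hq : q ^ ℓ = 1) (v : V) (i j : Fin (d v)) :
    Ring.inverse (T v) i j vac = if i = j then vac else 0 := by
  have e := Ring.inverse_mul_cancel _ (h.isUnit hℓ hq v)
  have e := LinearMap.congr_fun (congrFun (congrFun e i) j) vac
  rw [Matrix.mul_apply, LinearMap.sum_apply] at e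
  simp only [Module.End.mul_apply, h.fix_vac, apply_ite, map_zero, Finset.sum_ite_eq',
    Finset.mem_univ, if_true] at e
  rw [e, Matrix.one_apply]
  split_ifs <;> simp

end IsSmashModule

end Operators

/-! ### Powers of sums of q-commuting elements -/

section QPow

/-- The q-binomial coefficients. -/
def qBinom (ζ : ℂ) : ℕ → ℕ → ℂ
  | _, 0 => 1
  | 0, _ + 1 => 0
  | n + 1, k + 1 => qBinom ζ n k + ζ ^ (k + 1) * qBinom ζ n (k + 1)

/-- The q-integers. -/
def qInt (ζ : ℂ) (n : ℕ) : ℂ := ∑ i ∈ Finset.range n, ζ ^ i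

theorem qInt_add (ζ : ℂ) (m n : ℕ) : qInt ζ (m + n) = qInt ζ m + ζ ^ m * qInt ζ n := by
  simp [qInt, Finset.sum_range_add, Finset.mul_sum, pow_add]

theorem qBinom_zero (ζ : ℂ) (n : ℕ) : qBinom ζ n 0 = 1 := by cases n <;> rfl

theorem qBinom_of_lt (ζ : ℂ) : ∀ {n k : ℕ}, n < k → qBinom ζ n k = 0
  | 0, k + 1, _ => rfl
  | n + 1, k + 1, h => by
    rw [qBinom, qBinom_of_lt ζ (by omega), qBinom_of_lt ζ (by omega), mul_zero, add_zero]

theorem qBinom_self (ζ : ℂ) : ∀ n : ℕ, qBinom ζ n n = 1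
  | 0 => rfl
  | n + 1 => by rw [qBinom, qBinom_self ζ n, qBinom_of_lt ζ (by omega), mul_zero, add_zero]

/-- The factorial formula is stated without division because q-integers may vanish at a root of
unity. -/
theorem qBinom_mul_prod (ζ : ℂ) : ∀ n k : ℕ, qBinom ζ (n + k) k *
    (∏ i ∈ Finset.range n, qInt ζ (i + 1)) * (∏ i ∈ Finset.range k, qInt ζ (i + 1)) =
      ∏ i ∈ Finset.range (n + k), qInt ζ (i + 1)
  | n, 0 => by simp [qBinom_zero]
  | 0, k + 1 => by simp [qBinom_self]
  | n + 1, k + 1 => by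
    have h1 := qBinom_mul_prod ζ (n + 1) k
    have h2 := qBinom_mul_prod ζ n (k + 1)
    have e : n + 1 + (k + 1) = (n + k + 1) + 1 := by omega
    rw [show n + 1 + k = n + k + 1 by omega] at h1
    rw [show n + (k + 1) = n + k + 1 by omega] at h2
    rw [e, qBinom, Finset.prod_range_succ _ (n + k + 1),
      show n + k + 1 + 1 = (k + 1) + (n + 1) by omega, qInt_add]
    rw [Finset.prod_range_succ _ n] at h1 ⊢
    rw [Finset.prod_range_succ _ k] at h2 ⊢
    linear_combination qInt ζ (k + 1) * h1 + ζ ^ (k + 1) * qInt ζ (n + 1) * h2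

theorem qInt_eq_zero {ζ : ℂ} {ℓ : ℕ} (hℓ : 1 < ℓ) (h : IsPrimitiveRoot ζ ℓ) : qInt ζ ℓ = 0 :=
  h.geom_sum_eq_zero hℓ

theorem qInt_ne_zero {ζ : ℂ} {ℓ : ℕ} (h : IsPrimitiveRoot ζ ℓ) {n : ℕ} (h0 : n ≠ 0)
    (hn : n < ℓ) : qInt ζ n ≠ 0 := by
  intro h1
  have := mul_neg_geom_sum ζ n
  rw [← qInt, h1, mul_zero, eq_comm, sub_eq_zero] at this
  exact h.pow_ne_one_of_pos_of_lt h0 hn this.symm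

/-- The q-factorial of ℓ contains the vanishing factor of index ℓ, whereas the factorials of k and ℓ
− k have only nonzero factors; so the q-binomial coefficient must vanish. -/
theorem qBinom_eq_zero {ζ : ℂ} {ℓ : ℕ} (h : IsPrimitiveRoot ζ ℓ) {k : ℕ} (h0 : k ≠ 0)
    (hk : k < ℓ) : qBinom ζ ℓ k = 0 := by
  have h1 := qBinom_mul_prod ζ (ℓ - k) k
  rw [Nat.sub_add_cancel hk.le, Finset.prod_eq_zero (i := ℓ - 1) (s := Finset.range ℓ),
    mul_eq_zero, mul_eq_zero] at h1
  · rcases h1 with (h1 | h1) | h1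
    · exact h1
    · obtain ⟨i, hi, h2⟩ := Finset.prod_eq_zero_iff.1 h1
      rw [Finset.mem_range] at hi
      exact absurd h2 (qInt_ne_zero h (by omega) (by omega))
    · obtain ⟨i, hi, h2⟩ := Finset.prod_eq_zero_iff.1 h1
      rw [Finset.mem_range] at hi
      exact absurd h2 (qInt_ne_zero h (by omega) (by omega))
  · simp; omega
  · rw [Nat.sub_add_cancel (by omega), qInt_eq_zero (by omega) h]

variable {E : Type*} [Ring E] [Algebra ℂ E]

theorem add_pow_of_qcomm {ζ : ℂ} {a b : E} (h : b * a = ζ • (a * b)) (n : ℕ) :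
    (a + b) ^ n = ∑ k ∈ Finset.range (n + 1), qBinom ζ n k • (a ^ (n - k) * b ^ k) := by
  have hb : ∀ k, b ^ k * a = ζ ^ k • (a * b ^ k) := by
    intro k
    induction k with
    | zero => simp
    | succ k ih =>
      rw [pow_succ, mul_assoc, h, mul_smul_comm, ← mul_assoc, ih, smul_mul_assoc, smul_smul,
        mul_assoc, ← pow_succ']
  induction n with
  | zero => simp [qBinom]
  | succ n ih =>
    have e1 : ∀ k ∈ Finset.range (n + 1), qBinom ζ n k • (a ^ (n - k) * b ^ k) * a =
        (qBinom ζ n k * ζ ^ k) • (a ^ (n + 1 - k) * b ^ k) := by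
      intro k hk
      rw [Finset.mem_range] at hk
      rw [smul_mul_assoc, mul_assoc, hb, mul_smul_comm, ← mul_assoc, ← pow_succ, smul_smul,
        show n + 1 - k = n - k + 1 by omega]
    have e2 : ∀ k ∈ Finset.range (n + 1), qBinom ζ n k • (a ^ (n - k) * b ^ k) * b =
        qBinom ζ n k • (a ^ (n - k) * b ^ (k + 1)) := by
      intro k hk
      rw [smul_mul_assoc, mul_assoc, ← pow_succ]
    rw [pow_succ, ih, mul_add, Finset.sum_mul, Finset.sum_mul, Finset.sum_congr rfl e1,
      Finset.sum_congr rfl e2, Finset.sum_range_succ' _ (n + 1)]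
    have e3 := Finset.sum_range_succ (fun k => (qBinom ζ n k * ζ ^ k) • (a ^ (n + 1 - k) * b ^ k))
      (n + 1)
    rw [qBinom_of_lt ζ (Nat.lt_succ_self n), zero_mul, zero_smul, add_zero] at e3
    rw [← e3, Finset.sum_range_succ' _ (n + 1), add_right_comm, ← Finset.sum_add_distrib]
    congr 1
    · refine Finset.sum_congr rfl fun k _ => ?_
      rw [show n + 1 - (k + 1) = n - k by omega, ← add_smul, qBinom]
      congr 1
      ring
    · simp [qBinom_zero]

theorem add_pow_of_qcomm_primitive {ζ : ℂ} {ℓ : ℕ} (hℓ : 1 < ℓ) (hζ : IsPrimitiveRoot ζ ℓ)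
    {a b : E} (h : b * a = ζ • (a * b)) : (a + b) ^ ℓ = a ^ ℓ + b ^ ℓ := by
  rw [add_pow_of_qcomm h, Finset.sum_range_succ, Finset.sum_eq_single_of_mem 0 (by simp; omega)]
  · simp [qBinom_zero, qBinom_self]
  · intro k hk h0
    rw [qBinom_eq_zero hζ h0 (Finset.mem_range.1 hk), zero_smul]

/-- Adding the largest index last keeps one uniform relation: the new term ζ-commutes with the
entire partial sum. -/
theorem sum_pow_of_qcomm {ζ : ℂ} {ℓ : ℕ} (hℓ : 1 < ℓ) (hζ : IsPrimitiveRoot ζ ℓ)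
    {ι : Type*} [LinearOrder ι] (s : Finset ι) (a : ι → E)
    (h : ∀ i j, i < j → a j * a i = ζ • (a i * a j)) :
    (∑ i ∈ s, a i) ^ ℓ = ∑ i ∈ s, a i ^ ℓ := by
  induction s using Finset.induction_on_max with
  | empty => simp [zero_pow (by omega : ℓ ≠ 0)]
  | insert m s hm ih =>
    have hm' : m ∉ s := fun h => lt_irrefl _ (hm m h)
    rw [Finset.sum_insert hm', Finset.sum_insert hm', add_comm, add_comm (a m ^ ℓ), ← ih]
    apply add_pow_of_qcomm_primitive hℓ hζ
    rw [Finset.mul_sum, Finset.sum_mul, Finset.smul_sum]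
    exact Finset.sum_congr rfl fun i hi => h i m (hm i hi)

end QPow

/-! ### Powers of dressed entries: the quantum Frobenius property -/

section Power

variable {V : Type*} {q : ℂ} {d : V → ℕ} {E : Type*} [Ring E] [Algebra ℂ E]
  {C C' : ∀ v : V, Matrix (Fin (d v)) (Fin (d v)) E}

theorem IsQMat.mul_right (h : IsRTT q d C C') {t s : V}
    {X : Matrix (Fin (d t)) (Fin (d s)) E} (hX : IsQMat q d X) (hC' : EntriesCommute (C' s) X) :
    IsQMat q d (X * C' s) := by
  rw [IsQMat] at hX ⊢
  simp only [Matrix.mul_assoc] at hX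
  simp only [legL_mul, legR_mul, Matrix.mul_assoc]
  rw [mul_eq_mul_assoc hC'.leg_comm, mul_mul_eq_assoc hX]
  simp only [Matrix.mul_assoc]
  rw [h.flip_inv_comm, mul_eq_mul_assoc hC'.symm.leg_comm]

theorem IsRTT.row_comm (h : IsRTT q d C C') (u : V) (i : Fin (d u)) {m n : Fin (d u)}
    (hmn : m < n) : C u i n * C u i m = q • (C u i m * C u i n) := by
  have := congrFun (congrFun (h.rtt u u) (i, i)) (m, n)
  rw [← Matrix.mul_assoc (legR _ _), RE_self_mul_apply, mul_RE_self_apply, legL_mul_legR, legR_mul_legL] at this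
  simpa [hmn.ne, hmn.not_gt] using this.symm

theorem IsRTT.inv_col_comm (hq : q ≠ 0) (h : IsRTT q d C C') (u : V) (j : Fin (d u))
    {k i : Fin (d u)} (hki : k < i) : C' u i j * C' u k j = q⁻¹ • (C' u k j * C' u i j) := by
  have := congrFun (congrFun (h.inv_comm u u) (i, k)) (j, j)
  rw [← Matrix.mul_assoc (legL _ _), RE_self_mul_apply, mul_RE_self_apply, legL_mul_legR,
    legR_mul_legL] at this
  simp only [hki.ne', if_false, one_smul, hki.not_gt, zero_smul, add_zero, if_true,
    lt_irrefl] at this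
  rw [this, smul_smul, inv_mul_cancel₀ hq, one_smul]

theorem mul_mul_mul_of_comm {a b c e : E} (h : b * c = c * b) : a * b * (c * e) = a * c * (b * e) := by
  rw [mul_assoc, ← mul_assoc b, h, mul_assoc, mul_assoc]

/-- Different summands of one entry commute up to q⁻²: one factor q⁻¹ comes from a row of X, the
other from a column of C⁻¹. So the q-binomial theorem leaves only ℓ-th powers. -/
theorem IsQMat.mul_right_pow {ℓ : ℕ} (hℓ : 1 < ℓ) (hodd : Odd ℓ) (hq : IsPrimitiveRoot q ℓ)
    (h : IsRTT q d C C') {t s : V}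
    {X : Matrix (Fin (d t)) (Fin (d s)) E} (hX : IsQMat q d X) (hC' : EntriesCommute (C' s) X)
    (i : Fin (d t)) (j : Fin (d s)) :
    (X * C' s) i j ^ ℓ = ∑ l, X i l ^ ℓ * C' s l j ^ ℓ := by
  have hq0 : q ≠ 0 := hq.ne_zero (by omega)
  -- Oddness of ℓ ensures that the square of a primitive ℓ-th root is still primitive.
  have h2 : IsPrimitiveRoot (q⁻¹ ^ 2) ℓ := hq.inv.pow_of_coprime 2 hodd.coprime_two_left
  rw [Matrix.mul_apply, sum_pow_of_qcomm hℓ h2]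
  · exact Finset.sum_congr rfl fun l _ => Commute.mul_pow (hC' _ _ _ _).symm _
  · intro k l hkl
    rw [mul_mul_mul_of_comm (hC' _ _ _ _), mul_mul_mul_of_comm (hC' _ _ _ _),
      hX.relation_same hq0 i hkl, h.inv_col_comm hq0 s j hkl, smul_mul_smul_comm, pow_two]

theorem IsRTT.mul_pow {ℓ : ℕ} (hℓ : 1 < ℓ) (hodd : Odd ℓ) (hq : IsPrimitiveRoot q ℓ)
    (h : IsRTT q d C C') {t s : V}
    {X : Matrix (Fin (d t)) (Fin (d s)) E} (hX : IsQMat q d X) (hC : EntriesCommute (C t) X)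
    (i : Fin (d t)) (j : Fin (d s)) :
    (C t * X) i j ^ ℓ = ∑ k, C t i k ^ ℓ * X k j ^ ℓ := by
  have hq0 : q ≠ 0 := hq.ne_zero (by omega)
  have h2 : IsPrimitiveRoot (q ^ 2) ℓ := hq.pow_of_coprime 2 hodd.coprime_two_left
  rw [Matrix.mul_apply, sum_pow_of_qcomm hℓ h2]
  · exact Finset.sum_congr rfl fun l _ => Commute.mul_pow (hC _ _ _ _) _
  · intro k l hkl
    have e := hX.relation j j hkl
    rw [if_pos rfl, if_neg (lt_irrefl _), zero_smul, add_zero] at e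
    rw [mul_mul_mul_of_comm (hC _ _ _ _).symm, mul_mul_mul_of_comm (hC _ _ _ _).symm,
      h.row_comm t i hkl, e, smul_mul_smul_comm, pow_two]

theorem IsRTT.entriesCommute_inv (h : IsRTT q d C C') {t s : V} (hts : t ≠ s) :
    EntriesCommute (C t) (C' s) := by
  have e := h.inv_R_mul' t s
  rw [RE_of_ne hts, Matrix.one_mul, Matrix.one_mul] at e
  intro i i' j j'
  have := congrFun (congrFun e (i, j)) (i', j')
  rw [legL_mul_legR, legR_mul_legL] at this
  exact this.symm

/-- Dressing and taking ℓ-th powers entrywise are compatible. This is used twice: to see that the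
operators fix the ℓ-th powers of coordinates, and to see that dressed generators have vanishing ℓ-th
power on the fibre. -/
theorem IsRTT.dress_pow {ℓ : ℕ} (hℓ : 1 < ℓ) (hodd : Odd ℓ) (hq : IsPrimitiveRoot q ℓ)
    (h : IsRTT q d C C') {t s : V} (hts : t ≠ s)
    {X : Matrix (Fin (d t)) (Fin (d s)) E} (hX : IsQMat q d X) (hC : EntriesCommute (C t) X)
    (hC' : EntriesCommute (C' s) X) (i : Fin (d t)) (j : Fin (d s)) :
    (C t * (X * C' s)) i j ^ ℓ = ∑ k, C t i k ^ ℓ * ∑ l, X k l ^ ℓ * C' s l j ^ ℓ := by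
  rw [h.mul_pow hℓ hodd hq (hX.mul_right h hC') (hC.mul_right (h.entriesCommute_inv hts))]
  simp only [hX.mul_right_pow hℓ hodd hq h hC']

/-- A diagonal entry is a diagonal matrix of powers of q, of order dividing ℓ. An off-diagonal entry
is a multiple of one off-diagonal matrix unit, so its square is already zero. -/
theorem auxR_pow {ℓ : ℕ} (hℓ : 1 < ℓ) (hq : q ^ ℓ = 1) (u v : V) (j j' : Fin (d v)) :
    auxR E q d u v j j' ^ ℓ = if j = j' then 1 else 0 := by
  split_ifs with h
  · subst h
    have : ∀ i, ∃ c : ℂ, c ^ ℓ = 1 ∧ RE E q⁻¹ d u v (i, j) (i, j) = algebraMap ℂ E c := by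
      intro i
      obtain ⟨c, hc, e⟩ := RE_diag_apply (E := E) (q := q⁻¹) (d := d) u v i j
      exact ⟨c, by rcases hc with rfl | rfl <;> simp [hq], e⟩
    choose c hc e using this
    have e1 : auxR E q d u v j j = Matrix.diagonal fun i => algebraMap ℂ E (c i) := by
      ext i i'
      by_cases h1 : i = i'
      · subst h1; simp [auxR, e]
      · rw [Matrix.diagonal_apply_ne _ h1, auxR]
        by_cases h2 : u = v
        · subst h2
          simp only [RE, vertR_self, scal, Matrix.map_apply, stdR]
          rw [if_neg (by simp [h1]), if_neg (by simp; intro h3 h4 h5; exact h1 (by simp_all))]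
          simp
        · rw [RE_of_ne h2, Matrix.one_apply_ne (by simp [h1])]
    rw [e1, Matrix.diagonal_pow]
    ext i i'
    simp [Matrix.diagonal_apply, Matrix.one_apply, ← map_pow, hc]
  · suffices auxR E q d u v j j' * auxR E q d u v j j' = 0 by
      obtain ⟨k, rfl⟩ : ∃ k, ℓ = k + 2 := ⟨ℓ - 2, by omega⟩
      rw [pow_add, pow_two, this, mul_zero]
    have e : ∀ i i' : Fin (d u), (i : ℕ) ≠ j' ∨ (i' : ℕ) ≠ j → auxR E q d u v j j' i i' = 0 := by
      intro i i' h1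
      rw [auxR]
      by_cases h2 : u = v
      · subst h2
        simp only [RE, vertR_self, scal, Matrix.map_apply, stdR]
        rw [if_neg (by simp [h]), if_neg (by
          rintro ⟨-, h3⟩
          simp only [Prod.mk.injEq] at h3
          rcases h1 with h1 | h1
          · exact h1 (by rw [h3.2])
          · exact h1 (by rw [h3.1]))]
        simp
      · rw [RE_of_ne h2, Matrix.one_apply_ne (by simp [h])]
    ext i i'
    rw [Matrix.mul_apply]
    refine Finset.sum_eq_zero fun p _ => ?_
    by_cases hp : u = v
    · subst hp
      by_cases h1 : p = j
      · rw [e p i' (Or.inl fun h3 => h (by rw [← h1]; exact Fin.ext h3)), mul_zero]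
      · rw [e i p (Or.inr fun h3 => h1 (Fin.ext h3)), zero_mul]
    · rw [auxR, RE_of_ne hp, Matrix.one_apply_ne (by simp [h]), zero_mul]

end Power

/-! ### Modules with R-matrix operators from coactions -/

section Coaction

variable {V : Type*} {q : ℂ} {d : V → ℕ} {A : Type*} [Ring A] [Algebra ℂ A]

/-- Left multiplication on the quotient by a left ideal. -/
def quotMul (J : Submodule ℂ A) (hJ : ∀ a, ∀ y ∈ J, a * y ∈ J) : A →ₐ[ℂ] Module.End ℂ (A ⧸ J) where
  toFun a := J.mapQ J (LinearMap.mulLeft ℂ a) fun y hy => hJ a y hy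
  map_one' := by ext y; simp
  map_mul' a b := by
    ext y
    exact congrArg J.mkQ (mul_assoc a b y)
  map_zero' := by ext y; simp
  map_add' a b := by
    ext y
    exact (congrArg J.mkQ (add_mul a b y)).trans (map_add _ _ _)
  commutes' c := by
    ext y
    exact (congrArg J.mkQ (Algebra.smul_def c y).symm).trans (map_smul _ _ _)

theorem quotMul_mk {J : Submodule ℂ A} (hJ : ∀ a, ∀ y ∈ J, a * y ∈ J) (a y : A) :
    quotMul J hJ a (J.mkQ y) = J.mkQ (a * y) := rfl

/-- The operators on the quotient by a left ideal which come from a homomorphism to a matrix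
algebra. -/
def quotOp {w : Type*} [Fintype w] [DecidableEq w] (J : Submodule ℂ A) (τ : A →ₐ[ℂ] Matrix w w A)
    (hτ : ∀ y ∈ J, ∀ i j, τ y i j ∈ J) : Matrix w w (Module.End ℂ (A ⧸ J)) := fun i j =>
  J.mapQ J (Matrix.entryLinearMap ℂ A i j ∘ₗ τ.toLinearMap) fun y hy => hτ y hy i j

theorem quotOp_mk {w : Type*} [Fintype w] [DecidableEq w] {J : Submodule ℂ A}
    {τ : A →ₐ[ℂ] Matrix w w A} (hτ : ∀ y ∈ J, ∀ i j, τ y i j ∈ J) (i j : w) (y : A) :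
    quotOp J τ hτ i j (J.mkQ y) = J.mkQ (τ y i j) := rfl

theorem scal_map {B : Type*} [Ring B] [Algebra ℂ B] {a b : Type*} (f : A →ₐ[ℂ] B)
    (M : Matrix a b ℂ) : (scal A M).map f = scal B M := by
  ext i j
  simp [scal]

theorem legR_map {B : Type*} [Ring B] [Algebra ℂ B] {a b b' : Type*} [DecidableEq a]
    (f : A →ₐ[ℂ] B) (M : Matrix b b' A) : (legR a M).map f = legR a (M.map f) := by
  ext i j
  simp only [legR, Matrix.map_apply]
  split_ifs <;> simp

/-- The commutation of T with left multiplication is multiplicativity of τ, applied to a product of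
a generator and an arbitrary element; the class of 1 is fixed since τ is unital. -/
theorem isSmashModule_quot {κ : Type*} {t s : κ → V}
    {G : ∀ k : κ, Matrix (Fin (d (t k))) (Fin (d (s k))) A}
    (hG : Algebra.adjoin ℂ {a | ∃ k i j, a = G k i j} = ⊤)
    {τ : ∀ u, A →ₐ[ℂ] Matrix (Fin (d u)) (Fin (d u)) A}
    (hτ : ∀ u k i j, τ u (G k i j) = smashM q d u (G k) i j)
    {J : Submodule ℂ A} (hJ : ∀ a, ∀ y ∈ J, a * y ∈ J) (hτJ : ∀ u, ∀ y ∈ J, ∀ i j, τ u y i j ∈ J) :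
    IsSmashModule q d (fun u => quotOp J (τ u) (hτJ u))
      (fun k => (G k).map (quotMul J hJ)) (J.mkQ 1) where
  smash k u := by
    have e : ∀ i j K K', τ u (G k i j) K K' =
        (RE A q⁻¹ d u (t k) * (legR (Fin (d u)) (G k) * RE A q d u (s k))) (K, i) (K', j) := by
      intro i j K K'
      rw [hτ, ← unnest_smashM]
      rfl
    ext1 ⟨K, i⟩ ⟨K', j⟩
    refine LinearMap.ext fun y => ?_
    obtain ⟨y, rfl⟩ := J.mkQ_surjective y
    rw [legL_mul_legR]
    simp only [Matrix.map_apply, LinearMap.coe_comp, Function.comp_apply, Module.End.mul_apply,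
      quotMul_mk, quotOp_mk, map_mul, Matrix.mul_apply (M := τ u (G k i j))]
    rw [← Matrix.mul_assoc (legR _ _), ← Matrix.mul_assoc, Matrix.mul_apply]
    have e2 : RE (Module.End ℂ (A ⧸ J)) q⁻¹ d u (t k) *
        (legR (Fin (d u)) ((G k).map (quotMul J hJ)) * RE (Module.End ℂ (A ⧸ J)) q d u (s k)) =
        (RE A q⁻¹ d u (t k) * (legR (Fin (d u)) (G k) * RE A q d u (s k))).map (quotMul J hJ) := by
      rw [Matrix.map_mul, Matrix.map_mul, legR_map]
      simp only [RE, scal_map]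
    rw [e2, Fintype.sum_prod_type]
    simp only [legL, LinearMap.sum_apply, Module.End.mul_apply, Matrix.map_apply, ite_and]
    simp only [apply_ite (DFunLike.coe (F := Module.End ℂ (A ⧸ J))), ite_apply]
    simp [e, quotMul_mk, quotOp_mk]
    refine Finset.sum_congr rfl fun x _ => ?_
    rw [Finset.sum_eq_single j (fun b _ hb => by rw [if_neg hb, map_zero])
      (fun hj => absurd (Finset.mem_univ _) hj), if_pos rfl]
    rfl
  fix_vac u i j := by
    rw [quotOp_mk, map_one, Matrix.one_apply]
    split_ifs <;> simp
  cyclic W h1 h2 := by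
    rw [eq_top_iff]
    rintro y -
    obtain ⟨y, rfl⟩ := J.mkQ_surjective y
    have key : ∀ a : A, ∀ y : A ⧸ J, y ∈ W → quotMul J hJ a y ∈ W := by
      intro a
      have ha : a ∈ Algebra.adjoin ℂ {a | ∃ k i j, a = G k i j} := by rw [hG]; trivial
      induction ha using Algebra.adjoin_induction with
      | mem a ha =>
        obtain ⟨k, i, j, rfl⟩ := ha
        exact fun y hy => h2 k i j y hy
      | algebraMap c =>
        intro y hy
        rw [AlgHom.commutes, Module.algebraMap_end_apply]
        exact W.smul_mem c hy
      | add a b _ _ iha ihb =>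
        intro y hy
        rw [map_add, LinearMap.add_apply]
        exact W.add_mem (iha y hy) (ihb y hy)
      | mul a b _ _ iha ihb =>
        intro y hy
        rw [map_mul, Module.End.mul_apply]
        exact iha _ (ihb y hy)
    have := key y _ h1
    rwa [quotMul_mk, mul_one] at this

/-- The generators of an edge algebra, as matrices. -/
def edgeGenM (q : ℂ) (d : V → ℕ) (t s : V) : ∀ k : Bool,
    Matrix (Fin (d (cond k t s))) (Fin (d (cond k s t))) (EdgeAlg q (d t) (d s))
  | true => matX q (d t) (d s)
  | false => matD q (d t) (d s)

theorem edgeGenM_adjoin (q : ℂ) (d : V → ℕ) (t s : V) :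
    Algebra.adjoin ℂ {a | ∃ k i j, a = edgeGenM q d t s k i j} = ⊤ := by
  rw [eq_top_iff, ← edgeAlg_adjoin]
  apply Algebra.adjoin_mono
  rintro _ (⟨c, rfl⟩ | ⟨c, rfl⟩)
  · exact ⟨true, c.1, c.2, rfl⟩
  · exact ⟨false, c.2, c.1, rfl⟩

theorem edgeSmash_edgeGenM (hq : q ≠ 0) (u : V) {t s : V} (hts : t ≠ s) (k : Bool)
    (i : Fin (d (cond k t s))) (j : Fin (d (cond k s t))) :
    edgeSmash hq d u hts (edgeGenM q d t s k i j) = smashM q d u (edgeGenM q d t s k) i j := by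
  cases k
  · exact edgeSmash_edgePd hq u hts j i
  · exact edgeSmash_edgeX hq u hts i j

/-- The ℓ-th powers of coordinates are invariant: by `IsRTT.dress_pow` they are transformed by the
entrywise ℓ-th powers of R-matrices, which form identity matrices. -/
theorem edgeSmash_edgeX_pow {ℓ : ℕ} (hℓ : 1 < ℓ) (hodd : Odd ℓ) (hq : IsPrimitiveRoot q ℓ)
    (u : V) {t s : V} (hts : t ≠ s) (i : Fin (d t)) (j : Fin (d s)) :
    edgeSmash (hq.ne_zero (by omega)) d u hts (edgeX q i j ^ ℓ) =
      Matrix.scalar (Fin (d u)) (edgeX q i j ^ ℓ) := by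
  have hq0 : q ≠ 0 := hq.ne_zero (by omega)
  rw [map_pow, edgeSmash_edgeX, smashM]
  have h1 : IsQMat q d (E := Matrix (Fin (d u)) (Fin (d u)) (EdgeAlg q (d t) (d s)))
      (nestM (Fin (d u)) (matX q (d t) (d s))) :=
    IsQMat.map (F := Matrix (Fin (d u)) (Fin (d u)) (EdgeAlg q (d t) (d s)))
      (Matrix.scalarAlgHom (Fin (d u)) ℂ) (isQMat_matX hq0 t s)
  rw [IsRTT.dress_pow (E := Matrix (Fin (d u)) (Fin (d u)) (EdgeAlg q (d t) (d s))) hℓ hodd hq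
    (isRTT_auxR hq0 u) hts h1 (auxR_comm_nestM u t _) (by
      have := auxR_comm_nestM (q := q⁻¹) (d := d) u s (matX q (d t) (d s))
      exact this)]
  simp only [auxR_pow hℓ hq.pow_eq_one, auxR_pow hℓ hq.inv.pow_eq_one]
  simp only [ite_mul, one_mul, zero_mul, mul_ite, mul_one, mul_zero, Finset.sum_ite_eq,
    Finset.sum_ite_eq', Finset.mem_univ, if_true]
  rw [nestM, Matrix.map_apply, ← map_pow]
  rfl

/-- The left ideal generated by the derivations and by the `ℓ`-th powers of the coordinates. -/
def edgeIdeal (q : ℂ) (ℓ M N : ℕ) : Submodule (EdgeAlg q M N) (EdgeAlg q M N) :=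
  Submodule.span _ {z | ∃ i j, z = edgePd q i j ∨ z = edgeX q i j ^ ℓ}

/-- The operators mix derivations linearly among themselves and fix the ℓ-th powers of coordinates,
so they descend to the module of the fibre over zero. -/
theorem edgeSmash_mem_edgeIdeal {ℓ : ℕ} (hℓ : 1 < ℓ) (hodd : Odd ℓ) (hq : IsPrimitiveRoot q ℓ)
    (u : V) {t s : V} (hts : t ≠ s) {y : EdgeAlg q (d t) (d s)}
    (hy : y ∈ edgeIdeal q ℓ (d t) (d s)) (K K' : Fin (d u)) :
    edgeSmash (hq.ne_zero (by omega)) d u hts y K K' ∈ edgeIdeal q ℓ (d t) (d s) := by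
  revert K K'
  induction hy using Submodule.span_induction with
  | mem y hy =>
    obtain ⟨i, j, rfl | rfl⟩ := hy
    · intro K K'
      rw [edgeSmash_edgePd]
      change unnest (smashM q d u (matD q (d t) (d s))) (K, j) (K', i) ∈ _
      rw [unnest_smashM, Matrix.mul_apply]
      refine Submodule.sum_mem _ fun p _ => ?_
      rw [Matrix.mul_apply, Finset.mul_sum]
      refine Submodule.sum_mem _ fun p' _ => Submodule.smul_mem _ _ ?_
      rw [RE, scal, Matrix.map_apply, ← Algebra.commutes]
      refine Submodule.smul_mem _ _ ?_
      rw [legR]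
      split_ifs
      · exact Submodule.subset_span ⟨_, _, Or.inl rfl⟩
      · exact Submodule.zero_mem _
    · intro K K'
      rw [edgeSmash_edgeX_pow hℓ hodd hq, Matrix.scalar_apply, Matrix.diagonal_apply]
      split_ifs
      · exact Submodule.subset_span ⟨_, _, Or.inr rfl⟩
      · exact Submodule.zero_mem _
  | zero => intro K K'; rw [map_zero]; exact Submodule.zero_mem _
  | add a b _ _ iha ihb =>
    intro K K'; rw [map_add]; exact Submodule.add_mem _ (iha K K') (ihb K K')
  | smul a b _ ih =>
    intro K K'
    rw [smul_eq_mul, map_mul, Matrix.mul_apply]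
    exact Submodule.sum_mem _ fun p _ => Submodule.smul_mem _ _ (ih _ _)

end Coaction

/-! ### Products of commuting families of operators -/

section Dressing

variable {V : Type*} {q : ℂ} {d : V → ℕ} {E : Type*} [Ring E] [Algebra ℂ E]

theorem EntriesCommute.one_left {a b b' : Type*} [DecidableEq a] (B : Matrix b b' E) :
    EntriesCommute (1 : Matrix a a E) B := by
  intro i i' j j'
  rw [Matrix.one_apply]
  split_ifs <;> simp

theorem legL_map {F : Type*} [Ring F] [Algebra ℂ F] {a a' b : Type*} [DecidableEq b]
    (f : E →ₐ[ℂ] F) (M : Matrix a a' E) : (legL b M).map f = legL b (M.map f) := by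
  ext i j
  simp only [legL, Matrix.map_apply]
  split_ifs <;> simp

theorem RE_map {F : Type*} [Ring F] [Algebra ℂ F] (f : E →ₐ[ℂ] F) (u v : V) :
    (RE E q d u v).map f = RE F q d u v := scal_map f _

theorem IsRTT.one : IsRTT q d (fun v => (1 : Matrix (Fin (d v)) (Fin (d v)) E)) (fun _ => 1) where
  mul_inv v := Matrix.one_mul _
  inv_mul v := Matrix.one_mul _
  rtt u v := by simp [legL_one, legR_one]

theorem IsRTT.map {F : Type*} [Ring F] [Algebra ℂ F] (f : E →ₐ[ℂ] F)
    {C C' : ∀ v : V, Matrix (Fin (d v)) (Fin (d v)) E} (h : IsRTT q d C C') :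
    IsRTT q d (fun v => (C v).map f) (fun v => (C' v).map f) where
  mul_inv v := by rw [← Matrix.map_mul, h.mul_inv, Matrix.map_one _ (map_zero f) (map_one f)]
  inv_mul v := by rw [← Matrix.map_mul, h.inv_mul, Matrix.map_one _ (map_zero f) (map_one f)]
  rtt u v := by
    have := congrArg (fun M => M.map f) (h.rtt u v)
    simpa only [Matrix.map_mul, legL_map, legR_map, RE_map] using this

theorem IsSmash.map {F : Type*} [Ring F] [Algebra ℂ F] (f : E →ₐ[ℂ] F)
    {C : ∀ v : V, Matrix (Fin (d v)) (Fin (d v)) E} {t s : V}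
    {A : Matrix (Fin (d t)) (Fin (d s)) E} (h : IsSmash q d C A) :
    IsSmash q d (fun v => (C v).map f) (A.map f) := fun v => by
  have := congrArg (fun M => M.map f) (h v)
  simpa only [Matrix.map_mul, legL_map, legR_map, RE_map] using this

/-- The matrix form of the coproduct: the two factors play the role of L-operators on two tensor
factors. -/
theorem IsRTT.mul {C C' D D' : ∀ v : V, Matrix (Fin (d v)) (Fin (d v)) E} (h : IsRTT q d C C')
    (k : IsRTT q d D D') (hCD : ∀ u v, EntriesCommute (C u) (D v)) :
    IsRTT q d (fun v => C v * D v) (fun v => D' v * C' v) where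
  mul_inv v := by
    rw [Matrix.mul_assoc, mul_eq_one_assoc (k.mul_inv v), h.mul_inv]
  inv_mul v := by
    rw [Matrix.mul_assoc, mul_eq_one_assoc (h.inv_mul v), k.inv_mul]
  rtt u v := by
    simp only [legL_mul, legR_mul, Matrix.mul_assoc]
    rw [mul_eq_mul_assoc (hCD v u).symm.leg_comm, mul_mul_eq_assoc (h.rtt u v)]
    simp only [Matrix.mul_assoc]
    rw [k.rtt u v, mul_eq_mul_assoc (hCD u v).leg_comm]

variable {ε : Type*}

/-- The product of the families of matrices labelled by a list. -/
def dressL (C : ε → ∀ v : V, Matrix (Fin (d v)) (Fin (d v)) E) (l : List ε) (v : V) :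
    Matrix (Fin (d v)) (Fin (d v)) E :=
  (l.map fun e => C e v).prod

/-- The product, in the opposite order, of the families of matrices labelled by a list. -/
def dressR (C : ε → ∀ v : V, Matrix (Fin (d v)) (Fin (d v)) E) (l : List ε) (v : V) :
    Matrix (Fin (d v)) (Fin (d v)) E :=
  (l.reverse.map fun e => C e v).prod

theorem EntriesCommute.list_prod_left {a b b' : Type*} [Fintype a] [DecidableEq a]
    [Fintype b] [Fintype b'] {B : Matrix b b' E} : ∀ {l : List (Matrix a a E)}, (∀ A ∈ l, EntriesCommute A B) →
      EntriesCommute l.prod B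
  | [], _ => EntriesCommute.one_left B
  | A :: l, h => by
    rw [List.prod_cons]
    exact (h A (by simp)).mul_left (EntriesCommute.list_prod_left fun A hA => h A (by simp [hA]))

theorem dressL_comm {C : ε → ∀ v : V, Matrix (Fin (d v)) (Fin (d v)) E} {l : List ε} {v : V}
    {b b' : Type*} [Fintype b] [Fintype b'] {B : Matrix b b' E} (h : ∀ e ∈ l, EntriesCommute (C e v) B) :
    EntriesCommute (dressL C l v) B :=
  EntriesCommute.list_prod_left (by simpa using h)

theorem dressR_comm {C : ε → ∀ v : V, Matrix (Fin (d v)) (Fin (d v)) E} {l : List ε} {v : V}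
    {b b' : Type*} [Fintype b] [Fintype b'] {B : Matrix b b' E} (h : ∀ e ∈ l, EntriesCommute (C e v) B) :
    EntriesCommute (dressR C l v) B :=
  EntriesCommute.list_prod_left (by simpa using h)

theorem isRTT_dress {C C' : ε → ∀ v : V, Matrix (Fin (d v)) (Fin (d v)) E}
    (h : ∀ e, IsRTT q d (C e) (C' e))
    (hC : ∀ e f, e ≠ f → ∀ u v, EntriesCommute (C e u) (C f v)) :
    ∀ {l : List ε}, l.Nodup → IsRTT q d (dressL C l) (dressR C' l)
  | [], _ => IsRTT.one
  | e :: l, hl => by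
    have := (h e).mul (isRTT_dress h hC (List.nodup_cons.1 hl).2) fun u v =>
      (dressL_comm fun f hf => hC f e (by
        rintro rfl; exact (List.nodup_cons.1 hl).1 hf) v u).symm
    convert this using 2 with v v
    · simp [dressL]
    · simp [dressR]

theorem dressL_append (C : ε → ∀ v : V, Matrix (Fin (d v)) (Fin (d v)) E) (l l' : List ε) (v : V) :
    dressL C (l ++ l') v = dressL C l v * dressL C l' v := by simp [dressL]

theorem dressR_append (C : ε → ∀ v : V, Matrix (Fin (d v)) (Fin (d v)) E) (l l' : List ε) (v : V) :
    dressR C (l ++ l') v = dressR C l' v * dressR C l v := by simp [dressR]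

/-- The cross relations between dressed matrices. -/
theorem isCross_dress (hq : q ≠ 0) {C C' : ε → ∀ v : V, Matrix (Fin (d v)) (Fin (d v)) E}
    (h : ∀ e, IsRTT q d (C e) (C' e))
    (hC : ∀ e f, e ≠ f → ∀ u v, EntriesCommute (C e u) (C f v))
    (hC' : ∀ e f, e ≠ f → ∀ u v, EntriesCommute (C' e u) (C f v))
    (hC'' : ∀ e f, e ≠ f → ∀ u v, EntriesCommute (C' e u) (C' f v))
    {l l' : List ε} {e f : ε} (hl : (l ++ e :: l').Nodup) (hf : f ∉ l ++ e :: l')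
    {ta sa tb sb : V}
    {A : Matrix (Fin (d ta)) (Fin (d sa)) E} {B : Matrix (Fin (d tb)) (Fin (d sb)) E}
    (hA : IsSmash q d (C e) A) (hAB : EntriesCommute A B)
    (hAC : ∀ g, g ≠ e → ∀ v, EntriesCommute (C g v) A)
    (hAC' : ∀ g, g ≠ e → ∀ v, EntriesCommute (C' g v) A)
    (hBC : ∀ g, g ≠ f → ∀ v, EntriesCommute (C g v) B)
    (hBC' : ∀ g, g ≠ f → ∀ v, EntriesCommute (C' g v) B) :
    IsCross q d (dressL C l ta * (A * dressR C' l sa))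
      (dressL C (l ++ e :: l') tb * (B * dressR C' (l ++ e :: l') sb)) := by
  rw [List.nodup_append] at hl
  have hel : ∀ g ∈ l, g ≠ e := fun g hg => hl.2.2 g hg e (by simp)
  have hel' : ∀ g ∈ l', g ≠ e := fun g hg h => (List.nodup_cons.1 hl.2.1).1 (h ▸ hg)
  have hll' : ∀ g ∈ l, ∀ g' ∈ l', g ≠ g' := fun g hg g' hg' => hl.2.2 g hg g' (by simp [hg'])
  simp only [List.mem_append, List.mem_cons, not_or] at hf
  have hfl : ∀ g ∈ l, g ≠ f := fun g hg h => hf.1 (h ▸ hg)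
  have hfl' : ∀ g ∈ l', g ≠ f := fun g hg h => hf.2.2 (h ▸ hg)
  -- The dressing of the later edge splits into the edges before e, the edge e itself, and the edges
  -- between. The latter commute with A and are absorbed into B; the factor of e gives the braiding
  -- by `IsSmash.isCross`. The common dressing by l is added to both sides afterwards, by
  -- covariance.
  have h1 : IsCross q d A (C e tb * ((dressL C l' tb * (B * dressR C' l' sb)) * C' e sb)) := by
    refine hA.isCross (h e) hq ?_
    refine EntriesCommute.mul_right ?_ (EntriesCommute.mul_right hAB ?_)
    · exact (dressL_comm fun g hg => hAC g (hel' g hg) _).symm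
    · exact (dressR_comm fun g hg => hAC' g (hel' g hg) _).symm
  have h2 := (isRTT_dress h hC hl.1).isCross hq h1
    (fun v => dressL_comm fun g hg => hAC g (hel g hg) v)
    (fun v => dressR_comm fun g hg => hAC' g (hel g hg) v)
    (fun v => dressL_comm fun g hg => (hC _ _ (hel g hg) _ _).mul_right
      (((dressL_comm fun g' hg' => (hC g g' (hll' g hg g' hg') _ _).symm).symm.mul_right
        ((hBC g (hfl g hg) v).mul_right (dressR_comm fun g' hg' =>
          hC' g' g (hll' g hg g' hg').symm _ _).symm)).mul_right (hC' e g (hel g hg).symm _ _).symm))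
    (fun v => dressR_comm fun g hg => (hC' _ _ (hel g hg) _ _).mul_right
      (((dressL_comm fun g' hg' => (hC' g g' (hll' g hg g' hg') _ _).symm).symm.mul_right
        ((hBC' g (hfl g hg) v).mul_right (dressR_comm fun g' hg' =>
          hC'' g' g (hll' g hg g' hg').symm _ _).symm)).mul_right (hC'' e g (hel g hg).symm _ _).symm))
  rw [dressL_append, dressR_append]
  have e1 : dressL C (e :: l') tb = C e tb * dressL C l' tb := by simp [dressL]
  have e2 : dressR C' (e :: l') sb = dressR C' l' sb * C' e sb := by simp [dressR]
  rw [e1, e2]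
  simpa only [Matrix.mul_assoc] using h2

end Dressing

/-! ### Operators on tensor products -/

section PiTensor

variable {ε : Type*} [DecidableEq ε] {P : ε → Type*} [∀ e, AddCommGroup (P e)]
  [∀ e, Module ℂ (P e)]

theorem PiTensorProduct.map_update_one_tprod (e : ε) (f : Module.End ℂ (P e)) (y : ∀ e, P e) :
    PiTensorProduct.map (Function.update (fun e => (1 : Module.End ℂ (P e))) e f)
      (PiTensorProduct.tprod ℂ y) = PiTensorProduct.tprod ℂ (Function.update y e (f (y e))) := by
  rw [PiTensorProduct.map_tprod]
  congr 1
  ext e'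
  by_cases h : e' = e
  · subst h; simp
  · simp [h]

/-- An operator on one factor of a tensor product, as an operator on the tensor product. -/
def tensorOp (P : ε → Type*) [∀ e, AddCommGroup (P e)] [∀ e, Module ℂ (P e)] (e : ε) :
    Module.End ℂ (P e) →ₐ[ℂ] Module.End ℂ (⨂[ℂ] e, P e) where
  toFun f := PiTensorProduct.map (Function.update (fun e => (1 : Module.End ℂ (P e))) e f)
  map_one' := by
    ext y
    simp [PiTensorProduct.map_update_one_tprod]
  map_mul' f g := by
    ext y
    simp only [LinearMap.compMultilinearMap_apply, Module.End.mul_apply,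
      PiTensorProduct.map_update_one_tprod, Function.update_self, Function.update_idem]
  map_zero' := by
    ext y
    simp only [LinearMap.compMultilinearMap_apply, PiTensorProduct.map_update_one_tprod,
      LinearMap.zero_apply]
    exact (PiTensorProduct.tprod ℂ).map_coord_zero e (by simp)
  map_add' f g := by
    ext y
    simp only [LinearMap.compMultilinearMap_apply, LinearMap.add_apply,
      PiTensorProduct.map_update_one_tprod, MultilinearMap.map_update_add]
  commutes' c := by
    ext y
    simp only [LinearMap.compMultilinearMap_apply, PiTensorProduct.map_update_one_tprod,
      Module.algebraMap_end_apply, MultilinearMap.map_update_smul, Function.update_eq_self]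

theorem tensorOp_tprod (e : ε) (f : Module.End ℂ (P e)) (y : ∀ e, P e) :
    tensorOp P e f (PiTensorProduct.tprod ℂ y) =
      PiTensorProduct.tprod ℂ (Function.update y e (f (y e))) :=
  PiTensorProduct.map_update_one_tprod e f y

theorem tensorOp_comm {e e' : ε} (h : e ≠ e') (f : Module.End ℂ (P e)) (g : Module.End ℂ (P e')) :
    tensorOp P e f * tensorOp P e' g = tensorOp P e' g * tensorOp P e f := by
  ext y
  simp only [LinearMap.compMultilinearMap_apply, Module.End.mul_apply, tensorOp_tprod]
  rw [Function.update_of_ne h, Function.update_of_ne h.symm, Function.update_comm h]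

theorem entriesCommute_tensorOp {e e' : ε} (h : e ≠ e') {a a' b b' : Type*}
    (A : Matrix a a' (Module.End ℂ (P e))) (B : Matrix b b' (Module.End ℂ (P e'))) :
    EntriesCommute (A.map (tensorOp P e)) (B.map (tensorOp P e')) :=
  fun _ _ _ _ => tensorOp_comm h _ _

end PiTensor

/-! ### Coordinate form of the cross relations -/

section CrossCoordinates

variable {V : Type*} {q : ℂ} {d : V → ℕ} {E : Type*} [Ring E] [Algebra ℂ E]

theorem ite_inv_sub (p : Prop) [Decidable p] :
    (if p then q⁻¹ - q else 0) = -(if p then q - q⁻¹ else 0) := by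
  split_ifs <;> simp

theorem sum_comm_two_two {a b c e : Type*} [Fintype a] [Fintype b] [Fintype c] [Fintype e]
    (f : a → b → c → e → E) :
    ∑ i, ∑ j, ∑ k, ∑ l, f i j k l = ∑ k, ∑ l, ∑ i, ∑ j, f i j k l := by
  have h1 : ∀ i j, ∑ k, ∑ l, f i j k l = ∑ x : c × e, f i j x.1 x.2 := fun i j => by
    rw [Fintype.sum_prod_type]
  have h2 : ∀ k l, ∑ i, ∑ j, f i j k l = ∑ x : a × b, f x.1 x.2 k l := fun i j => by
    rw [Fintype.sum_prod_type]
  simp only [h1]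
  rw [← Fintype.sum_prod_type' (f := fun i j => ∑ x : c × e, f i j x.1 x.2), Finset.sum_comm,
    Fintype.sum_prod_type]
  simp only [h2]

/-- All four elementary braidings, of upper or lower indices, are one R-matrix or its inverse with
its row and column indices read in different roles. -/
theorem vertR_eq_braidUL' {u v : V} (L' L : Fin (d u)) (I I' : Fin (d v)) :
    vertR q⁻¹ d u v (L', I) (L, I') = braidUL' (d := d) q ⟨v, I⟩ ⟨u, L⟩ ⟨u, L'⟩ ⟨v, I'⟩ := by
  classical
  rw [vertR, braidUL', inv_inv, ite_inv_sub, ← sub_eq_add_neg]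
  congr 1
  · by_cases h : (L', I) = (L, I')
    · obtain ⟨rfl, rfl⟩ := Prod.mk.inj h
      simp [eq_comm]
    · rw [if_neg h, if_neg]
      rintro ⟨h1, h2⟩
      exact h (by simp_all)
  · refine if_congr ⟨?_, ?_⟩ rfl rfl
    · rintro ⟨h1, h2, h3⟩
      exact ⟨h2.symm, h3.symm, by rwa [h3]⟩
    · rintro ⟨h1, h2, h3⟩
      exact ⟨by rwa [h2], h1.symm, h2.symm⟩

theorem vertR_eq_braidUL {u v : V} (K K' : Fin (d u)) (J J' : Fin (d v)) :
    vertR q d u v (K, J') (K', J) = braidUL (d := d) q ⟨u, K⟩ ⟨v, J⟩ ⟨v, J'⟩ ⟨u, K'⟩ := by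
  classical
  rw [vertR, braidUL]
  congr 1
  · by_cases h : (K, J') = (K', J)
    · obtain ⟨rfl, rfl⟩ := Prod.mk.inj h
      simp [eq_comm]
    · rw [if_neg h, if_neg]
      rintro ⟨h1, h2⟩
      exact h (by simp_all)
  · refine if_congr ⟨?_, ?_⟩ rfl rfl
    · rintro ⟨h1, h2, h3⟩
      exact ⟨h3, h2.symm, by rwa [h2]⟩
    · rintro ⟨h1, h2, h3⟩
      exact ⟨by rwa [h2], h2.symm, h1⟩

theorem vertR_eq_braidUU {u v : V} (K K' : Fin (d u)) (I I' : Fin (d v)) :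
    vertR q⁻¹ d u v (K, I) (K', I') = braidUU (d := d) q ⟨u, K⟩ ⟨v, I⟩ ⟨v, I'⟩ ⟨u, K'⟩ := by
  classical
  rw [vertR, braidUU, inv_inv, ite_inv_sub, ← sub_eq_add_neg]
  congr 1
  · by_cases h : (K, I) = (K', I')
    · obtain ⟨rfl, rfl⟩ := Prod.mk.inj h
      simp [eq_comm]
    · rw [if_neg h, if_neg]
      rintro ⟨h1, h2⟩
      exact h (by simp_all)
  · refine if_congr ⟨?_, ?_⟩ rfl rfl
    · rintro ⟨h1, h2, h3⟩
      exact ⟨h1, h3, h2⟩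
    · rintro ⟨h1, h2, h3⟩
      exact ⟨h1, h3, h2⟩

theorem vertR_eq_braidLL {u v : V} (L L' : Fin (d u)) (J J' : Fin (d v)) :
    vertR q⁻¹ d u v (L', J') (L, J) = braidLL (d := d) q ⟨u, L⟩ ⟨v, J⟩ ⟨v, J'⟩ ⟨u, L'⟩ := by
  classical
  rw [vertR, braidLL, inv_inv, ite_inv_sub, ← sub_eq_add_neg]
  congr 1
  · by_cases h : (L', J') = (L, J)
    · obtain ⟨rfl, rfl⟩ := Prod.mk.inj h
      simp [eq_comm]
    · rw [if_neg h, if_neg]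
      rintro ⟨h1, h2⟩
      exact h (by simp_all)
  · refine if_congr ⟨?_, ?_⟩ rfl rfl
    · rintro ⟨h1, h2, h3⟩
      exact ⟨by rw [h3]; rwa [h2], h2.symm, h3.symm⟩
    · rintro ⟨h1, h2, h3⟩
      exact ⟨by change VIdx.Before ⟨u, L'⟩ ⟨v, J'⟩; rwa [h3, h2], h2.symm, h3.symm⟩

theorem isCross_iff {ta sa tb sb : V} {A : Matrix (Fin (d ta)) (Fin (d sa)) E}
    {B : Matrix (Fin (d tb)) (Fin (d sb)) E} :
    IsCross q d A B ↔ ∀ I J K L,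
      ∑ L' : Fin (d sb), ∑ I' : Fin (d ta),
          braidUL' (d := d) q ⟨ta, I⟩ ⟨sb, L⟩ ⟨sb, L'⟩ ⟨ta, I'⟩ • (B K L' * A I' J) =
        ∑ I' : Fin (d ta), ∑ K' : Fin (d tb), ∑ J' : Fin (d sa), ∑ L' : Fin (d sb),
          ∑ J'' : Fin (d sa), ∑ K'' : Fin (d tb),
          (braidUU (d := d) q ⟨tb, K⟩ ⟨ta, I⟩ ⟨ta, I'⟩ ⟨tb, K'⟩
            * braidLL (d := d) q ⟨sb, L⟩ ⟨sa, J⟩ ⟨sa, J'⟩ ⟨sb, L'⟩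
            * braidUL (d := d) q ⟨tb, K'⟩ ⟨sa, J'⟩ ⟨sa, J''⟩ ⟨tb, K''⟩) •
            (A I' J'' * B K'' L') := by
  have h1 : ∀ I J K L, (legL (Fin (d ta)) B * (RE E q⁻¹ d sb ta * legR (Fin (d sb)) A))
      (K, I) (L, J) = ∑ L' : Fin (d sb), ∑ I' : Fin (d ta),
          braidUL' (d := d) q ⟨ta, I⟩ ⟨sb, L⟩ ⟨sb, L'⟩ ⟨ta, I'⟩ • (B K L' * A I' J) := by
    intro I J K L
    simp only [← vertR_eq_braidUL', Algebra.smul_def]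
    rw [Matrix.mul_apply, Fintype.sum_prod_type]
    refine Finset.sum_congr rfl fun L' _ => ?_
    simp only [legL, Matrix.mul_apply, Fintype.sum_prod_type, legR]
    simp only [ite_mul, zero_mul, Finset.sum_ite_eq, Finset.mem_univ, if_true, mul_ite, mul_zero]
    rw [Finset.sum_comm, Finset.mul_sum]
    refine Finset.sum_congr rfl fun I' _ => ?_
    rw [Finset.sum_ite_eq' Finset.univ L, if_pos (Finset.mem_univ _), RE, scal, Matrix.map_apply,
      ← mul_assoc, ← mul_assoc, Algebra.commutes]
  have h2 : ∀ I J K L, (RE E q⁻¹ d tb ta * (legR (Fin (d tb)) A * (RE E q d tb sa *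
      (legL (Fin (d sa)) B * RE E q⁻¹ d sb sa)))) (K, I) (L, J) =
        ∑ I' : Fin (d ta), ∑ K' : Fin (d tb), ∑ J' : Fin (d sa), ∑ L' : Fin (d sb),
          ∑ J'' : Fin (d sa), ∑ K'' : Fin (d tb),
          (braidUU (d := d) q ⟨tb, K⟩ ⟨ta, I⟩ ⟨ta, I'⟩ ⟨tb, K'⟩
            * braidLL (d := d) q ⟨sb, L⟩ ⟨sa, J⟩ ⟨sa, J'⟩ ⟨sb, L'⟩
            * braidUL (d := d) q ⟨tb, K'⟩ ⟨sa, J'⟩ ⟨sa, J''⟩ ⟨tb, K''⟩) •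
            (A I' J'' * B K'' L') := by
    intro I J K L
    simp only [← vertR_eq_braidUU, ← vertR_eq_braidLL, ← vertR_eq_braidUL]
    have e1 : ∀ K'' J', (legL (Fin (d sa)) B * RE E q⁻¹ d sb sa) (K'', J') (L, J) =
        ∑ L', vertR q⁻¹ d sb sa (L', J') (L, J) • B K'' L' := by
      intro K'' J'
      rw [Matrix.mul_apply, Fintype.sum_prod_type]
      simp only [legL, ite_mul, zero_mul, Finset.sum_ite_eq, Finset.mem_univ, if_true]
      simp only [RE, scal, Matrix.map_apply, Algebra.smul_def, Algebra.commutes]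
    have e2 : ∀ (Z : Matrix (Fin (d tb) × Fin (d sa)) (Fin (d sb) × Fin (d sa)) E) K' I' p,
        (legR (Fin (d tb)) A * Z) (K', I') p = ∑ J'', A I' J'' * Z (K', J'') p := by
      intro Z K' I' p
      rw [Matrix.mul_apply, Fintype.sum_prod_type, Finset.sum_comm]
      simp only [legR, ite_mul, zero_mul, Finset.sum_ite_eq, Finset.mem_univ, if_true]
    rw [Matrix.mul_apply, Fintype.sum_prod_type]
    simp only [e2, Matrix.mul_apply (M := RE E q d tb sa), Fintype.sum_prod_type, e1]
    rw [Finset.sum_comm]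
    refine Finset.sum_congr rfl fun I' _ => Finset.sum_congr rfl fun K' _ => ?_
    simp only [Finset.mul_sum]
    rw [sum_comm_two_two]
    refine Finset.sum_congr rfl fun J' _ => Finset.sum_congr rfl fun L' _ =>
      Finset.sum_congr rfl fun J'' _ => Finset.sum_congr rfl fun K'' _ => ?_
    simp only [RE, scal, Matrix.map_apply, ← Algebra.smul_def, mul_smul_comm, smul_smul]
    congr 1
    ring
  rw [IsCross, ← Matrix.ext_iff]
  simp only [Prod.forall, h1, h2]
  exact ⟨fun h I J K L => h K I L J, fun h K I L J => h I J K L⟩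

end CrossCoordinates

/-! ### Homomorphisms from the quiver algebra -/

section QuiverLift

variable {V : Type*} [Quiver V] {q : ℂ} {d : V → ℕ} {E : Type*} [Ring E] [Algebra ℂ E]

/-- The matrix of the generators of an arrow of the doubled quiver. -/
def arrowM (W : ∀ e : Quiver.Total V, EdgeAlg q (d e.right) (d e.left) →ₐ[ℂ] E) :
    ∀ a : DArrow V, Matrix (Fin (d a.tgt)) (Fin (d a.src)) E
  | (e, true) => (matX q (d e.right) (d e.left)).map (W e)
  | (e, false) => (matD q (d e.right) (d e.left)).map (W e)

variable [LinearOrder (Quiver.Total V)]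

theorem edgeIncl_edgeX (e : Quiver.Total V) (i : Fin (d e.right)) (j : Fin (d e.left)) :
    edgeIncl q d e (edgeX q i j) =
      RingQuot.mkAlgHom ℂ (QuiverRel q d) (FreeAlgebra.ι ℂ ⟨e, EdgeGen.x i j⟩) := by
  simp [edgeIncl, edgeX, freeIncl]

theorem edgeIncl_edgePd (e : Quiver.Total V) (i : Fin (d e.right)) (j : Fin (d e.left)) :
    edgeIncl q d e (edgePd q i j) =
      RingQuot.mkAlgHom ℂ (QuiverRel q d) (FreeAlgebra.ι ℂ ⟨e, EdgeGen.pd i j⟩) := by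
  simp [edgeIncl, edgePd, freeIncl]

theorem arrowM_edgeIncl (a : DArrow V) (i : Fin (d a.tgt)) (j : Fin (d a.src)) :
    arrowM (edgeIncl q d) a i j = RingQuot.mkAlgHom ℂ (QuiverRel q d) (freeEntry a i j) := by
  obtain ⟨e, k⟩ := a
  cases k
  · exact edgeIncl_edgePd e j i
  · exact edgeIncl_edgeX e i j

theorem isCross_edgeIncl {a b : DArrow V} (hab : a.1 < b.1) :
    IsCross q d (arrowM (edgeIncl q d) a) (arrowM (edgeIncl q d) b) := by
  rw [isCross_iff]
  intro I J K L
  have := RingQuot.mkAlgHom_rel ℂ (QuiverRel.cross (q := q) (d := d) a b hab I J K L)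
  simpa only [map_sum, map_smul, map_mul, ← arrowM_edgeIncl] using this

/-- The homomorphism from the quiver algebra given by homomorphisms from the edge algebras which
satisfy the cross relations. -/
def quiverLift (W : ∀ e : Quiver.Total V, EdgeAlg q (d e.right) (d e.left) →ₐ[ℂ] E)
    (hW : ∀ a b : DArrow V, a.1 < b.1 → IsCross q d (arrowM W a) (arrowM W b)) :
    QuiverAlg q d →ₐ[ℂ] E :=
  RingQuot.liftAlgHom ℂ ⟨FreeAlgebra.lift ℂ
    (fun g => W g.1 (RingQuot.mkAlgHom ℂ _ (FreeAlgebra.ι ℂ g.2))), by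
      have h1 : ∀ a i j, FreeAlgebra.lift ℂ (fun g : QuiverGen d => W g.1 (RingQuot.mkAlgHom ℂ _
          (FreeAlgebra.ι ℂ g.2))) (freeEntry a i j) = arrowM W a i j := by
        rintro ⟨e, k⟩ i j
        cases k <;> simp only [freeEntry, FreeAlgebra.lift_ι_apply, arrowM, Matrix.map_apply] <;> rfl
      intro x y hxy
      cases hxy with
      | edge e h =>
        have h2 : (FreeAlgebra.lift ℂ (fun g : QuiverGen d => W g.1 (RingQuot.mkAlgHom ℂ _
            (FreeAlgebra.ι ℂ g.2)))).comp (freeIncl d e) =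
            (W e).comp (RingQuot.mkAlgHom ℂ (EdgeRel q (d e.right) (d e.left))) := by
          ext g
          simp [freeIncl]
        have h3 := fun z => DFunLike.congr_fun h2 z
        simp only [AlgHom.comp_apply] at h3
        rw [h3, h3, RingQuot.mkAlgHom_rel ℂ h]
      | cross a b hab I J K L =>
        have := isCross_iff.1 (hW a b hab) I J K L
        simpa only [map_sum, map_smul, map_mul, h1] using this⟩

theorem quiverLift_edgeIncl
    (W : ∀ e : Quiver.Total V, EdgeAlg q (d e.right) (d e.left) →ₐ[ℂ] E)
    (hW : ∀ a b : DArrow V, a.1 < b.1 → IsCross q d (arrowM W a) (arrowM W b))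
    (e : Quiver.Total V) (z : EdgeAlg q (d e.right) (d e.left)) :
    quiverLift W hW (edgeIncl q d e z) = W e z := by
  rw [← AlgHom.comp_apply]
  congr 1
  apply edgeAlg_hom_ext
  · intro i j
    rw [AlgHom.comp_apply, edgeIncl_edgeX, quiverLift, RingQuot.liftAlgHom_mkAlgHom_apply,
      FreeAlgebra.lift_ι_apply]
    rfl
  · intro i j
    rw [AlgHom.comp_apply, edgeIncl_edgePd, quiverLift, RingQuot.liftAlgHom_mkAlgHom_apply,
      FreeAlgebra.lift_ι_apply]
    rfl

end QuiverLift

/-! ### The edges preceding a given edge -/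

section QuiverRep

variable {V : Type*} [Quiver V] {q : ℂ} {d : V → ℕ} [Fintype (Quiver.Total V)]
  [LinearOrder (Quiver.Total V)]
  {P : Quiver.Total V → Type*} [∀ e, AddCommGroup (P e)] [∀ e, Module ℂ (P e)]

/-- The edges which precede an edge, in increasing order. -/
def edgesBefore (e : Quiver.Total V) : List (Quiver.Total V) :=
  (Finset.univ.sort (· ≤ ·)).filter (· < e)

theorem mem_edgesBefore {e f : Quiver.Total V} : f ∈ edgesBefore e ↔ f < e := by
  simp [edgesBefore]

theorem edgesBefore_nodup (e : Quiver.Total V) : (edgesBefore e).Nodup :=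
  (Finset.sort_nodup _ _).filter _

theorem edgesBefore_eq_append {e f : Quiver.Total V} (h : e < f) :
    ∃ l, edgesBefore f = edgesBefore e ++ e :: l := by
  have key : ∀ L : List (Quiver.Total V), L.Pairwise (· < ·) → e ∈ L →
      ∃ l, L.filter (· < f) = L.filter (· < e) ++ e :: l := by
    intro L hL he
    induction L with
    | nil => simp at he
    | cons a L ih =>
      rw [List.pairwise_cons] at hL
      rcases List.mem_cons.1 he with rfl | he
      · refine ⟨L.filter (· < f), ?_⟩
        have h1 : L.filter (· < e) = [] :=
          List.filter_eq_nil_iff.2 fun b hb => by simpa using (hL.1 b hb).le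
        rw [List.filter_cons_of_pos (by simpa using h), List.filter_cons_of_neg (by simp), h1,
          List.nil_append]
      · obtain ⟨l, hl⟩ := ih hL.2 he
        have hae := hL.1 e he
        refine ⟨l, ?_⟩
        rw [List.filter_cons_of_pos (by simpa using hae.trans h),
          List.filter_cons_of_pos (by simpa using hae), hl, List.cons_append]
  exact key _ (Finset.sortedLT_sort _).pairwise (by simp)

end QuiverRep

/-! ### The action of the quiver algebra on a tensor product of modules of the edge algebras -/

section QuiverRep

variable {V : Type*} [Quiver V] {q : ℂ} {d : V → ℕ} [Fintype (Quiver.Total V)]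
  [LinearOrder (Quiver.Total V)]
  {P : Quiver.Total V → Type*} [∀ e, AddCommGroup (P e)] [∀ e, Module ℂ (P e)]

/-- The operators of one edge on the tensor product. -/
def tensorT (T : ∀ e, ∀ v, Matrix (Fin (d v)) (Fin (d v)) (Module.End ℂ (P e)))
    (e : Quiver.Total V) (v : V) :
    Matrix (Fin (d v)) (Fin (d v)) (Module.End ℂ (⨂[ℂ] e, P e)) :=
  (T e v).map (tensorOp P e)

/-- A family of modules over the edge algebras, with operators acting by the R-matrix. -/
structure IsEdgeRep (q : ℂ) (d : V → ℕ)
    (L : ∀ e : Quiver.Total V, EdgeAlg q (d e.right) (d e.left) →ₐ[ℂ] Module.End ℂ (P e))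
    (T T' : ∀ e, ∀ v, Matrix (Fin (d v)) (Fin (d v)) (Module.End ℂ (P e)))
    (vac : ∀ e, P e) : Prop where
  ne_zero : q ≠ 0
  ne : ∀ e : Quiver.Total V, e.right ≠ e.left
  rtt : ∀ e, IsRTT q d (T e) (T' e)
  smash : ∀ e, IsSmashModule q d (T e) (fun k => (edgeGenM q d e.right e.left k).map (L e)) (vac e)
  inv_vac : ∀ e v i j, T' e v i j (vac e) = if i = j then vac e else 0

namespace IsEdgeRep

variable {L : ∀ e : Quiver.Total V, EdgeAlg q (d e.right) (d e.left) →ₐ[ℂ] Module.End ℂ (P e)}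
  {T T' : ∀ e, ∀ v, Matrix (Fin (d v)) (Fin (d v)) (Module.End ℂ (P e))} {vac : ∀ e, P e}

theorem tensor_isRTT (h : IsEdgeRep q d L T T' vac) (e : Quiver.Total V) :
    IsRTT q d (tensorT T e) (tensorT T' e) := (h.rtt e).map (tensorOp P e)

theorem dress_isRTT (h : IsEdgeRep q d L T T' vac) (e : Quiver.Total V) :
    IsRTT q d (dressL (tensorT T) (edgesBefore e)) (dressR (tensorT T') (edgesBefore e)) :=
  isRTT_dress h.tensor_isRTT (fun _ _ hef _ _ => entriesCommute_tensorOp hef _ _)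
    (edgesBefore_nodup e)

theorem dressL_comm (T : ∀ e, ∀ v, Matrix (Fin (d v)) (Fin (d v)) (Module.End ℂ (P e)))
    (e : Quiver.Total V) (v : V) {a b : Type*} [Fintype a] [Fintype b]
    (A : Matrix a b (Module.End ℂ (P e))) :
    EntriesCommute (dressL (tensorT T) (edgesBefore e) v) (A.map (tensorOp P e)) :=
  _root_.dressL_comm fun _ hf => entriesCommute_tensorOp (mem_edgesBefore.1 hf).ne _ _

theorem dressR_comm (T : ∀ e, ∀ v, Matrix (Fin (d v)) (Fin (d v)) (Module.End ℂ (P e)))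
    (e : Quiver.Total V) (v : V) {a b : Type*} [Fintype a] [Fintype b]
    (A : Matrix a b (Module.End ℂ (P e))) :
    EntriesCommute (dressR (tensorT T) (edgesBefore e) v) (A.map (tensorOp P e)) :=
  _root_.dressR_comm fun _ hf => entriesCommute_tensorOp (mem_edgesBefore.1 hf).ne _ _

/-- The dressed action of an edge algebra on the tensor product. -/
def edgeHom (h : IsEdgeRep q d L T T' vac) (e : Quiver.Total V) :
    EdgeAlg q (d e.right) (d e.left) →ₐ[ℂ] Module.End ℂ (⨂[ℂ] e, P e) :=
  edgeLift (E := Module.End ℂ (⨂[ℂ] e, P e)) h.ne_zero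
    ((h.dress_isRTT e).isQMat h.ne_zero (h.ne e)
      (((isQMat_matX h.ne_zero e.right e.left).map (L e)).map (tensorOp P e))
      (fun v => dressL_comm T e v _) (fun v => dressR_comm T' e v _))
    ((h.dress_isRTT e).isQMat h.ne_zero (h.ne e).symm
      (((isQMat_matD h.ne_zero e.right e.left).map (L e)).map (tensorOp P e))
      (fun v => dressL_comm T e v _) (fun v => dressR_comm T' e v _))
    ((h.dress_isRTT e).isWeyl h.ne_zero (h.ne e)
      (((isWeyl_matX_matD h.ne_zero e.right e.left).map (L e)).map (tensorOp P e))
      (fun v => dressL_comm T e v _) (fun v => dressR_comm T' e v _)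
      (fun v => dressL_comm T e v _) (fun v => dressR_comm T' e v _))

theorem edgeHom_edgeGenM (h : IsEdgeRep q d L T T' vac) (e : Quiver.Total V) (k : Bool) :
    (edgeGenM q d e.right e.left k).map (h.edgeHom e) =
      dressL (tensorT T) (edgesBefore e) (cond k e.right e.left) *
        (((edgeGenM q d e.right e.left k).map (L e)).map (tensorOp P e) *
          dressR (tensorT T') (edgesBefore e) (cond k e.left e.right)) := by
  ext1 i j
  cases k
  · exact edgeLift_edgePd ..
  · exact edgeLift_edgeX ..

/-- The homomorphism to the operators on the tensor product. -/
def rep (h : IsEdgeRep q d L T T' vac) : QuiverAlg q d →ₐ[ℂ] Module.End ℂ (⨂[ℂ] e, P e) :=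
  quiverLift h.edgeHom <| by
    have key : ∀ (e f : Quiver.Total V) (k k' : Bool), e < f → IsCross q d
        ((edgeGenM q d e.right e.left k).map (h.edgeHom e))
        ((edgeGenM q d f.right f.left k').map (h.edgeHom f)) := by
      intro e f k k' hef
      rw [h.edgeHom_edgeGenM, h.edgeHom_edgeGenM]
      obtain ⟨l, hl⟩ := edgesBefore_eq_append hef
      rw [hl]
      refine isCross_dress h.ne_zero h.tensor_isRTT
        (fun _ _ hef _ _ => entriesCommute_tensorOp hef _ _)
        (fun _ _ hef _ _ => entriesCommute_tensorOp hef _ _)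
        (fun _ _ hef _ _ => entriesCommute_tensorOp hef _ _)
        (hl ▸ edgesBefore_nodup f) (hl ▸ fun hf => lt_irrefl _ (mem_edgesBefore.1 hf))
        (((h.smash e).smash k).map (tensorOp P e)) (entriesCommute_tensorOp hef.ne _ _)
        (fun _ hg _ => entriesCommute_tensorOp hg _ _)
        (fun _ hg _ => entriesCommute_tensorOp hg _ _)
        (fun _ hg _ => entriesCommute_tensorOp hg _ _)
        (fun _ hg _ => entriesCommute_tensorOp hg _ _)
    rintro ⟨e, k⟩ ⟨f, k'⟩ hef
    have := key e f k k' hef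
    cases k <;> cases k' <;> exact this

theorem rep_edgeIncl (h : IsEdgeRep q d L T T' vac) (e : Quiver.Total V)
    (z : EdgeAlg q (d e.right) (d e.left)) : h.rep (edgeIncl q d e z) = h.edgeHom e z :=
  quiverLift_edgeIncl _ _ _ _

/-- The tensors which are the cyclic vector in the factors before an edge. -/
def vacBefore (vac : ∀ e, P e) (e : Quiver.Total V) : Submodule ℂ (⨂[ℂ] e, P e) :=
  Submodule.span ℂ {z | ∃ y : ∀ e, P e, (∀ f < e, y f = vac f) ∧ z = PiTensorProduct.tprod ℂ y}

theorem tensorOp_mem_vacBefore {e f : Quiver.Total V} (hef : e ≤ f) (g : Module.End ℂ (P f))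
    {z : ⨂[ℂ] e, P e} (hz : z ∈ vacBefore vac e) : tensorOp P f g z ∈ vacBefore vac e := by
  induction hz using Submodule.span_induction with
  | mem z hz =>
    obtain ⟨y, hy, rfl⟩ := hz
    rw [tensorOp_tprod]
    refine Submodule.subset_span ⟨_, fun f' hf' => ?_, rfl⟩
    rw [Function.update_of_ne (hf'.trans_le hef).ne, hy f' hf']
  | zero => rw [map_zero]; exact Submodule.zero_mem _
  | add a b _ _ iha ihb => rw [map_add]; exact Submodule.add_mem _ iha ihb
  | smul c a _ ih => rw [map_smul]; exact Submodule.smul_mem _ _ ih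

theorem tensorT_vacBefore {T : ∀ e, ∀ v, Matrix (Fin (d v)) (Fin (d v)) (Module.End ℂ (P e))}
    (hT : ∀ e v i j, T e v i j (vac e) = if i = j then vac e else 0)
    {e f : Quiver.Total V} (hef : f < e) (v : V) (i j : Fin (d v)) {z : ⨂[ℂ] e, P e}
    (hz : z ∈ vacBefore vac e) : tensorT T f v i j z = if i = j then z else 0 := by
  induction hz using Submodule.span_induction with
  | mem z hz =>
    obtain ⟨y, hy, rfl⟩ := hz
    rw [tensorT, Matrix.map_apply, tensorOp_tprod, hy f hef, hT]
    split_ifs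
    · rw [← hy f hef, Function.update_eq_self]
    · exact (PiTensorProduct.tprod ℂ).map_coord_zero f (by simp)
  | zero => simp
  | add a b _ _ iha ihb => rw [map_add, iha, ihb]; split_ifs <;> simp
  | smul c a _ ih => rw [map_smul, ih]; split_ifs <;> simp

theorem list_prod_vacBefore {T : ∀ e, ∀ v, Matrix (Fin (d v)) (Fin (d v)) (Module.End ℂ (P e))}
    (hT : ∀ e v i j, T e v i j (vac e) = if i = j then vac e else 0)
    {e : Quiver.Total V} (v : V) {z : ⨂[ℂ] e, P e} (hz : z ∈ vacBefore vac e) :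
    ∀ (l : List (Quiver.Total V)), (∀ f ∈ l, f < e) → ∀ (i j : Fin (d v)),
    (l.map fun f => tensorT T f v).prod i j z = if i = j then z else 0
  | [], _, i, j => by
    rw [List.map_nil, List.prod_nil, Matrix.one_apply]
    split_ifs <;> simp
  | f :: l, hl, i, j => by
    rw [List.map_cons, List.prod_cons, Matrix.mul_apply, LinearMap.sum_apply]
    simp only [Module.End.mul_apply,
      list_prod_vacBefore hT v hz l (fun f hf => hl f (by simp [hf])), apply_ite, map_zero,
      Finset.sum_ite_eq', Finset.mem_univ, if_true]
    rw [tensorT_vacBefore hT (hl f (by simp)) v i j hz]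
    split_ifs <;> rfl

/-- As long as the factors before e are still in the vacuum, every dressing operator acts by the
identity matrix, so edge e acts undressed on its own factor. -/
theorem edgeHom_apply_vacBefore (h : IsEdgeRep q d L T T' vac) (e : Quiver.Total V)
    (a : EdgeAlg q (d e.right) (d e.left)) :
    ∀ z ∈ vacBefore vac e, h.edgeHom e a z = tensorOp P e (L e a) z := by
  have ha : a ∈ Algebra.adjoin ℂ {a | ∃ k i j, a = edgeGenM q d e.right e.left k i j} := by
    rw [edgeGenM_adjoin]; trivial
  induction ha using Algebra.adjoin_induction with
  | mem a ha =>
    obtain ⟨k, i, j, rfl⟩ := ha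
    intro z hz
    have := congrFun (congrFun (h.edgeHom_edgeGenM e k) i) j
    rw [Matrix.map_apply] at this
    rw [this, Matrix.mul_apply, LinearMap.sum_apply]
    simp only [Module.End.mul_apply, Matrix.mul_apply, LinearMap.sum_apply]
    have hR : ∀ i j, dressR (tensorT T') (edgesBefore e) (cond k e.left e.right) i j z =
        if i = j then z else 0 :=
      list_prod_vacBefore h.inv_vac _ hz _ fun f hf =>
        mem_edgesBefore.1 (List.mem_reverse.1 hf)
    have hL : ∀ z ∈ vacBefore vac e, ∀ i j,
        dressL (tensorT T) (edgesBefore e) (cond k e.right e.left) i j z =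
        if i = j then z else 0 := fun z hz =>
      list_prod_vacBefore (fun e => (h.smash e).fix_vac) _ hz _ fun f hf => mem_edgesBefore.1 hf
    simp only [hR, apply_ite, map_zero, Finset.sum_ite_eq', Finset.mem_univ, if_true]
    simp only [Matrix.map_apply]
    rw [Finset.sum_eq_single i]
    · rw [hL _ (tensorOp_mem_vacBefore le_rfl _ hz), if_pos rfl]
    · intro b _ hb
      rw [hL _ (tensorOp_mem_vacBefore le_rfl _ hz), if_neg hb.symm]
    · simp
  | algebraMap c => intro z _; simp only [AlgHom.commutes]
  | add a b _ _ iha ihb =>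
    intro z hz
    simp only [map_add, LinearMap.add_apply, iha z hz, ihb z hz]
  | mul a b _ _ iha ihb =>
    intro z hz
    simp only [map_mul, Module.End.mul_apply]
    rw [ihb z hz, iha _ (tensorOp_mem_vacBefore le_rfl _ hz)]

/-- An ordered product of elements of the edge algebras acts on the tensor product of the cyclic
vectors factor by factor. -/
theorem rep_list_prod_vac (h : IsEdgeRep q d L T T' vac)
    (a : ∀ e : Quiver.Total V, EdgeAlg q (d e.right) (d e.left)) :
    h.rep ((Finset.univ.sort (· ≤ ·)).map fun e => edgeIncl q d e (a e)).prod
      (PiTensorProduct.tprod ℂ vac) = PiTensorProduct.tprod ℂ fun e => L e (a e) (vac e) := by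
  -- In an ordered product the later edges act first, so when e acts all factors before e are still
  -- vacua.
  have key : ∀ l : List (Quiver.Total V), l.Pairwise (· < ·) →
      h.rep (l.map fun e => edgeIncl q d e (a e)).prod (PiTensorProduct.tprod ℂ vac) =
        PiTensorProduct.tprod ℂ fun e => if e ∈ l then L e (a e) (vac e) else vac e := by
    intro l hl
    induction l with
    | nil => simp
    | cons e l ih =>
      rw [List.pairwise_cons] at hl
      rw [List.map_cons, List.prod_cons, map_mul, Module.End.mul_apply, ih hl.2, rep_edgeIncl,
        edgeHom_apply_vacBefore, tensorOp_tprod]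
      · congr 1
        ext f
        by_cases hf : f = e
        · subst hf
          have : f ∉ l := fun hf => lt_irrefl _ (hl.1 f hf)
          simp [this]
        · simp [hf]
      · refine Submodule.subset_span ⟨_, fun f hf => ?_, rfl⟩
        rw [if_neg]
        exact fun hf' => lt_asymm hf (hl.1 f hf')
  have := key _ (Finset.sortedLT_sort Finset.univ).pairwise
  simpa using this

end IsEdgeRep

end QuiverRep

/-! ### The ordered multiplication map -/

section OrderedProduct

variable {ε : Type*} [DecidableEq ε] {A : ε → Type*} [∀ e, Ring (A e)] [∀ e, Algebra ℂ (A e)]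
  {B : Type*} [Ring B] [Algebra ℂ B]

theorem list_prod_update (f : ∀ e, A e →ₐ[ℂ] B) {l : List ε} (hl : l.Nodup) (a : ∀ e, A e)
    (e : ε) (he : e ∈ l) : ∃ y z : B, ∀ b : A e,
      (l.map fun i => f i (Function.update a e b i)).prod = y * f e b * z := by
  obtain ⟨l₁, l₂, rfl⟩ := List.mem_iff_append.1 he
  rw [List.nodup_append] at hl
  refine ⟨(l₁.map fun i => f i (a i)).prod, (l₂.map fun i => f i (a i)).prod, fun b => ?_⟩
  have h1 : ∀ i ∈ l₁, f i (Function.update a e b i) = f i (a i) := fun i hi => by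
    rw [Function.update_of_ne (hl.2.2 i hi e (by simp))]
  have h2 : ∀ i ∈ l₂, f i (Function.update a e b i) = f i (a i) := fun i hi => by
    rw [Function.update_of_ne]
    rintro rfl
    exact (List.nodup_cons.1 hl.2.1).1 hi
  rw [List.map_append, List.prod_append, List.map_cons, List.prod_cons, Function.update_self,
    List.map_congr_left h1, List.map_congr_left h2, mul_assoc]

/-- The ordered product of elements of algebras mapped to a common algebra. -/
def orderedProd (f : ∀ e, A e →ₐ[ℂ] B) (l : List ε) (hl : l.Nodup) (hl' : ∀ e, e ∈ l) :
    MultilinearMap ℂ A B :=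
  MultilinearMap.mk' (fun a => (l.map fun i => f i (a i)).prod)
    (fun a e x y => by
      obtain ⟨y, z, h⟩ := list_prod_update f hl a e (hl' e)
      rw [h, h, h, map_add, mul_add, add_mul])
    (fun a e c x => by
      obtain ⟨y, z, h⟩ := list_prod_update f hl a e (hl' e)
      rw [h, h, map_smul, mul_smul_comm, smul_mul_assoc])

end OrderedProduct

/-! ### Bijectivity of ordered multiplication -/

section QuiverBasis

variable {V : Type*} [Quiver V] {q : ℂ} {d : V → ℕ}
  [LinearOrder (Quiver.Total V)]

/-- This is used with J = 0 for injectivity of ordered multiplication and with the ideal of the zero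
fibre for the matrix algebra. -/
theorem isEdgeRep_quot [Fintype (Quiver.Total V)]
    (hq : q ≠ 0) {ℓ : ℕ} (hℓ : ℓ ≠ 0) (hqℓ : q ^ ℓ = 1)
    (hne : ∀ e : Quiver.Total V, e.right ≠ e.left)
    (J : ∀ e : Quiver.Total V, Submodule ℂ (EdgeAlg q (d e.right) (d e.left)))
    (hJ : ∀ e, ∀ a, ∀ y ∈ J e, a * y ∈ J e)
    (hτJ : ∀ e u, ∀ y ∈ J e, ∀ i j, edgeSmash hq d u (hne e) y i j ∈ J e) :
    IsEdgeRep q d (fun e => quotMul (J e) (hJ e))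
      (fun e u => quotOp (J e) (edgeSmash hq d u (hne e)) (hτJ e u))
      (fun e u => Ring.inverse (quotOp (J e) (edgeSmash hq d u (hne e)) (hτJ e u)))
      (fun e => (J e).mkQ 1) := by
  have h : ∀ e : Quiver.Total V, IsSmashModule q d
      (fun u => quotOp (J e) (edgeSmash hq d u (hne e)) (hτJ e u))
      (fun k => (edgeGenM q d e.right e.left k).map (quotMul (J e) (hJ e))) ((J e).mkQ 1) :=
    fun e => isSmashModule_quot (edgeGenM_adjoin q d e.right e.left)
      (fun u => edgeSmash_edgeGenM hq u (hne e)) (hJ e) (hτJ e)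
  exact ⟨hq, hne, fun e => (h e).isRTT hq hℓ hqℓ, h, fun e => (h e).inverse_vac hℓ hqℓ⟩

/-- The span of the entries of the matrix of an arrow. -/
def arrowSpan (q : ℂ) (d : V → ℕ) (a : DArrow V) : Submodule ℂ (QuiverAlg q d) :=
  Submodule.span ℂ (Set.range fun c : Fin (d a.tgt) × Fin (d a.src) =>
    arrowM (edgeIncl q d) a c.1 c.2)

/-- The image of an edge algebra. -/
def edgeRange (q : ℂ) (d : V → ℕ) (e : Quiver.Total V) : Subalgebra ℂ (QuiverAlg q d) :=
  (edgeIncl q d e).range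

theorem arrowM_mem_arrowSpan (a : DArrow V) (i : Fin (d a.tgt)) (j : Fin (d a.src)) :
    arrowM (edgeIncl q d) a i j ∈ arrowSpan q d a :=
  Submodule.subset_span ⟨(i, j), rfl⟩

theorem sum_braidUL'_of_ne {V : Type*} {d : V → ℕ} {M : Type*} [AddCommGroup M] [Module ℂ M]
    {u v : V} (h : u ≠ v) (I : Fin (d u)) (L : Fin (d v)) (f : Fin (d v) → Fin (d u) → M) :
    ∑ L', ∑ I', braidUL' (d := d) q ⟨u, I⟩ ⟨v, L⟩ ⟨v, L'⟩ ⟨u, I'⟩ • f L' I' = f L I := by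
  have : ∀ L' I', braidUL' (d := d) q ⟨u, I⟩ ⟨v, L⟩ ⟨v, L'⟩ ⟨u, I'⟩ =
      if L' = L then (if I' = I then 1 else 0) else 0 := by
    intro L' I'
    simp [braidUL', h, ite_and]
  simp [this, ite_smul]

theorem sum_braidUL'_self {V : Type*} {d : V → ℕ} {M : Type*} [AddCommGroup M] [Module ℂ M]
    {u : V} (I : Fin (d u)) (L : Fin (d u)) (f : Fin (d u) → Fin (d u) → M) :
    ∑ L', ∑ I', braidUL' (d := d) q ⟨u, I⟩ ⟨u, L⟩ ⟨u, L'⟩ ⟨u, I'⟩ • f L' I' =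
      (if I = L then q⁻¹ else 1) • f L I -
        (if I = L then q - q⁻¹ else 0) • ∑ p ∈ Finset.Iio I, f p p := by
  have : ∀ L' I', braidUL' (d := d) q ⟨u, I⟩ ⟨u, L⟩ ⟨u, L'⟩ ⟨u, I'⟩ =
      (if L' = L then (if I' = I then (if I = L then q⁻¹ else 1) else 0) else 0) -
      (if L' = I' then (if I = L then (if I' < I then q - q⁻¹ else 0) else 0) else 0) := by
    intro L' I'
    have h1 : (I = L ∧ L' = I' ∧ I' < I) ↔ (L' = I' ∧ I = L ∧ I' < I) := by tauto
    simp only [braidUL', VIdx.Before, Sigma.mk.injEq, heq_eq_eq, true_and, Fin.val_fin_lt, h1]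
    simp only [ite_and]
  simp only [this, sub_smul, Finset.sum_sub_distrib, ite_smul, zero_smul]
  congr 1
  · simp
  · simp only [Finset.sum_ite_eq, Finset.mem_univ, if_true]
    split_ifs with h
    · rw [Finset.smul_sum, ← Finset.sum_filter, Finset.filter_gt_eq_Iio]
      simp only [Finset.smul_sum, Finset.sum_sub_distrib]
    · simp

/-- The left-hand side of the cross relation is triangular: besides a nonzero multiple of B K L * A
I J it contains only products contracted over indices p < I. Induction on I therefore solves it for
the unordered product. -/
theorem IsCross.mul_mem {V : Type*} {d : V → ℕ} {E : Type*} [Ring E] [Algebra ℂ E]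
    (hq : q ≠ 0) {ta sa tb sb : V} {A : Matrix (Fin (d ta)) (Fin (d sa)) E}
    {B : Matrix (Fin (d tb)) (Fin (d sb)) E} (h : IsCross q d A B) (S : Submodule ℂ E)
    (hS : ∀ I J K L, A I J * B K L ∈ S) (I : Fin (d ta)) (J : Fin (d sa)) (K : Fin (d tb))
    (L : Fin (d sb)) : B K L * A I J ∈ S := by
  have h1 : ∀ I J K L, ∑ L' : Fin (d sb), ∑ I' : Fin (d ta),
      braidUL' (d := d) q ⟨ta, I⟩ ⟨sb, L⟩ ⟨sb, L'⟩ ⟨ta, I'⟩ • (B K L' * A I' J) ∈ S := by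
    intro I J K L
    rw [isCross_iff.1 h]
    exact S.sum_mem fun _ _ => S.sum_mem fun _ _ => S.sum_mem fun _ _ => S.sum_mem fun _ _ =>
      S.sum_mem fun _ _ => S.sum_mem fun _ _ => S.smul_mem _ (hS _ _ _ _)
  by_cases hv : ta = sb
  · subst hv
    have key : ∀ n : ℕ, ∀ I : Fin (d ta), (I : ℕ) = n → ∀ L, B K L * A I J ∈ S := by
      intro n
      induction n using Nat.strong_induction_on with
      | _ n ih =>
        intro I hI L
        have h2 := h1 I J K L
        rw [sum_braidUL'_self I L fun L' I' => B K L' * A I' J] at h2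
        by_cases hIL : I = L
        · rw [if_pos hIL, if_pos hIL] at h2
          have h3 : ∑ p ∈ Finset.Iio I, B K p * A p J ∈ S := S.sum_mem fun p hp =>
            ih p (by rw [← hI]; exact Fin.lt_def.1 (Finset.mem_Iio.1 hp)) p rfl p
          have h4 := S.smul_mem q (S.add_mem h2 (S.smul_mem (q - q⁻¹) h3))
          rwa [sub_add_cancel, smul_smul, mul_inv_cancel₀ hq, one_smul] at h4
        · rwa [if_neg hIL, if_neg hIL, one_smul, zero_smul, sub_zero] at h2
    exact key _ I rfl L
  · have h2 := h1 I J K L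
    rwa [sum_braidUL'_of_ne hv I L fun L' I' => B K L' * A I' J] at h2

theorem arrowM_mul_mem (hq : q ≠ 0) {a b : DArrow V} (hab : a.1 < b.1)
    (I : Fin (d a.tgt)) (J : Fin (d a.src)) (K : Fin (d b.tgt)) (L : Fin (d b.src)) :
    arrowM (edgeIncl q d) b K L * arrowM (edgeIncl q d) a I J ∈
      arrowSpan q d a * arrowSpan q d b :=
  (isCross_edgeIncl hab).mul_mem hq _ (fun _ _ _ _ =>
    Submodule.mul_mem_mul (arrowM_mem_arrowSpan _ _ _) (arrowM_mem_arrowSpan _ _ _)) I J K L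

/-- Exchanging generators of two edges extends to their subalgebras, one side at a time, since the
cross relations are homogeneous. Hence the ordered product of the edge subalgebras absorbs left
multiplication by every generator; it contains 1, so it is everything. -/
theorem edgeIncl_list_prod_surjective [Fintype (Quiver.Total V)] (hq : q ≠ 0) :
    (⊤ : Submodule ℂ (QuiverAlg q d)) ≤
      ((Finset.univ.sort (· ≤ ·)).map fun e => (edgeRange q d e).toSubmodule).prod := by
  have hspan : ∀ a b : DArrow V, a.1 < b.1 →
      arrowSpan q d b * arrowSpan q d a ≤ arrowSpan q d a * arrowSpan q d b := by
    intro a b hab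
    rw [arrowSpan, arrowSpan, Submodule.span_mul_span, Submodule.span_le]
    rintro _ ⟨_, ⟨c, rfl⟩, _, ⟨c', rfl⟩, rfl⟩
    exact arrowM_mul_mem hq hab _ _ _ _
  have hmem : ∀ a : DArrow V, arrowSpan q d a ≤ (edgeRange q d a.1).toSubmodule := by
    rintro ⟨e, k⟩
    rw [arrowSpan, Submodule.span_le]
    rintro _ ⟨c, rfl⟩
    cases k
    · exact ⟨_, rfl⟩
    · exact ⟨_, rfl⟩
  have hadj : ∀ e, edgeRange q d e = Algebra.adjoin ℂ
      {z | ∃ k, z ∈ arrowSpan q d (e, k)} := by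
    intro e
    apply le_antisymm
    · rw [edgeRange, ← Algebra.map_top, ← edgeGenM_adjoin, AlgHom.map_adjoin]
      apply Algebra.adjoin_mono
      rintro _ ⟨_, ⟨k, i, j, rfl⟩, rfl⟩
      refine ⟨k, ?_⟩
      cases k
      · exact arrowM_mem_arrowSpan (q := q) (d := d) (e, false) i j
      · exact arrowM_mem_arrowSpan (q := q) (d := d) (e, true) i j
    · rw [Algebra.adjoin_le_iff]
      rintro z ⟨k, hz⟩
      exact hmem (e, k) hz
  -- The factor of the later edge stays in the span of single generators while an arbitrary element
  -- of the earlier subalgebra passes; this makes an induction on that element possible.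
  have h1 : ∀ (b : DArrow V) (e : Quiver.Total V), e < b.1 →
      arrowSpan q d b * (edgeRange q d e).toSubmodule ≤
        (edgeRange q d e).toSubmodule * arrowSpan q d b := by
    intro b e he
    rw [Submodule.mul_le]
    intro w hw z hz
    revert w
    rw [Subalgebra.mem_toSubmodule, hadj] at hz
    induction hz using Algebra.adjoin_induction with
    | mem z hz =>
      obtain ⟨k, hz⟩ := hz
      intro w hw
      exact mul_le_mul' (hmem (e, k)) le_rfl (hspan (e, k) b he (Submodule.mul_mem_mul hw hz))
    | algebraMap c =>
      intro w hw
      rw [← Algebra.commutes]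
      exact Submodule.mul_mem_mul (Subalgebra.algebraMap_mem _ c) hw
    | add x y _ _ ihx ihy => intro w hw; rw [mul_add]; exact Submodule.add_mem _ (ihx w hw) (ihy w hw)
    | mul x y _ _ ihx ihy =>
      intro w hw
      have hy : ∀ v ∈ (edgeRange q d e).toSubmodule * arrowSpan q d b, v * y ∈
          (edgeRange q d e).toSubmodule * arrowSpan q d b := by
        intro v hv
        refine Submodule.mul_induction_on hv (fun m hm n hn => ?_) (fun m n hm hn => ?_)
        · rw [mul_assoc]
          have := Submodule.mul_mem_mul hm (ihy n hn)
          rwa [← mul_assoc, Subalgebra.isIdempotentElem_toSubmodule] at this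
        · rw [add_mul]; exact Submodule.add_mem _ hm hn
      rw [← mul_assoc]
      exact hy _ (ihx w hw)
  have h2 : ∀ f e : Quiver.Total V, e < f →
      (edgeRange q d f).toSubmodule * (edgeRange q d e).toSubmodule ≤
        (edgeRange q d e).toSubmodule * (edgeRange q d f).toSubmodule := by
    intro f e he
    rw [Submodule.mul_le]
    intro w hw
    rw [Subalgebra.mem_toSubmodule, hadj] at hw
    induction hw using Algebra.adjoin_induction with
    | mem w hw =>
      obtain ⟨k, hw⟩ := hw
      intro z hz
      exact mul_le_mul' le_rfl (hmem (f, k)) (h1 (f, k) e he (Submodule.mul_mem_mul hw hz))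
    | algebraMap c =>
      intro z hz
      rw [Algebra.commutes]
      exact Submodule.mul_mem_mul hz (Subalgebra.algebraMap_mem _ c)
    | add x y _ _ ihx ihy => intro w hw; rw [add_mul]; exact Submodule.add_mem _ (ihx w hw) (ihy w hw)
    | mul x y _ _ ihx ihy =>
      intro z hz
      have hy : ∀ v ∈ (edgeRange q d e).toSubmodule * (edgeRange q d f).toSubmodule, x * v ∈
          (edgeRange q d e).toSubmodule * (edgeRange q d f).toSubmodule := by
        intro v hv
        refine Submodule.mul_induction_on hv (fun m hm n hn => ?_) (fun m n hm hn => ?_)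
        · rw [← mul_assoc]
          have := Submodule.mul_mem_mul (ihx m hm) hn
          rwa [mul_assoc, Subalgebra.isIdempotentElem_toSubmodule] at this
        · rw [mul_add]; exact Submodule.add_mem _ hm hn
      rw [mul_assoc]
      exact hy _ (ihy z hz)
  have h3 : ∀ (f : Quiver.Total V) (l : List (Quiver.Total V)), l.Pairwise (· < ·) → f ∈ l →
      (edgeRange q d f).toSubmodule * (l.map fun e => (edgeRange q d e).toSubmodule).prod ≤
        (l.map fun e => (edgeRange q d e).toSubmodule).prod := by
    intro f l hl hf
    induction l with
    | nil => simp at hf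
    | cons e l ih =>
      rw [List.pairwise_cons] at hl
      rw [List.map_cons, List.prod_cons, ← mul_assoc]
      rcases List.mem_cons.1 hf with rfl | hf
      · rw [Subalgebra.isIdempotentElem_toSubmodule]
      · refine (mul_le_mul' (h2 f e (hl.1 f hf)) le_rfl).trans ?_
        rw [mul_assoc]
        exact mul_le_mul' le_rfl (ih hl.2 hf)
  have h4 : ∀ a : QuiverAlg q d,
      ∀ s ∈ ((Finset.univ.sort (· ≤ ·)).map fun e => (edgeRange q d e).toSubmodule).prod,
      a * s ∈ ((Finset.univ.sort (· ≤ ·)).map fun e => (edgeRange q d e).toSubmodule).prod := by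
    intro a
    obtain ⟨y, rfl⟩ := RingQuot.mkAlgHom_surjective ℂ (QuiverRel q d) a
    induction y using FreeAlgebra.induction with
    | grade0 r =>
      intro s hs
      rw [AlgHom.commutes, ← Algebra.smul_def]
      exact Submodule.smul_mem _ _ hs
    | grade1 g =>
      intro s hs
      refine h3 g.1 _ (Finset.sortedLT_sort Finset.univ).pairwise (by simp)
        (Submodule.mul_mem_mul ?_ hs)
      obtain ⟨e, g⟩ := g
      cases g with
      | x i j => exact ⟨edgeX q i j, edgeIncl_edgeX e i j⟩
      | pd i j => exact ⟨edgePd q i j, edgeIncl_edgePd e i j⟩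
    | mul x y ihx ihy =>
      intro s hs
      rw [map_mul, mul_assoc]
      exact ihx _ (ihy _ hs)
    | add x y ihx ihy =>
      intro s hs
      rw [map_add, add_mul]
      exact Submodule.add_mem _ (ihx _ hs) (ihy _ hs)
  intro a _
  have h5 : ∀ l : List (Quiver.Total V),
      (1 : QuiverAlg q d) ∈ (l.map fun e => (edgeRange q d e).toSubmodule).prod := by
    intro l
    induction l with
    | nil => exact Submodule.one_le.1 le_rfl
    | cons e l ih =>
      rw [List.map_cons, List.prod_cons, ← mul_one (1 : QuiverAlg q d)]
      exact Submodule.mul_mem_mul (Subalgebra.one_mem _) ih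
  have := h4 a 1 (h5 _)
  rwa [mul_one] at this

theorem list_prod_range_le_span {ε : Type*} [DecidableEq ε] {A : ε → Type*} [∀ e, Ring (A e)]
    [∀ e, Algebra ℂ (A e)] {B : Type*} [Ring B] [Algebra ℂ B] (f : ∀ e, A e →ₐ[ℂ] B) :
    ∀ l : List ε, l.Nodup → (l.map fun e => (f e).range.toSubmodule).prod ≤
      Submodule.span ℂ (Set.range fun a : ∀ e, A e => (l.map fun e => f e (a e)).prod)
  | [], _ => by
    rw [List.map_nil, List.prod_nil, Submodule.one_le]
    exact Submodule.subset_span ⟨0, rfl⟩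
  | e :: l, hl => by
    rw [List.map_cons, List.prod_cons, Submodule.mul_le]
    rintro _ ⟨b, rfl⟩ n hn
    replace hn := list_prod_range_le_span f l (List.nodup_cons.1 hl).2 hn
    induction hn using Submodule.span_induction with
    | mem n hn =>
      obtain ⟨a, rfl⟩ := hn
      refine Submodule.subset_span ⟨Function.update a e b, ?_⟩
      have : ∀ i ∈ l, f i (Function.update a e b i) = f i (a i) := by
        intro i hi
        rw [Function.update_of_ne]
        rintro rfl
        exact (List.nodup_cons.1 hl).1 hi
      simp only [List.map_cons, List.prod_cons, Function.update_self]
      rw [List.map_congr_left this]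
      rfl
    | zero => rw [mul_zero]; exact Submodule.zero_mem _
    | add x y _ _ ihx ihy => rw [mul_add]; exact Submodule.add_mem _ ihx ihy
    | smul c x _ ih => rw [mul_smul_comm]; exact Submodule.smul_mem _ _ ih

/-- The ordered multiplication map. -/
def quiverMul (q : ℂ) (d : V → ℕ) [Fintype (Quiver.Total V)] :
    (⨂[ℂ] e : Quiver.Total V, EdgeAlg q (d e.right) (d e.left)) →ₗ[ℂ] QuiverAlg q d :=
  PiTensorProduct.lift (orderedProd (edgeIncl q d) (Finset.univ.sort (· ≤ ·))
    (Finset.sort_nodup _ _) (by simp))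

theorem quiverMul_tprod [Fintype (Quiver.Total V)]
    (a : ∀ e : Quiver.Total V, EdgeAlg q (d e.right) (d e.left)) :
    quiverMul q d (PiTensorProduct.tprod ℂ a) =
      ((Finset.univ.sort (· ≤ ·)).map fun e => edgeIncl q d e (a e)).prod := by
  rw [quiverMul, PiTensorProduct.lift.tprod]
  rfl

theorem quiverMul_surjective [Fintype (Quiver.Total V)] (hq : q ≠ 0) :
    Function.Surjective (quiverMul q d) := by
  rw [← LinearMap.range_eq_top, eq_top_iff]
  refine (edgeIncl_list_prod_surjective hq).trans
    ((list_prod_range_le_span (edgeIncl q d) _ (Finset.sort_nodup _ _)).trans ?_)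
  rw [Submodule.span_le]
  rintro _ ⟨a, rfl⟩
  exact ⟨PiTensorProduct.tprod ℂ a, quiverMul_tprod a⟩

/-- Each edge algebra is taken as a module over itself with vacuum 1. An ordered product applied to
the product of the vacua then returns the tensor of its factors, which gives a left inverse of
multiplication up to an identification. -/
theorem quiverMul_injective [Fintype (Quiver.Total V)] (hq : q ≠ 0) {ℓ : ℕ} (hℓ : ℓ ≠ 0)
    (hqℓ : q ^ ℓ = 1) (hne : ∀ e : Quiver.Total V, e.right ≠ e.left) :
    Function.Injective (quiverMul q d) := by
  have h := isEdgeRep_quot (d := d) hq hℓ hqℓ hne (fun _ => ⊥)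
    (fun e a y hy => by rw [(Submodule.mem_bot ℂ).1 hy, mul_zero]; exact Submodule.zero_mem _)
    (fun e u y hy i j => by
      rw [(Submodule.mem_bot ℂ).1 hy, map_zero]; exact Submodule.zero_mem _)
  let g : (⨂[ℂ] e : Quiver.Total V, EdgeAlg q (d e.right) (d e.left)) ≃ₗ[ℂ] _ :=
    PiTensorProduct.congr fun e => (Submodule.quotEquivOfEqBot
      (⊥ : Submodule ℂ (EdgeAlg q (d e.right) (d e.left))) rfl).symm
  -- The left inverse evaluates the representation at the product of the vacua; g only identifies an
  -- algebra with its quotient by zero.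
  have key : ((LinearMap.applyₗ (PiTensorProduct.tprod ℂ fun e : Quiver.Total V =>
      (⊥ : Submodule ℂ (EdgeAlg q (d e.right) (d e.left))).mkQ 1)) ∘ₗ h.rep.toLinearMap) ∘ₗ
      quiverMul q d = g.toLinearMap := by
    ext a
    simp only [LinearMap.compMultilinearMap_apply, LinearMap.comp_apply, quiverMul_tprod]
    refine (h.rep_list_prod_vac a).trans ?_
    simp only [g, LinearEquiv.coe_coe, PiTensorProduct.congr_tprod, quotMul_mk, mul_one]
    rfl
  have hinj : Function.Injective (((LinearMap.applyₗ (PiTensorProduct.tprod ℂ fun e : Quiver.Total V =>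
      (⊥ : Submodule ℂ (EdgeAlg q (d e.right) (d e.left))).mkQ 1)) ∘ₗ h.rep.toLinearMap) ∘ₗ
      quiverMul q d) := by
    rw [key]; exact g.injective
  rw [LinearMap.coe_comp] at hinj
  exact hinj.of_comp

end QuiverBasis

/-! ### The `ℓ`-th powers of the generators are central -/

section Chain

variable {E : Type*} [Ring E] [Algebra ℂ E] {x y z w : E} {a b c : ℂ}

theorem mul_pow_of_smul_comm (h : y * x = a • (x * y)) (n : ℕ) :
    y * x ^ n = a ^ n • (x ^ n * y) := by
  induction n with
  | zero => simp
  | succ n ih =>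
    rw [pow_succ, ← mul_assoc, ih, smul_mul_assoc, mul_assoc, h, mul_smul_comm, smul_smul,
      ← mul_assoc, ← pow_succ]

theorem commute_pow_of_smul_comm {ℓ : ℕ} (ha : a ^ ℓ = 1) (h : y * x = a • (x * y)) :
    y * x ^ ℓ = x ^ ℓ * y := by
  rw [mul_pow_of_smul_comm h, ha, one_smul]

/-- Moving y and z past x is a triangular substitution with eigenvalues a and b; the coefficient of
z after n + 1 steps is the divided difference of t^(n+1) at a and b. -/
theorem mul_pow_of_chain_two (hab : a ≠ b) (h : y * x = a • (x * y) + z)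
    (hz : z * x = b • (x * z)) (n : ℕ) :
    y * x ^ (n + 1) = a ^ (n + 1) • (x ^ (n + 1) * y) +
      ((a ^ (n + 1) - b ^ (n + 1)) / (a - b)) • (x ^ n * z) := by
  have hab' := sub_ne_zero.2 hab
  induction n with
  | zero => simp [h, div_self hab']
  | succ n ih =>
    rw [pow_succ x (n + 1), ← mul_assoc, ih, add_mul, smul_mul_assoc, smul_mul_assoc, mul_assoc, h,
      mul_assoc, hz, mul_add, mul_smul_comm, mul_smul_comm, ← mul_assoc, ← mul_assoc, ← pow_succ, ← pow_succ]
    match_scalars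
    · ring
    · field_simp
      ring

theorem commute_pow_of_chain_two {ℓ : ℕ} (hℓ : ℓ ≠ 0) (hab : a ≠ b) (ha : a ^ ℓ = 1) (hb : b ^ ℓ = 1)
    (h : y * x = a • (x * y) + z) (hz : z * x = b • (x * z)) : y * x ^ ℓ = x ^ ℓ * y := by
  obtain ⟨n, rfl⟩ := Nat.exists_eq_succ_of_ne_zero hℓ
  rw [Nat.succ_eq_add_one] at *
  rw [mul_pow_of_chain_two hab h hz, ha, hb]
  simp

/-- The coefficient of w is the divided difference of t^(n+2) at a, b, c. At exponent ℓ the function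
t^ℓ takes the value 1 at all three points, so this and the coefficient of z vanish. -/
theorem mul_pow_of_chain_three (hab : a ≠ b) (hac : a ≠ c) (hbc : b ≠ c)
    (h : y * x = a • (x * y) + z) (hz : z * x = b • (x * z) + w) (hw : w * x = c • (x * w)) (n : ℕ) :
    y * x ^ (n + 2) = a ^ (n + 2) • (x ^ (n + 2) * y) +
      ((a ^ (n + 2) - b ^ (n + 2)) / (a - b)) • (x ^ (n + 1) * z) +
      (a ^ (n + 2) / ((a - b) * (a - c)) + b ^ (n + 2) / ((b - a) * (b - c)) +
        c ^ (n + 2) / ((c - a) * (c - b))) • (x ^ n * w) := by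
  have h1 := sub_ne_zero.2 hab
  have h2 := sub_ne_zero.2 hac
  have h3 := sub_ne_zero.2 hbc
  have h1' := sub_ne_zero.2 hab.symm
  have h2' := sub_ne_zero.2 hac.symm
  have h3' := sub_ne_zero.2 hbc.symm
  have e1 : b - a = -(a - b) := by ring
  have e2 : c - a = -(a - c) := by ring
  have e3 : c - b = -(b - c) := by ring
  induction n with
  | zero =>
    simp only [zero_add, pow_two, pow_one, pow_zero, one_mul]
    rw [← mul_assoc, h, add_mul, smul_mul_assoc, mul_assoc, h, hz, mul_add, mul_smul_comm,
      ← mul_assoc]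
    match_scalars
    · ring
    · field_simp
      ring
    · rw [e1, e2, e3]
      field_simp
      ring
  | succ n ih =>
    rw [pow_succ x (n + 2), ← mul_assoc, ih, add_mul, add_mul, smul_mul_assoc, smul_mul_assoc,
      smul_mul_assoc, mul_assoc, h, mul_assoc, hz, mul_assoc, hw, mul_add, mul_add, mul_smul_comm,
      mul_smul_comm, mul_smul_comm, ← mul_assoc, ← mul_assoc, ← mul_assoc, ← pow_succ, ← pow_succ,
      ← pow_succ]
    match_scalars
    · ring
    · field_simp
      ring
    · rw [e1, e2, e3]
      field_simp
      ring

theorem commute_pow_of_chain_three {ℓ : ℕ} (hℓ : 1 < ℓ) (hab : a ≠ b) (hac : a ≠ c) (hbc : b ≠ c)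
    (ha : a ^ ℓ = 1) (hb : b ^ ℓ = 1) (hc : c ^ ℓ = 1)
    (h : y * x = a • (x * y) + z) (hz : z * x = b • (x * z) + w) (hw : w * x = c • (x * w)) :
    y * x ^ ℓ = x ^ ℓ * y := by
  obtain ⟨n, rfl⟩ : ∃ n, ℓ = n + 2 := ⟨ℓ - 2, by omega⟩
  rw [mul_pow_of_chain_three hab hac hbc h hz hw, ha, hb, hc]
  have h1 := sub_ne_zero.2 hab
  have h2 := sub_ne_zero.2 hac
  have h3 := sub_ne_zero.2 hbc
  have e1 : b - a = -(a - b) := by ring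
  have e2 : c - a = -(a - c) := by ring
  have e3 : c - b = -(b - c) := by ring
  have : 1 / ((a - b) * (a - c)) + 1 / ((b - a) * (b - c)) + 1 / ((c - a) * (c - b)) = 0 := by
    rw [e1, e2, e3]
    field_simp
    ring
  rw [this]
  simp

end Chain

/-! ### Centrality of the ℓ-th powers -/

section Central

variable {q : ℂ} {M N : ℕ}

/-- The dimension vector of two vertices. -/
abbrev pairDim (M N : ℕ) : Bool → ℕ := fun b => cond b M N

theorem isQMat_op {V : Type*} {d : V → ℕ} {E : Type*} [Ring E] [Algebra ℂ E] {t s : V}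
    {D : Matrix (Fin (d s)) (Fin (d t)) E} (hD : IsQMat q d D) :
    IsQMat q d (fun (i : Fin (d t)) (m : Fin (d s)) => MulOpposite.op (D m i)) := by
  refine isQMat_iff.2 fun i j m n => ?_
  have := congrArg MulOpposite.op (isQMat_iff.1 hD m n i j).symm
  simpa only [MulOpposite.op_add, MulOpposite.op_smul, MulOpposite.op_mul] using this

/-- Transposing and reversing products turns the relation between D and X into itself with D and X
exchanged. This symmetry allows the statements on powers of derivations to be deduced from those on
coordinates. -/
theorem isWeyl_op {V : Type*} {d : V → ℕ} {E : Type*} [Ring E] [Algebra ℂ E] {t s : V}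
    {X : Matrix (Fin (d t)) (Fin (d s)) E} {D : Matrix (Fin (d s)) (Fin (d t)) E}
    (h : IsWeyl q d X D) :
    IsWeyl q d (fun (i : Fin (d t)) (m : Fin (d s)) => MulOpposite.op (D m i))
      (fun (m : Fin (d s)) (i : Fin (d t)) => MulOpposite.op (X i m)) := by
  refine isWeyl_iff.2 fun i j m n => ?_
  apply MulOpposite.unop_injective
  have := isWeyl_iff.1 h n m j i
  simp only [MulOpposite.unop_add, MulOpposite.unop_sub, MulOpposite.unop_smul,
    MulOpposite.unop_mul, MulOpposite.unop_op, Finset.unop_sum]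
  rw [apply_ite MulOpposite.unop, MulOpposite.unop_one, MulOpposite.unop_zero]
  by_cases hin : i = n <;> by_cases hjm : j = m
  · subst hin hjm; simpa using this
  · subst hin; simpa [hjm, Ne.symm hjm] using this
  · subst hjm; simpa [hin, Ne.symm hin] using this
  · simpa [hjm, Ne.symm hjm, hin, Ne.symm hin] using this

/-- The anti-automorphism which exchanges coordinates and derivations. -/
def edgeAnti (hq : q ≠ 0) (M N : ℕ) : EdgeAlg q M N →ₐ[ℂ] (EdgeAlg q M N)ᵐᵒᵖ :=
  edgeLift (d := pairDim M N) (t := true) (s := false) hq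
    (isQMat_op (isQMat_matD (d := pairDim M N) hq true false))
    (isQMat_op (isQMat_matX (d := pairDim M N) hq true false))
    (isWeyl_op (isWeyl_matX_matD (d := pairDim M N) hq true false))

theorem edgeAnti_edgeX (hq : q ≠ 0) (i : Fin M) (j : Fin N) :
    edgeAnti hq M N (edgeX q i j) = MulOpposite.op (edgePd q i j) :=
  edgeLift_edgeX (d := pairDim M N) (t := true) (s := false) ..

theorem edgeAnti_edgePd (hq : q ≠ 0) (i : Fin M) (j : Fin N) :
    edgeAnti hq M N (edgePd q i j) = MulOpposite.op (edgeX q i j) :=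
  edgeLift_edgePd (d := pairDim M N) (t := true) (s := false) ..

/-- Two coordinates either commute up to a power of q or form a two-step chain with eigenvalues 1
and q² or q⁻², which differ because ℓ is odd. -/
theorem edgeX_pow_comm_edgeX {ℓ : ℕ} (hℓ : 1 < ℓ) (hodd : Odd ℓ) (hq : IsPrimitiveRoot q ℓ)
    (i j : Fin M) (n m : Fin N) :
    edgeX q i m * edgeX q j n ^ ℓ = edgeX q j n ^ ℓ * edgeX q i m := by
  have hq0 : q ≠ 0 := hq.ne_zero (by omega)
  have hqℓ := hq.pow_eq_one
  have hq2 : q ^ 2 ≠ 1 := hq.pow_ne_one_of_pos_of_lt (by omega) (by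
    rcases hodd with ⟨k, rfl⟩; omega)
  rcases lt_trichotomy i j with hij | rfl | hij
  · have e := edge_xx q j i n m hij
    rcases lt_trichotomy n m with hnm | rfl | hnm
    · rw [if_neg hnm.ne, if_pos hnm, one_smul] at e
      refine commute_pow_of_chain_two (a := 1) (b := (q ^ 2)⁻¹)
        (z := -(q - q⁻¹) • (edgeX q i n * edgeX q j m)) (by omega) ?_ (one_pow _) ?_ ?_ ?_
      · intro h; rw [eq_comm, inv_eq_one] at h; exact hq2 h
      · rw [inv_pow, ← pow_mul, mul_comm, pow_mul, hqℓ, one_pow, inv_one]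
      · rw [e]; module
      · rw [smul_mul_assoc, mul_assoc, edge_xx_same q j m n hnm, mul_smul_comm, ← mul_assoc]
        have e2 := edge_xx q j i n n hij
        rw [if_pos rfl, if_neg (lt_irrefl _), zero_smul, add_zero] at e2
        rw [mul_smul_comm, ← mul_assoc, e2, smul_mul_assoc]
        match_scalars
        field_simp
    · rw [if_pos rfl, if_neg (lt_irrefl _), zero_smul, add_zero] at e
      refine commute_pow_of_smul_comm (a := q⁻¹) (by rw [inv_pow, hqℓ, inv_one]) ?_
      rw [e, smul_smul, inv_mul_cancel₀ hq0, one_smul]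
    · rw [if_neg hnm.ne', if_neg hnm.not_gt, zero_smul, add_zero, one_smul] at e
      exact commute_pow_of_smul_comm (a := 1) (one_pow _) (by rw [one_smul, e])
  · rcases lt_trichotomy n m with hnm | rfl | hnm
    · exact commute_pow_of_smul_comm (a := q⁻¹) (by rw [inv_pow, hqℓ, inv_one])
        (edge_xx_same q i m n hnm)
    · rw [← pow_succ, ← pow_succ']
    · refine commute_pow_of_smul_comm (a := q) hqℓ ?_
      rw [edge_xx_same q i n m hnm, smul_smul, mul_inv_cancel₀ hq0, one_smul]
  · have e := edge_xx q i j m n hij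
    rcases lt_trichotomy m n with hnm | rfl | hnm
    · rw [if_neg hnm.ne, if_pos hnm, one_smul] at e
      refine commute_pow_of_chain_two (a := 1) (b := q ^ 2)
        (z := (q - q⁻¹) • (edgeX q j m * edgeX q i n)) (by omega) hq2.symm (one_pow _)
        (by rw [← pow_mul, mul_comm, pow_mul, hqℓ, one_pow]) (by rw [e, one_smul]) ?_
      have e2 := edge_xx q i j n n hij
      rw [if_pos rfl, if_neg (lt_irrefl _), zero_smul, add_zero] at e2
      have e3 : edgeX q j m * edgeX q j n = q • (edgeX q j n * edgeX q j m) := by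
        rw [edge_xx_same q j n m hnm, smul_smul, mul_inv_cancel₀ hq0, one_smul]
      rw [smul_mul_assoc, mul_assoc, e2, mul_smul_comm, ← mul_assoc, e3, smul_mul_assoc,
        mul_smul_comm, mul_assoc]
      match_scalars
      ring
    · rw [if_pos rfl, if_neg (lt_irrefl _), zero_smul, add_zero] at e
      exact commute_pow_of_smul_comm hqℓ e
    · rw [if_neg hnm.ne', if_neg hnm.not_gt, zero_smul, add_zero, one_smul] at e
      exact commute_pow_of_smul_comm (a := 1) (one_pow _) (by rw [one_smul, e])

/-- The relation is a plain commutation when neither index matches, a two-step chain with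
eigenvalues q and q⁻¹ when exactly one does, and a three-step chain with eigenvalues q², 1, q⁻² when
both do. -/
theorem edgeX_pow_comm_edgePd {ℓ : ℕ} (hℓ : 1 < ℓ) (hodd : Odd ℓ) (hq : IsPrimitiveRoot q ℓ)
    (m j : Fin M) (i n : Fin N) :
    edgePd q m i * edgeX q j n ^ ℓ = edgeX q j n ^ ℓ * edgePd q m i := by
  have hq0 : q ≠ 0 := hq.ne_zero (by omega)
  have hqℓ := hq.pow_eq_one
  have hqi : q⁻¹ ^ ℓ = 1 := by rw [inv_pow, hqℓ, inv_one]
  have hq2 : q ^ 2 ≠ 1 := hq.pow_ne_one_of_pos_of_lt (by omega) (by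
    rcases hodd with ⟨k, rfl⟩; omega)
  have hqq : q ≠ q⁻¹ := by
    intro h; apply hq2; rw [pow_two]; nth_rewrite 2 [h]; exact mul_inv_cancel₀ hq0
  have e := edge_dx q i n j m
  have hrow : ∀ p, n < p → edgeX q j p * edgeX q j n = q⁻¹ • (edgeX q j n * edgeX q j p) :=
    fun p hp => edge_xx_same q j p n hp
  have hcol : ∀ p, p < j → edgeX q p n * edgeX q j n = q⁻¹ • (edgeX q j n * edgeX q p n) := by
    intro p hp
    have e2 := edge_xx q j p n n hp
    rw [if_pos rfl, if_neg (lt_irrefl _), zero_smul, add_zero] at e2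
    rw [e2, smul_smul, inv_mul_cancel₀ hq0, one_smul]
  have hfar : ∀ r p, r ≠ j → p ≠ n → edgePd q r p * edgeX q j n = edgeX q j n * edgePd q r p := by
    intro r p hr hp
    have := edge_dx q p n j r
    simpa [hr.symm, hp] using this
  by_cases hin : i = n <;> by_cases hjm : j = m
  · subst hin hjm
    set x := edgeX q j i with hx
    set u := ∑ p ∈ Finset.Ioi i, edgeX q j p * edgePd q j p with hu
    set v := ∑ p ∈ Finset.Iio j, edgePd q p i * edgeX q p i with hv
    -- The correction sums u and v of the relation both commute with x up to this double sum, which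
    -- itself commutes with x up to q⁻²; the chain closes here.
    set S := ∑ p ∈ Finset.Ioi i, ∑ r ∈ Finset.Iio j, edgeX q j p * (edgePd q r p * edgeX q r i)
      with hS
    have hux : u * x = x * u + (q ^ 2 - 1) • S := by
      rw [hu, hS, Finset.sum_mul, Finset.mul_sum, Finset.smul_sum, ← Finset.sum_add_distrib]
      refine Finset.sum_congr rfl fun p hp => ?_
      rw [Finset.mem_Ioi] at hp
      have e2 := edge_dx q p i j j
      rw [if_neg hp.ne', if_pos rfl, if_neg hp.ne', if_pos rfl, if_neg (fun h => hp.ne' h.1), one_mul,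
        zero_smul, zero_smul, add_zero, add_zero] at e2
      rw [mul_assoc, e2, mul_add, mul_smul_comm, ← mul_assoc, hrow p hp, smul_mul_assoc, smul_smul,
        mul_inv_cancel₀ hq0, one_smul, mul_assoc, mul_smul_comm, Finset.mul_sum]
    have hvx : v * x = x * v + (1 - (q ^ 2)⁻¹) • S := by
      rw [hv, hS, Finset.sum_mul, Finset.mul_sum, Finset.sum_comm, Finset.smul_sum,
        ← Finset.sum_add_distrib]
      refine Finset.sum_congr rfl fun r hr => ?_
      rw [Finset.mem_Iio] at hr
      have e2 := edge_dx q i i j r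
      rw [if_pos rfl, if_neg hr.ne', if_pos rfl, if_neg hr.ne', if_neg (fun h => hr.ne' h.2), mul_one,
        one_mul, zero_smul, zero_smul, add_zero, add_zero] at e2
      rw [mul_assoc, hcol r hr, mul_smul_comm, ← mul_assoc, e2, add_mul, smul_mul_assoc,
        smul_mul_assoc, Finset.sum_mul, mul_assoc, smul_add, smul_smul, inv_mul_cancel₀ hq0, one_smul,
        smul_smul]
      congr 1
      rw [show q⁻¹ * (q - q⁻¹) = 1 - (q ^ 2)⁻¹ by field_simp]
      simp only [mul_assoc]
    have hSx : S * x = (q ^ 2)⁻¹ • (x * S) := by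
      rw [hS, Finset.sum_mul, Finset.mul_sum, Finset.smul_sum]
      refine Finset.sum_congr rfl fun p hp => ?_
      rw [Finset.sum_mul, Finset.mul_sum, Finset.smul_sum]
      refine Finset.sum_congr rfl fun r hr => ?_
      rw [Finset.mem_Ioi] at hp
      rw [Finset.mem_Iio] at hr
      rw [mul_assoc, mul_assoc, hcol r hr, mul_smul_comm, ← mul_assoc (edgePd q r p),
        hfar r p hr.ne hp.ne', mul_assoc x, mul_smul_comm, ← mul_assoc, hrow p hp, smul_mul_assoc,
        mul_assoc, smul_smul]
      congr 1
      field_simp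
    -- The coefficient of S in w collects (q² − 1)² from u and (q² − 1)(1 − q⁻²) from v. The
    -- eigenvalues are distinct since ℓ > 1 divides neither 2 nor 4.
    refine commute_pow_of_chain_three (a := q ^ 2) (b := 1) (c := (q ^ 2)⁻¹)
      (z := (q ^ 2 - 1) • u + (q ^ 2 - 1) • v + q • 1)
      (w := ((q ^ 2 - 1) * (q ^ 2 - (q ^ 2)⁻¹)) • S) hℓ hq2 ?_ ?_ ?_ (one_pow _) ?_ ?_ ?_ ?_
    · intro h
      have h4 : q ^ 4 = 1 := by
        rw [show q ^ 4 = q ^ 2 * q ^ 2 by ring]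
        nth_rewrite 2 [h]
        exact mul_inv_cancel₀ (pow_ne_zero _ hq0)
      have := (hq.pow_eq_one_iff_dvd 4).1 h4
      have h2 : ℓ ∣ 1 := by
        have hc : Nat.Coprime ℓ 4 := by
          rw [show 4 = 2 ^ 2 by rfl]
          exact (Nat.Coprime.pow_right 2 hodd.coprime_two_right)
        exact hc.dvd_of_dvd_mul_right (by simpa using this)
      exact absurd (Nat.le_of_dvd one_pos h2) (by omega)
    · intro h; rw [eq_comm, inv_eq_one] at h; exact hq2 h
    · rw [← pow_mul, mul_comm, pow_mul, hqℓ, one_pow]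
    · rw [inv_pow, ← pow_mul, mul_comm, pow_mul, hqℓ, one_pow, inv_one]
    · rw [e]
      simp only [if_true, and_self]
      match_scalars <;> field_simp
    · rw [add_mul, add_mul, smul_mul_assoc, smul_mul_assoc, hux, hvx, mul_add, mul_add,
        mul_smul_comm, mul_smul_comm, mul_smul_comm, smul_mul_assoc, mul_one, one_mul]
      match_scalars <;> field_simp <;> ring
    · rw [smul_mul_assoc, hSx, mul_smul_comm, smul_comm]
  · subst hin
    refine commute_pow_of_chain_two (a := q) (b := q⁻¹)
      (z := (q - q⁻¹) • ∑ p ∈ Finset.Ioi i, edgeX q j p * edgePd q m p) (by omega) hqq hqℓ hqi ?_ ?_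
    · simpa [hjm] using e
    · rw [smul_mul_assoc, mul_smul_comm, smul_comm q⁻¹, Finset.sum_mul, Finset.mul_sum,
        Finset.smul_sum (r := q⁻¹)]
      congr 1
      refine Finset.sum_congr rfl fun p hp => ?_
      rw [Finset.mem_Ioi] at hp
      rw [mul_assoc, hfar m p (Ne.symm hjm) hp.ne', ← mul_assoc, hrow p hp, smul_mul_assoc, mul_assoc]
  · subst hjm
    refine commute_pow_of_chain_two (a := q) (b := q⁻¹)
      (z := (q ^ 2 - 1) • ∑ p ∈ Finset.Iio j, edgePd q p i * edgeX q p n) (by omega) hqq hqℓ hqi ?_ ?_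
    · simpa [hin] using e
    · rw [smul_mul_assoc, mul_smul_comm, smul_comm q⁻¹, Finset.sum_mul, Finset.mul_sum,
        Finset.smul_sum (r := q⁻¹)]
      congr 1
      refine Finset.sum_congr rfl fun p hp => ?_
      rw [Finset.mem_Iio] at hp
      rw [mul_assoc, hcol p hp, mul_smul_comm, ← mul_assoc, hfar p i hp.ne hin, mul_assoc]
  · exact commute_pow_of_smul_comm (a := 1) (one_pow _)
      (by rw [hfar m i (Ne.symm hjm) hin, one_smul])

theorem edgeAlg_commute_of_generators {z : EdgeAlg q M N}
    (hX : ∀ i j, edgeX q i j * z = z * edgeX q i j)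
    (hD : ∀ i j, edgePd q i j * z = z * edgePd q i j) (a : EdgeAlg q M N) : a * z = z * a := by
  have ha : a ∈ Algebra.adjoin ℂ (Set.range (fun c : Fin M × Fin N => edgeX q c.1 c.2) ∪
      Set.range (fun c : Fin M × Fin N => edgePd q c.1 c.2)) := by
    rw [edgeAlg_adjoin]; trivial
  induction ha using Algebra.adjoin_induction with
  | mem a ha =>
    rcases ha with ⟨c, rfl⟩ | ⟨c, rfl⟩
    · exact hX _ _
    · exact hD _ _
  | algebraMap c => exact Algebra.commutes c z
  | add a b _ _ iha ihb => rw [add_mul, mul_add, iha, ihb]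
  | mul a b _ _ iha ihb => rw [mul_assoc, ihb, ← mul_assoc, iha, mul_assoc]

theorem edgeX_pow_comm {ℓ : ℕ} (hℓ : 1 < ℓ) (hodd : Odd ℓ) (hq : IsPrimitiveRoot q ℓ)
    (i : Fin M) (j : Fin N) (a : EdgeAlg q M N) : a * edgeX q i j ^ ℓ = edgeX q i j ^ ℓ * a :=
  edgeAlg_commute_of_generators (fun _ _ => edgeX_pow_comm_edgeX hℓ hodd hq _ _ _ _)
    (fun _ _ => edgeX_pow_comm_edgePd hℓ hodd hq _ _ _ _) a

/-- The anti-automorphism exchanging coordinates and derivations transports the statement for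
coordinates. -/
theorem edgePd_pow_comm {ℓ : ℕ} (hℓ : 1 < ℓ) (hodd : Odd ℓ) (hq : IsPrimitiveRoot q ℓ)
    (i : Fin M) (j : Fin N) (a : EdgeAlg q M N) : a * edgePd q i j ^ ℓ = edgePd q i j ^ ℓ * a := by
  have hq0 : q ≠ 0 := hq.ne_zero (by omega)
  refine edgeAlg_commute_of_generators (fun k l => ?_) (fun k l => ?_) a
  · have := congrArg (fun z => (edgeAnti hq0 M N z).unop) (edgeX_pow_comm hℓ hodd hq i j (edgePd q k l))
    simpa only [map_mul, map_pow, edgeAnti_edgeX, edgeAnti_edgePd, MulOpposite.unop_mul,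
      MulOpposite.unop_pow, MulOpposite.unop_op, eq_comm] using this.symm
  · have := congrArg (fun z => (edgeAnti hq0 M N z).unop) (edgeX_pow_comm hℓ hodd hq i j (edgeX q k l))
    simpa only [map_mul, map_pow, edgeAnti_edgeX, edgeAnti_edgePd, MulOpposite.unop_mul,
      MulOpposite.unop_pow, MulOpposite.unop_op, eq_comm] using this.symm

theorem edgeZ_le_center {ℓ : ℕ} (hℓ : 1 < ℓ) (hodd : Odd ℓ) (hq : IsPrimitiveRoot q ℓ)
    (M N : ℕ) : edgeZ q ℓ M N ≤ Subalgebra.center ℂ (EdgeAlg q M N) := by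
  rw [edgeZ, Algebra.adjoin_le_iff]
  rintro z ⟨i, j, rfl | rfl⟩
  · exact Subalgebra.mem_center_iff.2 fun a => edgeX_pow_comm hℓ hodd hq i j a
  · exact Subalgebra.mem_center_iff.2 fun a => edgePd_pow_comm hℓ hodd hq i j a

end Central

/-! ### Ordered monomials span the edge algebra -/

section Straighten

open Algebra Subalgebra

variable {A : Type*} [Ring A] [Algebra ℂ A]

theorem mul_list_prod_le {ι : Type*} (S : ι → Subalgebra ℂ A) {l : List ι}
    (h : l.Pairwise fun a b => toSubmodule (S b) * toSubmodule (S a) ≤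
      toSubmodule (S a) * toSubmodule (S b)) {i : ι} (hi : i ∈ l) :
    toSubmodule (S i) * (l.map fun a => toSubmodule (S a)).prod ≤
      (l.map fun a => toSubmodule (S a)).prod := by
  induction l with
  | nil => simp at hi
  | cons a l ih =>
    rw [List.pairwise_cons] at h
    rw [List.map_cons, List.prod_cons, ← mul_assoc]
    rcases List.mem_cons.1 hi with rfl | hi
    · rw [(Subalgebra.isIdempotentElem_toSubmodule _).eq]
    · exact (mul_le_mul' (h.1 i hi) le_rfl).trans
        ((mul_assoc _ _ _).le.trans (mul_le_mul' le_rfl (ih h.2 hi)))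

theorem one_mem_list_prod {ι : Type*} (S : ι → Subalgebra ℂ A) (l : List ι) :
    (1 : A) ∈ (l.map fun a => toSubmodule (S a)).prod := by
  induction l with
  | nil => exact Submodule.one_le.1 le_rfl
  | cons a l ih =>
    rw [List.map_cons, List.prod_cons, ← mul_one (1 : A)]
    exact Submodule.mul_mem_mul (one_mem (S a)) ih

/-- If every later subalgebra can be moved to the left across the earlier ones, the ordered product
of the subalgebras absorbs left multiplication by all generators, and it contains 1. -/
theorem adjoin_le_list_prod {ι : Type*} (S : ι → Subalgebra ℂ A) {l : List ι}
    (h : l.Pairwise fun a b => toSubmodule (S b) * toSubmodule (S a) ≤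
      toSubmodule (S a) * toSubmodule (S b)) {G : Set A} (hG : ∀ g ∈ G, ∃ i ∈ l, g ∈ S i) :
    toSubmodule (adjoin ℂ G) ≤ (l.map fun a => toSubmodule (S a)).prod := by
  intro x hx
  have key : ∀ y ∈ (l.map fun a => toSubmodule (S a)).prod,
      x * y ∈ (l.map fun a => toSubmodule (S a)).prod := by
    induction hx using Algebra.adjoin_induction with
    | mem x hx =>
      obtain ⟨i, hi, hxi⟩ := hG x hx
      exact fun y hy => mul_list_prod_le S h hi (Submodule.mul_mem_mul hxi hy)
    | algebraMap c =>
      intro y hy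
      rw [← Algebra.smul_def]
      exact Submodule.smul_mem _ _ hy
    | add a b _ _ iha ihb =>
      intro y hy
      rw [add_mul]
      exact Submodule.add_mem _ (iha y hy) (ihb y hy)
    | mul a b _ _ iha ihb =>
      intro y hy
      rw [mul_assoc]
      exact iha _ (ihb y hy)
  simpa using key 1 (one_mem_list_prod S l)

/-- The space W is an intermediate piece which keeps the right factor under control while a
generator passes. It may be larger than the span of H, for example contain 1, so inhomogeneous
relations are covered. -/
theorem adjoin_mul_adjoin_le {G H : Set A} {W : Submodule ℂ A} (hH : H ⊆ W)
    (hW : W ≤ toSubmodule (adjoin ℂ H))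
    (h : ∀ w ∈ W, ∀ g ∈ G, w * g ∈ toSubmodule (adjoin ℂ G) * W) :
    toSubmodule (adjoin ℂ H) * toSubmodule (adjoin ℂ G) ≤
      toSubmodule (adjoin ℂ G) * toSubmodule (adjoin ℂ H) := by
  have h1 : W * toSubmodule (adjoin ℂ G) ≤ toSubmodule (adjoin ℂ G) * W := by
    refine Submodule.mul_le.2 fun w hw g hg => ?_
    revert w
    change g ∈ adjoin ℂ G at hg
    induction hg using Algebra.adjoin_induction with
    | mem g hg => exact fun w hw => h w hw g hg
    | algebraMap c =>
      intro w hw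
      rw [← Algebra.commutes]
      exact Submodule.mul_mem_mul (Subalgebra.algebraMap_mem _ c) hw
    | add a b _ _ iha ihb =>
      intro w hw
      rw [mul_add]
      exact Submodule.add_mem _ (iha w hw) (ihb w hw)
    | mul a b _ _ iha ihb =>
      intro w hw
      rw [← mul_assoc]
      refine Submodule.mul_induction_on (iha w hw) (fun m hm w' hw' => ?_) (fun x y hx hy => ?_)
      · rw [mul_assoc]
        have := Submodule.mul_mem_mul hm (ihb w' hw')
        rwa [← mul_assoc, (Subalgebra.isIdempotentElem_toSubmodule _).eq] at this
      · rw [add_mul]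
        exact Submodule.add_mem _ hx hy
  refine Submodule.mul_le.2 fun a ha g hg => ?_
  revert g
  change a ∈ adjoin ℂ H at ha
  induction ha using Algebra.adjoin_induction with
  | mem a ha =>
    exact fun g hg => mul_le_mul' le_rfl hW (h1 (Submodule.mul_mem_mul (hH ha) hg))
  | algebraMap c =>
    intro g hg
    rw [Algebra.commutes]
    exact Submodule.mul_mem_mul hg (Subalgebra.algebraMap_mem _ c)
  | add a b _ _ iha ihb =>
    intro g hg
    rw [add_mul]
    exact Submodule.add_mem _ (iha g hg) (ihb g hg)
  | mul a b _ _ iha ihb =>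
    intro g hg
    rw [mul_assoc]
    refine Submodule.mul_induction_on (ihb g hg) (fun m hm w hw => ?_) (fun x y hx hy => ?_)
    · rw [← mul_assoc]
      have := Submodule.mul_mem_mul (iha m hm) hw
      rwa [mul_assoc, (Subalgebra.isIdempotentElem_toSubmodule _).eq] at this
    · rw [mul_add]
      exact Submodule.add_mem _ hx hy

theorem adjoin_singleton_mul_le {x y : A} {a : ℂ} (h : x * y = a • (y * x)) :
    toSubmodule (adjoin ℂ {x}) * toSubmodule (adjoin ℂ {y}) ≤
      toSubmodule (adjoin ℂ {y}) * toSubmodule (adjoin ℂ {x}) := by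
  refine adjoin_mul_adjoin_le (W := Submodule.span ℂ {x}) Submodule.subset_span
    (Algebra.span_le_adjoin ℂ _) ?_
  rintro w hw _ rfl
  obtain ⟨b, rfl⟩ := Submodule.mem_span_singleton.1 hw
  rw [smul_mul_assoc, h]
  exact Submodule.smul_mem _ _ (Submodule.smul_mem _ _ (Submodule.mul_mem_mul
    (Algebra.subset_adjoin rfl) (Submodule.mem_span_singleton_self _)))

theorem adjoin_range_mul_le {κ κ' : Type*} {x : κ → A} {y : κ' → A}
    (h : ∀ i j, x i * y j ∈ Submodule.span ℂ (Set.range y) * Submodule.span ℂ (Set.range x)) :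
    toSubmodule (adjoin ℂ (Set.range x)) * toSubmodule (adjoin ℂ (Set.range y)) ≤
      toSubmodule (adjoin ℂ (Set.range y)) * toSubmodule (adjoin ℂ (Set.range x)) := by
  refine adjoin_mul_adjoin_le (W := Submodule.span ℂ (Set.range x)) Submodule.subset_span
    (Algebra.span_le_adjoin ℂ _) ?_
  rintro w hw _ ⟨j, rfl⟩
  refine mul_le_mul' (Algebra.span_le_adjoin ℂ (Set.range y)) le_rfl ?_
  induction hw using Submodule.span_induction with
  | mem w hw => obtain ⟨i, rfl⟩ := hw; exact h i j
  | zero => rw [zero_mul]; exact Submodule.zero_mem _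
  | add a b _ _ iha ihb => rw [add_mul]; exact Submodule.add_mem _ iha ihb
  | smul c a _ ih => rw [smul_mul_assoc]; exact Submodule.smul_mem _ _ ih

/-- Pairs of indices, ordered by increasing first and decreasing second component. -/
def edgeOrder (M N : ℕ) : List (Fin M × Fin N) :=
  (List.finRange M).flatMap fun j => (List.finRange N).reverse.map fun i => (j, i)

/-- `c` precedes `c'` in the order of indices. -/
def EdgePrec {M N : ℕ} (c c' : Fin M × Fin N) : Prop := c.1 < c'.1 ∨ c.1 = c'.1 ∧ c'.2 < c.2

theorem mem_edgeOrder {M N : ℕ} (c : Fin M × Fin N) : c ∈ edgeOrder M N := by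
  simp [edgeOrder]

theorem edgeOrder_pairwise (M N : ℕ) : (edgeOrder M N).Pairwise EdgePrec := by
  rw [edgeOrder, List.pairwise_flatMap]
  constructor
  · intro j _
    rw [List.pairwise_map, List.pairwise_reverse]
    exact (List.pairwise_lt_finRange N).imp fun h => Or.inr ⟨rfl, h⟩
  · refine (List.pairwise_lt_finRange M).imp fun h => ?_
    intro x hx y hy
    obtain ⟨_, _, rfl⟩ := List.mem_map.1 hx
    obtain ⟨_, _, rfl⟩ := List.mem_map.1 hy
    exact Or.inl h

variable {q : ℂ} {M N : ℕ}

/-- The subalgebra generated by the coordinates. -/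
def subX (q : ℂ) (M N : ℕ) : Subalgebra ℂ (EdgeAlg q M N) :=
  adjoin ℂ (Set.range fun c : Fin M × Fin N => edgeX q c.1 c.2)

/-- The subalgebra generated by the derivations. -/
def subD (q : ℂ) (M N : ℕ) : Subalgebra ℂ (EdgeAlg q M N) :=
  adjoin ℂ (Set.range fun c : Fin M × Fin N => edgePd q c.1 c.2)

theorem list_prod_map_flatMap {ι κ : Type*} {B : Type*} [Monoid B] (l : List ι) (f : ι → List κ)
    (g : κ → B) : ((l.flatMap f).map g).prod = (l.map fun a => ((f a).map g).prod).prod := by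
  induction l with
  | nil => rfl
  | cons a l ih => simp [ih]

/-- Within a row coordinates commute up to q. Between rows the relations only recombine one
coordinate from each row, so the subalgebras of two rows exchange as a whole. -/
theorem subX_le (hq : q ≠ 0) : toSubmodule (subX q M N) ≤
    ((edgeOrder M N).map fun c => toSubmodule (adjoin ℂ {edgeX q c.1 c.2})).prod := by
  rw [edgeOrder, list_prod_map_flatMap]
  have h1 : ∀ j : Fin M, toSubmodule (adjoin ℂ (Set.range fun i : Fin N => edgeX q j i)) ≤
      (((List.finRange N).reverse.map fun i => (j, i)).map fun c =>
        toSubmodule (adjoin ℂ {edgeX q c.1 c.2})).prod := by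
    intro j
    rw [List.map_map]
    refine adjoin_le_list_prod (fun i => adjoin ℂ {edgeX q j i}) ?_ ?_
    · rw [List.pairwise_reverse]
      refine (List.pairwise_lt_finRange N).imp fun {a b} h => ?_
      refine adjoin_singleton_mul_le (a := q) ?_
      rw [edge_xx_same q j b a h, smul_smul, mul_inv_cancel₀ hq, one_smul]
    · rintro _ ⟨i, rfl⟩
      exact ⟨i, by simp, Algebra.subset_adjoin rfl⟩
  have h2 : toSubmodule (subX q M N) ≤ ((List.finRange M).map fun j =>
      toSubmodule (adjoin ℂ (Set.range fun i : Fin N => edgeX q j i))).prod := by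
    refine adjoin_le_list_prod (fun j => adjoin ℂ (Set.range fun i : Fin N => edgeX q j i)) ?_ ?_
    · refine (List.pairwise_lt_finRange M).imp fun {a b} h => ?_
      refine adjoin_range_mul_le fun m n => ?_
      rw [edge_xx q b a m n h]
      exact Submodule.add_mem _
        (Submodule.smul_mem _ _ (Submodule.mul_mem_mul (Submodule.subset_span ⟨_, rfl⟩)
          (Submodule.subset_span ⟨_, rfl⟩)))
        (Submodule.smul_mem _ _ (Submodule.mul_mem_mul (Submodule.subset_span ⟨_, rfl⟩)
          (Submodule.subset_span ⟨_, rfl⟩)))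
    · rintro _ ⟨c, rfl⟩
      exact ⟨c.1, by simp, Algebra.subset_adjoin ⟨c.2, rfl⟩⟩
  exact h2.trans (List.prod_le_prod' fun j _ => h1 j)

/-- The order of derivations is opposite to that of coordinates: the rightmost derivation, which
acts first, then has the index of the leftmost coordinate of a monomial. -/
theorem subD_le (hq : q ≠ 0) : toSubmodule (subD q M N) ≤
    ((edgeOrder M N).reverse.map fun c => toSubmodule (adjoin ℂ {edgePd q c.1 c.2})).prod := by
  have e : (edgeOrder M N).reverse =
      (List.finRange M).reverse.flatMap fun j => (List.finRange N).map fun i => (j, i) := by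
    simp [edgeOrder, List.reverse_flatMap, Function.comp_def]
  rw [e, list_prod_map_flatMap]
  have h1 : ∀ j : Fin M, toSubmodule (adjoin ℂ (Set.range fun i : Fin N => edgePd q j i)) ≤
      (((List.finRange N).map fun i => (j, i)).map fun c =>
        toSubmodule (adjoin ℂ {edgePd q c.1 c.2})).prod := by
    intro j
    rw [List.map_map]
    refine adjoin_le_list_prod (fun i => adjoin ℂ {edgePd q j i}) ?_ ?_
    · refine (List.pairwise_lt_finRange N).imp fun {a b} h => ?_
      refine adjoin_singleton_mul_le (a := q) ?_
      rw [edge_dd q b a j j h, if_pos rfl, if_neg (lt_irrefl _), zero_smul, add_zero]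
    · rintro _ ⟨i, rfl⟩
      exact ⟨i, by simp, Algebra.subset_adjoin rfl⟩
  have h2 : toSubmodule (subD q M N) ≤ ((List.finRange M).reverse.map fun j =>
      toSubmodule (adjoin ℂ (Set.range fun i : Fin N => edgePd q j i))).prod := by
    refine adjoin_le_list_prod (fun j => adjoin ℂ (Set.range fun i : Fin N => edgePd q j i)) ?_ ?_
    · rw [List.pairwise_reverse]
      refine (List.pairwise_lt_finRange M).imp fun {m n} h => ?_
      have hm : ∀ i j, edgePd q n i * edgePd q m j ∈
          Submodule.span ℂ (Set.range fun i : Fin N => edgePd q n i) *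
          Submodule.span ℂ (Set.range fun i : Fin N => edgePd q m i) := fun i j =>
        Submodule.mul_mem_mul (Submodule.subset_span ⟨_, rfl⟩) (Submodule.subset_span ⟨_, rfl⟩)
      refine adjoin_range_mul_le fun i j => ?_
      have hlt : ∀ i j : Fin N, i < j → edgePd q m i * edgePd q n j = edgePd q n j * edgePd q m i := by
        intro i j hij
        have := edge_dd q j i n m hij
        rw [if_neg h.ne', if_neg h.not_gt, zero_smul, add_zero, one_smul] at this
        exact this.symm
      rcases lt_trichotomy i j with hij | rfl | hij
      · simp only [hlt i j hij]
        exact hm _ _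
      · have := edge_dd_same q i n m h
        have e2 : edgePd q m i * edgePd q n i = q • (edgePd q n i * edgePd q m i) := by
          rw [this, smul_smul, mul_inv_cancel₀ hq, one_smul]
        simp only [e2]
        exact Submodule.smul_mem _ _ (hm _ _)
      · simp only [edge_dd q i j m n hij, hlt j i hij]
        exact Submodule.add_mem _ (Submodule.smul_mem _ _ (hm _ _))
          (Submodule.smul_mem _ _ (hm _ _))
    · rintro _ ⟨c, rfl⟩
      exact ⟨c.1, by simp, Algebra.subset_adjoin ⟨c.2, rfl⟩⟩
  exact h2.trans (List.prod_le_prod' fun j _ => h1 j)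

theorem subD_mul_subX_le : toSubmodule (subD q M N) * toSubmodule (subX q M N) ≤
    toSubmodule (subX q M N) * toSubmodule (subD q M N) := by
  let W : Submodule ℂ (EdgeAlg q M N) :=
    Submodule.span ℂ (insert 1 (Set.range fun c : Fin M × Fin N => edgePd q c.1 c.2))
  have hd : ∀ m i, edgePd q m i ∈ W := fun m i =>
    Submodule.subset_span (Or.inr ⟨(m, i), rfl⟩)
  have h1 : (1 : EdgeAlg q M N) ∈ W := Submodule.subset_span (Or.inl rfl)
  have hx : ∀ j n, edgeX q j n ∈ toSubmodule (subX q M N) := fun j n =>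
    Algebra.subset_adjoin ⟨(j, n), rfl⟩
  -- The relation again contains products ∂x on its right-hand side, but only with a smaller upper
  -- index p < j of the coordinate. The induction is on this index, and W contains 1 for the
  -- constant term.
  have key : ∀ (j m : Fin M) (i n : Fin N), edgePd q m i * edgeX q j n ∈
      toSubmodule (subX q M N) * W := by
    intro j
    induction j using WellFoundedLT.induction with
    | ind j ih =>
    intro m i n
    rw [edge_dx]
    refine Submodule.add_mem _ (Submodule.add_mem _ (Submodule.add_mem _ ?_ ?_) ?_) ?_
    · exact Submodule.smul_mem _ _ (Submodule.mul_mem_mul (hx _ _) (hd _ _))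
    · exact Submodule.smul_mem _ _ (Submodule.sum_mem _ fun p _ =>
        Submodule.mul_mem_mul (hx _ _) (hd _ _))
    · exact Submodule.smul_mem _ _ (Submodule.sum_mem _ fun p hp =>
        ih p (Finset.mem_Iio.1 hp) _ _ _)
    · refine Submodule.smul_mem _ _ ?_
      rw [← mul_one (1 : EdgeAlg q M N)]
      exact Submodule.mul_mem_mul (one_mem (subX q M N)) h1
  refine adjoin_mul_adjoin_le (W := W) (fun z hz => Submodule.subset_span (Or.inr hz)) ?_ ?_
  · refine Submodule.span_le.2 (Set.insert_subset ?_ Algebra.subset_adjoin)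
    exact one_mem (subD q M N)
  · rintro w hw _ ⟨⟨j, n⟩, rfl⟩
    induction hw using Submodule.span_induction with
    | mem w hw =>
      rcases hw with rfl | ⟨c, rfl⟩
      · rw [one_mul]
        have := Submodule.mul_mem_mul (hx j n) h1
        rw [mul_one] at this
        exact this
      · exact key _ _ _ _
    | zero => rw [zero_mul]; exact Submodule.zero_mem _
    | add a b _ _ iha ihb => rw [add_mul]; exact Submodule.add_mem _ iha ihb
    | smul c a _ ih => rw [smul_mul_assoc]; exact Submodule.smul_mem _ _ ih

theorem subX_mul_subD : toSubmodule (subX q M N) * toSubmodule (subD q M N) = ⊤ := by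
  rw [_root_.eq_top_iff, ← Algebra.top_toSubmodule, ← edgeAlg_adjoin]
  have := adjoin_le_list_prod (fun b : Bool => cond b (subX q M N) (subD q M N))
    (l := [true, false]) (G := Set.range (fun c : Fin M × Fin N => edgeX q c.1 c.2) ∪
      Set.range (fun c : Fin M × Fin N => edgePd q c.1 c.2))
    (by simpa using subD_mul_subX_le) (by
      rintro _ (⟨c, rfl⟩ | ⟨c, rfl⟩)
      · exact ⟨true, by simp, Algebra.subset_adjoin ⟨c, rfl⟩⟩
      · exact ⟨false, by simp, Algebra.subset_adjoin ⟨c, rfl⟩⟩)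
  simpa using this

end Straighten

/-! ### The action of derivations on ordered monomials -/

section Ladder

variable {q : ℂ} {M N : ℕ} {P : Type*} [AddCommGroup P] [Module ℂ P] [Module (EdgeAlg q M N) P]
  [IsScalarTower ℂ (EdgeAlg q M N) P]

instance : IsTrans (Fin M × Fin N) EdgePrec where
  trans a b c := by
    rintro (h1 | ⟨h1, h1'⟩) (h2 | ⟨h2, h2'⟩)
    · exact Or.inl (h1.trans h2)
    · exact Or.inl (h2 ▸ h1)
    · exact Or.inl (h1 ▸ h2)
    · exact Or.inr ⟨h1.trans h2, h2'.trans h1'⟩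

/-- The coordinate with a given index. -/
abbrev xAt (q : ℂ) {M N : ℕ} (c : Fin M × Fin N) : EdgeAlg q M N := edgeX q c.1 c.2

/-- The derivation with a given index. -/
abbrev dAt (q : ℂ) {M N : ℕ} (c : Fin M × Fin N) : EdgeAlg q M N := edgePd q c.1 c.2

/-- Vectors killed by all derivations whose index precedes a given one. -/
def KilledBefore (c : Fin M × Fin N) (w : P) : Prop := ∀ c', EdgePrec c' c → dAt q c' • w = 0

theorem edge_dx_smul (i n : Fin N) (j m : Fin M) (w : P) :
    edgePd q m i • edgeX q j n • w =
      ((if i = n then q else 1) * (if j = m then q else 1)) • edgeX q j n • edgePd q m i • w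
      + (if i = n then (if j = m then q else 1) * (q - q⁻¹) else 0) •
          ∑ p ∈ Finset.Ioi i, edgeX q j p • edgePd q m p • w
      + (if j = m then q ^ 2 - 1 else 0) • ∑ p ∈ Finset.Iio j, edgePd q p i • edgeX q p n • w
      + (if i = n ∧ j = m then q else 0) • w := by
  rw [← mul_smul, edge_dx]
  simp only [add_smul, smul_assoc, Finset.sum_smul, mul_smul, one_smul]

/-- All correction terms die: those with p > i are derivations earlier in the order, hence kill w,
and those with p < j survive only for j = m, where induction on the row applies. -/
theorem dAt_smul_xAt_smul_of_prec {w : P} : ∀ {c c' : Fin M × Fin N}, EdgePrec c c' →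
    KilledBefore (q := q) c w → dAt q c • w = 0 → dAt q c • xAt q c' • w = 0 := by
  rintro ⟨m, i⟩
  induction m using WellFoundedLT.induction with
  | ind m ih =>
  rintro ⟨j, n⟩ (h | ⟨h, h'⟩) hk h0
  · dsimp only at h
    have hp : ∀ p ∈ Finset.Ioi i, edgeX q j p • edgePd q m p • w = 0 := fun p hp => by
      rw [hk (m, p) (Or.inr ⟨rfl, Finset.mem_Ioi.1 hp⟩), smul_zero]
    rw [edge_dx_smul, h0, Finset.sum_eq_zero hp]
    simp [h.ne']
  · dsimp only at h h'
    subst h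
    have hp : ∀ p ∈ Finset.Iio m, edgePd q p i • edgeX q p n • w = 0 := fun p hp => by
      have hpm := Finset.mem_Iio.1 hp
      exact ih p hpm (c' := (p, n)) (Or.inr ⟨rfl, h'⟩)
        (fun c hc => hk c (_root_.trans hc (Or.inl hpm))) (hk (p, i) (Or.inl hpm))
    rw [edge_dx_smul, h0, Finset.sum_eq_zero hp]
    simp [h'.ne']

/-- Every sum in the relation collapses on w, which leaves a q-oscillator for the single pair ∂_c,
x_c. Its constant depends on the row because each smaller row contributes its own constant. -/
theorem dAt_smul_xAt_smul_self {w : P} : ∀ {c : Fin M × Fin N},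
    KilledBefore (q := q) c w →
    dAt q c • xAt q c • w = q ^ 2 • xAt q c • dAt q c • w + q ^ (2 * (c.1 : ℕ) + 1) • w := by
  rintro ⟨m, i⟩
  induction m using WellFoundedLT.induction with
  | ind m ih =>
  intro hk
  have h1 : ∀ p ∈ Finset.Ioi i, edgeX q m p • edgePd q m p • w = 0 := fun p hp => by
    rw [hk (m, p) (Or.inr ⟨rfl, Finset.mem_Ioi.1 hp⟩), smul_zero]
  have h2 : ∀ p ∈ Finset.Iio m, edgePd q p i • edgeX q p i • w = q ^ (2 * (p : ℕ) + 1) • w :=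
    fun p hp => by
      have hpm := Finset.mem_Iio.1 hp
      have := ih p hpm (fun c hc => hk c (_root_.trans hc (Or.inl hpm)))
      rw [this, hk (p, i) (Or.inl hpm), smul_zero, smul_zero, zero_add]
  rw [edge_dx_smul, Finset.sum_eq_zero h1, Finset.sum_congr rfl h2, ← Finset.sum_smul]
  simp only [if_true, and_self, smul_zero, add_zero, smul_smul]
  rw [pow_two, add_assoc, ← add_smul]
  congr 2
  -- What remains is q + (q² − 1) Σ_{p<m} q^{2p+1} = q^{2m+1}, a telescoping sum.
  have h3 : ∑ p ∈ Finset.Iio m, q ^ (2 * (p : ℕ) + 1) =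
      ∑ p ∈ Finset.range (m : ℕ), q ^ (2 * p + 1) := by
    rw [← Nat.Iio_eq_range, ← Fin.map_valEmbedding_Iio, Finset.sum_map]
    rfl
  rw [h3]
  induction (m : ℕ) with
  | zero => simp
  | succ k ihk => rw [Finset.sum_range_succ, mul_add, add_right_comm, ihk]; ring

theorem KilledBefore.xAt_smul {c : Fin M × Fin N} {w : P} (h : KilledBefore (q := q) c w) :
    KilledBefore (q := q) c (xAt q c • w) := fun c' hc =>
  dAt_smul_xAt_smul_of_prec hc (fun c'' hc' => h c'' (_root_.trans hc' hc)) (h c' hc)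

theorem KilledBefore.xAt_pow_smul {c : Fin M × Fin N} {w : P} (h : KilledBefore (q := q) c w)
    (n : ℕ) : KilledBefore (q := q) c (xAt q c ^ n • w) := by
  induction n with
  | zero => rwa [pow_zero, one_smul]
  | succ n ih => rw [pow_succ', mul_smul]; exact ih.xAt_smul

/-- The eigenvalues of `∂ x` on powers of `x`. -/
def ladder (q : ℂ) (m a : ℕ) : ℂ := q ^ (2 * m + 1) * ∑ r ∈ Finset.range a, (q ^ 2) ^ r

theorem dAt_smul_xAt_pow_succ_smul {c : Fin M × Fin N} {w : P}
    (h : KilledBefore (q := q) c w) (h0 : dAt q c • w = 0) (n : ℕ) :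
    dAt q c • xAt q c ^ (n + 1) • w = ladder q c.1 (n + 1) • xAt q c ^ n • w := by
  induction n with
  | zero =>
    rw [zero_add, pow_one, dAt_smul_xAt_smul_self h, h0]
    simp [ladder]
  | succ n ih =>
    rw [pow_succ', mul_smul, dAt_smul_xAt_smul_self (h.xAt_pow_smul _), ih,
      smul_comm (xAt q c) (ladder q c.1 (n + 1)), ← mul_smul (xAt q c), ← pow_succ', smul_smul,
      ← add_smul]
    congr 1
    rw [ladder, ladder, Finset.sum_range_succ' _ (n + 1), Finset.mul_sum, Finset.mul_sum, mul_add,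
      Finset.mul_sum]
    congr 1
    · exact Finset.sum_congr rfl fun r _ => by ring
    · simp

theorem dAt_pow_smul_xAt_pow_smul {c : Fin M × Fin N} {w : P}
    (h : KilledBefore (q := q) c w) (h0 : dAt q c • w = 0) (n m : ℕ) :
    dAt q c ^ n • xAt q c ^ (m + n) • w =
      (∏ r ∈ Finset.range n, ladder q c.1 (m + r + 1)) • xAt q c ^ m • w := by
  induction n with
  | zero => simp
  | succ n ih =>
    rw [pow_succ, mul_smul, ← add_assoc, dAt_smul_xAt_pow_succ_smul h h0, smul_comm, ih,
      smul_smul, Finset.prod_range_succ, mul_comm]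

theorem dAt_pow_smul_xAt_pow_smul_of_lt {c : Fin M × Fin N} {w : P}
    (h : KilledBefore (q := q) c w) (h0 : dAt q c • w = 0) {n m : ℕ} (hmn : m < n) :
    dAt q c ^ n • xAt q c ^ m • w = 0 := by
  obtain ⟨k, rfl⟩ := Nat.exists_eq_add_of_lt hmn
  have := dAt_pow_smul_xAt_pow_smul h h0 m 0
  rw [zero_add] at this
  rw [show m + k + 1 = k + 1 + m by ring, pow_add, mul_smul, this, smul_comm, pow_zero, one_smul,
    pow_succ, mul_smul, h0, smul_zero, smul_zero]

theorem ladder_ne_zero {ℓ : ℕ} (hodd : Odd ℓ) (hq : IsPrimitiveRoot q ℓ) (m : ℕ) {a : ℕ}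
    (ha : 0 < a) (haℓ : a < ℓ) : ladder q m a ≠ 0 := by
  have hq2 : IsPrimitiveRoot (q ^ 2) ℓ := hq.pow_of_coprime 2 hodd.coprime_two_left
  refine mul_ne_zero (pow_ne_zero _ (hq.ne_zero (by omega))) fun h => ?_
  have := geom_sum_mul (q ^ 2) a
  rw [h, zero_mul] at this
  exact hq2.pow_ne_one_of_pos_of_lt ha.ne' haℓ (sub_eq_zero.1 this.symm)

theorem ladder_self {ℓ : ℕ} (hℓ : 1 < ℓ) (hodd : Odd ℓ) (hq : IsPrimitiveRoot q ℓ) (m : ℕ) :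
    ladder q m ℓ = 0 := by
  have hq2 : IsPrimitiveRoot (q ^ 2) ℓ := hq.pow_of_coprime 2 hodd.coprime_two_left
  rw [ladder, hq2.geom_sum_eq_zero hℓ, mul_zero]

/-- An operator which singles out the power `b` of a coordinate. -/
def pick (q : ℂ) (ℓ : ℕ) {M N : ℕ} (c : Fin M × Fin N) (b : ℕ) : EdgeAlg q M N :=
  dAt q c ^ (ℓ - 1) * xAt q c ^ (ℓ - 1 - b)

/-- Multiplication by x^(ℓ−1−b) raises the exponent a to ℓ − 1 + (a − b), and ℓ − 1 derivations
follow. For a < b they pass below exponent 0; for a > b they meet the vanishing factor at exponent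
ℓ; for a = b they return w with a product of nonzero factors. -/
theorem pick_smul {ℓ : ℕ} (hℓ : 1 < ℓ) (hodd : Odd ℓ) (hq : IsPrimitiveRoot q ℓ)
    {c : Fin M × Fin N} {w : P} (h : KilledBefore (q := q) c w) (h0 : dAt q c • w = 0)
    {a b : ℕ} (ha : a < ℓ) (hb : b < ℓ) :
    pick q ℓ c b • xAt q c ^ a • w =
      if a = b then (∏ r ∈ Finset.range (ℓ - 1), ladder q c.1 (r + 1)) • w else 0 := by
  have hq0 : q ≠ 0 := hq.ne_zero (by omega)
  rw [pick, mul_smul, ← mul_smul (_ ^ _) (_ ^ a), ← pow_add]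
  rcases lt_trichotomy a b with hab | rfl | hab
  · rw [dAt_pow_smul_xAt_pow_smul_of_lt h h0 (by omega), if_neg hab.ne]
  · have := dAt_pow_smul_xAt_pow_smul h h0 (ℓ - 1) 0
    rw [if_pos rfl, show ℓ - 1 - a + a = 0 + (ℓ - 1) by omega, this]
    simp
  · rw [show ℓ - 1 - b + a = (a - b) + (ℓ - 1) by omega, dAt_pow_smul_xAt_pow_smul h h0,
      if_neg hab.ne', Finset.prod_eq_zero (i := ℓ - 1 - (a - b)), zero_smul]
    · rw [Finset.mem_range]; omega
    -- The index of this factor was chosen so that the exponent is exactly ℓ.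
    · rw [show a - b + (ℓ - 1 - (a - b)) + 1 = ℓ by omega, ladder_self hℓ hodd hq]

/-- Ordered monomials in the coordinates. -/
def xMon (q : ℂ) {M N : ℕ} (l : List (Fin M × Fin N)) (γ : Fin M × Fin N → ℕ) : EdgeAlg q M N :=
  (l.map fun c => xAt q c ^ γ c).prod

/-- The leading coordinate of the remaining monomial comes after c, so derivations with index at or
before c pass through all its factors to the vacuum. This puts every partial monomial into the
oscillator situation. -/
theorem xMon_smul_killed {vac : P} (hvac : ∀ c : Fin M × Fin N, dAt q c • vac = 0)
    (γ : Fin M × Fin N → ℕ) {c : Fin M × Fin N} {l : List (Fin M × Fin N)}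
    (hl : (c :: l).Pairwise EdgePrec) : dAt q c • xMon q l γ • vac = 0 ∧
      KilledBefore (q := q) c (xMon q l γ • vac) := by
  suffices h : ∀ c', (∀ c ∈ l, EdgePrec c' c) → dAt q c' • xMon q l γ • vac = 0 by
    rw [List.pairwise_cons] at hl
    exact ⟨h c hl.1, fun c' hc => h c' fun c'' hc' => _root_.trans hc (hl.1 c'' hc')⟩
  rw [List.pairwise_cons] at hl
  replace hl := hl.2
  clear c
  induction l with
  | nil => intro c _; simp [xMon, hvac]
  | cons c l ih =>
    intro c' hc
    rw [List.pairwise_cons] at hl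
    rw [xMon, List.map_cons, List.prod_cons, mul_smul]
    have hk : KilledBefore (q := q) c (xMon q l γ • vac) := fun c' hc' =>
      ih hl.2 c' fun c'' hc'' => _root_.trans hc' (hl.1 c'' hc'')
    exact hk.xAt_pow_smul _ c' (hc c (List.mem_cons_self ..))

/-- An operator which singles out a monomial. -/
def pickMon (q : ℂ) (ℓ : ℕ) {M N : ℕ} (l : List (Fin M × Fin N)) (β : Fin M × Fin N → ℕ) :
    EdgeAlg q M N :=
  (l.reverse.map fun c => pick q ℓ c (β c)).prod

/-- The selecting operators are composed in the reversed order, so each acts on the leftmost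
remaining power of the monomial and strips it off or kills the vector. -/
theorem pickMon_smul {ℓ : ℕ} (hℓ : 1 < ℓ) (hodd : Odd ℓ) (hq : IsPrimitiveRoot q ℓ) {vac : P}
    (hvac : ∀ c : Fin M × Fin N, dAt q c • vac = 0) {l : List (Fin M × Fin N)} (hl : l.Pairwise EdgePrec) :
    ∃ a : ℂ, a ≠ 0 ∧ ∀ β γ : Fin M × Fin N → ℕ, (∀ c, β c < ℓ) → (∀ c, γ c < ℓ) →
      pickMon q ℓ l β • xMon q l γ • vac = if ∀ c ∈ l, γ c = β c then a • vac else 0 := by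
  induction l with
  | nil => exact ⟨1, one_ne_zero, fun β γ _ _ => by simp [pickMon, xMon]⟩
  | cons c l ih =>
    obtain ⟨a, ha, h⟩ := ih (List.pairwise_cons.1 hl).2
    refine ⟨(∏ r ∈ Finset.range (ℓ - 1), ladder q c.1 (r + 1)) * a, mul_ne_zero
      (Finset.prod_ne_zero_iff.2 fun r hr => ladder_ne_zero hodd hq _ (by omega) (by
        rw [Finset.mem_range] at hr; omega)) ha, fun β γ hβ hγ => ?_⟩
    obtain ⟨h0, hk⟩ := xMon_smul_killed hvac γ hl
    have e1 : xMon q (c :: l) γ = xAt q c ^ γ c * xMon q l γ := by simp [xMon]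
    have e2 : pickMon q ℓ (c :: l) β = pickMon q ℓ l β * pick q ℓ c (β c) := by simp [pickMon]
    rw [e1, e2, mul_smul, mul_smul, pick_smul hℓ hodd hq hk h0 (hγ c) (hβ c)]
    simp only [List.mem_cons, forall_eq_or_imp]
    by_cases h1 : γ c = β c
    · rw [if_pos h1, smul_comm, h β γ hβ hγ]
      by_cases h2 : ∀ c ∈ l, γ c = β c
      · rw [if_pos h2, if_pos ⟨h1, h2⟩, smul_smul]
      · rw [if_neg h2, if_neg (fun h => h2 h.2), smul_zero]
    · rw [if_neg h1, if_neg (fun h => h1 h.1), smul_zero]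

end Ladder

/-! ### The relations among derivations follow from the Weyl relations -/

section WeylQMat

variable {V : Type*} {q : ℂ} {d : V → ℕ} {E : Type*} [Ring E] [Algebra ℂ E]

theorem leg13_RE_self_mul_apply {u : V} {p : Type*}
    (A : Matrix (Fin (d u) × Fin (d u) × Fin (d u)) p E) (i j k : Fin (d u)) (x : p) :
    (leg13 (Fin (d u)) (RE E q d u u) * A) (i, j, k) x =
      (if i = k then q else 1) • A (i, j, k) x + (if i < k then q - q⁻¹ else 0) • A (k, j, i) x := by
  have h := RE_self_mul_apply (q := q) (Matrix.of fun (y : Fin (d u) × Fin (d u)) (x : p) =>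
    A (y.1, j, y.2) x) i k x
  simp only [Matrix.of_apply] at h
  rw [← h, Matrix.mul_apply, Matrix.mul_apply]
  simp [leg13, Fintype.sum_prod_type, Finset.sum_ite_irrel]

theorem leg23_RE_self_mul_apply {u : V} {p : Type*}
    (A : Matrix (Fin (d u) × Fin (d u) × Fin (d u)) p E) (i j k : Fin (d u)) (x : p) :
    (leg23 (Fin (d u)) (RE E q d u u) * A) (i, j, k) x =
      (if j = k then q else 1) • A (i, j, k) x + (if j < k then q - q⁻¹ else 0) • A (i, k, j) x := by
  have h := RE_self_mul_apply (q := q) (Matrix.of fun (y : Fin (d u) × Fin (d u)) (x : p) =>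
    A (i, y) x) j k x
  simp only [Matrix.of_apply] at h
  rw [← h, Matrix.mul_apply, Matrix.mul_apply]
  simp [leg23, Fintype.sum_prod_type]

theorem entriesCommute_RE {b b' : Type*} (q : ℂ) (d : V → ℕ) (u v : V) (B : Matrix b b' E) :
    EntriesCommute (RE E q d u v) B := entriesCommute_scal _ _

theorem flipM_RE_inv_mul (hq : q ≠ 0) (u v : V) :
    flipM (RE E q⁻¹ d u v) * flipM (RE E q d u v) = 1 := by
  rw [← flipM_mul, RE_inv_mul hq, flipM_one]

theorem scal_swapM (a b : Type*) [DecidableEq a] [DecidableEq b] :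
    scal E (swapM ℂ a b) = swapM E a b := by
  ext i j
  simp only [scal, swapM, Matrix.map_apply]
  split_ifs <;> simp

theorem RE_sub_flip (u : V) :
    RE E q d u u - flipM (RE E q⁻¹ d u u) = (q - q⁻¹) • swapM E (Fin (d u)) (Fin (d u)) := by
  have h := congrArg (scal E) (vertR_sub_flip (q := q) (d := d) u)
  rw [← scal_swapM, RE, RE, flipM_scal]
  ext i j
  have := congrFun (congrFun h i) j
  simp only [scal, Matrix.map_apply, Matrix.sub_apply, Matrix.smul_apply, smul_eq_mul, map_mul,
    map_sub] at this ⊢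
  rw [Algebra.smul_def, map_sub]
  exact this

/-- This is the Yang–Baxter equation in the form of `leg_yangBaxter_inv₂₃` with the first two legs
exchanged; σ below is that exchange. -/
theorem flipM_yangBaxter_inv (hq : q ≠ 0) (t : V) :
    leg12 (Fin (d t)) (flipM (RE E q d t t)) * (leg13 (Fin (d t)) (RE E q⁻¹ d t t) *
        leg23 (Fin (d t)) (RE E q⁻¹ d t t)) =
      leg23 (Fin (d t)) (RE E q⁻¹ d t t) * (leg13 (Fin (d t)) (RE E q⁻¹ d t t) *
        leg12 (Fin (d t)) (flipM (RE E q d t t))) := by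
  have h := leg_yangBaxter_inv₂₃ (E := E) (d := d) hq t t t
  have e : ∀ (A B C : Matrix (Fin (d t) × Fin (d t)) (Fin (d t) × Fin (d t)) E) x y,
      (leg12 (Fin (d t)) (flipM A) * (leg13 (Fin (d t)) B * leg23 (Fin (d t)) C)) x y =
      (leg12 (Fin (d t)) A * (leg23 (Fin (d t)) B * leg13 (Fin (d t)) C))
        (x.2.1, x.1, x.2.2) (y.2.1, y.1, y.2.2) := by
    rintro A B C ⟨x1, x2, x3⟩ ⟨y1, y2, y3⟩
    let σ : (Fin (d t) × Fin (d t) × Fin (d t)) ≃ (Fin (d t) × Fin (d t) × Fin (d t)) :=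
      ⟨fun x => (x.2.1, x.1, x.2.2), fun x => (x.2.1, x.1, x.2.2), fun _ => rfl, fun _ => rfl⟩
    rw [Matrix.mul_apply, Matrix.mul_apply, ← σ.sum_comp]
    refine Finset.sum_congr rfl fun z _ => congrArg₂ _ rfl ?_
    rw [Matrix.mul_apply, Matrix.mul_apply, ← σ.sum_comp]
    rfl
  have e' : ∀ (A B C : Matrix (Fin (d t) × Fin (d t)) (Fin (d t) × Fin (d t)) E) x y,
      (leg23 (Fin (d t)) C * (leg13 (Fin (d t)) B * leg12 (Fin (d t)) (flipM A))) x y =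
      (leg13 (Fin (d t)) C * (leg23 (Fin (d t)) B * leg12 (Fin (d t)) A))
        (x.2.1, x.1, x.2.2) (y.2.1, y.1, y.2.2) := by
    rintro A B C ⟨x1, x2, x3⟩ ⟨y1, y2, y3⟩
    let σ : (Fin (d t) × Fin (d t) × Fin (d t)) ≃ (Fin (d t) × Fin (d t) × Fin (d t)) :=
      ⟨fun x => (x.2.1, x.1, x.2.2), fun x => (x.2.1, x.1, x.2.2), fun _ => rfl, fun _ => rfl⟩
    rw [Matrix.mul_apply, Matrix.mul_apply, ← σ.sum_comp]
    refine Finset.sum_congr rfl fun z _ => congrArg₂ _ rfl ?_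
    rw [Matrix.mul_apply, Matrix.mul_apply, ← σ.sum_comp]
    rfl
  ext x y
  rw [e, e', h]

/-- The failure of a matrix to be a quantum matrix. -/
def qMatDefect (q : ℂ) (d : V → ℕ) {t s : V} (D : Matrix (Fin (d s)) (Fin (d t)) E) :
    Matrix (Fin (d s) × Fin (d s)) (Fin (d t) × Fin (d t)) E :=
  RE E q d s s * (legL (Fin (d s)) D * legR (Fin (d t)) D) -
    legR (Fin (d s)) D * (legL (Fin (d t)) D * flipM (RE E q d t t))

variable {t s : V} {X : Matrix (Fin (d t)) (Fin (d s)) E} {D : Matrix (Fin (d s)) (Fin (d t)) E}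

theorem leg13_add {a a' b c c' : Type*} [DecidableEq b] (A B : Matrix (a × c) (a' × c') E) :
    leg13 b (A + B) = leg13 b A + leg13 b B := by
  ext i j
  simp only [leg13, Matrix.add_apply]
  split_ifs <;> simp

theorem leg23_add {a b b' c c' : Type*} [DecidableEq a] (A B : Matrix (b × c) (b' × c') E) :
    leg23 a (A + B) = leg23 a A + leg23 a B := by
  ext i j
  simp only [leg23, Matrix.add_apply]
  split_ifs <;> simp

theorem leg12_sub {a a' b b' c : Type*} [DecidableEq c] (A B : Matrix (a × b) (a' × b') E) :
    leg12 c (A - B) = leg12 c A - leg12 c B := by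
  ext i j
  simp only [leg12, Matrix.sub_apply]
  split_ifs <;> simp

theorem leg12_smul {a a' b b' c : Type*} [DecidableEq c] (z : ℂ) (A : Matrix (a × b) (a' × b') E) :
    leg12 c (z • A) = z • leg12 c A := by
  ext i j
  simp only [leg12, Matrix.smul_apply]
  split_ifs <;> simp

theorem IsWeyl.leg13 (h : IsWeyl q d X D) (b : Type*) [Fintype b] [DecidableEq b] :
    leg1 b (Fin (d t)) D * (leg13 b (RE E q⁻¹ d t t) * leg3 (Fin (d t)) b X) =
      leg3 (Fin (d s)) b X * (leg13 b (RE E q d s s) * leg1 b (Fin (d s)) D) +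
        leg13 b (swapM E (Fin (d s)) (Fin (d t))) := by
  have := congrArg (_root_.leg13 b) h
  simpa only [leg13_add, leg13_mul, leg13_legL, leg13_legR] using this

theorem IsWeyl.leg23 (h : IsWeyl q d X D) (a : Type*) [Fintype a] [DecidableEq a] :
    leg2 a (Fin (d t)) D * (leg23 a (RE E q⁻¹ d t t) * leg3 a (Fin (d t)) X) =
      leg3 a (Fin (d s)) X * (leg23 a (RE E q d s s) * leg2 a (Fin (d s)) D) +
        leg23 a (swapM E (Fin (d s)) (Fin (d t))) := by
  have := congrArg (_root_.leg23 a) h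
  simpa only [leg23_add, leg23_mul, leg23_legL, leg23_legR] using this

section Swap

variable {a a' b b' c c' : Type*} [Fintype a] [Fintype a'] [Fintype b] [Fintype b'] [Fintype c]
  [Fintype c'] [DecidableEq a] [DecidableEq a'] [DecidableEq b] [DecidableEq b'] [DecidableEq c]
  [DecidableEq c']

theorem entriesCommute_swapM (B : Matrix a a' E) : EntriesCommute (swapM E b c) B := by
  rw [← scal_swapM]
  exact entriesCommute_scal _ _

theorem leg13_mul_swap23 (A : Matrix (a × c) (a' × c') E) :
    leg13 b A * leg23 a' (swapM E b c') = leg23 a (swapM E b c) * leg12 b A := by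
  ext ⟨x1, x2, x3⟩ ⟨y1, y2, y3⟩
  simp [leg13, leg23, leg12, swapM, Matrix.mul_apply, Fintype.sum_prod_type, ite_and,
    Finset.sum_ite_irrel]

theorem leg23_mul_swap13 (A : Matrix (b × c) (b' × c') E) :
    leg23 a A * leg13 b' (swapM E a c') = leg13 b (swapM E a c) * leg12 a (flipM A) := by
  ext ⟨x1, x2, x3⟩ ⟨y1, y2, y3⟩
  simp [leg13, leg23, leg12, swapM, flipM, Matrix.mul_apply, Fintype.sum_prod_type, ite_and,
    Finset.sum_ite_irrel]

theorem swap13_mul_leg23 (A : Matrix (b × a) (b' × a') E) :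
    leg13 b (swapM E a c) * leg23 c A = leg12 c (flipM A) * leg13 b' (swapM E a' c) := by
  ext ⟨x1, x2, x3⟩ ⟨y1, y2, y3⟩
  simp [leg13, leg23, leg12, swapM, flipM, Matrix.mul_apply, Fintype.sum_prod_type, ite_and,
    Finset.sum_ite_irrel]

theorem swap23_mul_leg13 (A : Matrix (a × b) (a' × b') E) :
    leg23 a (swapM E b c) * leg13 c A = leg12 c A * leg23 a' (swapM E b' c) := by
  ext ⟨x1, x2, x3⟩ ⟨y1, y2, y3⟩
  simp [leg13, leg23, leg12, swapM, Matrix.mul_apply, Fintype.sum_prod_type, ite_and,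
    Finset.sum_ite_irrel]

theorem swap12_mul_swap13_mul_leg2 (B : Matrix a b E) :
    leg12 c (swapM E a a) * (leg13 a (swapM E a c) * leg2 c a B) =
      leg23 a (swapM E a c) * (leg1 c a B * leg12 a (swapM E b c)) := by
  ext ⟨x1, x2, x3⟩ ⟨y1, y2, y3⟩
  simp [leg13, leg23, leg12, leg1, leg2, swapM, Matrix.mul_apply, Fintype.sum_prod_type, ite_and,
    Finset.sum_ite_irrel]
  split_ifs <;> simp_all

end Swap

/-- Both R D₁D₂ and D₂D₁R₂₁ are moved across X₃ by applying the relation between D and X twice. The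
homogeneous terms match by the Yang–Baxter equation and the terms linear in D cancel by the Hecke
condition, so the defect passes X with no constant term. -/
theorem IsWeyl.qMatDefect_comm (hq : q ≠ 0) (h : IsWeyl q d X D) :
    leg12 (Fin (d t)) (qMatDefect q d D) * (_root_.leg13 (Fin (d t)) (RE E q⁻¹ d t t) *
        (_root_.leg23 (Fin (d t)) (RE E q⁻¹ d t t) * leg3 (Fin (d t)) (Fin (d t)) X)) =
      leg3 (Fin (d s)) (Fin (d s)) X * (_root_.leg23 (Fin (d s)) (RE E q d s s) *
        (_root_.leg13 (Fin (d s)) (RE E q d s s) * leg12 (Fin (d s)) (qMatDefect q d D))) := by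
  have eA : leg1 (Fin (d s)) (Fin (d t)) D * (leg2 (Fin (d t)) (Fin (d t)) D * (_root_.leg13 (Fin (d t)) (RE E q⁻¹ d t t) *
      (_root_.leg23 (Fin (d t)) (RE E q⁻¹ d t t) * leg3 (Fin (d t)) (Fin (d t)) X))) =
      leg3 (Fin (d s)) (Fin (d s)) X * (_root_.leg13 (Fin (d s)) (RE E q d s s) * (_root_.leg23 (Fin (d s)) (RE E q d s s) *
        (leg1 (Fin (d s)) (Fin (d s)) D * leg2 (Fin (d t)) (Fin (d s)) D))) +
      leg12 (Fin (d t)) (flipM (RE E q d s s)) * (_root_.leg13 (Fin (d s)) (swapM E (Fin (d s)) (Fin (d t))) * leg2 (Fin (d t)) (Fin (d s)) D) +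
      _root_.leg23 (Fin (d s)) (swapM E (Fin (d s)) (Fin (d t))) * (leg1 (Fin (d t)) (Fin (d s)) D * leg12 (Fin (d s)) (RE E q⁻¹ d t t)) := by
    rw [← mul_eq_mul_assoc (entriesCommute_RE _ _ _ _ _).leg13_leg2, h.leg23, Matrix.mul_add,
      Matrix.mul_add, leg13_mul_swap23, ← mul_eq_mul_assoc (entriesCommute_swapM _).leg23_leg1,
      mul_mul_eq_assoc (h.leg13 (Fin (d s))), Matrix.add_mul, Matrix.mul_assoc, Matrix.mul_assoc,
      ← mul_eq_mul_assoc (entriesCommute_RE _ _ _ _ _).leg23_leg1,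
      mul_eq_mul_assoc (swap13_mul_leg23 _)]
  have eB : leg2 (Fin (d s)) (Fin (d t)) D * (leg1 (Fin (d t)) (Fin (d t)) D * (_root_.leg23 (Fin (d t)) (RE E q⁻¹ d t t) *
      (_root_.leg13 (Fin (d t)) (RE E q⁻¹ d t t) * leg3 (Fin (d t)) (Fin (d t)) X))) =
      leg3 (Fin (d s)) (Fin (d s)) X * (_root_.leg23 (Fin (d s)) (RE E q d s s) * (_root_.leg13 (Fin (d s)) (RE E q d s s) *
        (leg2 (Fin (d s)) (Fin (d s)) D * leg1 (Fin (d t)) (Fin (d s)) D))) +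
      leg12 (Fin (d t)) (RE E q d s s) * (_root_.leg23 (Fin (d s)) (swapM E (Fin (d s)) (Fin (d t))) * leg1 (Fin (d t)) (Fin (d s)) D) +
      _root_.leg13 (Fin (d s)) (swapM E (Fin (d s)) (Fin (d t))) * (leg2 (Fin (d t)) (Fin (d s)) D * leg12 (Fin (d s)) (flipM (RE E q⁻¹ d t t))) := by
    rw [← mul_eq_mul_assoc (entriesCommute_RE _ _ _ _ _).leg23_leg1, h.leg13, Matrix.mul_add,
      Matrix.mul_add, leg23_mul_swap13, ← mul_eq_mul_assoc (entriesCommute_swapM _).leg13_leg2,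
      mul_mul_eq_assoc (h.leg23 (Fin (d s))), Matrix.add_mul, Matrix.mul_assoc, Matrix.mul_assoc,
      ← mul_eq_mul_assoc (entriesCommute_RE _ _ _ _ _).leg13_leg2,
      mul_eq_mul_assoc (swap23_mul_leg13 _)]
  have e1 : leg12 (Fin (d t)) (qMatDefect q d D) = leg12 (Fin (d t)) (RE E q d s s) * (leg1 (Fin (d s)) (Fin (d t)) D * leg2 (Fin (d t)) (Fin (d t)) D) -
      leg2 (Fin (d s)) (Fin (d t)) D * (leg1 (Fin (d t)) (Fin (d t)) D * leg12 (Fin (d t)) (flipM (RE E q d t t))) := by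
    rw [qMatDefect, leg12_sub, leg12_mul, leg12_mul, leg12_mul, leg12_mul, leg12_legL, leg12_legR,
      leg12_legL, leg12_legR]
  have e2 : leg12 (Fin (d s)) (qMatDefect q d D) = leg12 (Fin (d s)) (RE E q d s s) * (leg1 (Fin (d s)) (Fin (d s)) D * leg2 (Fin (d t)) (Fin (d s)) D) -
      leg2 (Fin (d s)) (Fin (d s)) D * (leg1 (Fin (d t)) (Fin (d s)) D * leg12 (Fin (d s)) (flipM (RE E q d t t))) := by
    rw [qMatDefect, leg12_sub, leg12_mul, leg12_mul, leg12_mul, leg12_mul, leg12_legL, leg12_legR,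
      leg12_legL, leg12_legR]
  have hyb := flipM_yangBaxter_inv (E := E) (d := d) hq t
  have hc : leg12 (Fin (d t)) (flipM (RE E q d t t)) * leg3 (Fin (d t)) (Fin (d t)) X =
      leg3 (Fin (d t)) (Fin (d t)) X * leg12 (Fin (d s)) (flipM (RE E q d t t)) := by
    rw [RE, flipM_scal]
    exact (entriesCommute_scal _ _).leg12_leg3
  have eB' : leg12 (Fin (d t)) (flipM (RE E q d t t)) * (_root_.leg13 (Fin (d t)) (RE E q⁻¹ d t t) *
      (_root_.leg23 (Fin (d t)) (RE E q⁻¹ d t t) * leg3 (Fin (d t)) (Fin (d t)) X)) =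
      _root_.leg23 (Fin (d t)) (RE E q⁻¹ d t t) * (_root_.leg13 (Fin (d t)) (RE E q⁻¹ d t t) *
      (leg3 (Fin (d t)) (Fin (d t)) X * leg12 (Fin (d s)) (flipM (RE E q d t t)))) := by
    rw [← hc]
    have := congrArg (fun Z => Z * leg3 (Fin (d t)) (Fin (d t)) X) hyb
    simpa only [Matrix.mul_assoc] using this
  have eB2 := congrArg (fun Z => Z * leg12 (Fin (d s)) (flipM (RE E q d t t))) eB
  simp only [Matrix.mul_assoc, Matrix.add_mul] at eB2
  rw [← leg12_mul, flipM_RE_inv_mul hq, leg12_one, Matrix.mul_one] at eB2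
  rw [e1, e2, Matrix.sub_mul]
  simp only [Matrix.mul_assoc]
  rw [eA, eB', eB2]
  have hR := leg_yangBaxter (E := E) (d := d) hq s s s
  have e3 : leg12 (Fin (d t)) (RE E q d s s) * (leg3 (Fin (d s)) (Fin (d s)) X * (_root_.leg13 (Fin (d s)) (RE E q d s s) *
      (_root_.leg23 (Fin (d s)) (RE E q d s s) * (leg1 (Fin (d s)) (Fin (d s)) D * leg2 (Fin (d t)) (Fin (d s)) D)))) =
      leg3 (Fin (d s)) (Fin (d s)) X * (_root_.leg23 (Fin (d s)) (RE E q d s s) * (_root_.leg13 (Fin (d s)) (RE E q d s s) *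
        (leg12 (Fin (d s)) (RE E q d s s) * (leg1 (Fin (d s)) (Fin (d s)) D * leg2 (Fin (d t)) (Fin (d s)) D)))) := by
    rw [mul_eq_mul_assoc (entriesCommute_RE _ _ _ _ _).leg12_leg3]
    have := congrArg (fun Z => leg3 (Fin (d s)) (Fin (d s)) X * (Z * (leg1 (Fin (d s)) (Fin (d s)) D * leg2 (Fin (d t)) (Fin (d s)) D))) hR
    simpa only [Matrix.mul_assoc] using this
  -- The Hecke condition gives RR₂₁ = 1 + (q − q⁻¹)RP at s here, and R⁻¹ = R₂₁ − (q − q⁻¹)P at t in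
  -- the next identity. The two multiples of q − q⁻¹ then cancel by `swap12_mul_swap13_mul_leg2`.
  have e4 : leg12 (Fin (d t)) (RE E q d s s) * leg12 (Fin (d t)) (flipM (RE E q d s s)) =
      1 + (q - q⁻¹) • (leg12 (Fin (d t)) (RE E q d s s) * leg12 (Fin (d t)) (swapM E (Fin (d s)) (Fin (d s)))) := by
    have h1 := RE_sub_flip (E := E) (q := q) (d := d) s
    have h2 : flipM (RE E q d s s) = RE E q⁻¹ d s s + (q - q⁻¹) • swapM E (Fin (d s)) (Fin (d s)) := by
      have := congrArg flipM h1
      rw [← flipM_swapM (E := E), ← sub_eq_iff_eq_add']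
      exact this
    rw [← leg12_mul, h2, Matrix.mul_add, RE_mul_inv hq, Matrix.mul_smul, ← leg12_mul, ← leg12_smul]
    rw [← leg12_one]
    ext i j
    simp only [leg12, Matrix.add_apply]
    split_ifs <;> simp
  have e5 : leg12 (Fin (d s)) (RE E q⁻¹ d t t) =
      leg12 (Fin (d s)) (flipM (RE E q d t t)) - (q - q⁻¹) • leg12 (Fin (d s)) (swapM E (Fin (d t)) (Fin (d t))) := by
    have h1 := congrArg flipM (RE_sub_flip (E := E) (q := q) (d := d) t)
    rw [← leg12_smul, ← leg12_sub]
    congr 1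
    rw [eq_sub_iff_add_eq, ← eq_sub_iff_add_eq', ← flipM_swapM (E := E)]
    exact h1.symm
  rw [Matrix.mul_sub, Matrix.mul_sub, Matrix.mul_sub, Matrix.mul_add, Matrix.mul_add, e3,
    ← Matrix.mul_assoc (leg12 (Fin (d t)) (RE E q d s s)) (leg12 (Fin (d t)) (flipM _)), e4, e5, Matrix.add_mul,
    Matrix.one_mul]
  simp only [Matrix.mul_sub, Matrix.mul_smul, Matrix.smul_mul, Matrix.mul_assoc]
  rw [swap12_mul_swap13_mul_leg2]
  abel

end WeylQMat

/-! ### Derivations on a cyclic module -/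

section Cyclic

variable {V : Type*} {q : ℂ} {d : V → ℕ} {P : Type*} [AddCommGroup P] [Module ℂ P] {t s : V}

theorem qMatDefect_apply {E : Type*} [Ring E] [Algebra ℂ E] (D : Matrix (Fin (d s)) (Fin (d t)) E)
    (i j : Fin (d s)) (m n : Fin (d t)) : qMatDefect q d D (i, j) (m, n) =
      (if i = j then q else 1) • (D i m * D j n) +
          (if i < j then q - q⁻¹ else 0) • (D j m * D i n) -
        ((if m = n then q else 1) • (D j n * D i m) +
          (if m < n then q - q⁻¹ else 0) • (D j m * D i n)) := by
  rw [qMatDefect, ← Matrix.mul_assoc (legR _ _), Matrix.sub_apply, RE_self_mul_apply,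
    mul_flipM_RE_apply, legL_mul_legR, legL_mul_legR, legR_mul_legL, legR_mul_legL]

/-- The defect annihilates the vacuum, and by `IsWeyl.qMatDefect_comm` its kernel should be stable
under the coordinates. The R-matrices in front of X mix its rows, but only triangularly, so
stability is proved by induction on the row. -/
theorem isQMat_of_isWeyl (hq : q ≠ 0) {X : Matrix (Fin (d t)) (Fin (d s)) (Module.End ℂ P)}
    {D : Matrix (Fin (d s)) (Fin (d t)) (Module.End ℂ P)} (h : IsWeyl q d X D) {vac : P}
    (hvac : ∀ i j, D i j vac = 0)
    (hcyc : ∀ W : Submodule ℂ P, vac ∈ W → (∀ i j, ∀ y ∈ W, X i j y ∈ W) → W = ⊤) :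
    IsQMat q d D := by
  let W : Submodule ℂ P := ⨅ a, ⨅ b, LinearMap.ker (qMatDefect q d D a b)
  have hW : ∀ y, y ∈ W ↔ ∀ a b, qMatDefect q d D a b y = 0 := by simp [W, Submodule.mem_iInf]
  have hX : ∀ (k : Fin (d t)) (c : Fin (d s)), ∀ y ∈ W, X k c y ∈ W := by
    intro k
    induction k using WellFoundedLT.induction with
    | ind k ih =>
    intro c y hy
    rw [hW]
    rintro ⟨i, j⟩ ⟨a, b⟩
    have e := LinearMap.congr_fun (congrFun (congrFun (h.qMatDefect_comm hq) (i, j, k)) (a, b, c)) y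
    have e1 : (leg3 (Fin (d s)) (Fin (d s)) X * (leg23 (Fin (d s)) (RE (Module.End ℂ P) q d s s) *
        (leg13 (Fin (d s)) (RE (Module.End ℂ P) q d s s) *
          leg12 (Fin (d s)) (qMatDefect q d D)))) (i, j, k) (a, b, c) y = 0 := by
      rw [← Matrix.mul_assoc, ← Matrix.mul_assoc, Matrix.mul_apply, LinearMap.sum_apply]
      refine Finset.sum_eq_zero fun p _ => ?_
      rw [Module.End.mul_apply]
      have : leg12 (Fin (d s)) (qMatDefect q d D) p (a, b, c) y = 0 := by
        rw [leg12]
        split_ifs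
        · exact (hW y).1 hy _ _
        · rfl
      rw [this, map_zero]
    rw [e1] at e
    set Z := leg13 (Fin (d t)) (RE (Module.End ℂ P) q⁻¹ d t t) *
      (leg23 (Fin (d t)) (RE (Module.End ℂ P) q⁻¹ d t t) * leg3 (Fin (d t)) (Fin (d t)) X) with hZ
    have h3 : ∀ x1 x2 x3 : Fin (d t), leg3 (Fin (d t)) (Fin (d t)) X (x1, x2, x3) (a, b, c) y =
        if x1 = a ∧ x2 = b then X x3 c y else 0 := by
      intro x1 x2 x3
      rw [leg3]
      split_ifs <;> rfl
    have h3' : ∀ x1 x2 x3 : Fin (d t), x3 < k →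
        leg3 (Fin (d t)) (Fin (d t)) X (x1, x2, x3) (a, b, c) y ∈ W := by
      intro x1 x2 x3 hx
      rw [h3]
      split_ifs
      · exact ih x3 hx c y hy
      · exact W.zero_mem
    -- The component with row index k is a nonzero multiple of X k c y, present only for the
    -- matching indices, plus vectors from smaller rows, already known to lie in the kernel.
    have key : ∀ a' b' : Fin (d t), ∃ w ∈ W, Z (a', b', k) (a, b, c) y =
        (if a' = a ∧ b' = b then ((if a = k then q⁻¹ else 1) * (if b = k then q⁻¹ else 1)) • X k c y
          else 0) + w := by
      intro a' b'
      rw [hZ, leg13_RE_self_mul_apply, leg23_RE_self_mul_apply, leg23_RE_self_mul_apply]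
      simp only [LinearMap.add_apply, LinearMap.smul_apply, smul_add]
      refine ⟨_, ?_, (add_assoc _ _ _).trans (congrArg₂ (· + ·) ?_ rfl)⟩
      · refine W.add_mem (W.smul_mem _ ?_) ?_
        · by_cases hb : b' < k
          · exact W.smul_mem _ (h3' _ _ _ hb)
          · rw [if_neg hb, zero_smul]; exact W.zero_mem
        · by_cases ha : a' < k
          · refine W.add_mem (W.smul_mem _ (W.smul_mem _ (h3' _ _ _ ha))) (W.smul_mem _ ?_)
            by_cases hb : b' < a'
            · exact W.smul_mem _ (h3' _ _ _ (hb.trans ha))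
            · rw [if_neg hb, zero_smul]; exact W.zero_mem
          · rw [if_neg ha, zero_smul, zero_smul, add_zero]; exact W.zero_mem
      · rw [h3]
        by_cases h1 : a' = a ∧ b' = b
        · rw [if_pos h1, if_pos h1, h1.1, h1.2, smul_smul]
        · rw [if_neg h1, if_neg h1, smul_zero, smul_zero]
    choose w hw hw' using key
    have e2 : (leg12 (Fin (d t)) (qMatDefect q d D) * Z) (i, j, k) (a, b, c) y =
        ∑ a', ∑ b', qMatDefect q d D (i, j) (a', b') (Z (a', b', k) (a, b, c) y) := by
      simp [Matrix.mul_apply, leg12, Fintype.sum_prod_type]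
    rw [e2] at e
    have e3 : ∀ a' b', qMatDefect q d D (i, j) (a', b') (Z (a', b', k) (a, b, c) y) =
        if a' = a then (if b' = b then ((if a = k then q⁻¹ else 1) * (if b = k then q⁻¹ else 1)) •
          qMatDefect q d D (i, j) (a, b) (X k c y) else 0) else 0 := by
      intro a' b'
      rw [hw', map_add, (hW _).1 (hw a' b'), add_zero]
      by_cases h1 : a' = a
      · by_cases h2 : b' = b
        · rw [if_pos ⟨h1, h2⟩, if_pos h1, if_pos h2, map_smul, h1, h2]
        · simp [h2]
      · simp [h1]
    simp only [e3, Finset.sum_ite_irrel, Finset.sum_const_zero, Finset.sum_ite_eq',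
      Finset.mem_univ, if_true] at e
    refine (smul_eq_zero.1 e).resolve_left (mul_ne_zero ?_ ?_) <;> split_ifs <;> simp [hq]
  have hv : vac ∈ W := by
    rw [hW]
    rintro ⟨i, j⟩ ⟨m, n⟩
    simp only [qMatDefect_apply, LinearMap.sub_apply, LinearMap.add_apply, LinearMap.smul_apply,
      Module.End.mul_apply, hvac, map_zero, smul_zero, add_zero, sub_zero]
  have htop := hcyc W hv fun i j => hX i j
  have h0 : ∀ a b, qMatDefect q d D a b = 0 := by
    intro a b
    ext y
    exact (hW y).1 (htop ▸ Submodule.mem_top) a b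
  rw [isQMat_iff]
  intro i j m n
  have := h0 (i, j) (m, n)
  rwa [qMatDefect_apply, sub_eq_zero] at this

end Cyclic

/-! ### The algebra of quantum matrices -/

section Coordinate

/-- The relations of the algebra of quantum matrices. -/
inductive CoordRel (q : ℂ) (M N : ℕ) :
    FreeAlgebra ℂ (Fin M × Fin N) → FreeAlgebra ℂ (Fin M × Fin N) → Prop
  | xx (i j : Fin M) (m n : Fin N) (h : j < i) :
      CoordRel q M N (FreeAlgebra.ι ℂ (i, m) * FreeAlgebra.ι ℂ (j, n))
        ((if m = n then q else 1) • (FreeAlgebra.ι ℂ (j, n) * FreeAlgebra.ι ℂ (i, m))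
          + (if m < n then q - q⁻¹ else 0) • (FreeAlgebra.ι ℂ (j, m) * FreeAlgebra.ι ℂ (i, n)))
  | xx_same (i : Fin M) (m n : Fin N) (h : n < m) :
      CoordRel q M N (FreeAlgebra.ι ℂ (i, m) * FreeAlgebra.ι ℂ (i, n))
        (q⁻¹ • (FreeAlgebra.ι ℂ (i, n) * FreeAlgebra.ι ℂ (i, m)))

/-- The algebra of quantum matrices. -/
abbrev CoordAlg (q : ℂ) (M N : ℕ) : Type := RingQuot (CoordRel q M N)

/-- The matrix of generators of the algebra of quantum matrices. -/
def coordM (q : ℂ) (M N : ℕ) : Matrix (Fin M) (Fin N) (CoordAlg q M N) := fun i j =>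
  RingQuot.mkAlgHom ℂ (CoordRel q M N) (FreeAlgebra.ι ℂ (i, j))

variable {V : Type*} {q : ℂ} {d : V → ℕ} {E : Type*} [Ring E] [Algebra ℂ E] {t s : V}

theorem isQMat_coordM (hq : q ≠ 0) (t s : V) : IsQMat q d (coordM q (d t) (d s)) := by
  refine isQMat_of_relations hq (fun i j m n h => ?_) (fun i m n h => ?_)
  · have h := RingQuot.mkAlgHom_rel ℂ (CoordRel.xx (q := q) i j m n h)
    simp only [map_add, map_smul, map_mul] at h
    exact h
  · simpa [coordM] using RingQuot.mkAlgHom_rel ℂ (CoordRel.xx_same (q := q) i m n h)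

/-- The homomorphism given by a quantum matrix. -/
def coordLift (hq : q ≠ 0) {X : Matrix (Fin (d t)) (Fin (d s)) E} (hX : IsQMat q d X) :
    CoordAlg q (d t) (d s) →ₐ[ℂ] E :=
  RingQuot.liftAlgHom ℂ ⟨FreeAlgebra.lift ℂ fun c => X c.1 c.2, by
    intro a b hab
    cases hab with
    | xx i j m n h =>
      simp only [map_add, map_smul, map_mul, FreeAlgebra.lift_ι_apply]
      exact hX.relation m n h
    | xx_same i m n h =>
      simp only [map_smul, map_mul, FreeAlgebra.lift_ι_apply]
      exact hX.relation_same hq i h⟩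

theorem coordLift_coordM (hq : q ≠ 0) {X : Matrix (Fin (d t)) (Fin (d s)) E} (hX : IsQMat q d X)
    (i : Fin (d t)) (j : Fin (d s)) : coordLift hq hX (coordM q (d t) (d s) i j) = X i j := by
  simp [coordLift, coordM]

theorem coordAlg_adjoin (q : ℂ) (M N : ℕ) :
    Algebra.adjoin ℂ (Set.range fun c : Fin M × Fin N => coordM q M N c.1 c.2) = ⊤ := by
  rw [eq_top_iff]
  rintro z -
  obtain ⟨y, rfl⟩ := RingQuot.mkAlgHom_surjective ℂ (CoordRel q M N) z
  induction y using FreeAlgebra.induction with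
  | grade0 r => rw [AlgHom.commutes]; exact Subalgebra.algebraMap_mem _ _
  | grade1 x => exact Algebra.subset_adjoin ⟨x, rfl⟩
  | mul a b ha hb => rw [map_mul]; exact mul_mem ha hb
  | add a b ha hb => rw [map_add]; exact add_mem ha hb

theorem coordAlg_hom_ext {M N : ℕ} {f g : CoordAlg q M N →ₐ[ℂ] E}
    (h : ∀ i j, f (coordM q M N i j) = g (coordM q M N i j)) : f = g := by
  apply AlgHom.ext_of_adjoin_eq_top (coordAlg_adjoin q M N)
  rintro _ ⟨c, rfl⟩
  exact h _ _

theorem smashM_source_apply (hts : t ≠ s) (X : Matrix (Fin (d t)) (Fin (d s)) E) (i : Fin (d t))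
    (m K K' : Fin (d s)) : smashM q d s X i m K K' =
      (if K = K' then (if K' = m then q else 1) • X i m else 0) +
        (if K = m ∧ m < K' then (q - q⁻¹) • X i K' else 0) := by
  have : smashM q d s X i m K K' = unnest (smashM q d s X) (K, i) (K', m) := rfl
  rw [this, unnest_smashM, RE_of_ne hts.symm, Matrix.one_mul, mul_RE_self_apply]
  simp only [legR, ite_and]
  by_cases h1 : K = K' <;> by_cases h2 : K = m <;> by_cases h3 : m < K' <;> simp [h1, h2, h3]

theorem smashM_target_apply (hts : t ≠ s) (X : Matrix (Fin (d t)) (Fin (d s)) E)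
    (i K K' : Fin (d t)) (m : Fin (d s)) : smashM q d t X i m K K' =
      (if K = K' then (if K = i then q⁻¹ else 1) • X i m else 0) -
        (if K < i ∧ i = K' then (q - q⁻¹) • X K m else 0) := by
  have : smashM q d t X i m K K' = unnest (smashM q d t X) (K, i) (K', m) := rfl
  rw [this, unnest_smashM, RE_of_ne hts, Matrix.mul_one, RE_self_mul_apply, inv_inv]
  simp only [legR, ite_and]
  rw [← neg_sub q q⁻¹]
  by_cases h2 : i = K'
  · subst h2
    by_cases h1 : K = i <;> by_cases h3 : K < i <;> simp [h1, h3, sub_eq_add_neg]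
    module
  · by_cases h1 : K = K' <;> by_cases h3 : K < i <;> simp [h1, h2, h3]

/-- The coaction which defines the derivations. -/
def blockM (q : ℂ) (d : V → ℕ) {t s : V} (X : Matrix (Fin (d t)) (Fin (d s)) E) :
    Matrix (Fin (d t)) (Fin (d s)) (Matrix (Fin (d s) ⊕ Fin (d t)) (Fin (d s) ⊕ Fin (d t)) E) :=
  fun i m => Matrix.fromBlocks (smashM q d s X i m) (Matrix.single m i 1) 0 (smashM q d t X i m)

/-- A block triangular homomorphism encodes a twisted derivation P with P(xy) = τ_s(x)P(y) +
P(x)τ_t(y). The diagonal blocks are the coactions already treated, so only compatibility of the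
upper right block, constant on generators, with the quadratic relations remains. -/
theorem isQMat_blockM (hq : q ≠ 0) (hts : t ≠ s) {X : Matrix (Fin (d t)) (Fin (d s)) E}
    (hX : IsQMat q d X) : IsQMat q d (blockM q d X) := by
  rw [isQMat_iff]
  intro i j m n
  have h1 := isQMat_iff.1 (isQMat_smashM hq s hts hX) i j m n
  have h2 := isQMat_iff.1 (isQMat_smashM hq t hts hX) i j m n
  simp only [blockM, Matrix.fromBlocks_multiply, Matrix.fromBlocks_smul, Matrix.fromBlocks_add,
    zero_mul, mul_zero, Matrix.zero_mul, Matrix.mul_zero, add_zero, zero_add, smul_zero, h1, h2]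
  congr 1
  have hA : ∀ (i j : Fin (d t)) (m n : Fin (d s)) K L,
      (smashM q d s X i m * Matrix.single n j (1 : E)) K L =
        if j = L then (if K = n then (if m = n then q else 1) • X i m else 0) +
          (if K = m then (if m < n then (q - q⁻¹) • X i n else 0) else 0) else 0 := by
    intro i j m n K L
    simp [Matrix.mul_apply, Matrix.single_apply, ite_and, smashM_source_apply hts, eq_comm]
  have hD : ∀ (i j : Fin (d t)) (m n : Fin (d s)) K L,
      (Matrix.single m i (1 : E) * smashM q d t X j n) K L =
        if K = m then (if i = L then (if i = j then q⁻¹ else 1) • X j n else 0) -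
          (if j = L then (if i < j then (q - q⁻¹) • X i n else 0) else 0) else 0 := by
    intro i j m n K L
    simp only [Matrix.mul_apply, Matrix.single_apply, ite_and, ite_mul, one_mul, zero_mul,
      Finset.sum_ite_eq, Finset.mem_univ, if_true, smashM_target_apply hts]
    by_cases h1 : K = m
    · subst h1
      by_cases h2 : j = L <;> by_cases h3 : i < j <;> simp [h2, h3]
    · simp [h1, Ne.symm h1]
  ext K L
  simp only [Matrix.add_apply, Matrix.smul_apply, hA, hD]
  clear hA hD h1 h2 hX
  -- Both sides depend only on coincidences of indices and on the order of i, j and of m, n; each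
  -- resulting case is a scalar identity in q.
  by_cases k1 : K = m <;> by_cases k2 : K = n <;> by_cases k3 : i = L <;> by_cases k4 : j = L
  all_goals
    rcases lt_trichotomy i j with h | h | h <;> rcases lt_trichotomy m n with h' | h' | h'
  all_goals try subst k1
  all_goals try subst k2
  all_goals try subst k3
  all_goals try subst k4
  all_goals try subst h
  all_goals try subst h'
  all_goals first
    | (exfalso; order)
    | (simp [*]; done)
    | (simp [*, h.ne, h.ne', h.not_gt]; done)
    | (simp [*, h'.ne, h'.ne', h'.not_gt]; done)
    | (simp [*, h.ne, h.ne', h.not_gt, h'.ne, h'.ne', h'.not_gt]; done)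
    | (simp [*]; match_scalars <;> field_simp <;> ring1)
    | (simp [*, h.ne, h.ne', h.not_gt]; match_scalars <;> field_simp <;> ring1)
    | (simp [*, h'.ne, h'.ne', h'.not_gt]; match_scalars <;> field_simp <;> ring1)

end Coordinate

/-! ### The Fock representation -/

section Fock

variable {V : Type*} {q : ℂ} {d : V → ℕ} {t s : V}

/-- The homomorphism by which the operators of a vertex act on quantum matrices. -/
def coordSmash (hq : q ≠ 0) (d : V → ℕ) (u : V) {t s : V} (hts : t ≠ s) :
    CoordAlg q (d t) (d s) →ₐ[ℂ] Matrix (Fin (d u)) (Fin (d u)) (CoordAlg q (d t) (d s)) :=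
  coordLift hq (isQMat_smashM hq u hts (isQMat_coordM (d := d) hq t s))

theorem coordSmash_coordM (hq : q ≠ 0) (u : V) (hts : t ≠ s) (i : Fin (d t)) (j : Fin (d s)) :
    coordSmash hq d u hts (coordM q (d t) (d s) i j) =
      smashM q d u (coordM q (d t) (d s)) i j := coordLift_coordM ..

/-- The coaction of quantum matrices which defines the derivations. -/
def coordBlock (hq : q ≠ 0) (d : V → ℕ) {t s : V} (hts : t ≠ s) :
    CoordAlg q (d t) (d s) →ₐ[ℂ]
      Matrix (Fin (d s) ⊕ Fin (d t)) (Fin (d s) ⊕ Fin (d t)) (CoordAlg q (d t) (d s)) :=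
  coordLift hq (isQMat_blockM hq hts (isQMat_coordM (d := d) hq t s))

theorem coordBlock_coordM (hq : q ≠ 0) (hts : t ≠ s) (i : Fin (d t)) (j : Fin (d s)) :
    coordBlock hq d hts (coordM q (d t) (d s) i j) =
      blockM q d (coordM q (d t) (d s)) i j := coordLift_coordM ..

theorem coordBlock_target (hq : q ≠ 0) (hts : t ≠ s) (y : CoordAlg q (d t) (d s)) :
    (coordBlock hq d hts y).toBlocks₂₁ = 0 ∧
      (coordBlock hq d hts y).toBlocks₂₂ = coordSmash hq d t hts y := by
  have hy : y ∈ Algebra.adjoin ℂ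
      (Set.range fun c : Fin (d t) × Fin (d s) => coordM q (d t) (d s) c.1 c.2) := by
    rw [coordAlg_adjoin]; trivial
  have hb : ∀ y, coordBlock hq d hts y = Matrix.fromBlocks (coordBlock hq d hts y).toBlocks₁₁
    (coordBlock hq d hts y).toBlocks₁₂ (coordBlock hq d hts y).toBlocks₂₁
    (coordBlock hq d hts y).toBlocks₂₂ := fun y => (Matrix.fromBlocks_toBlocks _).symm
  induction hy using Algebra.adjoin_induction with
  | mem y hy =>
    obtain ⟨c, rfl⟩ := hy
    rw [coordBlock_coordM, coordSmash_coordM, blockM, Matrix.toBlocks_fromBlocks₂₁,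
      Matrix.toBlocks_fromBlocks₂₂]
    exact ⟨rfl, rfl⟩
  | algebraMap c =>
    rw [AlgHom.commutes, AlgHom.commutes]
    constructor
    · ext i j
      simp [Matrix.toBlocks₂₁, Matrix.algebraMap_matrix_apply]
    · ext i j
      simp [Matrix.toBlocks₂₂, Matrix.algebraMap_matrix_apply]
  | add a b _ _ iha ihb =>
    rw [map_add, map_add, ← iha.2, ← ihb.2]
    exact ⟨(congrArg₂ (· + ·) iha.1 ihb.1).trans (add_zero 0), rfl⟩
  | mul a b _ _ iha ihb =>
    rw [map_mul, map_mul, hb a, hb b, Matrix.fromBlocks_multiply, iha.1, ihb.1, iha.2, ihb.2,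
      Matrix.toBlocks_fromBlocks₂₁, Matrix.toBlocks_fromBlocks₂₂]
    simp

/-- The underlying space of the Fock representation. -/
abbrev Fock (q : ℂ) (M N : ℕ) : Type := CoordAlg q M N ⧸ (⊥ : Submodule ℂ (CoordAlg q M N))

theorem mul_mem_bot {A : Type*} [Ring A] [Algebra ℂ A] :
    ∀ a : A, ∀ y ∈ (⊥ : Submodule ℂ A), a * y ∈ (⊥ : Submodule ℂ A) := by
  intro a y hy
  rw [Submodule.mem_bot] at hy ⊢
  rw [hy, mul_zero]

theorem map_entry_mem_bot {A w : Type*} [Ring A] [Algebra ℂ A] [Fintype w] [DecidableEq w]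
    (τ : A →ₐ[ℂ] Matrix w w A) :
    ∀ y ∈ (⊥ : Submodule ℂ A), ∀ i j, τ y i j ∈ (⊥ : Submodule ℂ A) := by
  intro y hy i j
  rw [Submodule.mem_bot] at hy ⊢
  rw [hy, map_zero, Matrix.zero_apply]

/-- Multiplication by the coordinates on the Fock space. -/
def fockX (q : ℂ) (M N : ℕ) : Matrix (Fin M) (Fin N) (Module.End ℂ (Fock q M N)) :=
  (coordM q M N).map (quotMul ⊥ mul_mem_bot)

/-- The operators of a vertex on the Fock space. -/
def fockT (hq : q ≠ 0) (d : V → ℕ) {t s : V} (hts : t ≠ s) (u : V) :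
    Matrix (Fin (d u)) (Fin (d u)) (Module.End ℂ (Fock q (d t) (d s))) :=
  quotOp ⊥ (coordSmash hq d u hts) (map_entry_mem_bot _)

/-- The derivations on the Fock space, up to the operators of the target. -/
def fockP (hq : q ≠ 0) (d : V → ℕ) {t s : V} (hts : t ≠ s) :
    Matrix (Fin (d s)) (Fin (d t)) (Module.End ℂ (Fock q (d t) (d s))) := fun i j =>
  quotOp ⊥ (coordBlock hq d hts) (map_entry_mem_bot _) (Sum.inl i) (Sum.inr j)

/-- The vacuum of the Fock space. -/
def fockVac (q : ℂ) (M N : ℕ) : Fock q M N := Submodule.mkQ ⊥ 1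

theorem isSmashModule_fock (hq : q ≠ 0) (hts : t ≠ s) :
    IsSmashModule q d (κ := Unit) (t := fun _ => t) (s := fun _ => s) (fockT hq d hts)
      (fun _ => fockX q (d t) (d s)) (fockVac q (d t) (d s)) := by
  refine isSmashModule_quot (κ := Unit) (t := fun _ => t) (s := fun _ => s)
    (G := fun _ => coordM q (d t) (d s)) ?_ (fun u _ i j => coordSmash_coordM hq u hts i j)
    mul_mem_bot (fun u => map_entry_mem_bot _)
  rw [eq_top_iff, ← coordAlg_adjoin]
  apply Algebra.adjoin_mono
  rintro _ ⟨c, rfl⟩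
  exact ⟨(), c.1, c.2, rfl⟩

theorem fockP_vac (hq : q ≠ 0) (hts : t ≠ s) (i : Fin (d s)) (j : Fin (d t)) :
    fockP hq d hts i j (fockVac q (d t) (d s)) = 0 := by
  rw [fockP, fockVac, quotOp_mk, map_one, Matrix.one_apply_ne (by simp), map_zero]

/-- This is the twisted Leibniz rule applied to a generator times y. It is the relation between D
and X except for T at the target, which appears where the identity is wanted and will be divided
out. -/
theorem fockP_comm (hq : q ≠ 0) (hts : t ≠ s) :
    legL (Fin (d t)) (fockP hq d hts) * legR (Fin (d t)) (fockX q (d t) (d s)) =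
      legR (Fin (d s)) (fockX q (d t) (d s)) *
        (RE (Module.End ℂ (Fock q (d t) (d s))) q d s s * legL (Fin (d s)) (fockP hq d hts)) +
      swapM (Module.End ℂ (Fock q (d t) (d s))) (Fin (d s)) (Fin (d t)) * legL (Fin (d s)) (fockT hq d hts t) := by
  ext1 ⟨K, i⟩ ⟨L, m⟩
  refine LinearMap.ext fun y => ?_
  obtain ⟨y, rfl⟩ := Submodule.mkQ_surjective _ y
  have e1 : ∀ i m K L, fockP hq d hts K L (fockX q (d t) (d s) i m (Submodule.mkQ ⊥ y)) =
      ∑ K', (Submodule.mkQ ⊥ (smashM q d s (coordM q (d t) (d s)) i m K K' *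
        coordBlock hq d hts y (Sum.inl K') (Sum.inr L)) : Fock q (d t) (d s)) +
      if K = m then fockT hq d hts t i L (Submodule.mkQ ⊥ y) else 0 := by
    intro i m K L
    rw [fockX, Matrix.map_apply, quotMul_mk, fockP, quotOp_mk, map_mul, coordBlock_coordM,
      Matrix.mul_apply, Fintype.sum_sum_type, map_add, map_sum]
    congr 1
    have h2 : ∀ x, coordBlock hq d hts y (Sum.inr x) (Sum.inr L) = coordSmash hq d t hts y x L :=
      fun x => congrFun (congrFun (coordBlock_target hq hts y).2 x) L
    simp only [h2, blockM, Matrix.fromBlocks_apply₁₂, Matrix.single_apply, ite_and, ite_mul, one_mul,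
      zero_mul]
    by_cases h : m = K
    · subst h
      simp only [Finset.sum_ite_eq, Finset.mem_univ, if_true]
      rfl
    · simp [h, Ne.symm h]
  rw [legL_mul_legR, Matrix.add_apply, ← Matrix.mul_assoc]
  simp only [LinearMap.add_apply, Module.End.mul_apply]
  rw [e1]
  congr 1
  · have e2 : ∀ K', (legR (Fin (d s)) (fockX q (d t) (d s)) *
        RE (Module.End ℂ (Fock q (d t) (d s))) q d s s) (K, i) (K', m) =
        quotMul ⊥ mul_mem_bot (smashM q d s (coordM q (d t) (d s)) i m K K') := by
      intro K'
      rw [mul_RE_self_apply, smashM_source_apply hts, map_add]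
      simp only [legR, fockX, Matrix.map_apply]
      congr 1
      · by_cases h1 : K = K' <;> simp only [h1, if_true, if_false, map_smul, map_zero, smul_zero]
      · by_cases h2 : K = m <;> by_cases h3 : m < K' <;> simp only [h2, h3, if_true, if_false,
          and_self, and_false, false_and, map_smul, map_zero, smul_zero, zero_smul]
    rw [Matrix.mul_apply, Fintype.sum_prod_type, LinearMap.sum_apply]
    refine Finset.sum_congr rfl fun K' _ => ?_
    rw [Finset.sum_eq_single m, e2, legL, if_pos rfl]
    · rfl
    · intro m' _ hm'
      rw [legL, if_neg hm', mul_zero]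
    · exact fun h => absurd (Finset.mem_univ _) h
  · simp only [Matrix.mul_apply, Fintype.sum_prod_type, swapM, legL, ite_and, ite_mul, one_mul,
      zero_mul, mul_ite, mul_zero]
    by_cases h : K = m <;> simp [h, eq_comm]

/-- The derivations on the Fock space. -/
def fockD (hq : q ≠ 0) (d : V → ℕ) {t s : V} (hts : t ≠ s) :
    Matrix (Fin (d s)) (Fin (d t)) (Module.End ℂ (Fock q (d t) (d s))) :=
  fockP hq d hts * Ring.inverse (fockT hq d hts t)

/-- Passing T at the target across X produces only an R⁻¹ on the left, as the source is another
vertex. So T⁻¹ absorbs the R⁻¹ of the wanted relation and also cancels the T next to the flip. -/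
theorem isWeyl_fock (hq : q ≠ 0) {ℓ : ℕ} (hℓ : ℓ ≠ 0) (hqℓ : q ^ ℓ = 1) (hts : t ≠ s) :
    IsWeyl q d (fockX q (d t) (d s)) (fockD hq d hts) := by
  have hm := isSmashModule_fock (d := d) hq hts
  have h := hm.isRTT hq hℓ hqℓ
  have hs := hm.smash () t
  rw [RE_of_ne hts, Matrix.one_mul] at hs
  have e : legL (Fin (d t)) (Ring.inverse (fockT hq d hts t)) *
      (RE (Module.End ℂ (Fock q (d t) (d s))) q⁻¹ d t t *
        legR (Fin (d t)) (fockX q (d t) (d s))) = legR (Fin (d t)) (fockX q (d t) (d s)) *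
      legL (Fin (d s)) (Ring.inverse (fockT hq d hts t)) := by
    have := congrArg (fun Z => legL (Fin (d t)) (Ring.inverse (fockT hq d hts t)) *
      (Z * legL (Fin (d s)) (Ring.inverse (fockT hq d hts t)))) hs
    simp only [Matrix.mul_assoc, h.legL_mul_inv, Matrix.mul_one] at this
    rw [mul_eq_one_assoc (h.legL_inv_mul _ _)] at this
    exact this.symm
  rw [IsWeyl, fockD, legL_mul, legL_mul, Matrix.mul_assoc, e, ← Matrix.mul_assoc, fockP_comm,
    Matrix.add_mul, Matrix.mul_assoc, Matrix.mul_assoc, Matrix.mul_assoc, h.legL_mul_inv,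
    Matrix.mul_one]

theorem fockD_vac (hq : q ≠ 0) {ℓ : ℕ} (hℓ : ℓ ≠ 0) (hqℓ : q ^ ℓ = 1) (hts : t ≠ s)
    (i : Fin (d s)) (j : Fin (d t)) : fockD hq d hts i j (fockVac q (d t) (d s)) = 0 := by
  have hm := isSmashModule_fock (d := d) hq hts
  rw [fockD, Matrix.mul_apply, LinearMap.sum_apply]
  refine Finset.sum_eq_zero fun k _ => ?_
  rw [Module.End.mul_apply, hm.inverse_vac hℓ hqℓ]
  split_ifs
  · exact fockP_vac hq hts i k
  · rw [map_zero]

/-- The quadratic relations of the derivations require no computation here: the Fock space is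
generated from a killed vacuum by the coordinates. -/
theorem isQMat_fockD (hq : q ≠ 0) {ℓ : ℕ} (hℓ : ℓ ≠ 0) (hqℓ : q ^ ℓ = 1) (hts : t ≠ s) :
    IsQMat q d (fockD hq d hts) :=
  isQMat_of_isWeyl hq (isWeyl_fock hq hℓ hqℓ hts) (fockD_vac hq hℓ hqℓ hts)
    fun W h1 h2 => (isSmashModule_fock (d := d) hq hts).cyclic W h1 fun _ => h2

theorem isQMat_fockX (hq : q ≠ 0) (t s : V) : IsQMat q d (fockX q (d t) (d s)) :=
  IsQMat.map (E := CoordAlg q (d t) (d s)) (F := Module.End ℂ (Fock q (d t) (d s)))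
    (quotMul ⊥ mul_mem_bot) (isQMat_coordM hq t s)

/-- The Fock representation. -/
def fockRep (hq : q ≠ 0) {ℓ : ℕ} (hℓ : ℓ ≠ 0) (hqℓ : q ^ ℓ = 1) (M N : ℕ) :
    EdgeAlg q M N →ₐ[ℂ] Module.End ℂ (Fock q M N) :=
  edgeLift (d := pairDim M N) (t := true) (s := false) (E := Module.End ℂ (Fock q M N))
    (X := fockX q M N) (D := fockD hq (pairDim M N) (t := true) (s := false) (by decide : true ≠ false)) hq
    (isQMat_fockX (d := pairDim M N) hq true false)
    (isQMat_fockD (d := pairDim M N) hq hℓ hqℓ (by decide : true ≠ false))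
    (isWeyl_fock (d := pairDim M N) hq hℓ hqℓ (by decide : true ≠ false))

theorem fockRep_edgeX (hq : q ≠ 0) {ℓ : ℕ} (hℓ : ℓ ≠ 0) (hqℓ : q ^ ℓ = 1) {M N : ℕ} (i : Fin M)
    (j : Fin N) : fockRep hq hℓ hqℓ M N (edgeX q i j) = quotMul ⊥ mul_mem_bot (coordM q M N i j) :=
  edgeLift_edgeX (d := pairDim M N) (t := true) (s := false) ..

theorem fockRep_edgePd_vac (hq : q ≠ 0) {ℓ : ℕ} (hℓ : ℓ ≠ 0) (hqℓ : q ^ ℓ = 1) {M N : ℕ}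
    (i : Fin M) (j : Fin N) : fockRep hq hℓ hqℓ M N (edgePd q i j) (fockVac q M N) = 0 := by
  have : fockRep hq hℓ hqℓ M N (edgePd q i j) =
      fockD hq (pairDim M N) (t := true) (s := false) (by decide : true ≠ false) j i :=
    edgeLift_edgePd (d := pairDim M N) (t := true) (s := false) ..
  rw [this]
  exact fockD_vac (d := pairDim M N) (t := true) (s := false) hq hℓ hqℓ (by decide : true ≠ false) j i

/-- The inclusion of the coordinates. -/
def coordIncl (hq : q ≠ 0) (M N : ℕ) : CoordAlg q M N →ₐ[ℂ] EdgeAlg q M N :=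
  coordLift (d := pairDim M N) (t := true) (s := false) hq
    (isQMat_matX (d := pairDim M N) hq true false)

theorem coordIncl_coordM (hq : q ≠ 0) {M N : ℕ} (i : Fin M) (j : Fin N) :
    coordIncl hq M N (coordM q M N i j) = edgeX q i j :=
  coordLift_coordM (d := pairDim M N) (t := true) (s := false) ..

theorem subX_le_range_coordIncl (hq : q ≠ 0) (M N : ℕ) :
    subX q M N ≤ (coordIncl hq M N).range := by
  rw [subX, Algebra.adjoin_le_iff]
  rintro _ ⟨c, rfl⟩
  exact ⟨coordM q M N c.1 c.2, coordIncl_coordM hq c.1 c.2⟩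

theorem fockRep_coordIncl (hq : q ≠ 0) {ℓ : ℕ} (hℓ : ℓ ≠ 0) (hqℓ : q ^ ℓ = 1) {M N : ℕ}
    (a : CoordAlg q M N) : fockRep hq hℓ hqℓ M N (coordIncl hq M N a) = quotMul ⊥ mul_mem_bot a := by
  have : (fockRep hq hℓ hqℓ M N).comp (coordIncl hq M N) = quotMul ⊥ mul_mem_bot :=
    coordAlg_hom_ext fun i j => by
      rw [AlgHom.comp_apply, coordIncl_coordM, fockRep_edgeX]
  exact DFunLike.congr_fun this a

theorem fockRep_vac_of_mem_span_edgePd (hq : q ≠ 0) {ℓ : ℕ} (hℓ : ℓ ≠ 0) (hqℓ : q ^ ℓ = 1)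
    {M N : ℕ} {a : EdgeAlg q M N}
    (ha : a ∈ Submodule.span (EdgeAlg q M N)
      {z : EdgeAlg q M N | ∃ (k : Fin M) (l : Fin N), z = edgePd q k l}) :
    fockRep hq hℓ hqℓ M N a (fockVac q M N) = 0 := by
  induction ha using Submodule.span_induction with
  | mem a ha => obtain ⟨k, l, rfl⟩ := ha; exact fockRep_edgePd_vac hq hℓ hqℓ k l
  | zero => rw [map_zero, LinearMap.zero_apply]
  | add a b _ _ iha ihb => rw [map_add, LinearMap.add_apply, iha, ihb, add_zero]
  | smul b a _ ih => rw [smul_eq_mul, map_mul, Module.End.mul_apply, ih, map_zero]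

/-- On the Fock vacuum a polynomial in the coordinates returns itself, whereas an element of the
left ideal of the derivations gives zero. -/
theorem eq_zero_of_mem_span_edgePd (hq : q ≠ 0) {ℓ : ℕ} (hℓ : ℓ ≠ 0) (hqℓ : q ^ ℓ = 1)
    {M N : ℕ} {a : EdgeAlg q M N} (haX : a ∈ subX q M N)
    (ha : a ∈ Submodule.span (EdgeAlg q M N)
      {z : EdgeAlg q M N | ∃ (k : Fin M) (l : Fin N), z = edgePd q k l}) : a = 0 := by
  obtain ⟨x, rfl⟩ := subX_le_range_coordIncl hq M N haX
  have h := fockRep_vac_of_mem_span_edgePd hq hℓ hqℓ ha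
  erw [fockRep_coordIncl, fockVac, quotMul_mk, mul_one, Submodule.mkQ_apply,
    Submodule.Quotient.mk_eq_zero, Submodule.mem_bot] at h
  rw [h, map_zero]

/-- The augmentation of the algebra of quantum matrices. -/
def coordAug (hq : q ≠ 0) (M N : ℕ) : CoordAlg q M N →ₐ[ℂ] ℂ :=
  coordLift (d := pairDim M N) (t := true) (s := false) hq
    (X := (0 : Matrix (Fin M) (Fin N) ℂ)) (isQMat_iff.2 fun i j m n => by simp)

theorem coordAug_coordM (hq : q ≠ 0) {M N : ℕ} (i : Fin M) (j : Fin N) :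
    coordAug hq M N (coordM q M N i j) = 0 :=
  coordLift_coordM (d := pairDim M N) (t := true) (s := false) ..

/-- Applied to the Fock vacuum, the ideal lands in the span of the images of the ℓ-th powers of
coordinates. The augmentation vanishes on this span but takes the value 1 at the vacuum. -/
theorem one_notMem_edgeIdeal {ℓ : ℕ} (hℓ : 1 < ℓ) (hodd : Odd ℓ) (hq : IsPrimitiveRoot q ℓ)
    (M N : ℕ) : (1 : EdgeAlg q M N) ∉ edgeIdeal q ℓ M N := by
  have hq0 : q ≠ 0 := hq.ne_zero (by omega)
  intro h1
  let ρ := fockRep hq0 (show ℓ ≠ 0 by omega) hq.pow_eq_one M N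
  let φ : Fock q M N →ₗ[ℂ] ℂ := Submodule.liftQ ⊥ (coordAug hq0 M N).toLinearMap bot_le
  let K : Submodule ℂ (Fock q M N) := Submodule.span ℂ {v | ∃ i j y, v = ρ (edgeX q i j ^ ℓ) y}
  -- Centrality of the ℓ-th powers makes their images a submodule.
  have hK : ∀ b, ∀ v ∈ K, ρ b v ∈ K := by
    intro b v hv
    induction hv using Submodule.span_induction with
    | mem v hv =>
      obtain ⟨i, j, y, rfl⟩ := hv
      refine Submodule.subset_span ⟨i, j, ρ b y, ?_⟩
      rw [← Module.End.mul_apply, ← Module.End.mul_apply, ← map_mul, ← map_mul,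
        edgeX_pow_comm hℓ hodd hq]
    | zero => rw [map_zero]; exact zero_mem _
    | add v w _ _ hv hw => rw [map_add]; exact add_mem hv hw
    | smul c v _ hv => rw [map_smul]; exact Submodule.smul_mem _ _ hv
  have key : ∀ a ∈ edgeIdeal q ℓ M N, ρ a (fockVac q M N) ∈ K := by
    intro a ha
    induction ha using Submodule.span_induction with
    | mem a ha =>
      obtain ⟨i, j, rfl | rfl⟩ := ha
      · rw [fockRep_edgePd_vac]; exact zero_mem _
      · exact Submodule.subset_span ⟨i, j, _, rfl⟩
    | zero => rw [map_zero]; exact zero_mem _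
    | add a b _ _ iha ihb => rw [map_add]; exact add_mem iha ihb
    | smul b a ha ih =>
      rw [smul_eq_mul, map_mul, Module.End.mul_apply]
      exact hK b _ ih
  have hφ : K ≤ LinearMap.ker φ := by
    refine Submodule.span_le.2 ?_
    rintro _ ⟨i, j, y, rfl⟩
    obtain ⟨y, rfl⟩ := Submodule.mkQ_surjective _ y
    change φ (fockRep _ _ _ M N (edgeX q i j ^ ℓ) _) = 0
    rw [map_pow, fockRep_edgeX, ← map_pow, quotMul_mk]
    change coordAug hq0 M N _ = 0
    rw [map_mul, map_pow, coordAug_coordM, zero_pow (by omega), zero_mul]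
  have h2 : φ (ρ 1 (fockVac q M N)) = 0 := hφ (key 1 h1)
  rw [map_one] at h2
  have h3 : φ (fockVac q M N) = 1 := map_one (coordAug hq0 M N)
  rw [Module.End.one_apply, h3] at h2
  exact one_ne_zero h2

end Fock

/-! ### Endomorphisms of modules generated by a vacuum -/

section PowSpan

open Algebra Subalgebra

variable {A : Type*} [Ring A] [Algebra ℂ A] {ι : Type*}

/-- The span of the powers of an element with exponents in a given set. -/
def powSpan (S : Set ℕ) (a : A) : Submodule ℂ A := Submodule.span ℂ ((a ^ ·) '' S)

theorem adjoin_singleton_le_powSpan (a : A) :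
    toSubmodule (adjoin ℂ {a}) ≤ powSpan Set.univ a := by
  rw [Algebra.adjoin_eq_span]
  refine Submodule.span_mono ?_
  intro x hx
  obtain ⟨n, rfl⟩ := Submonoid.mem_closure_singleton.1 hx
  exact ⟨n, trivial, rfl⟩

theorem map_powSpan_univ_le {B : Type*} [Ring B] [Algebra ℂ B] (f : A →ₐ[ℂ] B) {ℓ : ℕ} {a : A}
    (h : f (a ^ ℓ) = 0) : (powSpan Set.univ a).map f.toLinearMap ≤
      (powSpan (Set.Iio ℓ) a).map f.toLinearMap := by
  rw [powSpan, Submodule.map_span, Submodule.span_le]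
  rintro _ ⟨_, ⟨n, -, rfl⟩, rfl⟩
  rcases lt_or_ge n ℓ with hn | hn
  · exact Submodule.mem_map_of_mem (Submodule.subset_span ⟨n, hn, rfl⟩)
  · obtain ⟨k, rfl⟩ := Nat.exists_eq_add_of_le hn
    have : f.toLinearMap (a ^ (ℓ + k)) = 0 := by
      rw [AlgHom.toLinearMap_apply, pow_add, map_mul, h, zero_mul]
    dsimp only
    rw [this]
    exact Submodule.zero_mem _

theorem map_list_prod_le {B : Type*} [Ring B] [Algebra ℂ B] (f : A →ₐ[ℂ] B)
    {F G : ι → Submodule ℂ A} (l : List ι)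
    (h : ∀ i, (F i).map f.toLinearMap ≤ (G i).map f.toLinearMap) :
    ((l.map F).prod).map f.toLinearMap ≤ ((l.map G).prod).map f.toLinearMap := by
  induction l with
  | nil => rfl
  | cons a l ih =>
    rw [List.map_cons, List.prod_cons, List.map_cons, List.prod_cons, Submodule.map_mul,
      Submodule.map_mul]
    exact mul_le_mul' (h a) ih

theorem list_prod_powSpan_le {S : Set ℕ} (h0 : 0 ∈ S) (y : ι → A) {l : List ι} (hl : l.Nodup) :
    (l.map fun c => powSpan S (y c)).prod ≤
      Submodule.span ℂ {z | ∃ γ : ι → ℕ, (∀ c, γ c ∈ S) ∧ z = (l.map fun c => y c ^ γ c).prod} := by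
  classical
  induction l with
  | nil =>
    rw [List.map_nil, List.prod_nil, Submodule.one_eq_span, Submodule.span_le,
      Set.singleton_subset_iff]
    exact Submodule.subset_span ⟨fun _ => 0, fun _ => h0, rfl⟩
  | cons c l ih =>
    rw [List.nodup_cons] at hl
    rw [List.map_cons, List.prod_cons]
    refine (mul_le_mul' le_rfl (ih hl.2)).trans ?_
    rw [powSpan, Submodule.span_mul_span, Submodule.span_le]
    rintro _ ⟨_, ⟨n, hn, rfl⟩, _, ⟨γ, hγ, rfl⟩, rfl⟩
    refine Submodule.subset_span ⟨Function.update γ c n, fun c' => ?_, ?_⟩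
    · by_cases h : c' = c
      · subst h; rwa [Function.update_self]
      · rw [Function.update_of_ne h]; exact hγ c'
    · rw [List.map_cons, List.prod_cons, Function.update_self]
      have : l.map (fun c' => y c' ^ Function.update γ c n c') = l.map fun c => y c ^ γ c :=
        List.map_congr_left fun c' hc' => by
          have hcc : c' ≠ c := fun h => hl.1 (h ▸ hc')
          rw [Function.update_of_ne hcc]
      rw [this]

theorem exists_eq_sum_of_mem_mul_powSpan {W : Submodule ℂ A} {ℓ : ℕ} {a x : A}
    (hx : x ∈ W * powSpan (Set.Iio ℓ) a) :
    ∃ g : ℕ → A, (∀ n, g n ∈ W) ∧ x = ∑ n ∈ Finset.range ℓ, g n * a ^ n := by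
  induction hx using Submodule.mul_induction_on' with
  | mem_mul_mem w hw p hp =>
    induction hp using Submodule.span_induction with
    | mem p hp =>
      obtain ⟨n, hn, rfl⟩ := hp
      refine ⟨Pi.single n w, fun m => ?_, ?_⟩
      · by_cases h : m = n
        · subst h; rwa [Pi.single_eq_same]
        · rw [Pi.single_eq_of_ne h]; exact W.zero_mem
      · rw [Finset.sum_eq_single n]
        · simp
        · intro m _ hm; rw [Pi.single_eq_of_ne hm, zero_mul]
        · exact fun h => absurd (Finset.mem_range.2 hn) h
    | zero => exact ⟨0, fun _ => W.zero_mem, by simp⟩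
    | add p p' _ _ ih ih' =>
      obtain ⟨g, hg, e⟩ := ih
      obtain ⟨g', hg', e'⟩ := ih'
      exact ⟨g + g', fun n => W.add_mem (hg n) (hg' n), by
        rw [mul_add, e, e', ← Finset.sum_add_distrib]; simp [add_mul]⟩
    | smul c p _ ih =>
      obtain ⟨g, hg, e⟩ := ih
      exact ⟨c • g, fun n => W.smul_mem _ (hg n), by
        rw [mul_smul_comm, e, Finset.smul_sum]; simp [smul_mul_assoc]⟩
  | add p _ p' _ ih ih' =>
    obtain ⟨g, hg, e⟩ := ih
    obtain ⟨g', hg', e'⟩ := ih'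
    exact ⟨g + g', fun n => W.add_mem (hg n) (hg' n), by
      rw [e, e', ← Finset.sum_add_distrib]; simp [add_mul]⟩

end PowSpan

/-! ### Truncated normal forms, faithfulness and density on vacuum modules -/

section Vacuum

open Algebra Subalgebra

variable {q : ℂ} {M N : ℕ}

theorem edgeOrder_nodup (M N : ℕ) : (edgeOrder M N).Nodup :=
  (edgeOrder_pairwise M N).imp fun {a b} h hab => by
    subst hab
    rcases h with h | ⟨_, h⟩ <;> exact lt_irrefl _ h

/-- Products of coordinates and of powers of derivations less than the `ℓ`-th. -/
def restricted (ℓ : ℕ) (X₀ : Submodule ℂ (EdgeAlg q M N)) (l : List (Fin M × Fin N)) :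
    Submodule ℂ (EdgeAlg q M N) :=
  X₀ * (l.reverse.map fun c => powSpan (Set.Iio ℓ) (dAt q c)).prod

/-- Normal ordering places coordinates before powers of single derivations, and the kernel of f
contains the ℓ-th powers of derivations, so their exponents can be truncated. -/
theorem exists_restricted (hq : q ≠ 0) {ℓ : ℕ} {B : Type*} [Ring B] [Algebra ℂ B]
    (f : EdgeAlg q M N →ₐ[ℂ] B) (h : ∀ c : Fin M × Fin N, f (dAt q c ^ ℓ) = 0)
    {X₀ : Submodule ℂ (EdgeAlg q M N)}
    (hX : (toSubmodule (subX q M N)).map f.toLinearMap ≤ X₀.map f.toLinearMap) (a : EdgeAlg q M N) :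
    ∃ b ∈ restricted ℓ X₀ (edgeOrder M N), f b = f a := by
  have h1 : (⊤ : Submodule ℂ (EdgeAlg q M N)).map f.toLinearMap ≤
      (restricted ℓ X₀ (edgeOrder M N)).map f.toLinearMap := by
    rw [← subX_mul_subD, restricted, Submodule.map_mul, Submodule.map_mul]
    refine mul_le_mul' hX ((Submodule.map_mono (subD_le hq)).trans (map_list_prod_le f _ fun c => ?_))
    exact (Submodule.map_mono (adjoin_singleton_le_powSpan _)).trans (map_powSpan_univ_le f (h c))
  obtain ⟨b, hb, e⟩ := h1 (Submodule.mem_map_of_mem (Submodule.mem_top (x := a)))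
  exact ⟨b, hb, e⟩

variable {P : Type*} [AddCommGroup P] [Module ℂ P] [Module (EdgeAlg q M N) P]
  [IsScalarTower ℂ (EdgeAlg q M N) P] {vac : P}

theorem smul_vac_of_mem_subD (hvac : ∀ c : Fin M × Fin N, dAt q c • vac = 0) {a : EdgeAlg q M N}
    (ha : a ∈ subD q M N) : ∃ z : ℂ, a • vac = z • vac := by
  induction ha using Algebra.adjoin_induction with
  | mem a ha => obtain ⟨c, rfl⟩ := ha; exact ⟨0, by rw [zero_smul]; exact hvac c⟩
  | algebraMap z => exact ⟨z, algebraMap_smul _ _ _⟩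
  | add a b _ _ iha ihb =>
    obtain ⟨z, e⟩ := iha
    obtain ⟨z', e'⟩ := ihb
    exact ⟨z + z', by rw [add_smul, add_smul, e, e']⟩
  | mul a b _ _ iha ihb =>
    obtain ⟨z, e⟩ := iha
    obtain ⟨z', e'⟩ := ihb
    exact ⟨z' * z, by rw [mul_smul, e', smul_comm, e, smul_smul]⟩

theorem smul_vac_mem_span_xMon (hq : q ≠ 0) (hvac : ∀ c : Fin M × Fin N, dAt q c • vac = 0)
    (a : EdgeAlg q M N) :
    a • vac ∈ Submodule.span ℂ (Set.range fun γ => xMon q (edgeOrder M N) γ • vac) := by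
  have ha : a ∈ toSubmodule (subX q M N) * toSubmodule (subD q M N) := by
    rw [subX_mul_subD]; trivial
  induction ha using Submodule.mul_induction_on' with
  | mem_mul_mem x hx y hy =>
    obtain ⟨z, e⟩ := smul_vac_of_mem_subD hvac hy
    rw [mul_smul, e, smul_comm]
    refine Submodule.smul_mem _ _ ?_
    have h1 := (subX_le hq).trans (List.prod_le_prod'
      (fun c _ => adjoin_singleton_le_powSpan (edgeX q c.1 c.2))) hx
    have h2 := list_prod_powSpan_le (Set.mem_univ 0) (fun c : Fin M × Fin N => xAt q c)
      (edgeOrder_nodup M N) h1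
    clear h1 hx
    induction h2 using Submodule.span_induction with
    | mem x hx => obtain ⟨γ, -, rfl⟩ := hx; exact Submodule.subset_span ⟨γ, rfl⟩
    | zero => rw [zero_smul]; exact Submodule.zero_mem _
    | add a b _ _ iha ihb => rw [add_smul]; exact Submodule.add_mem _ iha ihb
    | smul c a _ ih => rw [smul_assoc]; exact Submodule.smul_mem _ _ ih
  | add a _ b _ iha ihb => rw [add_smul]; exact Submodule.add_mem _ iha ihb

/-- The operator is expanded in powers of its rightmost derivation ∂_c with coefficients g n. On
x_c^n times a monomial in the later coordinates, higher powers of ∂_c give zero and lower ones have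
vanishing coefficients by induction, so g n acts by zero, up to a nonzero factor. The induction over
the indices ends with a coordinate part acting on the vacuum. -/
theorem eq_zero_of_smul_xMon {ℓ : ℕ} (hodd : Odd ℓ) (hq : IsPrimitiveRoot q ℓ)
    (hvac : ∀ c : Fin M × Fin N, dAt q c • vac = 0) {X₀ : Submodule ℂ (EdgeAlg q M N)}
    (hX : ∀ a ∈ X₀, a • vac = 0 → a = 0) {l : List (Fin M × Fin N)} (hl : l.Pairwise EdgePrec)
    (hn : l.Nodup) {D : EdgeAlg q M N} (hD : D ∈ restricted ℓ X₀ l)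
    (h : ∀ γ : Fin M × Fin N → ℕ, (∀ c, γ c < ℓ) → D • xMon q l γ • vac = 0) : D = 0 := by
  have hℓ : 0 < ℓ := hodd.pos
  induction l generalizing D with
  | nil =>
    rw [restricted, List.reverse_nil, List.map_nil, List.prod_nil, mul_one] at hD
    refine hX D hD ?_
    have := h (fun _ => 0) fun _ => hℓ
    rwa [xMon, List.map_nil, List.prod_nil, one_smul] at this
  | cons c l ih =>
    have hR : restricted ℓ X₀ (c :: l) = restricted ℓ X₀ l * powSpan (Set.Iio ℓ) (dAt q c) := by
      simp [restricted, mul_assoc]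
    rw [hR] at hD
    obtain ⟨g, hg, rfl⟩ := exists_eq_sum_of_mem_mul_powSpan hD
    have hg0 : ∀ n < ℓ, g n = 0 := by
      intro n
      induction n using Nat.strong_induction_on with
      | h n ihn =>
      intro hnℓ
      refine ih (List.pairwise_cons.1 hl).2 (List.nodup_cons.1 hn).2 (hg n) fun γ hγ => ?_
      have h1 := h (Function.update γ c n) fun c' => by
        by_cases hc : c' = c
        · subst hc; rwa [Function.update_self]
        · rw [Function.update_of_ne hc]; exact hγ c'
      have e1 : xMon q (c :: l) (Function.update γ c n) = xAt q c ^ n * xMon q l γ := by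
        rw [xMon, List.map_cons, List.prod_cons, Function.update_self]
        congr 2
        exact List.map_congr_left fun c' hc' => by
          have hcc : c' ≠ c := fun h => (List.nodup_cons.1 hn).1 (h ▸ hc')
          rw [Function.update_of_ne hcc]
      obtain ⟨h0, hk⟩ := xMon_smul_killed hvac γ hl
      rw [e1, mul_smul, Finset.sum_smul, Finset.sum_eq_single n] at h1
      · have h2 := dAt_pow_smul_xAt_pow_smul hk h0 n 0
        rw [zero_add, pow_zero, one_smul] at h2
        rw [mul_smul, h2, smul_comm] at h1
        refine (smul_eq_zero.1 h1).resolve_left (Finset.prod_ne_zero_iff.2 fun r hr => ?_)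
        rw [Finset.mem_range] at hr
        exact ladder_ne_zero hodd hq _ (by omega) (by omega)
      · intro b hb hbn
        rcases lt_or_gt_of_ne hbn with hbn | hbn
        · rw [ihn b hbn (hbn.trans hnℓ), zero_mul, zero_smul]
        · rw [mul_smul, dAt_pow_smul_xAt_pow_smul_of_lt hk h0 hbn, smul_zero]
      · exact fun h => absurd (Finset.mem_range.2 hnℓ) h
    refine Finset.sum_eq_zero fun n hn => ?_
    rw [hg0 n (Finset.mem_range.1 hn), zero_mul]

/-- Exponents are divided by ℓ with remainder, and centrality collects all ℓ-th powers on the left.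
-/
theorem xMon_eq_mul {ℓ : ℕ} (hℓ : 1 < ℓ) (hodd : Odd ℓ) (hq : IsPrimitiveRoot q ℓ)
    (l : List (Fin M × Fin N)) (γ : Fin M × Fin N → ℕ) :
    xMon q l γ = (l.map fun c => (xAt q c ^ ℓ) ^ (γ c / ℓ)).prod * xMon q l fun c => γ c % ℓ := by
  induction l with
  | nil => simp [xMon]
  | cons c l ih =>
    have hc : ∀ a : EdgeAlg q M N, a * (xAt q c ^ ℓ) ^ (γ c / ℓ) = (xAt q c ^ ℓ) ^ (γ c / ℓ) * a :=
      fun a => (Commute.pow_right (edgeX_pow_comm hℓ hodd hq c.1 c.2 a) _).eq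
    have hz : ∀ a : EdgeAlg q M N, a * (l.map fun c => (xAt q c ^ ℓ) ^ (γ c / ℓ)).prod =
        (l.map fun c => (xAt q c ^ ℓ) ^ (γ c / ℓ)).prod * a := fun a => by
      refine (Commute.list_prod_right _ _ fun x hx => ?_).eq
      obtain ⟨c, -, rfl⟩ := List.mem_map.1 hx
      exact Commute.pow_right (edgeX_pow_comm hℓ hodd hq c.1 c.2 a) _
    simp only [xMon, List.map_cons, List.prod_cons] at ih ⊢
    rw [ih]
    nth_rewrite 1 [← Nat.div_add_mod (γ c) ℓ]
    rw [pow_add, pow_mul]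
    simp only [mul_assoc]
    rw [← mul_assoc (xAt q c ^ (γ c % ℓ)), hz]
    simp only [mul_assoc]

/-- Modulo the central ℓ-th powers the module is spanned by finitely many truncated monomials. An
operator commuting with those powers is determined by its values there, and arbitrary values can be
prescribed. -/
theorem exists_smul_of_comm {ℓ : ℕ} (hℓ : 1 < ℓ) (hodd : Odd ℓ) (hq : IsPrimitiveRoot q ℓ)
    (hvac : ∀ c : Fin M × Fin N, dAt q c • vac = 0) (hgen : ∀ y : P, ∃ a : EdgeAlg q M N, a • vac = y)
    (f : P →ₗ[ℂ] P)
    (hf : ∀ (c : Fin M × Fin N) (y : P), f (xAt q c ^ ℓ • y) = xAt q c ^ ℓ • f y) :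
    ∃ D : EdgeAlg q M N, ∀ y, f y = D • y := by
  obtain ⟨κ, hκ, hpick⟩ := pickMon_smul hℓ hodd hq hvac (edgeOrder_pairwise M N)
  choose a ha using fun g : Fin M × Fin N → Fin ℓ =>
    hgen (f (xMon q (edgeOrder M N) (fun c => g c) • vac))
  -- Each summand isolates one truncated monomial, returning κ times the vacuum, and then creates
  -- the prescribed image from the vacuum.
  let D : EdgeAlg q M N := ∑ g, κ⁻¹ • (a g * pickMon q ℓ (edgeOrder M N) fun c => g c)
  have hD : ∀ γ : Fin M × Fin N → ℕ, (∀ c, γ c < ℓ) →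
      f (xMon q (edgeOrder M N) γ • vac) = D • xMon q (edgeOrder M N) γ • vac := by
    intro γ hγ
    have e : γ = fun c => ((fun c => ⟨γ c, hγ c⟩ : Fin M × Fin N → Fin ℓ) c : ℕ) := rfl
    rw [Finset.sum_smul, Finset.sum_eq_single fun c => ⟨γ c, hγ c⟩]
    · rw [smul_assoc, mul_smul, hpick _ _ hγ hγ, if_pos fun _ _ => rfl, smul_comm (a _), ha,
        smul_smul, inv_mul_cancel₀ hκ, one_smul]
    · intro g _ hg
      rw [smul_assoc, mul_smul, hpick _ _ (fun c => (g c).2) hγ, if_neg, smul_zero, smul_zero]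
      intro h
      apply hg
      ext c
      exact (h c (mem_edgeOrder c)).symm
    · exact fun h => absurd (Finset.mem_univ _) h
  have hz : ∀ (l : List (Fin M × Fin N)) (ε : Fin M × Fin N → ℕ) (y : P), f y = D • y →
      f ((l.map fun c => (xAt q c ^ ℓ) ^ ε c).prod • y) =
        D • (l.map fun c => (xAt q c ^ ℓ) ^ ε c).prod • y := by
    intro l ε
    induction l with
    | nil => intro y hy; simpa using hy
    | cons c l ih =>
      intro y hy
      rw [List.map_cons, List.prod_cons, mul_smul]
      have hp : ∀ n : ℕ, ∀ y : P, f y = D • y →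
          f ((xAt q c ^ ℓ) ^ n • y) = D • (xAt q c ^ ℓ) ^ n • y := by
        intro n
        induction n with
        | zero => intro y hy; simpa using hy
        | succ n ihn =>
          intro y hy
          have e : D * xAt q c ^ ℓ = xAt q c ^ ℓ * D := edgeX_pow_comm hℓ hodd hq c.1 c.2 D
          rw [pow_succ', mul_smul, hf, ihn y hy, ← mul_smul, ← e, mul_smul]
      exact hp _ _ (ih y hy)
  refine ⟨D, fun y => ?_⟩
  obtain ⟨b, rfl⟩ := hgen y
  have hb := smul_vac_mem_span_xMon (hq.ne_zero (by omega)) hvac b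
  generalize b • vac = y at hb ⊢
  induction hb using Submodule.span_induction with
  | mem y hy =>
    obtain ⟨γ, rfl⟩ := hy
    dsimp only
    rw [xMon_eq_mul hℓ hodd hq, mul_smul]
    exact hz _ _ _ (hD _ fun c => Nat.mod_lt _ (by omega))
  | zero => rw [map_zero, smul_zero]
  | add y z _ _ hy hz => rw [map_add, smul_add, hy, hz]
  | smul c y _ hy => rw [map_smul, hy, smul_comm]

end Vacuum

/-! ### The fibre over zero of an edge algebra -/

theorem map_adjoin_singleton_le {A B : Type*} [Ring A] [Algebra ℂ A] [Ring B] [Algebra ℂ B]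
    (f : A →ₐ[ℂ] B) {ℓ : ℕ} {a : A} (h : f (a ^ ℓ) = 0) :
    (Subalgebra.toSubmodule (Algebra.adjoin ℂ {a})).map f.toLinearMap ≤
      (powSpan (Set.Iio ℓ) a).map f.toLinearMap :=
  (Submodule.map_mono (adjoin_singleton_le_powSpan a)).trans (map_powSpan_univ_le f h)

/-! ### Bases and annihilators of vacuum modules -/

section Cyclic

variable {q : ℂ} {M N : ℕ} {P : Type*} [AddCommGroup P] [Module ℂ P] [Module (EdgeAlg q M N) P]
  [IsScalarTower ℂ (EdgeAlg q M N) P] {vac : P}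

theorem smul_eq_zero_of_central (hgen : ∀ y : P, ∃ a : EdgeAlg q M N, a • vac = y)
    {z : EdgeAlg q M N} (hz : ∀ a, a * z = z * a) (h : z • vac = 0) (y : P) : z • y = 0 := by
  obtain ⟨a, rfl⟩ := hgen y
  rw [← mul_smul, ← hz, mul_smul, h, smul_zero]

theorem edgePd_pow_smul_eq_zero {ℓ : ℕ} (hℓ : 1 < ℓ) (hodd : Odd ℓ) (hq : IsPrimitiveRoot q ℓ)
    (hvac : ∀ c : Fin M × Fin N, dAt q c • vac = 0) (hgen : ∀ y : P, ∃ a : EdgeAlg q M N, a • vac = y)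
    (c : Fin M × Fin N) (y : P) : dAt q c ^ ℓ • y = 0 := by
  refine smul_eq_zero_of_central hgen (edgePd_pow_comm hℓ hodd hq c.1 c.2) ?_ y
  obtain ⟨k, rfl⟩ := Nat.exists_eq_succ_of_ne_zero (by omega : ℓ ≠ 0)
  rw [pow_succ, mul_smul, hvac, smul_zero]

/-- The selecting operator of one monomial kills all other truncated monomials and returns a nonzero
multiple of the vacuum, so it reads off the coefficient. -/
theorem linearIndependent_xMon {ℓ : ℕ} (hℓ : 1 < ℓ) (hodd : Odd ℓ) (hq : IsPrimitiveRoot q ℓ)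
    (hvac : ∀ c : Fin M × Fin N, dAt q c • vac = 0) (h0 : vac ≠ 0) :
    LinearIndependent ℂ fun g : Fin M × Fin N → Fin ℓ =>
      xMon q (edgeOrder M N) (fun c => g c) • vac := by
  obtain ⟨κ, hκ, hpick⟩ := pickMon_smul hℓ hodd hq hvac (edgeOrder_pairwise M N)
  rw [Fintype.linearIndependent_iff]
  intro w hw g
  have h1 := congrArg (fun y => pickMon q ℓ (edgeOrder M N) (fun c => g c) • y) hw
  simp only [Finset.smul_sum, smul_zero] at h1
  rw [Finset.sum_eq_single g] at h1
  · rw [smul_comm, hpick _ _ (fun c => (g c).2) (fun c => (g c).2), if_pos fun _ _ => rfl] at h1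
    simpa [hκ, h0] using h1
  · intro g' _ hg'
    rw [smul_comm, hpick _ _ (fun c => (g c).2) (fun c => (g' c).2), if_neg, smul_zero]
    intro h
    exact hg' (funext fun c => Fin.ext (h c (mem_edgeOrder c)))
  · exact fun h => absurd (Finset.mem_univ _) h

theorem span_xMon_eq_top {ℓ : ℕ} (hℓ : 1 < ℓ) (hodd : Odd ℓ) (hq : IsPrimitiveRoot q ℓ)
    (hvac : ∀ c : Fin M × Fin N, dAt q c • vac = 0) (hgen : ∀ y : P, ∃ a : EdgeAlg q M N, a • vac = y)
    (hx : ∀ (c : Fin M × Fin N) (y : P), xAt q c ^ ℓ • y = 0) :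
    Submodule.span ℂ (Set.range fun g : Fin M × Fin N → Fin ℓ =>
      xMon q (edgeOrder M N) (fun c => g c) • vac) = ⊤ := by
  rw [eq_top_iff]
  rintro y -
  obtain ⟨a, rfl⟩ := hgen y
  refine Submodule.span_le.2 ?_ (smul_vac_mem_span_xMon (hq.ne_zero (by omega)) hvac a)
  rintro _ ⟨γ, rfl⟩
  by_cases hγ : ∀ c, γ c < ℓ
  · exact Submodule.subset_span ⟨fun c => ⟨γ c, hγ c⟩, rfl⟩
  · push Not at hγ
    obtain ⟨c, hc⟩ := hγ
    have key : ∀ (l : List (Fin M × Fin N)) (y : P), c ∈ l →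
        (l.map fun c => (xAt q c ^ ℓ) ^ (γ c / ℓ)).prod • y = 0 := by
      intro l
      induction l with
      | nil => simp
      | cons c' l ih =>
        intro y hcl
        rw [List.map_cons, List.prod_cons, mul_smul]
        rcases List.mem_cons.1 hcl with rfl | hcl
        · have : γ c / ℓ ≠ 0 := (Nat.div_pos hc (by omega)).ne'
          obtain ⟨k, hk⟩ := Nat.exists_eq_succ_of_ne_zero this
          rw [hk, pow_succ', mul_smul, hx]
        · rw [ih _ hcl, smul_zero]
    dsimp only
    rw [xMon_eq_mul hℓ hodd hq, mul_smul, key _ _ (mem_edgeOrder c)]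
    exact Submodule.zero_mem _

/-- The space X₀ is a choice of coordinate parts of normal forms: all coordinates for the module D =
0, and truncated monomials for the zero fibre. What is required is that they are not killed on the
vacuum. -/
theorem map_eq_zero_of_smul_eq_zero {ℓ : ℕ} (hodd : Odd ℓ) (hq : IsPrimitiveRoot q ℓ)
    (hvac : ∀ c : Fin M × Fin N, dAt q c • vac = 0) {B : Type*} [Ring B] [Algebra ℂ B]
    (f : EdgeAlg q M N →ₐ[ℂ] B) (hf : ∀ c : Fin M × Fin N, f (dAt q c ^ ℓ) = 0)
    (hP : ∀ a, f a = 0 → ∀ y : P, a • y = 0) {X₀ : Submodule ℂ (EdgeAlg q M N)}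
    (hX : (Subalgebra.toSubmodule (subX q M N)).map f.toLinearMap ≤ X₀.map f.toLinearMap)
    (hX₀ : ∀ a ∈ X₀, a • vac = 0 → a = 0) {a : EdgeAlg q M N} (ha : ∀ y : P, a • y = 0) :
    f a = 0 := by
  obtain ⟨b, hb, hba⟩ := exists_restricted (hq.ne_zero hodd.pos.ne') f hf hX a
  have hb0 : ∀ y : P, b • y = 0 := fun y => by
    have := hP (b - a) (by rw [map_sub, hba, sub_self]) y
    rwa [sub_smul, ha, sub_zero] at this
  rw [← hba, eq_zero_of_smul_xMon hodd hq hvac hX₀ (edgeOrder_pairwise M N) (edgeOrder_nodup M N) hb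
    fun γ _ => hb0 _, map_zero]

end Cyclic

section ZeroFibre

variable (q : ℂ) (ℓ M N : ℕ)

/-- The left ideal defining the module of the fibre over zero, as a subspace. -/
def zeroIdeal : Submodule ℂ (EdgeAlg q M N) := (edgeIdeal q ℓ M N).restrictScalars ℂ

theorem mul_mem_zeroIdeal (a y : EdgeAlg q M N) (hy : y ∈ zeroIdeal q ℓ M N) :
    a * y ∈ zeroIdeal q ℓ M N := (edgeIdeal q ℓ M N).smul_mem a hy

/-- The module of the fibre over zero. -/
abbrev ZeroMod : Type := EdgeAlg q M N ⧸ zeroIdeal q ℓ M N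

/-- The action of an edge algebra on the module of its fibre over zero. -/
def zeroAct : EdgeAlg q M N →ₐ[ℂ] Module.End ℂ (ZeroMod q ℓ M N) :=
  quotMul (zeroIdeal q ℓ M N) (mul_mem_zeroIdeal q ℓ M N)

instance zeroModModule : Module (EdgeAlg q M N) (ZeroMod q ℓ M N) :=
  Module.compHom _ (zeroAct q ℓ M N).toRingHom

variable {q ℓ M N}

theorem zeroMod_smul_def (a : EdgeAlg q M N) (y : ZeroMod q ℓ M N) : a • y = zeroAct q ℓ M N a y := rfl

instance : IsScalarTower ℂ (EdgeAlg q M N) (ZeroMod q ℓ M N) where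
  smul_assoc c a y := by rw [zeroMod_smul_def, zeroMod_smul_def, map_smul, LinearMap.smul_apply]

theorem zeroMod_smul_vac (a : EdgeAlg q M N) :
    a • (zeroIdeal q ℓ M N).mkQ 1 = (zeroIdeal q ℓ M N).mkQ a := by
  rw [zeroMod_smul_def, zeroAct, quotMul_mk, mul_one]

theorem zeroMod_gen (y : ZeroMod q ℓ M N) :
    ∃ a : EdgeAlg q M N, a • (zeroIdeal q ℓ M N).mkQ 1 = y := by
  obtain ⟨a, rfl⟩ := (zeroIdeal q ℓ M N).mkQ_surjective y
  exact ⟨a, zeroMod_smul_vac a⟩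

theorem dAt_smul_zeroMod_vac (c : Fin M × Fin N) : dAt q c • (zeroIdeal q ℓ M N).mkQ 1 = 0 := by
  rw [zeroMod_smul_vac, Submodule.mkQ_apply, Submodule.Quotient.mk_eq_zero]
  exact Submodule.subset_span ⟨c.1, c.2, Or.inl rfl⟩

theorem zeroMod_vac_ne_zero (hℓ : 1 < ℓ) (hodd : Odd ℓ) (hq : IsPrimitiveRoot q ℓ) :
    (zeroIdeal q ℓ M N).mkQ 1 ≠ 0 := by
  rw [Submodule.mkQ_apply, Ne, Submodule.Quotient.mk_eq_zero]
  exact one_notMem_edgeIdeal hℓ hodd hq M N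

theorem xAt_pow_smul_zeroMod (hℓ : 1 < ℓ) (hodd : Odd ℓ) (hq : IsPrimitiveRoot q ℓ)
    (c : Fin M × Fin N) (y : ZeroMod q ℓ M N) : xAt q c ^ ℓ • y = 0 := by
  refine smul_eq_zero_of_central zeroMod_gen (edgeX_pow_comm hℓ hodd hq c.1 c.2) ?_ y
  rw [zeroMod_smul_vac, Submodule.mkQ_apply, Submodule.Quotient.mk_eq_zero]
  exact Submodule.subset_span ⟨c.1, c.2, Or.inr rfl⟩

theorem dAt_pow_smul_zeroMod (hℓ : 1 < ℓ) (hodd : Odd ℓ) (hq : IsPrimitiveRoot q ℓ)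
    (c : Fin M × Fin N) (y : ZeroMod q ℓ M N) : dAt q c ^ ℓ • y = 0 :=
  edgePd_pow_smul_eq_zero hℓ hodd hq dAt_smul_zeroMod_vac zeroMod_gen c y

theorem zeroAct_surjective (hℓ : 1 < ℓ) (hodd : Odd ℓ) (hq : IsPrimitiveRoot q ℓ) :
    Function.Surjective (zeroAct q ℓ M N) := by
  intro f
  obtain ⟨D, hD⟩ := exists_smul_of_comm hℓ hodd hq dAt_smul_zeroMod_vac zeroMod_gen f fun c y => by
    rw [xAt_pow_smul_zeroMod hℓ hodd hq, xAt_pow_smul_zeroMod hℓ hodd hq, map_zero]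
  exact ⟨D, LinearMap.ext fun y => (hD y).symm⟩

/-- The monomial basis of the module of the fibre over zero. -/
def zeroModBasis (M N : ℕ) (hℓ : 1 < ℓ) (hodd : Odd ℓ) (hq : IsPrimitiveRoot q ℓ) :
    Module.Basis (Fin M × Fin N → Fin ℓ) ℂ (ZeroMod q ℓ M N) :=
  Module.Basis.mk
    (linearIndependent_xMon hℓ hodd hq dAt_smul_zeroMod_vac (zeroMod_vac_ne_zero hℓ hodd hq))
    (span_xMon_eq_top hℓ hodd hq dAt_smul_zeroMod_vac zeroMod_gen
      (xAt_pow_smul_zeroMod hℓ hodd hq)).ge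

theorem zeroAct_pow (hℓ : 1 < ℓ) (hodd : Odd ℓ) (hq : IsPrimitiveRoot q ℓ) (c : Fin M × Fin N) :
    zeroAct q ℓ M N (xAt q c ^ ℓ) = 0 ∧ zeroAct q ℓ M N (dAt q c ^ ℓ) = 0 :=
  ⟨LinearMap.ext fun y => xAt_pow_smul_zeroMod hℓ hodd hq c y,
    LinearMap.ext fun y => dAt_pow_smul_zeroMod hℓ hodd hq c y⟩

/-- The action of the fibre over zero on its module. -/
def edgeFiberAct (M N : ℕ) (hℓ : 1 < ℓ) (hodd : Odd ℓ) (hq : IsPrimitiveRoot q ℓ) :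
    EdgeFiber q ℓ M N →ₐ[ℂ] Module.End ℂ (ZeroMod q ℓ M N) :=
  RingQuot.liftAlgHom ℂ ⟨zeroAct q ℓ M N, by
    rintro a _ ⟨rfl, i, j, rfl | rfl⟩
    · rw [map_zero]; exact (zeroAct_pow hℓ hodd hq (i, j)).1
    · rw [map_zero]; exact (zeroAct_pow hℓ hodd hq (i, j)).2⟩

theorem edgeFiberAct_mk (hℓ : 1 < ℓ) (hodd : Odd ℓ) (hq : IsPrimitiveRoot q ℓ) (a : EdgeAlg q M N) :
    edgeFiberAct M N hℓ hodd hq (RingQuot.mkAlgHom ℂ (EdgeZeroRel q ℓ M N) a) =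
      zeroAct q ℓ M N a := RingQuot.liftAlgHom_mkAlgHom_apply ..

/-- A combination of truncated monomials vanishing on the vacuum has zero coefficients, by linear
independence in the module. -/
theorem eq_zero_of_smul_zeroMod_vac (hℓ : 1 < ℓ) (hodd : Odd ℓ) (hq : IsPrimitiveRoot q ℓ)
    {x : EdgeAlg q M N}
    (hx : x ∈ ((edgeOrder M N).map fun c => powSpan (Set.Iio ℓ) (xAt q c)).prod)
    (h0 : x • (zeroIdeal q ℓ M N).mkQ 1 = 0) : x = 0 := by
  have h2 := list_prod_powSpan_le (S := Set.Iio ℓ) (Set.mem_Iio.2 (by omega))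
    (fun c : Fin M × Fin N => xAt q c) (edgeOrder_nodup M N) hx
  have h3 : x ∈ Submodule.span ℂ (Set.range fun g : Fin M × Fin N → Fin ℓ =>
      xMon q (edgeOrder M N) fun c => g c) := by
    refine Submodule.span_mono ?_ h2
    rintro _ ⟨γ, hγ, rfl⟩
    exact ⟨fun c => ⟨γ c, hγ c⟩, rfl⟩
  obtain ⟨w, rfl⟩ := (Submodule.mem_span_range_iff_exists_fun ℂ).1 h3
  rw [Finset.sum_smul] at h0
  simp only [smul_assoc] at h0
  have h4 := Fintype.linearIndependent_iff.1 (linearIndependent_xMon hℓ hodd hq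
    dAt_smul_zeroMod_vac (zeroMod_vac_ne_zero (M := M) (N := N) hℓ hodd hq)) w h0
  exact Finset.sum_eq_zero fun g _ => by rw [h4, zero_smul]

theorem edgeFiber_mk_pow (q : ℂ) (ℓ : ℕ) (c : Fin M × Fin N) :
    RingQuot.mkAlgHom ℂ (EdgeZeroRel q ℓ M N) (edgeX q c.1 c.2 ^ ℓ) = 0 ∧
      RingQuot.mkAlgHom ℂ (EdgeZeroRel q ℓ M N) (edgePd q c.1 c.2 ^ ℓ) = 0 :=
  ⟨(RingQuot.mkAlgHom_rel (s := EdgeZeroRel q ℓ M N) ℂ ⟨rfl, c.1, c.2, Or.inl rfl⟩).trans (map_zero _),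
    (RingQuot.mkAlgHom_rel (s := EdgeZeroRel q ℓ M N) ℂ ⟨rfl, c.1, c.2, Or.inr rfl⟩).trans (map_zero _)⟩

theorem map_eq_zero_of_smul_zeroMod (hℓ : 1 < ℓ) (hodd : Odd ℓ) (hq : IsPrimitiveRoot q ℓ)
    {B : Type*} [Ring B] [Algebra ℂ B] (f : EdgeAlg q M N →ₐ[ℂ] B)
    (hf : ∀ c : Fin M × Fin N, f (edgeX q c.1 c.2 ^ ℓ) = 0 ∧ f (edgePd q c.1 c.2 ^ ℓ) = 0)
    (hP : ∀ a, f a = 0 → ∀ y : ZeroMod q ℓ M N, a • y = 0) {a : EdgeAlg q M N}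
    (ha : ∀ y : ZeroMod q ℓ M N, a • y = 0) : f a = 0 :=
  map_eq_zero_of_smul_eq_zero (vac := (zeroIdeal q ℓ M N).mkQ 1) hodd hq dAt_smul_zeroMod_vac
    f (fun c => (hf c).2) hP
    ((Submodule.map_mono (subX_le (hq.ne_zero (by omega)))).trans (map_list_prod_le _ _ fun c =>
      map_adjoin_singleton_le f (hf c).1))
    (fun x hx h0 => eq_zero_of_smul_zeroMod_vac hℓ hodd hq hx h0) ha

theorem edgeFiberAct_injective (hℓ : 1 < ℓ) (hodd : Odd ℓ) (hq : IsPrimitiveRoot q ℓ) :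
    Function.Injective (edgeFiberAct M N hℓ hodd hq) := by
  rw [injective_iff_map_eq_zero]
  intro z hz
  obtain ⟨a, rfl⟩ := RingQuot.mkAlgHom_surjective ℂ _ z
  refine map_eq_zero_of_smul_zeroMod (B := EdgeFiber q ℓ M N) hℓ hodd hq (RingQuot.mkAlgHom ℂ (EdgeZeroRel q ℓ M N))
    (edgeFiber_mk_pow q ℓ) (fun a ha y => ?_) fun y => ?_
  · rw [zeroMod_smul_def, ← edgeFiberAct_mk hℓ hodd hq, ha, map_zero, LinearMap.zero_apply]
  · rw [zeroMod_smul_def, ← edgeFiberAct_mk hℓ hodd hq, hz, LinearMap.zero_apply]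

theorem edgeFiberAct_surjective (hℓ : 1 < ℓ) (hodd : Odd ℓ) (hq : IsPrimitiveRoot q ℓ) :
    Function.Surjective (edgeFiberAct M N hℓ hodd hq) := fun f => by
  obtain ⟨a, rfl⟩ := zeroAct_surjective hℓ hodd hq f
  exact ⟨_, edgeFiberAct_mk hℓ hodd hq a⟩

/-- The fibre over zero as the algebra of endomorphisms of its module. -/
def edgeFiberEquiv (M N : ℕ) (hℓ : 1 < ℓ) (hodd : Odd ℓ) (hq : IsPrimitiveRoot q ℓ) :
    EdgeFiber q ℓ M N ≃ₐ[ℂ] Module.End ℂ (ZeroMod q ℓ M N) :=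
  AlgEquiv.ofBijective _ ⟨edgeFiberAct_injective hℓ hodd hq, edgeFiberAct_surjective hℓ hodd hq⟩

theorem finrank_zeroMod (M N : ℕ) (hℓ : 1 < ℓ) (hodd : Odd ℓ) (hq : IsPrimitiveRoot q ℓ) :
    Module.finrank ℂ (ZeroMod q ℓ M N) = ℓ ^ (M * N) := by
  rw [Module.finrank_eq_card_basis (zeroModBasis M N hℓ hodd hq)]
  simp

/-- An endomorphism algebra is a matrix algebra. -/
theorem nonempty_end_algEquiv_matrix {P : Type*} [AddCommGroup P] [Module ℂ P]
    [Module.Finite ℂ P] {n : ℕ} (h : Module.finrank ℂ P = n) :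
    Nonempty (Module.End ℂ P ≃ₐ[ℂ] Matrix (Fin n) (Fin n) ℂ) :=
  ⟨algEquivMatrix (Module.finBasisOfFinrankEq ℂ P h)⟩

theorem edgeFiber_algEquiv_matrix (M N : ℕ) (hℓ : 1 < ℓ) (hodd : Odd ℓ) (hq : IsPrimitiveRoot q ℓ) :
    Nonempty (EdgeFiber q ℓ M N ≃ₐ[ℂ] Matrix (Fin (ℓ ^ (M * N))) (Fin (ℓ ^ (M * N))) ℂ) := by
  have := Module.Finite.of_basis (zeroModBasis M N hℓ hodd hq)
  obtain ⟨e⟩ := nonempty_end_algEquiv_matrix (finrank_zeroMod M N hℓ hodd hq)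
  exact ⟨(edgeFiberEquiv M N hℓ hodd hq).trans e⟩

end ZeroFibre

/-! ### The Azumaya property over the locus where the derivations are nilpotent -/

section EdgeModule

variable {q : ℂ} {ℓ M N : ℕ}

/-- The cyclic vector of the module of functions. -/
def edgeVac (q : ℂ) (M N : ℕ) : EdgeMod q M N := Submodule.Quotient.mk 1

theorem smul_edgeVac (a : EdgeAlg q M N) :
    a • edgeVac q M N = (Submodule.Quotient.mk a : EdgeMod q M N) := by
  rw [edgeVac, ← Submodule.Quotient.mk_smul, smul_eq_mul, mul_one]

theorem edgeMod_gen (y : EdgeMod q M N) : ∃ a : EdgeAlg q M N, a • edgeVac q M N = y := by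
  obtain ⟨a, rfl⟩ := Submodule.Quotient.mk_surjective _ y
  exact ⟨a, smul_edgeVac a⟩

theorem dAt_smul_edgeVac (c : Fin M × Fin N) : dAt q c • edgeVac q M N = 0 := by
  rw [smul_edgeVac, Submodule.Quotient.mk_eq_zero]
  exact Submodule.subset_span ⟨c.1, c.2, rfl⟩

theorem edgePd_pow_smul_edgeMod (hℓ : 1 < ℓ) (hodd : Odd ℓ) (hq : IsPrimitiveRoot q ℓ)
    (c : Fin M × Fin N) (y : EdgeMod q M N) : dAt q c ^ ℓ • y = 0 :=
  edgePd_pow_smul_eq_zero hℓ hodd hq dAt_smul_edgeVac edgeMod_gen c y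

/-- Here the normal forms keep all coordinates; the Fock representation shows that none of them dies
on the vacuum. -/
theorem eq_mk_zero_of_smul_edgeMod (hℓ : 1 < ℓ) (hodd : Odd ℓ) (hq : IsPrimitiveRoot q ℓ)
    {a : EdgeAlg q M N} (h : ∀ y : EdgeMod q M N, a • y = 0) :
    RingQuot.mkAlgHom ℂ (EdgePdRel q ℓ M N) a = 0 := by
  have hdp : ∀ c : Fin M × Fin N, RingQuot.mkAlgHom ℂ (EdgePdRel q ℓ M N) (dAt q c ^ ℓ) = 0 :=
    fun c => (RingQuot.mkAlgHom_rel ℂ ⟨rfl, c.1, c.2, rfl⟩).trans (map_zero _)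
  let ρ : EdgeA q ℓ M N →ₐ[ℂ] Module.End ℂ (EdgeMod q M N) :=
    RingQuot.liftAlgHom ℂ ⟨Algebra.lsmul ℂ ℂ (EdgeMod q M N), by
      rintro a _ ⟨rfl, k, l, rfl⟩
      rw [map_zero]
      exact LinearMap.ext fun y => edgePd_pow_smul_edgeMod hℓ hodd hq (k, l) y⟩
  have hρ : ∀ a (y : EdgeMod q M N), ρ (RingQuot.mkAlgHom ℂ (EdgePdRel q ℓ M N) a) y = a • y :=
    fun a y => LinearMap.congr_fun (RingQuot.liftAlgHom_mkAlgHom_apply ..) y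
  refine map_eq_zero_of_smul_eq_zero (B := EdgeA q ℓ M N) (vac := edgeVac q M N) hodd hq dAt_smul_edgeVac
    (RingQuot.mkAlgHom ℂ (EdgePdRel q ℓ M N)) hdp (fun a ha y => ?_) le_rfl (fun x hx h0 => ?_) h
  · rw [← hρ, ha, map_zero, LinearMap.zero_apply]
  · rw [smul_edgeVac, Submodule.Quotient.mk_eq_zero] at h0
    exact eq_zero_of_mem_span_edgePd (hq.ne_zero (by omega)) (by omega) hq.pow_eq_one hx h0

theorem edgeMod_azumaya (M N : ℕ) (hℓ : 1 < ℓ) (hodd : Odd ℓ) (hq : IsPrimitiveRoot q ℓ) :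
    ∃ inst : Module (EdgeZbar q ℓ M N) (EdgeMod q M N),
      (∀ (z : edgeZ q ℓ M N) (y : EdgeMod q M N),
        RingQuot.mkRingHom (EdgeZRel q ℓ M N) z • y = (z : EdgeAlg q M N) • y) ∧
      ∃ φ : EdgeA q ℓ M N ≃+* Module.End (EdgeZbar q ℓ M N) (EdgeMod q M N),
        ∀ (D : EdgeAlg q M N) (y : EdgeMod q M N),
          φ (RingQuot.mkRingHom (EdgePdRel q ℓ M N) D) y = D • y := by
  let σ : edgeZ q ℓ M N →+* Module.End ℂ (EdgeMod q M N) :=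
    ((Algebra.lsmul ℂ ℂ (EdgeMod q M N)).comp (edgeZ q ℓ M N).val).toRingHom
  have hσ : ∀ ⦃a b⦄, EdgeZRel q ℓ M N a b → σ a = σ b := by
    rintro a _ ⟨rfl, k, l, h⟩
    rw [map_zero]
    refine LinearMap.ext fun y => ?_
    change (a : EdgeAlg q M N) • y = 0
    rw [h]
    exact edgePd_pow_smul_edgeMod hℓ hodd hq (k, l) y
  let ρ : EdgeZbar q ℓ M N →+* Module.End ℂ (EdgeMod q M N) := RingQuot.lift ⟨σ, hσ⟩
  have hρ : ∀ z, ρ (RingQuot.mkRingHom (EdgeZRel q ℓ M N) z) = σ z := fun z =>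
    RingQuot.lift_mkRingHom_apply ..
  let _inst : Module (EdgeZbar q ℓ M N) (EdgeMod q M N) := Module.compHom _ ρ
  have hsmul : ∀ (z : edgeZ q ℓ M N) (y : EdgeMod q M N),
      RingQuot.mkRingHom (EdgeZRel q ℓ M N) z • y = (z : EdgeAlg q M N) • y := fun z y =>
    congrArg (fun f => f y) (hρ z)
  have : SMulCommClass (EdgeZbar q ℓ M N) (EdgeAlg q M N) (EdgeMod q M N) := ⟨fun z a y => by
    obtain ⟨z, rfl⟩ := RingQuot.mkRingHom_surjective _ z
    rw [hsmul, hsmul, ← mul_smul, ← mul_smul]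
    rw [Subalgebra.mem_center_iff.1 (edgeZ_le_center hℓ hodd hq M N z.2) a]⟩
  have := SMulCommClass.symm (EdgeZbar q ℓ M N) (EdgeAlg q M N) (EdgeMod q M N)
  let ψ : EdgeAlg q M N →+* Module.End (EdgeZbar q ℓ M N) (EdgeMod q M N) :=
    Module.toModuleEnd (EdgeZbar q ℓ M N) (EdgeMod q M N)
  have hψ : ∀ a y, ψ a y = a • y := fun _ _ => rfl
  have hψr : ∀ ⦃a b⦄, EdgePdRel q ℓ M N a b → ψ a = ψ b := by
    rintro a _ ⟨rfl, k, l, rfl⟩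
    rw [map_zero]
    exact LinearMap.ext fun y => edgePd_pow_smul_edgeMod hℓ hodd hq (k, l) y
  let Ψ : EdgeA q ℓ M N →+* Module.End (EdgeZbar q ℓ M N) (EdgeMod q M N) :=
    RingQuot.lift ⟨ψ, hψr⟩
  have hΨ : ∀ D y, Ψ (RingQuot.mkRingHom (EdgePdRel q ℓ M N) D) y = D • y := fun D y =>
    congrArg (fun f => f y) (RingQuot.lift_mkRingHom_apply ψ hψr D)
  refine ⟨_inst, hsmul, RingEquiv.ofBijective Ψ ⟨?_, ?_⟩, hΨ⟩
  · rw [injective_iff_map_eq_zero]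
    intro z hz
    obtain ⟨a, rfl⟩ := RingQuot.mkRingHom_surjective _ z
    have := eq_mk_zero_of_smul_edgeMod hℓ hodd hq (a := a) fun y => by rw [← hΨ, hz]; rfl
    rwa [← RingQuot.mkAlgHom_coe ℂ]
  · intro f
    -- Density only uses that f is complex linear and commutes with the ℓ-th powers of coordinates;
    -- both follow from linearity over the central quotient.
    let f' : EdgeMod q M N →ₗ[ℂ] EdgeMod q M N :=
      { toFun := f
        map_add' := map_add f
        map_smul' := fun c y => by
          have e : ∀ y : EdgeMod q M N, c • y =
              RingQuot.mkRingHom (EdgeZRel q ℓ M N) (algebraMap ℂ _ c) • y := fun y => by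
            rw [hsmul]
            exact (algebraMap_smul (EdgeAlg q M N) c y).symm
          rw [e, map_smul, RingHom.id_apply, e] }
    obtain ⟨D, hD⟩ := exists_smul_of_comm hℓ hodd hq dAt_smul_edgeVac edgeMod_gen f' fun c y => by
      have hz : xAt q c ^ ℓ ∈ edgeZ q ℓ M N := Algebra.subset_adjoin ⟨c.1, c.2, Or.inl rfl⟩
      have e := fun y => hsmul ⟨_, hz⟩ y
      change f _ = _ • f y
      rw [← e y, map_smul, e]
    exact ⟨_, LinearMap.ext fun y => (hΨ D y).trans (hD y).symm⟩

end EdgeModule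

/-! ### Operators on tensor products of finite-dimensional spaces -/

section PiTensorEnd

variable {ε : Type*} [DecidableEq ε] {P : ε → Type*} [∀ e, AddCommGroup (P e)]
  [∀ e, Module ℂ (P e)]

theorem list_prod_tensorOp_tprod (g : ∀ e, Module.End ℂ (P e)) {l : List ε} (hl : l.Nodup)
    (y : ∀ e, P e) : (l.map fun e => tensorOp P e (g e)).prod (PiTensorProduct.tprod ℂ y) =
      PiTensorProduct.tprod ℂ fun e => if e ∈ l then g e (y e) else y e := by
  induction l with
  | nil => simp
  | cons e l ih =>
    rw [List.nodup_cons] at hl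
    rw [List.map_cons, List.prod_cons, Module.End.mul_apply, ih hl.2, tensorOp_tprod]
    congr 1
    ext f
    by_cases hf : f = e
    · subst hf; simp [hl.1]
    · simp [hf]

/-- Operators on the factors generate all operators on a tensor product. -/
theorem eq_top_of_tensorOp_mem [Fintype ε] {κ : ε → Type*} [∀ e, Fintype (κ e)]
    (b : ∀ e, Module.Basis (κ e) ℂ (P e)) (S : Subalgebra ℂ (Module.End ℂ (⨂[ℂ] e, P e)))
    (hS : ∀ e g, tensorOp P e g ∈ S) : S = ⊤ := by
  classical
  have hmap : ∀ g : ∀ e, Module.End ℂ (P e), ∃ s ∈ S, ∀ y : ∀ e, P e,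
      s (PiTensorProduct.tprod ℂ y) = PiTensorProduct.tprod ℂ fun e => g e (y e) := fun g =>
    ⟨(Finset.univ.toList.map fun e => tensorOp P e (g e)).prod,
      list_prod_mem (by simpa using fun e => hS e (g e)), fun y => by
        rw [list_prod_tensorOp_tprod g (Finset.nodup_toList _)]
        simp⟩
  let B := Basis.piTensorProduct b
  -- The matrix units of the product basis are tensor products of matrix units of the factors.
  have hunit : ∀ I J : ∀ e, κ e, ∃ s ∈ S, ∀ K, s (B K) = if K = J then B I else 0 := by
    intro I J
    obtain ⟨s, hs, h⟩ := hmap fun e => (b e).constr ℂ fun k => if k = J e then b e (I e) else 0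
    refine ⟨s, hs, fun K => ?_⟩
    simp only [B, Basis.piTensorProduct_apply, h, Module.Basis.constr_basis]
    split_ifs with hK
    · simp [hK]
    · obtain ⟨e, he⟩ : ∃ e, K e ≠ J e := by
        by_contra! hc
        exact hK (funext hc)
      exact (PiTensorProduct.tprod ℂ).map_coord_zero e (if_neg he)
  choose s hs hsB using hunit
  rw [eq_top_iff]
  rintro f -
  have : f = ∑ J, ∑ I, B.repr (f (B J)) I • s I J := by
    refine B.ext fun K => ?_
    simp only [LinearMap.sum_apply, LinearMap.smul_apply, hsB, smul_ite, smul_zero]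
    rw [Finset.sum_eq_single K]
    · simp only [if_true]
      exact (B.sum_repr _).symm
    · intro J _ hJ
      simp [hJ.symm]
    · exact fun h => absurd (Finset.mem_univ _) h
  rw [this]
  exact Subalgebra.sum_mem _ fun J _ => Subalgebra.sum_mem _ fun I _ => S.smul_mem (hs I J) _

theorem finite_piTensorProduct [Fintype ε] {κ : ε → Type*} [∀ e, Fintype (κ e)]
    (b : ∀ e, Module.Basis (κ e) ℂ (P e)) : Module.Finite ℂ (⨂[ℂ] e, P e) :=
  Module.Finite.of_basis (Basis.piTensorProduct b)

theorem finrank_piTensorProduct [Fintype ε] {κ : ε → Type*} [∀ e, Fintype (κ e)]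
    (b : ∀ e, Module.Basis (κ e) ℂ (P e)) :
    Module.finrank ℂ (⨂[ℂ] e, P e) = ∏ e, Module.finrank ℂ (P e) := by
  rw [Module.finrank_eq_card_basis (Basis.piTensorProduct b), Fintype.card_pi]
  exact Finset.prod_congr rfl fun e _ => (Module.finrank_eq_card_basis (b e)).symm

end PiTensorEnd

/-! ### The image of an algebra acting on a tensor product of edge modules -/

section Image

variable {V : Type*} [Quiver V] {q : ℂ} {d : V → ℕ} [Fintype (Quiver.Total V)]
  [LinearOrder (Quiver.Total V)]
  {P : Quiver.Total V → Type*} [∀ e, AddCommGroup (P e)] [∀ e, Module ℂ (P e)]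

theorem list_prod_apply_mem {E w : Type*} [Ring E] [Algebra ℂ E] [Fintype w] [DecidableEq w]
    (S : Subalgebra ℂ E) : ∀ {l : List (Matrix w w E)}, (∀ A ∈ l, ∀ i j, A i j ∈ S) →
      ∀ i j, l.prod i j ∈ S
  | [], _, i, j => by
    rw [List.prod_nil, Matrix.one_apply]
    split_ifs
    · exact S.one_mem
    · exact S.zero_mem
  | A :: l, h, i, j => by
    rw [List.prod_cons, Matrix.mul_apply]
    exact S.sum_mem fun k _ => S.mul_mem (h A (by simp) i k)
      (list_prod_apply_mem S (fun A hA => h A (by simp [hA])) k j)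

namespace IsEdgeRep

variable {L : ∀ e : Quiver.Total V, EdgeAlg q (d e.right) (d e.left) →ₐ[ℂ] Module.End ℂ (P e)}
  {T T' : ∀ e, ∀ v, Matrix (Fin (d v)) (Fin (d v)) (Module.End ℂ (P e))} {vac : ∀ e, P e}

/-- The dressing of e and its inverse consist of operators on earlier factors, which lie in the
image by induction on the edge. Multiplying the dressed generators by them recovers the undressed
ones. -/
theorem tensorOp_mem_range (h : IsEdgeRep q d L T T' vac)
    (hL : ∀ e, Function.Surjective (L e)) (e : Quiver.Total V) :
    ∀ g, tensorOp P e g ∈ h.rep.range := by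
  induction e using WellFoundedLT.induction with
  | ind e ih =>
  have hC : ∀ v i j, dressL (tensorT T) (edgesBefore e) v i j ∈ h.rep.range := fun v =>
    list_prod_apply_mem _ (by
      intro A hA i j
      obtain ⟨f, hf, rfl⟩ := List.mem_map.1 hA
      exact ih f (mem_edgesBefore.1 hf) _)
  have hC' : ∀ v i j, dressR (tensorT T') (edgesBefore e) v i j ∈ h.rep.range := fun v =>
    list_prod_apply_mem _ (by
      intro A hA i j
      obtain ⟨f, hf, rfl⟩ := List.mem_map.1 hA
      exact ih f (mem_edgesBefore.1 (List.mem_reverse.1 hf)) _)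
  have hG : ∀ k i j, tensorOp P e (L e (edgeGenM q d e.right e.left k i j)) ∈ h.rep.range := by
    intro k i j
    have e1 : ((edgeGenM q d e.right e.left k).map (L e)).map (tensorOp P e) =
        dressR (tensorT T') (edgesBefore e) (cond k e.right e.left) *
          ((edgeGenM q d e.right e.left k).map (h.edgeHom e) *
            dressL (tensorT T) (edgesBefore e) (cond k e.left e.right)) := by
      rw [h.edgeHom_edgeGenM, Matrix.mul_assoc, Matrix.mul_assoc, (h.dress_isRTT e).inv_mul,
        Matrix.mul_one, ← Matrix.mul_assoc, (h.dress_isRTT e).inv_mul, Matrix.one_mul]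
    have e2 := congrFun (congrFun e1 i) j
    rw [Matrix.map_apply, Matrix.map_apply] at e2
    rw [e2, Matrix.mul_apply]
    refine Subalgebra.sum_mem _ fun a _ => Subalgebra.mul_mem _ (hC' _ _ _) ?_
    rw [Matrix.mul_apply]
    refine Subalgebra.sum_mem _ fun b _ => Subalgebra.mul_mem _ ?_ (hC _ _ _)
    rw [Matrix.map_apply, ← rep_edgeIncl]
    exact ⟨_, rfl⟩
  intro g
  obtain ⟨a, rfl⟩ := hL e g
  have ha : a ∈ Algebra.adjoin ℂ {a | ∃ k i j, a = edgeGenM q d e.right e.left k i j} := by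
    rw [edgeGenM_adjoin]; trivial
  have hle : Algebra.adjoin ℂ {a | ∃ k i j, a = edgeGenM q d e.right e.left k i j} ≤
      h.rep.range.comap ((tensorOp P e).comp (L e)) := by
    rw [Algebra.adjoin_le_iff]
    rintro _ ⟨k, i, j, rfl⟩
    exact hG k i j
  exact hle ha

theorem rep_surjective (h : IsEdgeRep q d L T T' vac)
    (hL : ∀ e, Function.Surjective (L e)) {κ : Quiver.Total V → Type*} [∀ e, Fintype (κ e)]
    (b : ∀ e, Module.Basis (κ e) ℂ (P e)) : Function.Surjective h.rep := by
  rw [← AlgHom.range_eq_top]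
  exact eq_top_of_tensorOp_mem b _ (h.tensorOp_mem_range hL)

/-- By the quantum Frobenius property the ℓ-th power of a dressed generator is a combination of ℓ-th
powers of undressed generators, all of which act by zero. -/
theorem rep_pow_eq_zero (h : IsEdgeRep q d L T T' vac) {ℓ : ℕ} (hℓ : 1 < ℓ) (hodd : Odd ℓ)
    (hq : IsPrimitiveRoot q ℓ)
    (hL : ∀ e k i j, L e (edgeGenM q d e.right e.left k i j ^ ℓ) = 0) (e : Quiver.Total V) (k : Bool)
    (i : Fin (d (cond k e.right e.left))) (j : Fin (d (cond k e.left e.right))) :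
    h.rep (edgeIncl q d e (edgeGenM q d e.right e.left k i j) ^ ℓ) = 0 := by
  have hne : cond k e.right e.left ≠ cond k e.left e.right := by
    cases k
    · exact (h.ne e).symm
    · exact h.ne e
  have hX : IsQMat q d (((edgeGenM q d e.right e.left k).map (L e)).map (tensorOp P e)) := by
    cases k
    · exact ((isQMat_matD h.ne_zero e.right e.left).map (L e)).map (tensorOp P e)
    · exact ((isQMat_matX h.ne_zero e.right e.left).map (L e)).map (tensorOp P e)
  have e2 := congrFun (congrFun (h.edgeHom_edgeGenM e k) i) j
  rw [Matrix.map_apply] at e2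
  rw [map_pow, rep_edgeIncl, e2, (h.dress_isRTT e).dress_pow hℓ hodd hq hne hX
    (dressL_comm T e _ _) (dressR_comm T' e _ _)]
  refine Finset.sum_eq_zero fun a _ => ?_
  rw [Finset.sum_eq_zero, mul_zero]
  intro b _
  rw [Matrix.map_apply, Matrix.map_apply, ← map_pow, ← map_pow, hL, map_zero, zero_mul]

end IsEdgeRep

end Image

/-! ### The fibre over the zero representation of a quiver -/

section QuiverFibre

variable {V : Type*} [Quiver V] {q : ℂ} {ℓ : ℕ} {d : V → ℕ}
  [LinearOrder (Quiver.Total V)]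

variable [Fintype (Quiver.Total V)]

/-- Ordered products span B, and each edge algebra maps to B through End(P e). So B is a quotient of
the tensor product of these endomorphism algebras as a vector space. -/
theorem finrank_le_of_edgeIncl (hq : q ≠ 0) {P : Quiver.Total V → Type*} [∀ e, AddCommGroup (P e)]
    [∀ e, Module ℂ (P e)] {κ : Quiver.Total V → Type*} [∀ e, Fintype (κ e)]
    (b : ∀ e, Module.Basis (κ e) ℂ (P e)) {B : Type*} [Ring B] [Algebra ℂ B]
    (f : QuiverAlg q d →ₐ[ℂ] B) (hf : Function.Surjective f) (g : ∀ e, Module.End ℂ (P e) →ₐ[ℂ] B)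
    (L : ∀ e : Quiver.Total V, EdgeAlg q (d e.right) (d e.left) → Module.End ℂ (P e))
    (hg : ∀ e a, g e (L e a) = f (edgeIncl q d e a)) :
    Module.Finite ℂ B ∧ Module.finrank ℂ B ≤ ∏ e, Module.finrank ℂ (P e) ^ 2 := by
  have hP : ∀ e, Module.Finite ℂ (P e) := fun e => Module.Finite.of_basis (b e)
  let c := fun e : Quiver.Total V => Module.finBasis ℂ (Module.End ℂ (P e))
  have := finite_piTensorProduct c
  let m : (⨂[ℂ] e, Module.End ℂ (P e)) →ₗ[ℂ] B :=
    PiTensorProduct.lift (orderedProd g (Finset.univ.sort (· ≤ ·))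
      (Finset.sort_nodup _ _) fun e => (Finset.mem_sort _).2 (Finset.mem_univ e))
  have hm : ∀ a, m (PiTensorProduct.tprod ℂ a) =
      ((Finset.univ.sort (· ≤ ·)).map fun e => g e (a e)).prod := fun a =>
    PiTensorProduct.lift.tprod _
  have hsurj : Function.Surjective m := by
    intro z
    obtain ⟨w, rfl⟩ := hf z
    obtain ⟨t, rfl⟩ := quiverMul_surjective hq w
    induction t using PiTensorProduct.induction_on with
    | smul_tprod c a =>
      refine ⟨c • PiTensorProduct.tprod ℂ fun e => L e (a e), ?_⟩
      rw [map_smul, map_smul, map_smul, hm, quiverMul_tprod, map_list_prod, List.map_map]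
      simp only [hg]
      rfl
    | add x y hx hy =>
      obtain ⟨u, hu⟩ := hx
      obtain ⟨v, hv⟩ := hy
      exact ⟨u + v, by rw [map_add, hu, hv, map_add, map_add]⟩
  refine ⟨Module.Finite.of_surjective m hsurj,
    (m.finrank_le_finrank_of_surjective hsurj).trans_eq ?_⟩
  rw [finrank_piTensorProduct c]
  exact Finset.prod_congr rfl fun e _ => by rw [Module.finrank_linearMap, sq]

/-- The homomorphism from the fibre of an edge algebra to the fibre of the quiver algebra. -/
def edgeFiberIncl (q : ℂ) (ℓ : ℕ) (d : V → ℕ) (e : Quiver.Total V) :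
    EdgeFiber q ℓ (d e.right) (d e.left) →ₐ[ℂ] QuiverFiber q ℓ d :=
  RingQuot.liftAlgHom ℂ ⟨(RingQuot.mkAlgHom ℂ (QuiverZeroRel q ℓ d)).comp (edgeIncl q d e), by
    rintro a _ ⟨rfl, i, j, h⟩
    rw [AlgHom.comp_apply, AlgHom.comp_apply, map_zero (edgeIncl q d e)]
    refine RingQuot.mkAlgHom_rel ℂ ⟨rfl, e, i, j, ?_⟩
    rcases h with rfl | rfl
    · exact Or.inl (map_pow _ _ _)
    · exact Or.inr (map_pow _ _ _)⟩

theorem edgeFiberIncl_mk (e : Quiver.Total V) (a : EdgeAlg q (d e.right) (d e.left)) :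
    edgeFiberIncl q ℓ d e (RingQuot.mkAlgHom ℂ (EdgeZeroRel q ℓ _ _) a) =
      RingQuot.mkAlgHom ℂ (QuiverZeroRel q ℓ d) (edgeIncl q d e a) :=
  RingQuot.liftAlgHom_mkAlgHom_apply ..

/-- An algebra of small dimension which acts on a space by all its endomorphisms is a matrix
algebra. -/
theorem nonempty_algEquiv_matrix_of_finrank_le {B Q κ : Type*} [Ring B] [Algebra ℂ B]
    [AddCommMonoid Q] [Module ℂ Q] [Fintype κ] [DecidableEq κ] (b : Module.Basis κ ℂ Q)
    {n : ℕ} (hn : Fintype.card κ = n) (ρ : B →ₐ[ℂ] Module.End ℂ Q) (hρ : Function.Surjective ρ)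
    [Module.Finite ℂ B] (hB : Module.finrank ℂ B ≤ n ^ 2) :
    Nonempty (B ≃ₐ[ℂ] Matrix (Fin n) (Fin n) ℂ) := by
  let f : B →ₐ[ℂ] Matrix (Fin n) (Fin n) ℂ := (((algEquivMatrix b).trans
    (Matrix.reindexAlgEquiv ℂ ℂ (Fintype.equivFinOfCardEq hn))).toAlgHom).comp ρ
  have hf : Function.Surjective f := 
    (((algEquivMatrix b).trans
      (Matrix.reindexAlgEquiv ℂ ℂ (Fintype.equivFinOfCardEq hn))).surjective).comp hρ
  have hM : Module.finrank ℂ (Matrix (Fin n) (Fin n) ℂ) = n ^ 2 := by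
    rw [Module.finrank_matrix]; simp [sq]
  have hinj : Function.Injective f.toLinearMap :=
    (LinearMap.injective_iff_surjective_of_finrank_eq_finrank (le_antisymm (hB.trans_eq hM.symm)
      (f.toLinearMap.finrank_le_finrank_of_surjective hf))).2 hf
  exact ⟨AlgEquiv.ofBijective f ⟨hinj, hf⟩⟩

/-- The fibre maps onto all endomorphisms of the product of the edge modules, and ordered products
bound its dimension by that of the endomorphism algebra. Equality of dimensions makes the map an
isomorphism, with no direct study of the two-sided ideal. -/
theorem quiverFiber_algEquiv_matrix (hℓ : 1 < ℓ) (hodd : Odd ℓ) (hq : IsPrimitiveRoot q ℓ)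
    (hne : ∀ e : Quiver.Total V, e.right ≠ e.left) :
    Nonempty (QuiverFiber q ℓ d ≃ₐ[ℂ]
      Matrix (Fin (ℓ ^ ∑ e : Quiver.Total V, d e.right * d e.left))
        (Fin (ℓ ^ ∑ e : Quiver.Total V, d e.right * d e.left)) ℂ) := by
  have hq0 : q ≠ 0 := hq.ne_zero (by omega)
  have h := isEdgeRep_quot (d := d) hq0 (by omega) hq.pow_eq_one hne
    (fun e => zeroIdeal q ℓ (d e.right) (d e.left)) (fun e => mul_mem_zeroIdeal q ℓ _ _)
    (fun e u y hy i j => edgeSmash_mem_edgeIdeal hℓ hodd hq u (hne e) hy i j)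
  let b := fun e : Quiver.Total V => zeroModBasis (d e.right) (d e.left) hℓ hodd hq
  have hsurj : Function.Surjective h.rep :=
    h.rep_surjective (fun e => zeroAct_surjective hℓ hodd hq) b
  have hpow : ∀ (e : Quiver.Total V) (k : Bool) (i : Fin (d (cond k e.right e.left)))
      (j : Fin (d (cond k e.left e.right))),
      zeroAct q ℓ (d e.right) (d e.left) (edgeGenM q d e.right e.left k i j ^ ℓ) = 0 := by
    intro e k i j
    cases k
    · exact (zeroAct_pow hℓ hodd hq (j, i)).2
    · exact (zeroAct_pow hℓ hodd hq (i, j)).1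
  have hrel : ∀ ⦃a c⦄, QuiverZeroRel q ℓ d a c → h.rep a = h.rep c := by
    rintro a _ ⟨rfl, e, i, j, rfl | rfl⟩
    · rw [map_zero]
      exact h.rep_pow_eq_zero hℓ hodd hq hpow e true i j
    · rw [map_zero]
      exact h.rep_pow_eq_zero hℓ hodd hq hpow e false j i
  let ρ : QuiverFiber q ℓ d →ₐ[ℂ] Module.End ℂ
      (⨂[ℂ] e : Quiver.Total V, ZeroMod q ℓ (d e.right) (d e.left)) :=
    RingQuot.liftAlgHom ℂ ⟨h.rep, hrel⟩
  have hρ : Function.Surjective ρ := fun f => by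
    obtain ⟨a, rfl⟩ := hsurj f
    exact ⟨RingQuot.mkAlgHom ℂ _ a, RingQuot.liftAlgHom_mkAlgHom_apply ..⟩
  let g := fun e : Quiver.Total V => (edgeFiberIncl q ℓ d e).comp
    (edgeFiberEquiv (d e.right) (d e.left) hℓ hodd hq).symm.toAlgHom
  have hg : ∀ e a, g e (zeroAct q ℓ _ _ a) =
      RingQuot.mkAlgHom ℂ (QuiverZeroRel q ℓ d) (edgeIncl q d e a) := by
    intro e a
    rw [← edgeFiberIncl_mk, ← edgeFiberAct_mk hℓ hodd hq]
    exact congrArg _ ((edgeFiberEquiv _ _ hℓ hodd hq).symm_apply_apply _)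
  obtain ⟨hfin, hle⟩ := finrank_le_of_edgeIncl
    (P := fun e : Quiver.Total V => ZeroMod q ℓ (d e.right) (d e.left)) (B := QuiverFiber q ℓ d)
    hq0 b (RingQuot.mkAlgHom ℂ (QuiverZeroRel q ℓ d)) (RingQuot.mkAlgHom_surjective ℂ _) g _ hg
  rw [Finset.prod_congr rfl fun e _ => congrArg (· ^ 2) (finrank_zeroMod _ _ hℓ hodd hq),
    Finset.prod_pow, Finset.prod_pow_eq_pow_sum] at hle
  exact nonempty_algEquiv_matrix_of_finrank_le (B := QuiverFiber q ℓ d) (Basis.piTensorProduct b)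
    (by simp [Finset.prod_pow_eq_pow_sum]) ρ hρ hle

end QuiverFibre

end

/-! ### The theorem -/

theorem mainTheorem7 (ℓ : ℕ) (hℓ : 1 < ℓ) (hodd : Odd ℓ) (q : ℂ)
    (hq : IsPrimitiveRoot q ℓ) :
    (∀ M N : ℕ,
      edgeZ q ℓ M N ≤ Subalgebra.center ℂ (EdgeAlg q M N) ∧
      (∃ inst : Module (EdgeZbar q ℓ M N) (EdgeMod q M N),
        (∀ (z : edgeZ q ℓ M N) (y : EdgeMod q M N),
          RingQuot.mkRingHom (EdgeZRel q ℓ M N) z • y = (z : EdgeAlg q M N) • y) ∧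
        ∃ φ : EdgeA q ℓ M N ≃+* Module.End (EdgeZbar q ℓ M N) (EdgeMod q M N),
          ∀ (D : EdgeAlg q M N) (y : EdgeMod q M N),
            φ (RingQuot.mkRingHom (EdgePdRel q ℓ M N) D) y = D • y) ∧
      Nonempty (EdgeFiber q ℓ M N ≃ₐ[ℂ]
        Matrix (Fin (ℓ ^ (M * N))) (Fin (ℓ ^ (M * N))) ℂ)) ∧
    (∀ (V : Type u) [Quiver.{v + 1} V] [Fintype (Quiver.Total V)]
      [LinearOrder (Quiver.Total V)] (d : V → ℕ), (∀ w : V, IsEmpty (w ⟶ w)) →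
      (∃ Φ : (⨂[ℂ] e : Quiver.Total V, EdgeAlg q (d e.right) (d e.left)) ≃ₗ[ℂ] QuiverAlg q d,
        ∀ a : (e : Quiver.Total V) → EdgeAlg q (d e.right) (d e.left),
          Φ (PiTensorProduct.tprod ℂ a) =
            ((Finset.univ.sort (· ≤ ·)).map fun e => edgeIncl q d e (a e)).prod) ∧
      Nonempty (QuiverFiber q ℓ d ≃ₐ[ℂ]
        Matrix (Fin (ℓ ^ ∑ e : Quiver.Total V, d e.right * d e.left))
          (Fin (ℓ ^ ∑ e : Quiver.Total V, d e.right * d e.left)) ℂ)) := by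
  refine ⟨fun M N => ⟨edgeZ_le_center hℓ hodd hq M N, edgeMod_azumaya M N hℓ hodd hq,
    edgeFiber_algEquiv_matrix M N hℓ hodd hq⟩, fun V _ _ _ d hV => ?_⟩
  have hne : ∀ e : Quiver.Total V, e.right ≠ e.left := by
    rintro ⟨s, t, e⟩ (h : t = s)
    subst h
    exact (hV t).false e
  have hq0 : q ≠ 0 := hq.ne_zero (by omega)
  exact ⟨⟨LinearEquiv.ofBijective (quiverMul q d)
    ⟨quiverMul_injective hq0 (by omega) hq.pow_eq_one hne, quiverMul_surjective hq0⟩,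
    fun a => quiverMul_tprod a⟩, quiverFiber_algEquiv_matrix hℓ hodd hq hne⟩
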